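/- Let $R,c_v,\mu,\kappa>0$. For $L>0$ consider on $(0,L)\times(0,\infty)$ the system $$\partial_tJ=\partial_yv,\qquad \varrho_0\partial_tv-\mu\,\partial_y\Big(\frac{\partial_yv}{J}\Big)+\partial_y\pi=0,\qquad c_v\varrho_0\partial_t\vartheta+\pi\,\partial_yv-\kappa\,\partial_y\Big(\frac{\partial_y\vartheta}{J}\Big)=\mu\frac{(\partial_yv)^2}{J},\qquad \pi=R\frac{\varrho_0}{J}\vartheta,$$ with $v=\partial_y\vartheta=0$ at $y=0,L$ and $(J,v,\vartheta)|_{t=0}=(1,v_0,\vartheta_0)$. Write $\|\cdot\|_q$ for the norm of $L^q((0,L))$ and $H^m=H^m((0,L))$. The data satisfy $\varrho_0,v_0,\vartheta_0\in H^2$, $v_0(0)=v_0(L)=0$ and $\inf_{(0,L)}\varrho_0>0$, $\inf_{(0,L)}\vartheta_0>0$. Put $$E_0=\int_0^L\Big(\frac{\varrho_0}{2}v_0^2+c_v\varrho_0\vartheta_0\Big)dy,\quad m_1=\exp\Big\{\frac2\mu\sqrt{2\|\varrho_0\|_1E_0}\Big\},\quad \bar\varrho=\|\varrho_0\|_\infty,\quad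 \omega_0=\big|\{y\in(0,L):\varrho_0(y)\ge\bar\varrho/2\}\big|,$$ $$N_1=\frac{E_0}{c_v}+\bar\varrho+\frac1{\bar\varrho}+L+\frac1L+\frac1{\omega_0}+\|\varrho_0'\|_\infty,\qquad N_2=\|\sqrt{\varrho_0}v_0^2\|_2+\|\sqrt{\varrho_0}\vartheta_0\|_2+\|v_0'\|_2,$$ $$g_0=\frac{\mu v_0''-R(\varrho_0\vartheta_0)'}{\sqrt{\varrho_0}},\quad h_0=\frac{\mu(v_0')^2+\kappa\vartheta_0''-Rv_0'\varrho_0\vartheta_0}{\sqrt{\varrho_0}},\quad N_3=\|\varrho_0''\|_2+\|g_0\|_2+\|h_0\|_2 .$$ Let $(J,v,\vartheta)$ be a global solution with $J,\vartheta>0$ on $(0,L)\times(0,\infty)$ and, for every $T\in(0,\infty)$, $$J\in C([0,T];H^2),\quad \partial_tJ\in L^\infty(0,T;H^1)\cap L^2(0,T;H^2),$$ $$v,\vartheta\in C([0,T];H^2)\cap L^2(0,T;H^3),\quad \partial_tv,\partial_t\vartheta\in L^\infty(0,T;L^2)\cap L^2(0,T;H^1).$$ Then for every $T\in(0,\infty)$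 there are positive constants $\underline C$ and $C$, depending only on $R,c_v,\mu,\kappa,T$ and on (upper bounds for) $m_1,N_1,N_2,N_3$, and in particular not on $\inf\varrho_0$, such that $$\inf_{0\le t\le T}\ \inf_{y\in(0,L)}J(y,t)\ge\underline C$$ and $$\sup_{0\le t\le T}\|(J,v,\vartheta)\|_{H^2}^2+\int_0^T\Big(\|\partial_tJ\|_{H^2}^2+\|(v,\vartheta)\|_{H^3}^2+\|(\partial_tv,\partial_t\vartheta)\|_{H^1}^2\Big)dt\le C .$$ -/

import Mathlib

open MeasureTheory Set
open scoped ENNReal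

noncomputable section

namespace HeatNS

/-- The Lebesgue measure on the interval `(0, L)`. -/
abbrev leb (L : ℝ) : Measure ℝ := volume.restrict (Ioo 0 L)

/-- `L²((0, L))`. -/
abbrev L2 (L : ℝ) : Type := Lp ℝ 2 (leb L)

/-- `g` is the weak (distributional) derivative of `f` on `(0, L)`; both are locally integrable
there. -/
structure IsWeakDeriv (L : ℝ) (f g : ℝ → ℝ) : Prop where
  locInt_left : LocallyIntegrableOn f (Ioo 0 L)
  locInt_right : LocallyIntegrableOn g (Ioo 0 L)
  integral_eq : ∀ φ : ℝ → ℝ, ContDiff ℝ (⊤ : ℕ∞) φ → HasCompactSupport φ → tsupport φ ⊆ Ioo 0 L →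
    ∫ y in Ioo 0 L, f y * deriv φ y = -∫ y in Ioo 0 L, g y * φ y

theorem L2.locInt {L : ℝ} (f : L2 L) : LocallyIntegrableOn f (Ioo 0 L) :=
  IntegrableOn.locallyIntegrableOn ((Lp.memLp f).integrable (by norm_num))

theorem L2.integrable_mul {L : ℝ} (f : L2 L) {ψ : ℝ → ℝ} (hc : Continuous ψ)
    (hs : HasCompactSupport ψ) : IntegrableOn (fun y => f y * ψ y) (Ioo 0 L) := by
  obtain ⟨C, hC⟩ := hc.bounded_above_of_compact_support hs
  exact ((Lp.memLp f).integrable (by norm_num)).mul_bdd (c := C)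
    hc.aestronglyMeasurable (Filter.Eventually.of_forall hC)

theorem IsWeakDeriv.zero (L : ℝ) : IsWeakDeriv L (0 : L2 L) (0 : L2 L) := by
  refine ⟨L2.locInt _, L2.locInt _, fun φ _ _ _ => ?_⟩
  have h : ((0 : L2 L) : ℝ → ℝ) =ᵐ[leb L] 0 := Lp.coeFn_zero _ _ _
  rw [integral_congr_ae (g := fun _ => (0 : ℝ)) (by filter_upwards [h] with y hy; rw [hy]; simp),
    integral_congr_ae (f := fun y => (0 : L2 L) y * φ y) (g := fun _ => (0 : ℝ))
      (by filter_upwards [h] with y hy; rw [hy]; simp)]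
  simp

theorem IsWeakDeriv.add {L : ℝ} {f g f' g' : L2 L} (h : IsWeakDeriv L f g)
    (h' : IsWeakDeriv L f' g') : IsWeakDeriv L (f + f' : L2 L) (g + g' : L2 L) := by
  refine ⟨L2.locInt _, L2.locInt _, fun φ hφ hs ht => ?_⟩
  have e1 := Lp.coeFn_add f f'
  have e2 := Lp.coeFn_add g g'
  have hd : Continuous (deriv φ) := hφ.continuous_deriv (by simp)
  rw [integral_congr_ae (g := fun y => f y * deriv φ y + f' y * deriv φ y)
      (by filter_upwards [e1] with y hy; rw [hy]; simp [add_mul]),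
    integral_congr_ae (f := fun y => (g + g' : L2 L) y * φ y) (g := fun y => g y * φ y + g' y * φ y)
      (by filter_upwards [e2] with y hy; rw [hy]; simp [add_mul]),
    integral_add (f.integrable_mul hd hs.deriv) (f'.integrable_mul hd hs.deriv),
    integral_add (g.integrable_mul hφ.continuous hs) (g'.integrable_mul hφ.continuous hs),
    h.integral_eq φ hφ hs ht, h'.integral_eq φ hφ hs ht]
  ring

theorem IsWeakDeriv.smul {L : ℝ} (a : ℝ) {f g : L2 L} (h : IsWeakDeriv L f g) :
    IsWeakDeriv L (a • f : L2 L) (a • g : L2 L) := by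
  refine ⟨L2.locInt _, L2.locInt _, fun φ hφ hs ht => ?_⟩
  have e1 := Lp.coeFn_smul a f
  have e2 := Lp.coeFn_smul a g
  rw [integral_congr_ae (g := fun y => a * (f y * deriv φ y))
      (by filter_upwards [e1] with y hy; rw [hy]; simp [mul_assoc]),
    integral_congr_ae (f := fun y => (a • g : L2 L) y * φ y) (g := fun y => a * (g y * φ y))
      (by filter_upwards [e2] with y hy; rw [hy]; simp [mul_assoc]),
    integral_const_mul, integral_const_mul, h.integral_eq φ hφ hs ht]
  ring

/-- The Sobolev space `H^m((0, L))`. An element is a function in `L²` together with its weak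
derivatives of order at most `m`, all in `L²`; the latter are determined by the function. The norm
is the usual one, `‖f‖² = ∑_{k ≤ m} ‖∂^k f‖₂²`. -/
def sobolev (L : ℝ) (m : ℕ) : Submodule ℝ (PiLp 2 fun _ : Fin (m + 1) => L2 L) where
  carrier := {f | ∀ k : Fin m, IsWeakDeriv L (f k.castSucc) (f k.succ)}
  add_mem' hf hg k := (hf k).add (hg k)
  zero_mem' _ := IsWeakDeriv.zero L
  smul_mem' a _ hf k := (hf k).smul a

/-- `H^m((0, L))` as a type. -/
abbrev H (L : ℝ) (m : ℕ) : Type := sobolev L m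

/-- The `k`-th weak derivative of `f ∈ H^m((0, L))`, for `k ≤ m`; `f.d 0` is `f` itself. -/
def H.d {L : ℝ} {m : ℕ} (f : H L m) (k : Fin (m + 1)) : L2 L := f.1 k

/-- `c` is the representative of `f` that is continuous on `[0, L]`. Elements of `H^1((0, L))` have
exactly one; pointwise conditions on `[0, L]` refer to it. -/
def IsContRep {L : ℝ} (f : L2 L) (c : ℝ → ℝ) : Prop :=
  ContinuousOn c (Icc 0 L) ∧ f =ᵐ[leb L] c

/-- `f(0) = f(L) = 0`. -/
def VanishesAtEnds {L : ℝ} (f : L2 L) : Prop :=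
  ∃ c : ℝ → ℝ, IsContRep f c ∧ c 0 = 0 ∧ c L = 0

/-- `f > 0` at every point of `(0, L)`. -/
def IsPositive {L : ℝ} (f : L2 L) : Prop :=
  ∃ c : ℝ → ℝ, IsContRep f c ∧ ∀ y ∈ Ioo 0 L, 0 < c y

/-- `inf_{(0, L)} f ≥ a`. -/
def IsBoundedBelowBy {L : ℝ} (f : L2 L) (a : ℝ) : Prop :=
  ∃ c : ℝ → ℝ, IsContRep f c ∧ ∀ y ∈ Ioo 0 L, a ≤ c y

/-- `w ∈ L^p(0, T; X)` for every `T ∈ (0, ∞)`. -/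
def MemLpTime {X : Type*} [NormedAddCommGroup X] (p : ℝ≥0∞) (w : ℝ → X) : Prop :=
  ∀ T : ℝ, 0 < T → MemLp w p (leb T)

/-- The curve `u` in `L²((0, L))` has the locally integrable time derivative `w` on `[0, ∞)`. -/
def IsTimeDeriv {L : ℝ} (u w : ℝ → L2 L) : Prop :=
  ∀ t : ℝ, 0 ≤ t → IntervalIntegrable w volume 0 t ∧ u t = u 0 + ∫ s in (0 : ℝ)..t, w s

/-- A global solution `(J, v, ϑ)`, on `(0, L) × (0, ∞)`, of
`∂_t J = ∂_y v`,
`ϱ₀ ∂_t v - μ ∂_y(∂_y v / J) + ∂_y π = 0`,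
`c_v ϱ₀ ∂_t ϑ + ∂_y v π - κ ∂_y(∂_y ϑ / J) = μ (∂_y v)² / J`, where `π = R ϱ₀ ϑ / J`,
with `v = ∂_y ϑ = 0` at `y = 0, L` and `(J, v, ϑ) = (1, v₀, ϑ₀)` at `t = 0`, in the
regularity class of the non-vacuum theory. Derivatives in `y` are weak derivatives, and the
equations hold for almost every time. -/
structure GlobalSolution (R c_v μ κ L : ℝ) (ϱ₀ v₀ ϑ₀ : H L 2) where
  /-- The Jacobian of the flow map. -/
  J : ℝ → H L 2
  /-- The velocity. -/
  v : ℝ → H L 2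
  /-- The temperature. -/
  ϑ : ℝ → H L 2
  /-- The velocity as an element of `H³`, for almost every time. -/
  v₃ : ℝ → H L 3
  /-- The temperature as an element of `H³`, for almost every time. -/
  ϑ₃ : ℝ → H L 3
  /-- The time derivative of `J`. -/
  J_t : ℝ → H L 2
  /-- The time derivative of `v`. -/
  v_t : ℝ → H L 1
  /-- The time derivative of `ϑ`. -/
  ϑ_t : ℝ → H L 1
  J_cont : ContinuousOn J (Ici 0)
  v_cont : ContinuousOn v (Ici 0)
  ϑ_cont : ContinuousOn ϑ (Ici 0)
  v₃_eq : ∀ᵐ t ∂volume.restrict (Ioi 0), (v₃ t).d 0 = (v t).d 0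
  ϑ₃_eq : ∀ᵐ t ∂volume.restrict (Ioi 0), (ϑ₃ t).d 0 = (ϑ t).d 0
  v₃_mem : MemLpTime 2 v₃
  ϑ₃_mem : MemLpTime 2 ϑ₃
  J_t_deriv : IsTimeDeriv (fun t => (J t).d 0) (fun t => (J_t t).d 0)
  v_t_deriv : IsTimeDeriv (fun t => (v t).d 0) (fun t => (v_t t).d 0)
  ϑ_t_deriv : IsTimeDeriv (fun t => (ϑ t).d 0) (fun t => (ϑ_t t).d 0)
  J_t_mem : MemLpTime 2 J_t
  v_t_mem : MemLpTime 2 v_t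
  ϑ_t_mem : MemLpTime 2 ϑ_t
  /-- `∂_t J ∈ L^∞(0, T; H^1)`. -/
  J_t_bdd : MemLpTime ∞ (fun t => (J_t t).d 0) ∧ MemLpTime ∞ (fun t => (J_t t).d 1)
  v_t_bdd : MemLpTime ∞ (fun t => (v_t t).d 0)
  ϑ_t_bdd : MemLpTime ∞ (fun t => (ϑ_t t).d 0)
  J_pos : ∀ t : ℝ, 0 < t → IsPositive ((J t).d 0)
  ϑ_pos : ∀ t : ℝ, 0 < t → IsPositive ((ϑ t).d 0)
  J_init : (J 0).d 0 =ᵐ[leb L] fun _ => 1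
  v_init : v 0 = v₀
  ϑ_init : ϑ 0 = ϑ₀
  v_boundary : ∀ t : ℝ, 0 < t → VanishesAtEnds ((v t).d 0)
  ϑ_boundary : ∀ t : ℝ, 0 < t → VanishesAtEnds ((ϑ t).d 1)
  eq_J : ∀ᵐ t ∂volume.restrict (Ioi 0), (J_t t).d 0 = (v t).d 1
  /-- `∂_y (μ ∂_y v / J - π) = ϱ₀ ∂_t v`. -/
  eq_v : ∀ᵐ t ∂volume.restrict (Ioi 0), IsWeakDeriv L
    (fun y => μ * ((v t).d 1 y / (J t).d 0 y) - R * (ϱ₀.d 0 y / (J t).d 0 y) * (ϑ t).d 0 y)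
    (fun y => ϱ₀.d 0 y * (v_t t).d 0 y)
  /-- `∂_y (κ ∂_y ϑ / J) = c_v ϱ₀ ∂_t ϑ + ∂_y v π - μ (∂_y v)² / J`. -/
  eq_ϑ : ∀ᵐ t ∂volume.restrict (Ioi 0), IsWeakDeriv L
    (fun y => κ * ((ϑ t).d 1 y / (J t).d 0 y))
    (fun y => c_v * ϱ₀.d 0 y * (ϑ_t t).d 0 y
      + (v t).d 1 y * (R * (ϱ₀.d 0 y / (J t).d 0 y) * (ϑ t).d 0 y)
      - μ * ((v t).d 1 y ^ 2 / (J t).d 0 y))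

section Data

variable (R c_v μ κ : ℝ) {L : ℝ} (ϱ₀ v₀ ϑ₀ : H L 2)

/-- The initial energy. -/
def E₀ : ℝ := ∫ y in Ioo 0 L, (ϱ₀.d 0 y / 2 * v₀.d 0 y ^ 2 + c_v * ϱ₀.d 0 y * ϑ₀.d 0 y)

/-- `m₁ = exp ((2/μ) √(2 ‖ϱ₀‖₁ E₀))`. -/
def m₁ : ℝ :=
  Real.exp (2 / μ * Real.sqrt (2 * lpNorm (ϱ₀.d 0) 1 (leb L) * E₀ c_v ϱ₀ v₀ ϑ₀))

/-- `ϱ̄ = ‖ϱ₀‖_∞`. -/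
def rhoBar : ℝ := lpNorm (ϱ₀.d 0) ∞ (leb L)

/-- `ω₀`, the measure of `{y ∈ (0, L) | ϱ₀(y) ≥ ϱ̄ / 2}`. -/
def ω₀ : ℝ := (leb L).real {y | rhoBar ϱ₀ / 2 ≤ ϱ₀.d 0 y}

/-- `N₁ = E₀ / c_v + ϱ̄ + 1 / ϱ̄ + L + 1 / L + 1 / ω₀ + ‖ϱ₀'‖_∞`. -/
def N₁ : ℝ :=
  E₀ c_v ϱ₀ v₀ ϑ₀ / c_v + rhoBar ϱ₀ + 1 / rhoBar ϱ₀ + L + 1 / L + 1 / ω₀ ϱ₀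
    + lpNorm (ϱ₀.d 1) ∞ (leb L)

/-- `N₂ = ‖√ϱ₀ v₀²‖₂ + ‖√ϱ₀ ϑ₀‖₂ + ‖v₀'‖₂`. -/
def N₂ : ℝ :=
  lpNorm (fun y => Real.sqrt (ϱ₀.d 0 y) * v₀.d 0 y ^ 2) 2 (leb L)
    + lpNorm (fun y => Real.sqrt (ϱ₀.d 0 y) * ϑ₀.d 0 y) 2 (leb L)
    + lpNorm (v₀.d 1) 2 (leb L)

/-- `g₀ = (μ v₀'' - R (ϱ₀ ϑ₀)') / √ϱ₀`. -/
def g₀ (y : ℝ) : ℝ :=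
  (μ * v₀.d 2 y - R * (ϱ₀.d 1 y * ϑ₀.d 0 y + ϱ₀.d 0 y * ϑ₀.d 1 y)) / Real.sqrt (ϱ₀.d 0 y)

/-- `h₀ = (μ (v₀')² + κ ϑ₀'' - R v₀' ϱ₀ ϑ₀) / √ϱ₀`. -/
def h₀ (y : ℝ) : ℝ :=
  (μ * v₀.d 1 y ^ 2 + κ * ϑ₀.d 2 y - R * v₀.d 1 y * ϱ₀.d 0 y * ϑ₀.d 0 y)
    / Real.sqrt (ϱ₀.d 0 y)

/-- `N₃ = ‖ϱ₀''‖₂ + ‖g₀‖₂ + ‖h₀‖₂`. -/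
def N₃ : ℝ :=
  lpNorm (ϱ₀.d 2) 2 (leb L) + lpNorm (g₀ R μ ϱ₀ v₀ ϑ₀) 2 (leb L)
    + lpNorm (h₀ R μ κ ϱ₀ v₀ ϑ₀) 2 (leb L)

end Data

end HeatNS

end

/-!
The a priori estimate is carried out on continuous representatives. Elements of `H¹` on an interval
are primitives, so all components of a global solution, their space derivatives of first order and,
for almost every time, their time derivatives have continuous representatives; the equations say
that the effective viscous flux `G = (μ ∂_y v - R ρ ϑ) / J` and the heat flux `Q = κ ∂_y ϑ / J` are
primitives in space of `ρ ∂_t v` and `c_v ρ ∂_t ϑ - ∂_y v G`. This is collected in the structure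
`Flow`, which `GlobalSolution.exists_flow` provides. Positivity of `J` at the end points is not
assumed and comes from the momentum equation (`exists_rep_J_ge`). The infimum of the density enters
only in such qualitative statements; every constant depends on the data through `Controlled`.

Conservation of energy (`integL_energy`) bounds the momentum of `[0, y]`, and integrating the
momentum equation in space and time gives `J = h(t) B(y, t) exp (μ⁻¹ ∫₀ᵗ π)` with `1 / m ≤ B ≤ m`
(`J_rep`). As `∫ J = L`, this bounds `h` from both sides, hence `J` from below, and bounds `J` from
above by the time integral of the sup norm of `ρ ϑ` (`exists_J_bounds`). That sup norm is controlled
by the dissipation `∫ (∂_y ϑ)² / J` and the sup norm of `J` (`exists_sq_norm_ρϑ_le`), and the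
dissipation by the balance of `∫ ρ e² / 2 + M ρ v⁴ / 4`, which for suitable `M` is coercive
(`higher_energy_coercive`). Gronwall's inequality closes the circle (`exists_energyBounded`).
Testing the equation of `G` with `G` itself bounds `∫ J G²` and `∫ ρ (∂_t v)²` in time
(`exists_fluxBounded`), and thus `G` and `∂_y v` in the sup norm, square integrably in time
(`exists_tame`).

The time derivatives satisfy equations only in a dual space. The energy inequality for `√ρ ∂_t v`
is therefore obtained from difference quotients of the momentum equation
(`energy_inequality_of_difference`, `W_le`), with the initial value `g₀`. Added to the balance for
`(κ/2) ∫ (∂_y ϑ)² / J - ∫ ∂_y v G ϑ`, which dissipates `∫ ρ (∂_t ϑ)²`, it closes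
(`exists_rateBounded`). With these bounds the energy inequality for `√ρ ∂_t ϑ`, with the initial
value `h₀`, closes as well (`Θ_le`, `exists_heat_rate_le`). The compatibility terms `g₀` and `h₀`
are weighted so that no lower bound of the density is needed; the unweighted norm
of `∂_t v` follows from that of `∂_t ∂_y v`, and the unweighted norm of `∂_t ϑ` from `√ρ ∂_t ϑ`,
`∂_t ∂_y ϑ` and a lower bound for the mass, which is where the measure of the set
`{ρ₀ ≥ sup ρ₀ / 2}` enters.

Finally `∂_y² v`, `∂_y² ϑ` and `∂_y³ v`, `∂_y³ ϑ` are read off the equations in terms of `∂_y J` and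
`∂_y² J`; since `∂_t J = ∂_y v`, these satisfy Gronwall inequalities
(`exists_second_derivative_le`, `exists_third_derivative_le`).
-/

namespace HeatNS
open Filter Topology

noncomputable section

/-! ### Primitives of integrable functions -/

section Primitive

variable {E F G : Type*} [NormedAddCommGroup E] [NormedSpace ℝ E]
  [NormedAddCommGroup F] [NormedSpace ℝ F] [NormedAddCommGroup G] [NormedSpace ℝ G]

/-- `u` is a primitive of `w` on `[0, b]`: `w` is integrable there and
`u t = u 0 + ∫₀ᵗ w`. -/
structure IsPrimitiveOn (b : ℝ) (u w : ℝ → E) : Prop where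
  nonneg : 0 ≤ b
  intble : IntervalIntegrable w volume 0 b
  eq_add : ∀ t ∈ Icc 0 b, u t = u 0 + ∫ s in (0 : ℝ)..t, w s

theorem intervalIntegrable_of_mem {E : Type*} [NormedAddCommGroup E] {b : ℝ} {w : ℝ → E}
    (h : IntervalIntegrable w volume 0 b)
    {s t : ℝ} (hs : s ∈ Icc 0 b) (ht : t ∈ Icc 0 b) : IntervalIntegrable w volume s t := by
  have hb : (0 : ℝ) ≤ b := hs.1.trans hs.2
  refine h.mono_set ?_
  rw [uIcc_of_le hb]
  exact uIcc_subset_Icc hs ht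

/-- A function whose increments are dominated by those of a primitive is absolutely continuous. -/
theorem absolutelyContinuous_of_dominated {E : Type*} [NormedAddCommGroup E] {b : ℝ} (hb : 0 ≤ b) {f : ℝ → E} {k : ℝ → ℝ}
    (hk : IntervalIntegrable k volume 0 b)
    (hfk : ∀ s ∈ Icc 0 b, ∀ t ∈ Icc 0 b, s ≤ t → ‖f t - f s‖ ≤ ∫ r in s..t, k r) :
    AbsolutelyContinuousOnInterval f 0 b := by
  have hK := hk.absolutelyContinuousOnInterval_intervalIntegral (c := 0) (by simp)
  have key : ∀ s ∈ Icc 0 b, ∀ t ∈ Icc 0 b,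
      dist (f s) (f t) ≤ dist (∫ r in (0 : ℝ)..s, k r) (∫ r in (0 : ℝ)..t, k r) := by
    intro s hs t ht
    wlog hst : s ≤ t generalizing s t
    · rw [dist_comm, dist_comm (∫ r in (0 : ℝ)..s, k r)]
      exact this t ht s hs (le_of_not_ge hst)
    have h0 : (0 : ℝ) ∈ Icc 0 b := ⟨le_rfl, hb⟩
    rw [dist_comm, dist_comm (∫ r in (0 : ℝ)..s, k r), dist_eq_norm, Real.dist_eq,
      intervalIntegral.integral_interval_sub_left (intervalIntegrable_of_mem hk h0 ht)
        (intervalIntegrable_of_mem hk h0 hs)]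
    exact (hfk s hs t ht hst).trans (le_abs_self _)
  unfold AbsolutelyContinuousOnInterval at hK ⊢
  refine squeeze_zero' (Eventually.of_forall fun _ => Finset.sum_nonneg fun _ _ => dist_nonneg)
    ?_ hK
  have : ∀ᶠ P in (AbsolutelyContinuousOnInterval.totalLengthFilter ⊓
      𝓟 (AbsolutelyContinuousOnInterval.disjWithin 0 b)),
      P ∈ AbsolutelyContinuousOnInterval.disjWithin 0 b := eventually_inf_principal.mpr (by simp)
  filter_upwards [this] with P hP
  refine Finset.sum_le_sum fun i hi => ?_
  have h := hP.1 i hi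
  rw [uIcc_of_le hb] at h
  exact key _ h.1 _ h.2

namespace IsPrimitiveOn

variable {b : ℝ} {u w u' w' : ℝ → E}

theorem intble_mem (h : IsPrimitiveOn b u w) {s t : ℝ} (hs : s ∈ Icc 0 b) (ht : t ∈ Icc 0 b) :
    IntervalIntegrable w volume s t := intervalIntegrable_of_mem h.intble hs ht

theorem sub_eq (h : IsPrimitiveOn b u w) {s t : ℝ} (hs : s ∈ Icc 0 b) (ht : t ∈ Icc 0 b) :
    u t - u s = ∫ r in s..t, w r := by
  have h0 : (0 : ℝ) ∈ Icc 0 b := ⟨le_rfl, hs.1.trans hs.2⟩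
  rw [h.eq_add t ht, h.eq_add s hs, add_sub_add_left_eq_sub,
    intervalIntegral.integral_interval_sub_left (h.intble_mem h0 ht) (h.intble_mem h0 hs)]

theorem continuousOn (h : IsPrimitiveOn b u w) : ContinuousOn u (Icc 0 b) := by
  have := intervalIntegral.continuousOn_primitive_interval'
    (μ := volume) (f := w) (b₁ := 0) (b₂ := b) (a := 0) h.intble (by simp)
  rw [uIcc_of_le h.nonneg] at this
  exact (continuousOn_const.add this).congr h.eq_add

theorem congr_ae (h : IsPrimitiveOn b u w) (hw : w =ᵐ[leb b] w') : IsPrimitiveOn b u w' := by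
  have hb := h.nonneg
  have hw' : w =ᵐ[volume.restrict (Ioc 0 b)] w' := by
    rwa [← restrict_Ioo_eq_restrict_Ioc]
  refine ⟨hb, ?_, fun t ht => ?_⟩
  · rw [intervalIntegrable_iff, uIoc_of_le hb]
    have := h.intble
    rw [intervalIntegrable_iff, uIoc_of_le hb] at this
    exact this.congr_fun_ae hw'
  · rw [h.eq_add t ht]
    congr 1
    refine intervalIntegral.integral_congr_ae ?_
    rw [uIoc_of_le ht.1]
    have := ae_restrict_of_ae_restrict_of_subset (Ioc_subset_Ioc_right ht.2) hw'
    exact (ae_restrict_iff' measurableSet_Ioc).1 this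

theorem congr_left (h : IsPrimitiveOn b u w) (hu : ∀ t ∈ Icc 0 b, u' t = u t) :
    IsPrimitiveOn b u' w :=
  ⟨h.nonneg, h.intble, fun t ht => by
    rw [hu t ht, hu 0 ⟨le_rfl, h.nonneg⟩]; exact h.eq_add t ht⟩

theorem dominated (h : IsPrimitiveOn b u w) : ∀ s ∈ Icc 0 b, ∀ t ∈ Icc 0 b, s ≤ t →
    ‖u t - u s‖ ≤ ∫ r in s..t, ‖w r‖ := fun s hs t ht hst => by
  rw [h.sub_eq hs ht]
  exact intervalIntegral.norm_integral_le_integral_norm hst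

theorem absolutelyContinuous (h : IsPrimitiveOn b u w) : AbsolutelyContinuousOnInterval u 0 b :=
  absolutelyContinuous_of_dominated h.nonneg h.intble.norm h.dominated

theorem ae_hasDerivAt [CompleteSpace E] (h : IsPrimitiveOn b u w) :
    ∀ᵐ t ∂leb b, HasDerivAt u (w t) t := by
  rw [ae_restrict_iff' measurableSet_Ioo]
  filter_upwards [h.intble.ae_hasDerivAt_integral] with t ht htb
  have h1 := ht (by rw [uIcc_of_le h.nonneg]; exact Ioo_subset_Icc_self htb) 0 (by simp)
  refine (h1.const_add (u 0)).congr_of_eventuallyEq ?_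
  filter_upwards [Icc_mem_nhds htb.1 htb.2] with s hs using h.eq_add s hs

/-- A function whose increments are dominated by an integral is the primitive of its almost everywhere
derivative. -/
theorem of_dominated [CompleteSpace E] (hb : 0 ≤ b) {k : ℝ → ℝ}
    (hk : IntervalIntegrable k volume 0 b)
    (hfk : ∀ s ∈ Icc 0 b, ∀ t ∈ Icc 0 b, s ≤ t → ‖u t - u s‖ ≤ ∫ r in s..t, k r)
    (hw : IntervalIntegrable w volume 0 b) (hd : ∀ᵐ t ∂leb b, HasDerivAt u (w t) t) :
    IsPrimitiveOn b u w := by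
  have hP : IsPrimitiveOn b (fun t => ∫ s in (0 : ℝ)..t, w s) w := ⟨hb, hw, fun t _ => by simp⟩
  have hac := (absolutelyContinuous_of_dominated hb hk hfk).sub hP.absolutelyContinuous
  obtain ⟨C, hC⟩ := hac.const_of_ae_hasDerivAt_zero (by
    rw [ae_restrict_iff' measurableSet_Ioo] at hd
    have hd' := hP.ae_hasDerivAt
    rw [ae_restrict_iff' measurableSet_Ioo] at hd'
    have n0 : ∀ᵐ t : ℝ, t ≠ 0 := by simp [ae_iff, measure_singleton]
    have nb : ∀ᵐ t : ℝ, t ≠ b := by simp [ae_iff, measure_singleton]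
    filter_upwards [hd, hd', n0, nb] with t h1 h2 h3 h4 h5
    rw [uIcc_of_le hb] at h5
    have h6 : t ∈ Ioo 0 b := ⟨lt_of_le_of_ne h5.1 (Ne.symm h3), lt_of_le_of_ne h5.2 h4⟩
    simpa using (h1 h6).sub (h2 h6))
  rw [uIcc_of_le hb] at hC
  refine ⟨hb, hw, fun t ht => ?_⟩
  have h1 := hC t ht
  have h0 := hC 0 ⟨le_rfl, hb⟩
  simp only [Pi.sub_apply, intervalIntegral.integral_same, sub_zero] at h1 h0
  rw [h0, ← h1]; abel

theorem ae_eq [CompleteSpace E] (h : IsPrimitiveOn b u w) (h' : IsPrimitiveOn b u w') :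
    w =ᵐ[leb b] w' := by
  filter_upwards [h.ae_hasDerivAt, h'.ae_hasDerivAt] with t h1 h2 using h1.unique h2

theorem const (hb : 0 ≤ b) (c : E) : IsPrimitiveOn b (fun _ => c) (fun _ => (0 : E)) :=
  ⟨hb, intervalIntegrable_const, fun t _ => by simp⟩

theorem add (h : IsPrimitiveOn b u w) (h' : IsPrimitiveOn b u' w') :
    IsPrimitiveOn b (fun t => u t + u' t) (fun t => w t + w' t) := by
  refine ⟨h.nonneg, h.intble.add h'.intble, fun t ht => ?_⟩
  have h0 : (0 : ℝ) ∈ Icc 0 b := ⟨le_rfl, h.nonneg⟩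
  rw [intervalIntegral.integral_add (h.intble_mem h0 ht) (h'.intble_mem h0 ht), h.eq_add t ht,
    h'.eq_add t ht]
  abel

theorem map [CompleteSpace E] [CompleteSpace F] (L : E →L[ℝ] F) (h : IsPrimitiveOn b u w) :
    IsPrimitiveOn b (fun t => L (u t)) (fun t => L (w t)) := by
  refine ⟨h.nonneg, ?_, fun t ht => ?_⟩
  · have := h.intble
    rw [intervalIntegrable_iff] at this ⊢
    exact L.integrable_comp this
  · rw [h.eq_add t ht, map_add, L.intervalIntegral_comp_comm
      (h.intble_mem ⟨le_rfl, h.nonneg⟩ ht)]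

theorem of_map_injective [CompleteSpace E] [CompleteSpace F] (L : E →L[ℝ] F)
    (hL : Function.Injective L) (hw : IntervalIntegrable w volume 0 b)
    (h : IsPrimitiveOn b (fun t => L (u t)) (fun t => L (w t))) : IsPrimitiveOn b u w := by
  refine ⟨h.nonneg, hw, fun t ht => hL ?_⟩
  rw [h.eq_add t ht, map_add, L.intervalIntegral_comp_comm
      (intervalIntegrable_of_mem hw ⟨le_rfl, h.nonneg⟩ ht)]

theorem const_smul (c : ℝ) (h : IsPrimitiveOn b u w) :
    IsPrimitiveOn b (fun t => c • u t) (fun t => c • w t) := by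
  refine ⟨h.nonneg, h.intble.smul c, fun t ht => ?_⟩
  rw [h.eq_add t ht, smul_add, intervalIntegral.integral_smul]

theorem neg (h : IsPrimitiveOn b u w) : IsPrimitiveOn b (fun t => -u t) (fun t => -w t) := by
  simpa using h.const_smul (-1)

theorem sub (h : IsPrimitiveOn b u w) (h' : IsPrimitiveOn b u' w') :
    IsPrimitiveOn b (fun t => u t - u' t) (fun t => w t - w' t) := by
  simpa [sub_eq_add_neg] using h.add h'.neg

theorem exists_bound (h : IsPrimitiveOn b u w) : ∃ M, 0 ≤ M ∧ ∀ t ∈ Icc 0 b, ‖u t‖ ≤ M := by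
  obtain ⟨M, hM⟩ := isCompact_Icc.exists_bound_of_continuousOn h.continuousOn
  exact ⟨M, (norm_nonneg _).trans (hM 0 ⟨le_rfl, h.nonneg⟩), hM⟩

end IsPrimitiveOn

/-- A bilinear image of an integrable function and a continuous one is integrable. -/
theorem intervalIntegrable_bilin {b : ℝ} (hb : 0 ≤ b) (B : E →L[ℝ] F →L[ℝ] G) {w : ℝ → E}
    {u : ℝ → F} (hw : IntervalIntegrable w volume 0 b) (hu : ContinuousOn u (Icc 0 b)) :
    IntervalIntegrable (fun t => B (w t) (u t)) volume 0 b := by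
  rw [intervalIntegrable_iff, uIoc_of_le hb] at hw ⊢
  obtain ⟨M, hM⟩ := isCompact_Icc.exists_bound_of_continuousOn hu
  have hum : AEStronglyMeasurable u (volume.restrict (Ioc 0 b)) :=
    (hu.aestronglyMeasurable_of_isCompact isCompact_Icc measurableSet_Icc).mono_measure
      (Measure.restrict_mono Ioc_subset_Icc_self le_rfl)
  have hm : AEStronglyMeasurable (fun t => B (w t) (u t)) (volume.restrict (Ioc 0 b)) :=
    B.aestronglyMeasurable_comp₂ hw.aestronglyMeasurable hum
  refine Integrable.mono' (hw.norm.const_mul (‖B‖ * M)) hm ?_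
  rw [ae_restrict_iff' measurableSet_Ioc]
  filter_upwards with t ht
  calc _ ≤ ‖B‖ * ‖w t‖ * ‖u t‖ := B.le_opNorm₂ _ _
    _ ≤ ‖B‖ * ‖w t‖ * M := by gcongr; exact hM t (Ioc_subset_Icc_self ht)
    _ = _ := by ring

/-- Leibniz' rule for a continuous bilinear map. -/
theorem IsPrimitiveOn.bilin [CompleteSpace E] [CompleteSpace F] [CompleteSpace G]
    (B : E →L[ℝ] F →L[ℝ] G) {b : ℝ} {u w : ℝ → E} {u' w' : ℝ → F}
    (h : IsPrimitiveOn b u w) (h' : IsPrimitiveOn b u' w') :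
    IsPrimitiveOn b (fun t => B (u t) (u' t)) (fun t => B (w t) (u' t) + B (u t) (w' t)) := by
  obtain ⟨M, hM0, hM⟩ := h.exists_bound
  obtain ⟨M', hM0', hM'⟩ := h'.exists_bound
  have i1 := intervalIntegrable_bilin h.nonneg B h.intble h'.continuousOn
  have i2 := intervalIntegrable_bilin h.nonneg B.flip h'.intble h.continuousOn
  refine IsPrimitiveOn.of_dominated h.nonneg (k := fun t => ‖B‖ * M' * ‖w t‖ + ‖B‖ * M * ‖w' t‖)
    ((h.intble.norm.const_mul _).add (h'.intble.norm.const_mul _)) ?_ (i1.add i2) ?_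
  · intro s hs t ht hst
    have e : B (u t) (u' t) - B (u s) (u' s) = B (u t - u s) (u' t) + B (u s) (u' t - u' s) := by
      simp
    rw [e, intervalIntegral.integral_add ((h.intble_mem hs ht).norm.const_mul _)
      ((h'.intble_mem hs ht).norm.const_mul _), intervalIntegral.integral_const_mul,
      intervalIntegral.integral_const_mul]
    refine (norm_add_le _ _).trans (add_le_add ?_ ?_)
    · calc _ ≤ ‖B‖ * ‖u t - u s‖ * ‖u' t‖ := B.le_opNorm₂ _ _
        _ ≤ ‖B‖ * (∫ r in s..t, ‖w r‖) * M' := by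
          gcongr
          · exact mul_nonneg B.opNorm_nonneg
              (intervalIntegral.integral_nonneg hst fun _ _ => norm_nonneg _)
          · exact h.dominated s hs t ht hst
          · exact hM' t ht
        _ = _ := by ring
    · calc _ ≤ ‖B‖ * ‖u s‖ * ‖u' t - u' s‖ := B.le_opNorm₂ _ _
        _ ≤ ‖B‖ * M * (∫ r in s..t, ‖w' r‖) := by
          gcongr
          · exact hM s hs
          · exact h'.dominated s hs t ht hst
  · filter_upwards [h.ae_hasDerivAt, h'.ae_hasDerivAt] with t h1 h2
    have := (B.hasFDerivAt_of_bilinear (h1.hasFDerivAt) (h2.hasFDerivAt)).hasDerivAt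
    simpa [add_comm] using this

theorem IsPrimitiveOn.mul {b : ℝ} {u w u' w' : ℝ → ℝ}
    (h : IsPrimitiveOn b u w) (h' : IsPrimitiveOn b u' w') :
    IsPrimitiveOn b (fun t => u t * u' t) (fun t => w t * u' t + u t * w' t) :=
  h.bilin (ContinuousLinearMap.mul ℝ ℝ) h'

theorem IsPrimitiveOn.of_hasDerivAt [CompleteSpace E] {b : ℝ} (hb : 0 ≤ b) {u w : ℝ → E}
    (hu : ContinuousOn u (Icc 0 b)) (hd : ∀ t ∈ Ioo 0 b, HasDerivAt u (w t) t)
    (hw : ContinuousOn w (Icc 0 b)) : IsPrimitiveOn b u w := by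
  have hi : ∀ t ∈ Icc 0 b, IntervalIntegrable w volume 0 t := fun t ht =>
    (hw.mono (by rw [uIcc_of_le ht.1]; exact Icc_subset_Icc_right ht.2)).intervalIntegrable
  refine ⟨hb, hi b ⟨hb, le_rfl⟩, fun t ht => ?_⟩
  rw [intervalIntegral.integral_eq_sub_of_hasDerivAt_of_le ht.1
    (hu.mono (Icc_subset_Icc_right ht.2)) (fun s hs => hd s ⟨hs.1, hs.2.trans_le ht.2⟩) (hi t ht)]
  abel

theorem IsPrimitiveOn.hasDerivAt [CompleteSpace E] {b : ℝ} {u w : ℝ → E}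
    (h : IsPrimitiveOn b u w)
    (hw : ContinuousOn w (Icc 0 b)) : ∀ t ∈ Ioo 0 b, HasDerivAt u (w t) t := by
  intro t ht
  have hm : Icc 0 b ∈ 𝓝 t := Icc_mem_nhds ht.1 ht.2
  have h1 : HasDerivAt (fun t => ∫ s in (0 : ℝ)..t, w s) (w t) t := by
    refine intervalIntegral.integral_hasDerivAt_right
      (h.intble_mem ⟨le_rfl, h.nonneg⟩ (Ioo_subset_Icc_self ht)) ?_ (hw.continuousAt hm)
    exact hw.stronglyMeasurableAtFilter_nhdsWithin measurableSet_Icc t |>.filter_mono (by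
      rw [nhdsWithin_eq_nhds.2 hm])
  refine (h1.const_add (u 0)).congr_of_eventuallyEq ?_
  filter_upwards [hm] with s hs using h.eq_add s hs

theorem IsPrimitiveOn.exp {b : ℝ} {u w : ℝ → ℝ} (h : IsPrimitiveOn b u w) :
    IsPrimitiveOn b (fun t => Real.exp (u t)) (fun t => Real.exp (u t) * w t) := by
  obtain ⟨M, hM0, hM⟩ := h.exists_bound
  have i1 := intervalIntegrable_bilin h.nonneg (ContinuousLinearMap.mul ℝ ℝ) h.intble
    (Real.continuous_exp.comp_continuousOn h.continuousOn)
  refine IsPrimitiveOn.of_dominated h.nonneg (k := fun t => Real.exp M * ‖w t‖)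
    (h.intble.norm.const_mul _) ?_ (by simpa [mul_comm] using i1) ?_
  · intro s hs t ht hst
    rw [intervalIntegral.integral_const_mul]
    have hc : Convex ℝ (Icc (-M) M) := convex_Icc _ _
    have := hc.norm_image_sub_le_of_norm_deriv_le (f := Real.exp) (C := Real.exp M)
      (fun x _ => Real.differentiableAt_exp) (fun x hx => by
        rw [Real.deriv_exp, Real.norm_eq_abs, Real.abs_exp]; exact Real.exp_le_exp.2 hx.2)
      (x := u s) (y := u t) (abs_le.1 (hM s hs)) (abs_le.1 (hM t ht))
    exact this.trans (by gcongr; exact h.dominated s hs t ht hst)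
  · filter_upwards [h.ae_hasDerivAt] with t h1 using h1.exp

/-- Gronwall's inequality with an integrable coefficient. -/
theorem gronwall_integral {b A : ℝ} (hb : 0 ≤ b) {f a : ℝ → ℝ}
    (ha : IntervalIntegrable a volume 0 b) (ha0 : ∀ᵐ t ∂leb b, 0 ≤ a t)
    (haf : IntervalIntegrable (fun t => a t * f t) volume 0 b)
    (hf : ∀ᵐ t ∂leb b, f t ≤ A + ∫ s in (0 : ℝ)..t, a s * f s) :
    ∀ t ∈ Icc 0 b, A + ∫ s in (0 : ℝ)..t, a s * f s ≤ A * Real.exp (∫ s in (0 : ℝ)..t, a s) := by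
  have hF : IsPrimitiveOn b (fun t => A + ∫ s in (0 : ℝ)..t, a s * f s) (fun t => a t * f t) :=
    ⟨hb, haf, fun t _ => by simp⟩
  have ha' : IsPrimitiveOn b (fun t => ∫ s in (0 : ℝ)..t, a s) a := ⟨hb, ha, fun t _ => by simp⟩
  have hP := hF.mul ha'.neg.exp
  intro t ht
  have h := hP.eq_add t ht
  simp only [intervalIntegral.integral_same, neg_zero, Real.exp_zero, add_zero, mul_one] at h
  have hneg : ∫ s in (0 : ℝ)..t, (a s * f s * Real.exp (-∫ s in (0 : ℝ)..s, a s) +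
      (A + ∫ s in (0 : ℝ)..s, a s * f s) * (Real.exp (-∫ s in (0 : ℝ)..s, a s) * -a s)) ≤ 0 := by
    rw [intervalIntegral.integral_of_le ht.1, integral_Ioc_eq_integral_Ioo]
    refine integral_nonpos_of_ae ?_
    filter_upwards [ae_restrict_of_ae_restrict_of_subset (Ioo_subset_Ioo_right ht.2) hf,
      ae_restrict_of_ae_restrict_of_subset (Ioo_subset_Ioo_right ht.2) ha0] with s h1 h2
    have h3 := Real.exp_pos (-∫ r in (0 : ℝ)..s, a r)
    have h4 : 0 ≤ (A + (∫ r in (0 : ℝ)..s, a r * f r) - f s) *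
      (a s * Real.exp (-∫ r in (0 : ℝ)..s, a r)) :=
      mul_nonneg (sub_nonneg.2 h1) (mul_nonneg h2 h3.le)
    simp only [Pi.zero_apply]
    nlinarith
  have h5 : (A + ∫ s in (0 : ℝ)..t, a s * f s) * Real.exp (-∫ s in (0 : ℝ)..t, a s) ≤ A := by
    linarith
  rw [Real.exp_neg] at h5
  have h6 := Real.exp_pos (∫ r in (0 : ℝ)..t, a r)
  rwa [← div_eq_mul_inv, div_le_iff₀ h6] at h5

end Primitive

/-! ### An energy inequality from difference quotients -/

section Steklov

variable {F : Type*} [NormedAddCommGroup F] [NormedSpace ℝ F]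

theorem measurePreserving_sub_right' (σ : ℝ) :
    MeasurePreserving (fun t : ℝ => t - σ) volume volume := measurePreserving_sub_right volume σ

/-- The pairing of two square integrable functions is continuous under translations of one of them,
by continuity of translations in `L²`. -/
theorem continuous_integral_translate {V : ℝ → F →L[ℝ] ℝ} {W : ℝ → F} (hV : MemLp V 2)
    (hW : MemLp W 2) : Continuous fun σ : ℝ => ∫ t, V (t - σ) (W t) := by
  let g : ℝ → C(ℝ, ℝ) := fun σ => ⟨fun t => t - σ, by fun_prop⟩
  have hg : Continuous g := by
    let g2 : C(ℝ × ℝ, ℝ) := ⟨fun p => p.2 - p.1, by fun_prop⟩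
    exact g2.curry.continuous
  have hgm : ∀ σ, MeasurePreserving (g σ) (volume : Measure ℝ) volume := fun σ =>
    measurePreserving_sub_right volume σ
  have hc : Continuous fun σ => Lp.compMeasurePreserving (g σ) (hgm σ) (hV.toLp V) :=
    (continuous_const).compMeasurePreservingLp hg hgm (by simp)
  let P := (ContinuousLinearMap.id ℝ (F →L[ℝ] ℝ)).lpPairing (volume : Measure ℝ) 2 2
  have h2 : Continuous fun σ => P (Lp.compMeasurePreserving (g σ) (hgm σ) (hV.toLp V))
      (hW.toLp W) := by fun_prop
  convert h2 using 2 with σ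
  rw [ContinuousLinearMap.lpPairing_eq_integral]
  refine integral_congr_ae ?_
  have e1 := Lp.coeFn_compMeasurePreserving (hV.toLp V) (hgm σ)
  have e2 := (hgm σ).quasiMeasurePreserving.ae_eq_comp hV.coeFn_toLp
  filter_upwards [e1, e2, hW.coeFn_toLp] with t h1 h2 h3
  simp only [ContinuousLinearMap.id_apply, h1, h3]
  rw [h2]
  rfl

theorem integrable_translate_prod {V : ℝ → F →L[ℝ] ℝ} {W : ℝ → F} (hV : Integrable V)
    (hW : Integrable W) :
    Integrable (fun p : ℝ × ℝ => V (p.2 - p.1) (W p.2)) (volume.prod volume) := by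
  have := hW.convolution_integrand (ContinuousLinearMap.id ℝ (F →L[ℝ] ℝ)).flip hV.comp_neg
  simpa using this

/-- Fubini for the pairing of `W` with the increments over a time step `h` of a primitive of `V`. -/
theorem integrable_primitive_sub_apply [CompleteSpace F] {V : ℝ → F →L[ℝ] ℝ} {W : ℝ → F}
    (hV : Integrable V) (hW : Integrable W) {h : ℝ} (hh : 0 ≤ h) :
    Integrable (fun t => (∫ r in (t - h)..t, V r) (W t)) ∧
    ∫ t, (∫ r in (t - h)..t, V r) (W t) = ∫ σ in (0 : ℝ)..h, ∫ t, V (t - σ) (W t) := by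
  have e : ∀ t, (∫ r in (t - h)..t, V r) (W t) =
      ∫ σ, V (t - σ) (W t) ∂(volume.restrict (Ioc 0 h)) := by
    intro t
    have h1 := intervalIntegral.integral_comp_sub_left (a := 0) (b := h) V t
    rw [sub_zero] at h1
    rw [← h1, ContinuousLinearMap.intervalIntegral_apply, intervalIntegral.integral_of_le hh]
    exact ((hV.comp_sub_left t)).intervalIntegrable
  have hi : Integrable (fun p : ℝ × ℝ => V (p.2 - p.1) (W p.2))
      ((volume.restrict (Ioc 0 h)).prod volume) := by
    have h1 := (integrable_translate_prod hV hW).integrableOn (s := Ioc 0 h ×ˢ univ)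
    rwa [IntegrableOn, ← Measure.prod_restrict, Measure.restrict_univ] at h1
  constructor
  · simp_rw [e]
    exact hi.integral_prod_right
  · simp_rw [e]
    rw [intervalIntegral.integral_of_le hh]
    exact (integral_integral_swap hi).symm

theorem memLp_two_indicator {E : Type*} [NormedAddCommGroup E] {T : ℝ} {u : ℝ → E}
    (hu : MemLp u 2 (leb T)) :
    MemLp ((Ioo 0 T).indicator u) 2 ∧ Integrable ((Ioo 0 T).indicator u) :=
  ⟨(memLp_indicator_iff_restrict measurableSet_Ioo).2 hu,
    (integrable_indicator_iff measurableSet_Ioo).2 (hu.integrable (by norm_num))⟩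

/-- Passing from difference quotients to the differentiated energy inequality: if
`f t - f s ≤ 2 (U t - U s) (w t)` for almost all `s < t`, also with `f0` and `U 0` in
place of the values at `s ≤ 0`, then `f t ≤ f0 + 2 ∫₀ᵗ U' w`. No time derivative of `w` enters. -/
theorem energy_inequality_of_difference [CompleteSpace F] {T : ℝ} (hT : 0 < T)
    {U U' : ℝ → F →L[ℝ] ℝ} (hU : IsPrimitiveOn T U U') (hU2 : MemLp U' 2 (leb T))
    {w : ℝ → F} (hw : MemLp w 2 (leb T)) {f : ℝ → ℝ} {f0 : ℝ}
    (hf : IntegrableOn f (Ioo 0 T)) {g : Set ℝ} (hg : ∀ᵐ t ∂leb T, t ∈ g)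
    (h0 : ∀ t ∈ g, t ∈ Ioo 0 T → f t - f0 ≤ 2 * (U t - U 0) (w t))
    (h : ∀ t ∈ g, t ∈ Ioo 0 T → ∀ s ∈ g, s ∈ Ioo 0 T → s < t → f t - f s ≤ 2 * (U t - U s) (w t)) :
    ∀ᵐ t ∂leb T, f t ≤ f0 + 2 * ∫ s in (0 : ℝ)..t, U' s (w s) := by
  classical
  set V : ℝ → F →L[ℝ] ℝ := (Ioo 0 T).indicator U' with hVdef
  obtain ⟨hV, hV1⟩ := memLp_two_indicator hU2
  rw [← hVdef] at hV hV1
  set fe : ℝ → ℝ := fun t => if t ≤ 0 then f0 else (Ioo 0 T).indicator f t with hfe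
  have hfloc : LocallyIntegrable fe := by
    have e : fe = fun t => (Iic (0 : ℝ)).indicator (fun _ => f0) t + (Ioo 0 T).indicator f t := by
      funext t
      by_cases ht : t ≤ 0
      · simp [hfe, ht, indicator, not_lt.2 ht]
      · simp [hfe, ht, indicator]
    rw [e]
    exact ((locallyIntegrable_const f0).indicator measurableSet_Iic).add
      ((integrable_indicator_iff measurableSet_Ioo).2 hf).locallyIntegrable
  have hfi : ∀ a b, IntervalIntegrable fe volume a b := fun a b =>
    intervalIntegrable_iff.2 ((hfloc.integrableOn_isCompact isCompact_uIcc).mono_set uIoc_subset_uIcc)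
  -- the differences of `U` as integrals of the extended derivative
  have hUV : ∀ t ∈ Ioo 0 T, ∀ s ≤ t, (if s ≤ 0 then U t - U 0 else U t - U s) =
      ∫ r in s..t, V r := by
    intro t ht s hst
    have hVU : ∀ s ∈ Ico 0 T, s ≤ t → ∫ r in s..t, V r = U t - U s := by
      intro s hs hst
      rw [hU.sub_eq (Ico_subset_Icc_self hs) (Ioo_subset_Icc_self ht),
        intervalIntegral.integral_of_le hst, intervalIntegral.integral_of_le hst]
      refine setIntegral_congr_fun measurableSet_Ioc fun r hr => ?_
      simp only [hVdef]
      rw [indicator_of_mem]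
      exact ⟨hs.1.trans_lt hr.1, hr.2.trans_lt ht.2⟩
    split_ifs with hs
    · rw [← intervalIntegral.integral_add_adjacent_intervals (b := 0)
        hV1.intervalIntegrable hV1.intervalIntegrable, hVU 0 ⟨le_rfl, hT⟩ ht.1.le]
      have : ∫ r in s..0, V r = 0 := by
        rw [intervalIntegral.integral_of_le hs]
        refine setIntegral_eq_zero_of_forall_eq_zero fun r hr => ?_
        simp only [hVdef]
        rw [indicator_of_notMem]
        exact fun h => absurd h.1 (not_lt.2 hr.2)
      rw [this, zero_add]
    · rw [hVU s ⟨(not_le.1 hs).le, hst.trans_lt ht.2⟩ hst]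
  rw [ae_restrict_iff' measurableSet_Ioo]
  have hg' := (ae_restrict_iff' measurableSet_Ioo).1 hg
  filter_upwards [_root_.LocallyIntegrable.ae_hasDerivAt_integral hfloc] with τ hτ hτT
  set W : ℝ → F := (Ioo 0 τ).indicator w with hWdef
  have hwτ : MemLp w 2 (leb τ) := hw.mono_measure
    (Measure.restrict_mono (Ioo_subset_Ioo_right hτT.2.le) le_rfl)
  obtain ⟨hW, hW1⟩ := memLp_two_indicator hwτ
  rw [← hWdef] at hW hW1
  set Γ : ℝ → ℝ := fun σ => ∫ t, V (t - σ) (W t) with hΓ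
  have hΓc : Continuous Γ := continuous_integral_translate hV hW
  -- the inequality between averages
  have key : ∀ h > 0, (∫ t in (τ - h)..τ, fe t) - h * f0 ≤ 2 * ∫ σ in (0 : ℝ)..h, Γ σ := by
    intro δ hδ
    obtain ⟨i1, e1⟩ := integrable_primitive_sub_apply hV1 hW1 hδ.le
    rw [← e1]
    have e2 : (∫ t in (τ - δ)..τ, fe t) - δ * f0 = ∫ t in (0 : ℝ)..τ, (fe t - fe (t - δ)) := by
      have hc : IntervalIntegrable (fun t => fe (t - δ)) volume 0 τ := by
        have := (hfi (0 - δ) (τ - δ)).comp_sub_right δ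
        simpa using this
      rw [intervalIntegral.integral_sub (hfi _ _) hc, intervalIntegral.integral_comp_sub_right]
      have e3 : ∫ t in (0 - δ)..0, fe t = δ * f0 := by
        rw [intervalIntegral.integral_congr (g := fun _ => f0)]
        · simp
        · intro t ht
          rw [uIcc_of_le (by linarith)] at ht
          simp [hfe, ht.2]
      have e4 := intervalIntegral.integral_add_adjacent_intervals (hfi (0 - δ) 0) (hfi 0 τ)
      have e5 := intervalIntegral.integral_add_adjacent_intervals (hfi (0 - δ) (τ - δ))
        (hfi (τ - δ) τ)
      linarith
    have e6 : ∫ t, (∫ r in (t - δ)..t, V r) (W t) =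
        ∫ t in (0 : ℝ)..τ, (∫ r in (t - δ)..t, V r) (w t) := by
      rw [intervalIntegral.integral_of_le hτT.1.le, integral_Ioc_eq_integral_Ioo,
        ← integral_indicator measurableSet_Ioo]
      refine integral_congr_ae (Eventually.of_forall fun t => ?_)
      simp only [hWdef]
      by_cases ht : t ∈ Ioo 0 τ
      · simp only [indicator_of_mem ht]
      · simp only [indicator_of_notMem ht, map_zero]
    rw [e2, e6, intervalIntegral.integral_of_le hτT.1.le, intervalIntegral.integral_of_le hτT.1.le,
      integral_Ioc_eq_integral_Ioo, integral_Ioc_eq_integral_Ioo, ← integral_const_mul]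
    refine integral_mono_ae ?_ ?_ ?_
    · have hc : IntervalIntegrable (fun t => fe (t - δ)) volume 0 τ := by
        have := (hfi (0 - δ) (τ - δ)).comp_sub_right δ
        simpa using this
      have := (hfi 0 τ).sub hc
      rw [intervalIntegrable_iff, uIoc_of_le hτT.1.le] at this
      exact this.mono_set Ioo_subset_Ioc_self
    · refine Integrable.const_mul ?_ 2
      have := i1.integrableOn (s := Ioo 0 τ)
      refine this.congr_fun (fun t ht => ?_) measurableSet_Ioo
      simp only [hWdef, indicator_of_mem ht]
    · have hg2 : ∀ᵐ t : ℝ, t - δ ∈ Ioo 0 T → t - δ ∈ g :=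
        (measurePreserving_sub_right' δ).quasiMeasurePreserving.ae hg'
      rw [Filter.EventuallyLE, ae_restrict_iff' measurableSet_Ioo]
      filter_upwards [hg', hg2] with t ht1 ht2 ht
      have htT : t ∈ Ioo 0 T := ⟨ht.1, ht.2.trans hτT.2⟩
      have hUt := hUV t htT (t - δ) (by linarith)
      rw [← hUt]
      by_cases hs : t - δ ≤ 0
      · have := h0 t (ht1 htT) htT
        simp only [hfe, if_pos hs, if_neg (not_le.2 ht.1), indicator_of_mem htT]
        exact this
      · have hsT : t - δ ∈ Ioo 0 T := ⟨not_le.1 hs, by linarith [htT.2]⟩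
        have := h t (ht1 htT) htT (t - δ) (ht2 hsT) hsT (by linarith)
        simp only [hfe, if_neg hs, if_neg (not_le.2 ht.1), indicator_of_mem htT,
          indicator_of_mem hsT]
        exact this
  -- passing to the limit
  have hL : Tendsto (fun δ : ℝ => δ⁻¹ * ((∫ t in (τ - δ)..τ, fe t) - δ * f0)) (𝓝[>] 0)
      (𝓝 (fe τ - f0)) := by
    have h1 := (hτ τ).tendsto_slope_zero_left
    have hn : Tendsto (fun δ : ℝ => -δ) (𝓝[>] 0) (𝓝[<] 0) := by
      simpa using (tendsto_neg_nhdsGT (a := (0 : ℝ)))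
    have h2 := h1.comp hn
    refine (h2.sub_const f0).congr' ?_
    filter_upwards [self_mem_nhdsWithin] with δ hδ
    have hδ0 : δ ≠ 0 := ne_of_gt hδ
    simp only [Function.comp, intervalIntegral.integral_same, sub_zero, smul_eq_mul]
    rw [← sub_eq_add_neg, intervalIntegral.integral_symm]
    field_simp
  have hR : Tendsto (fun δ : ℝ => δ⁻¹ * (2 * ∫ σ in (0 : ℝ)..δ, Γ σ)) (𝓝[>] 0)
      (𝓝 (2 * Γ 0)) := by
    have h1 := (hΓc.integral_hasStrictDerivAt 0 0).hasDerivAt.tendsto_slope_zero_right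
    have h2 := h1.const_mul 2
    refine h2.congr fun δ => ?_
    simp; ring
  have hle := le_of_tendsto_of_tendsto hL hR (by
    filter_upwards [self_mem_nhdsWithin] with δ hδ
    exact mul_le_mul_of_nonneg_left (key δ hδ) (inv_nonneg.2 (le_of_lt hδ)))
  have e7 : Γ 0 = ∫ s in (0 : ℝ)..τ, U' s (w s) := by
    rw [intervalIntegral.integral_of_le hτT.1.le, integral_Ioc_eq_integral_Ioo,
      ← integral_indicator measurableSet_Ioo]
    refine integral_congr_ae (Eventually.of_forall fun t => ?_)
    simp only [hWdef, hVdef, sub_zero]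
    by_cases ht : t ∈ Ioo 0 τ
    · simp only [indicator_of_mem ht]
      rw [indicator_of_mem (show t ∈ Ioo 0 T from ⟨ht.1, ht.2.trans hτT.2⟩)]
    · simp only [indicator_of_notMem ht, map_zero]
  rw [e7] at hle
  simp only [hfe, if_neg (not_le.2 hτT.1), indicator_of_mem hτT] at hle
  linarith

end Steklov

/-! ### Weak derivatives on an interval -/

section WeakDerivative

variable {L : ℝ}

theorem integrableOn_mul_of_tsupport {h φ : ℝ → ℝ} {U : Set ℝ} (hU : MeasurableSet U)
    (hh : LocallyIntegrableOn h U)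
    (hφ : Continuous φ) (hs : HasCompactSupport φ) (ht : tsupport φ ⊆ U) :
    IntegrableOn (fun y => h y * φ y) U := by
  have h1 : IntegrableOn h (tsupport φ) := hh.integrableOn_compact_subset ht hs
  have h2 : IntegrableOn (fun y => h y * φ y) (tsupport φ) := by
    obtain ⟨C, hC⟩ := hφ.bounded_above_of_compact_support hs
    exact h1.mul_bdd (c := C) hφ.aestronglyMeasurable (Eventually.of_forall hC)
  refine h2.of_forall_sdiff_eq_zero hU fun y hy => ?_
  rw [image_eq_zero_of_notMem_tsupport hy.2, mul_zero]

/-- The lemma of du Bois-Reymond: a function with vanishing weak derivative is constant. -/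
theorem exists_ae_eq_const_of_weakDeriv_zero (hL : 0 < L) {h : ℝ → ℝ}
    (hh : LocallyIntegrableOn h (Ioo 0 L))
    (hz : ∀ φ : ℝ → ℝ, ContDiff ℝ (⊤ : ℕ∞) φ → HasCompactSupport φ → tsupport φ ⊆ Ioo 0 L →
      ∫ y in Ioo 0 L, h y * deriv φ y = 0) :
    ∃ c : ℝ, h =ᵐ[leb L] fun _ => c := by
  -- a bump function of mean one
  obtain ⟨ψ, hψ1, hψ2, hψ3, hψ4, hψ5⟩ := exists_contDiff_tsupport_subset (n := ⊤)
    (Ioo_mem_nhds (show (0 : ℝ) < L / 2 by linarith) (show L / 2 < L by linarith))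
  have hψ0 : ∀ x, 0 ≤ ψ x := fun x => (hψ4 ⟨x, rfl⟩).1
  have hm : 0 < ∫ y, ψ y := by
    rw [integral_pos_iff_support_of_nonneg hψ0 (hψ3.continuous.integrable_of_hasCompactSupport hψ2)]
    exact (hψ3.continuous.isOpen_support).measure_pos _ ⟨L / 2, by simp [hψ5]⟩
  set m := ∫ y, ψ y with hmdef
  refine ⟨m⁻¹ * ∫ y in Ioo 0 L, h y * ψ y, ?_⟩
  set c := m⁻¹ * ∫ y in Ioo 0 L, h y * ψ y with hc
  have key := isOpen_Ioo.ae_eq_zero_of_integral_contDiff_smul_eq_zero (E := ℝ) (μ := volume.restrict (Ioo 0 L))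
    (U := Ioo 0 L) (f := fun y => h y - c) ?_ ?_
  · filter_upwards [ae_restrict_of_ae_restrict_of_subset (μ := volume) (subset_refl _) key,
      ae_restrict_mem measurableSet_Ioo] with y hy hyL
    exact sub_eq_zero.1 (hy hyL)
  · refine LocallyIntegrableOn.sub ?_ ((locallyIntegrable_const c).locallyIntegrableOn _)
    intro x hx
    obtain ⟨s, hs, hi⟩ := hh x hx
    exact ⟨s, hs, hi.restrict⟩
  intro φ hφ hφs hφt
  set a := m⁻¹ * ∫ y, φ y with ha
  -- subtracting a multiple of `ψ` gives mean zero, hence a test function as primitive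
  set χ : ℝ → ℝ := fun y => φ y - a * ψ y with hχ
  have hχc : Continuous χ := hφ.continuous.sub (continuous_const.mul hψ3.continuous)
  have hχd : ContDiff ℝ (⊤ : ℕ∞) χ := hφ.sub (contDiff_const.mul hψ3)
  set Φ : ℝ → ℝ := fun y => ∫ s in (0 : ℝ)..y, χ s with hΦ
  have hΦd : ∀ y, HasDerivAt Φ (χ y) y := fun y =>
    (hχc.integral_hasStrictDerivAt 0 y).hasDerivAt
  have hderiv : deriv Φ = χ := funext fun y => (hΦd y).deriv
  have hΦs : ContDiff ℝ (⊤ : ℕ∞) Φ := by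
    rw [contDiff_infty_iff_deriv]
    exact ⟨fun y => (hΦd y).differentiableAt, by rw [hderiv]; exact hχd⟩
  have hK : IsCompact (tsupport φ ∪ tsupport ψ) := hφs.isCompact.union hψ2.isCompact
  have hKs : tsupport φ ∪ tsupport ψ ⊆ Ioo 0 L := union_subset hφt hψ1
  obtain ⟨a', b', ha', hb', hab⟩ : ∃ a' b' : ℝ, 0 < a' ∧ b' < L ∧
      tsupport φ ∪ tsupport ψ ⊆ Icc a' b' := by
    have hne : (tsupport φ ∪ tsupport ψ).Nonempty :=
      ⟨L / 2, Or.inr (subset_tsupport _ (by simp [hψ5]))⟩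
    refine ⟨sInf (tsupport φ ∪ tsupport ψ), sSup (tsupport φ ∪ tsupport ψ),
      (hKs (hK.sInf_mem hne)).1, (hKs (hK.sSup_mem hne)).2, fun x hx => ⟨?_, ?_⟩⟩
    · exact csInf_le hK.bddBelow hx
    · exact le_csSup hK.bddAbove hx
  have hχ0 : ∀ y, y ∉ Icc a' b' → χ y = 0 := fun y hy => by
    have h1 : y ∉ tsupport φ := fun h => hy (hab (Or.inl h))
    have h2 : y ∉ tsupport ψ := fun h => hy (hab (Or.inr h))
    simp [hχ, image_eq_zero_of_notMem_tsupport h1, image_eq_zero_of_notMem_tsupport h2]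
  have hχi : ∫ y, χ y = 0 := by
    rw [hχ, integral_sub (hφ.continuous.integrable_of_hasCompactSupport hφs)
      ((hψ3.continuous.integrable_of_hasCompactSupport hψ2).const_mul a), integral_const_mul,
      ← hmdef, ha]
    field_simp
    ring
  have hΦ0 : ∀ y, y ∉ Icc a' b' → Φ y = 0 := by
    intro y hy
    have hy' : y < a' ∨ b' < y := by
      by_contra hcon
      push Not at hcon
      exact hy ⟨hcon.1, hcon.2⟩
    rcases hy' with hy' | hy'
    · refine intervalIntegral.integral_zero_ae (Eventually.of_forall fun s hs => hχ0 s ?_)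
      intro hs'
      rcases le_total 0 y with h0 | h0
      · rw [uIoc_of_le h0] at hs
        linarith [hs.2, hs'.1]
      · rw [uIoc_of_ge h0] at hs
        linarith [hs.2, hs'.1]
    · by_cases hb0 : y ≤ 0
      · refine intervalIntegral.integral_zero_ae (Eventually.of_forall fun s hs => hχ0 s ?_)
        intro hs'
        rw [uIoc_of_ge hb0] at hs
        linarith [hs.1, hs'.2]
      · rw [← hχi, hΦ]
        simp only
        rw [intervalIntegral.integral_of_le (not_le.1 hb0).le]
        refine setIntegral_eq_integral_of_forall_compl_eq_zero fun s hs => hχ0 s fun hs' => hs ?_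
        exact ⟨ha'.trans_le hs'.1, hs'.2.trans hy'.le⟩
  have hΦts : tsupport Φ ⊆ Icc a' b' :=
    closure_minimal (fun y hy => by_contra fun h => hy (hΦ0 y h)) isClosed_Icc
  have hfin := hz Φ hΦs (HasCompactSupport.of_support_subset_isCompact isCompact_Icc
    ((subset_tsupport _).trans hΦts)) (hΦts.trans fun y hy => ⟨ha'.trans_le hy.1, hy.2.trans_lt hb'⟩)
  rw [hderiv] at hfin
  have i1 := integrableOn_mul_of_tsupport measurableSet_Ioo hh hφ.continuous hφs hφt
  have i2 := integrableOn_mul_of_tsupport measurableSet_Ioo hh hψ3.continuous hψ2 hψ1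
  have e1 : ∫ y in Ioo 0 L, h y * φ y = a * ∫ y in Ioo 0 L, h y * ψ y := by
    have : ∫ y in Ioo 0 L, h y * χ y =
        (∫ y in Ioo 0 L, h y * φ y) - a * ∫ y in Ioo 0 L, h y * ψ y := by
      rw [← integral_const_mul, ← integral_sub i1 (i2.const_mul a)]
      refine integral_congr_ae (Eventually.of_forall fun y => ?_)
      simp only [hχ]; ring
    linarith
  have e2 : ∫ y in Ioo 0 L, φ y = ∫ y, φ y :=
    setIntegral_eq_integral_of_forall_compl_eq_zero fun s hs =>
      image_eq_zero_of_notMem_tsupport fun h => hs (hφt h)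
  have i3 : IntegrableOn φ (Ioo 0 L) :=
    (hφ.continuous.integrable_of_hasCompactSupport hφs).integrableOn
  calc ∫ y in Ioo 0 L, φ y • (h y - c)
      = ∫ y in Ioo 0 L, (h y * φ y - c * φ y) := by
        refine integral_congr_ae (Eventually.of_forall fun y => ?_)
        simp only [smul_eq_mul]; ring
    _ = 0 := by
        rw [integral_sub i1 (i3.const_mul c), integral_const_mul, e1, e2, hc, ha]; ring

theorem IsPrimitiveOn.isWeakDeriv {u w : ℝ → ℝ} (h : IsPrimitiveOn L u w) :
    IsWeakDeriv L u w := by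
  have hL := h.nonneg
  have hwi : IntegrableOn w (Ioo 0 L) := by
    have := h.intble
    rw [intervalIntegrable_iff, uIoc_of_le hL] at this
    exact this.mono_set Ioo_subset_Ioc_self
  have hui : IntegrableOn u (Ioo 0 L) :=
    (h.continuousOn.integrableOn_compact isCompact_Icc).mono_set Ioo_subset_Icc_self
  refine ⟨hui.locallyIntegrableOn, hwi.locallyIntegrableOn, fun φ hφ hφs hφt => ?_⟩
  have hd : Continuous (deriv φ) := hφ.continuous_deriv (by simp)
  have hP : IsPrimitiveOn L φ (deriv φ) := IsPrimitiveOn.of_hasDerivAt hL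
    hφ.continuous.continuousOn (fun t _ => (hφ.differentiable (by simp) t).hasDerivAt)
    hd.continuousOn
  have hm := (h.mul hP).eq_add L ⟨hL, le_rfl⟩
  have z0 : φ 0 = 0 := image_eq_zero_of_notMem_tsupport fun h => (lt_irrefl _ (hφt h).1)
  have zL : φ L = 0 := image_eq_zero_of_notMem_tsupport fun h => (lt_irrefl _ (hφt h).2)
  have j1 := integrableOn_mul_of_tsupport measurableSet_Ioo hwi.locallyIntegrableOn
    hφ.continuous hφs hφt
  have j2 := integrableOn_mul_of_tsupport measurableSet_Ioo hui.locallyIntegrableOn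
    hd hφs.deriv ((tsupport_deriv_subset).trans hφt)
  rw [z0, zL, intervalIntegral.integral_of_le hL, integral_Ioc_eq_integral_Ioo,
    integral_add j1 j2] at hm
  linarith

/-- A function with an integrable weak derivative is a primitive of it. -/
theorem IsWeakDeriv.exists_ae_eq (hL : 0 < L) {f g : ℝ → ℝ} (h : IsWeakDeriv L f g)
    (hg : IntegrableOn g (Ioo 0 L)) :
    ∃ c : ℝ, f =ᵐ[leb L] fun y => c + ∫ s in (0 : ℝ)..y, g s := by
  have hgi : IntervalIntegrable g volume 0 L := by
    rw [intervalIntegrable_iff, uIoc_of_le hL.le]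
    exact hg.congr_set_ae Ioo_ae_eq_Ioc.symm
  have hP : IsPrimitiveOn L (fun y => ∫ s in (0 : ℝ)..y, g s) g := ⟨hL.le, hgi, fun t _ => by simp⟩
  have hW := hP.isWeakDeriv
  obtain ⟨c, hc⟩ := exists_ae_eq_const_of_weakDeriv_zero hL (h.locInt_left.sub hW.locInt_left)
    (fun φ hφ hφs hφt => by
      have hd : Continuous (deriv φ) := hφ.continuous_deriv (by simp)
      have ht := (tsupport_deriv_subset (f := φ)).trans hφt
      simp only [Pi.sub_apply, sub_mul]
      rw [integral_sub (integrableOn_mul_of_tsupport measurableSet_Ioo h.locInt_left hd hφs.deriv ht)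
        (integrableOn_mul_of_tsupport measurableSet_Ioo hW.locInt_left hd hφs.deriv ht),
        h.integral_eq φ hφ hφs hφt, hW.integral_eq φ hφ hφs hφt, sub_self])
  refine ⟨c, ?_⟩
  filter_upwards [hc] with y hy
  simp only [Pi.sub_apply] at hy
  linarith

end WeakDerivative

/-! ### Sobolev functions and continuous representatives -/

section Spaces

/-- Bounded continuous functions on `ℝ`. Continuous functions on `[0, L]` are represented by
their extension that is constant on either side of the interval. -/
abbrev CB : Type := BoundedContinuousFunction ℝ ℝ

theorem CB.norm_coe_le (f : CB) (y : ℝ) : |f y| ≤ ‖f‖ := f.norm_coe_le_norm y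

theorem memLp_coe {L : ℝ} (f : L2 L) : MemLp f 2 (leb L) := Lp.memLp f

theorem CB.memLp (f : CB) (L : ℝ) : MemLp f 2 (leb L) :=
  MemLp.of_bound f.continuous.aestronglyMeasurable ‖f‖
    (Eventually.of_forall fun y => f.norm_coe_le_norm y)

theorem integrable_mul_of_memLp {α : Type*} {m : MeasurableSpace α} {μ : Measure α} {f g : α → ℝ}
    (hf : MemLp f 2 μ) (hg : MemLp g 2 μ) : Integrable (fun y => f y * g y) μ :=
  hf.integrable_mul hg

/-- Cauchy--Schwarz for integrals. -/
theorem sq_integral_mul_le {α : Type*} {m : MeasurableSpace α} {μ : Measure α} {f g : α → ℝ}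
    (hf : MemLp f 2 μ) (hg : MemLp g 2 μ) :
    (∫ y, f y * g y ∂μ) ^ 2 ≤ (∫ y, f y ^ 2 ∂μ) * ∫ y, g y ^ 2 ∂μ := by
  have key : ∀ {f g : α → ℝ} (hf : MemLp f 2 μ) (hg : MemLp g 2 μ),
      inner ℝ (hf.toLp f) (hg.toLp g) = ∫ y, f y * g y ∂μ := by
    intro f g hf hg
    rw [L2.inner_def]
    refine integral_congr_ae ?_
    filter_upwards [hf.coeFn_toLp, hg.coeFn_toLp] with y h1 h2
    rw [h1, h2]
    simp [mul_comm]
  have h := real_inner_mul_inner_self_le (hf.toLp f) (hg.toLp g)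
  rw [key, key, key] at h
  simpa [pow_two] using h

theorem L2.inner_eq {L : ℝ} (f g : L2 L) : inner ℝ f g = ∫ y in Ioo 0 L, f y * g y := by
  rw [L2.inner_def]
  refine integral_congr_ae (Eventually.of_forall fun y => ?_)
  simp [mul_comm]

theorem L2.norm_sq_eq {L : ℝ} (f : L2 L) : ‖f‖ ^ 2 = ∫ y in Ioo 0 L, f y ^ 2 := by
  rw [← real_inner_self_eq_norm_sq, L2.inner_eq]
  simp [pow_two]

/-- A bounded continuous function as an element of `L²`. -/
def toL2 (L : ℝ) : CB →L[ℝ] L2 L := BoundedContinuousFunction.toLp 2 (leb L) ℝ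

theorem toL2_coe {L : ℝ} (f : CB) : toL2 L f =ᵐ[leb L] f :=
  BoundedContinuousFunction.coeFn_toLp 2 (leb L) ℝ f

/-- Multiplication of `L²` functions by bounded continuous ones. -/
def mulL2 (L : ℝ) : CB →L[ℝ] L2 L →L[ℝ] L2 L :=
  ((ContinuousLinearMap.mul ℝ ℝ).holderL (leb L) ∞ 2 2).comp
    (BoundedContinuousFunction.toLp ∞ (leb L) ℝ)

theorem mulL2_coe {L : ℝ} (a : CB) (f : L2 L) :
    mulL2 L a f =ᵐ[leb L] fun y => a y * f y := by
  have h1 := (ContinuousLinearMap.mul ℝ ℝ).coeFn_holder (r := 2)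
    (BoundedContinuousFunction.toLp ∞ (leb L) ℝ a) f
  have h2 := BoundedContinuousFunction.coeFn_toLp ∞ (leb L) ℝ a
  refine EventuallyEq.trans h1 ?_
  filter_upwards [h2] with y hy
  simp [hy]

/-- Integration over `(0, L)`. -/
def integL (L : ℝ) : CB →L[ℝ] ℝ := (innerSL ℝ (toL2 L 1)).comp (toL2 L)

theorem integL_eq {L : ℝ} (f : CB) : integL L f = ∫ y in Ioo 0 L, f y := by
  simp only [integL, ContinuousLinearMap.comp_apply, innerSL_apply_apply, L2.inner_eq]
  refine integral_congr_ae ?_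
  filter_upwards [toL2_coe (L := L) f, toL2_coe (L := L) 1] with y h1 h2
  rw [h1, h2]; simp

/-- The nearest point of `[0, L]`. -/
def clamp (L y : ℝ) : ℝ := max 0 (min y L)

theorem clamp_mem {L : ℝ} (hL : 0 ≤ L) (y : ℝ) : clamp L y ∈ Icc 0 L :=
  ⟨le_max_left _ _, max_le hL (min_le_right _ _)⟩

theorem clamp_of_mem {L y : ℝ} (hy : y ∈ Icc 0 L) : clamp L y = y := by
  rw [clamp, min_eq_left hy.2, max_eq_right hy.1]

theorem continuous_clamp (L : ℝ) : Continuous (clamp L) := by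
  unfold clamp; fun_prop

theorem L2.integrableOn {L : ℝ} (f : L2 L) : IntegrableOn f (Ioo 0 L) :=
  (memLp_coe f).integrable (by norm_num)

theorem intervalIntegrable_of_integrableOn_Ioo {L : ℝ} (hL : 0 ≤ L) {f : ℝ → ℝ}
    (hf : IntegrableOn f (Ioo 0 L)) : IntervalIntegrable f volume 0 L := by
  rw [intervalIntegrable_iff, uIoc_of_le hL]
  exact hf.congr_set_ae Ioo_ae_eq_Ioc.symm

theorem intervalIntegral_eq_Ioo {L : ℝ} (hL : 0 ≤ L) (f : ℝ → ℝ) :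
    ∫ y in (0 : ℝ)..L, f y = ∫ y in Ioo 0 L, f y := by
  rw [intervalIntegral.integral_of_le hL, integral_Ioc_eq_integral_Ioo]

theorem L2.intervalIntegrable {L : ℝ} (hL : 0 ≤ L) (f : L2 L) :
    IntervalIntegrable f volume 0 L := intervalIntegrable_of_integrableOn_Ioo hL f.integrableOn

theorem L2.integral_abs_le {L : ℝ} (hL : 0 ≤ L) (f : L2 L) :
    ∫ y in Ioo 0 L, |f y| ≤ Real.sqrt L * ‖f‖ := by
  have h := sq_integral_mul_le (μ := leb L) (memLp_const (1 : ℝ)) (memLp_coe f).abs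
  simp only [one_mul, one_pow, sq_abs, Pi.abs_apply, ← L2.norm_sq_eq] at h
  rw [integral_const] at h
  simp only [Measure.real, Measure.restrict_apply_univ, Real.volume_Ioo, sub_zero, smul_eq_mul,
    mul_one, ENNReal.toReal_ofReal hL] at h
  refine abs_le_of_sq_le_sq' ?_ (by positivity) |>.2
  rw [mul_pow, Real.sq_sqrt hL]
  exact h

theorem abs_primitive_le {L : ℝ} {f : ℝ → ℝ} (hf : IntegrableOn f (Ioo 0 L)) {x y : ℝ}
    (hx : x ∈ Icc 0 L) (hy : y ∈ Icc 0 L) :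
    |∫ s in x..y, f s| ≤ ∫ s in Ioo 0 L, |f s| := by
  have hL : 0 ≤ L := hx.1.trans hx.2
  rw [← Real.norm_eq_abs]
  refine (intervalIntegral.norm_integral_le_integral_norm_uIoc).trans ?_
  rw [← integral_Ioc_eq_integral_Ioo]
  refine setIntegral_mono_set ((show IntegrableOn (fun s => |f s|) (Ioo 0 L) volume from hf.abs).congr_set_ae Ioo_ae_eq_Ioc.symm)
    (Eventually.of_forall fun s => abs_nonneg _) (Eventually.of_forall ?_)
  intro s hs
  exact ⟨(le_min hx.1 hy.1).trans_lt hs.1, hs.2.trans (max_le hx.2 hy.2)⟩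

/-- The primitive of an `L²` function vanishing at `0`. -/
def primL {L : ℝ} (hL : 0 < L) : L2 L →L[ℝ] CB :=
  LinearMap.mkContinuous
    { toFun := fun f => BoundedContinuousFunction.ofNormedAddCommGroup
        (fun y => ∫ s in (0 : ℝ)..clamp L y, f s)
        (by
          have h := intervalIntegral.continuousOn_primitive_interval' (μ := volume)
            (f.intervalIntegrable hL.le) (a := 0) (by simp)
          rw [uIcc_of_le hL.le] at h
          exact h.comp_continuous (continuous_clamp L) (clamp_mem hL.le))
        (Real.sqrt L * ‖f‖)
        (fun y => (abs_primitive_le f.integrableOn ⟨le_rfl, hL.le⟩ (clamp_mem hL.le y)).trans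
          (f.integral_abs_le hL.le))
      map_add' := fun f g => by
        ext y
        simp only [BoundedContinuousFunction.coe_ofNormedAddCommGroup,
          BoundedContinuousFunction.coe_add, Pi.add_apply]
        have h0 : (0 : ℝ) ∈ Icc 0 L := ⟨le_rfl, hL.le⟩
        rw [← intervalIntegral.integral_add
          (intervalIntegrable_of_mem (f.intervalIntegrable hL.le) h0 (clamp_mem hL.le y))
          (intervalIntegrable_of_mem (g.intervalIntegrable hL.le) h0 (clamp_mem hL.le y))]
        have hc := clamp_mem hL.le y
        rw [intervalIntegral.integral_of_le hc.1, intervalIntegral.integral_of_le hc.1,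
          integral_Ioc_eq_integral_Ioo, integral_Ioc_eq_integral_Ioo]
        exact integral_congr_ae (ae_restrict_of_ae_restrict_of_subset
          (Ioo_subset_Ioo_right hc.2) (Lp.coeFn_add f g))
      map_smul' := fun a f => by
        ext y
        simp only [BoundedContinuousFunction.coe_ofNormedAddCommGroup, RingHom.id_apply,
          BoundedContinuousFunction.coe_smul]
        rw [← intervalIntegral.integral_smul]
        have hc := clamp_mem hL.le y
        rw [intervalIntegral.integral_of_le hc.1, intervalIntegral.integral_of_le hc.1,
          integral_Ioc_eq_integral_Ioo, integral_Ioc_eq_integral_Ioo]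
        exact integral_congr_ae (ae_restrict_of_ae_restrict_of_subset
          (Ioo_subset_Ioo_right hc.2) (Lp.coeFn_smul a f)) }
    (Real.sqrt L) (fun f => by
      refine (BoundedContinuousFunction.norm_le (by positivity)).2 fun y => ?_
      exact (abs_primitive_le f.integrableOn ⟨le_rfl, hL.le⟩ (clamp_mem hL.le y)).trans
          (f.integral_abs_le hL.le))

theorem primL_apply {L : ℝ} (hL : 0 < L) (f : L2 L) (y : ℝ) :
    primL hL f y = ∫ s in (0 : ℝ)..clamp L y, f s := rfl

theorem H.weakDeriv {L : ℝ} {m : ℕ} (f : H L m) (k : Fin m) :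
    IsWeakDeriv L (f.d k.castSucc) (f.d k.succ) := f.2 k

/-- The `k`-th weak derivative as a continuous linear map. -/
def dL (L : ℝ) (m : ℕ) (k : Fin (m + 1)) : H L m →L[ℝ] L2 L :=
  (PiLp.proj 2 (fun _ : Fin (m + 1) => L2 L) k).comp (sobolev L m).subtypeL

@[simp] theorem dL_apply {L : ℝ} {m : ℕ} (k : Fin (m + 1)) (f : H L m) : dL L m k f = f.d k := rfl

theorem H.norm_sq_eq {L : ℝ} {m : ℕ} (f : H L m) : ‖f‖ ^ 2 = ∑ k, ‖f.d k‖ ^ 2 := by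
  rw [← Submodule.norm_coe, PiLp.norm_sq_eq_of_L2]
  rfl

/-- Assembles an element of `H^m` from its derivatives. -/
def mkH (L : ℝ) (n m : ℕ) (j : Fin (m + 1) → Fin (n + 1))
    (hj : ∀ (f : H L n) (k : Fin m), IsWeakDeriv L (f.d (j k.castSucc)) (f.d (j k.succ))) :
    H L n →L[ℝ] H L m :=
  ContinuousLinearMap.codRestrict
    (((PiLp.continuousLinearEquiv 2 ℝ (fun _ : Fin (m + 1) => L2 L)).symm :
      (Fin (m + 1) → L2 L) →L[ℝ] PiLp 2 (fun _ : Fin (m + 1) => L2 L)).comp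
      (ContinuousLinearMap.pi fun k : Fin (m + 1) => dL L n (j k)))
    (sobolev L m) (fun f k => hj f k)

/-- The restriction `H^{m+1} → H^m`. -/
def truncL (L : ℝ) (m : ℕ) : H L (m + 1) →L[ℝ] H L m :=
  mkH L (m + 1) m Fin.castSucc fun f k => f.2 k.castSucc

/-- The derivative `H^{m+1} → H^m`. -/
def derivL (L : ℝ) (m : ℕ) : H L (m + 1) →L[ℝ] H L m :=
  mkH L (m + 1) m Fin.succ fun f k => f.2 k.succ

/-- The continuous representative of an element of `H¹`. The additive constant is recovered
from the mean value. -/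
def evL {L : ℝ} (hL : 0 < L) : H L 1 →L[ℝ] CB :=
  ((ContinuousLinearMap.toSpanSingleton ℝ (1 : CB)).comp
    (L⁻¹ • ((innerSL ℝ (toL2 L 1)).comp (dL L 1 0) -
      (integL L).comp ((primL hL).comp (dL L 1 1))))) + (primL hL).comp (dL L 1 1)

theorem evL_apply {L : ℝ} (hL : 0 < L) (f : H L 1) (y : ℝ) :
    evL hL f y = L⁻¹ * ((∫ s in Ioo 0 L, f.d 0 s) - ∫ s in Ioo 0 L, primL hL (f.d 1) s) +
      ∫ s in (0 : ℝ)..clamp L y, f.d 1 s := by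
  have h : inner ℝ (toL2 L 1) (f.d 0) = ∫ s in Ioo 0 L, f.d 0 s := by
    rw [L2.inner_eq]
    refine integral_congr_ae ?_
    filter_upwards [toL2_coe (L := L) 1] with y h2
    rw [h2]; simp
  simp only [evL, add_apply, ContinuousLinearMap.comp_apply,
    smul_apply, sub_apply, innerSL_apply_apply, dL_apply, h,
    integL_eq, ContinuousLinearMap.toSpanSingleton_apply, BoundedContinuousFunction.coe_add,
    Pi.add_apply, BoundedContinuousFunction.coe_smul, BoundedContinuousFunction.coe_one,
    Pi.one_apply, smul_eq_mul, mul_one, primL_apply]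

theorem evL_clamp {L : ℝ} (hL : 0 < L) (f : H L 1) (y : ℝ) :
    evL hL f (clamp L y) = evL hL f y := by
  rw [evL_apply, evL_apply, clamp_of_mem (clamp_mem hL.le y)]

theorem evL_isPrimitiveOn {L : ℝ} (hL : 0 < L) (f : H L 1) : IsPrimitiveOn L (evL hL f) (f.d 1) := by
  refine ⟨hL.le, (f.d 1).intervalIntegrable hL.le, fun y hy => ?_⟩
  rw [evL_apply, evL_apply, clamp_of_mem hy, clamp_of_mem ⟨le_rfl, hL.le⟩]
  simp

theorem evL_ae_eq {L : ℝ} (hL : 0 < L) (f : H L 1) : f.d 0 =ᵐ[leb L] evL hL f := by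
  obtain ⟨c, hc⟩ := (f.weakDeriv 0).exists_ae_eq hL (f.d 1).integrableOn
  have hc' : f.d 0 =ᵐ[leb L] fun y => c + primL hL (f.d 1) y := by
    filter_upwards [hc, ae_restrict_mem measurableSet_Ioo] with y hy hyL
    rw [primL_apply, clamp_of_mem (Ioo_subset_Icc_self hyL)]
    exact hy
  have hint : ∫ s in Ioo 0 L, f.d 0 s = L * c + ∫ s in Ioo 0 L, primL hL (f.d 1) s := by
    rw [integral_congr_ae hc', integral_add (integrable_const _)
      (((primL hL (f.d 1)).memLp L).integrable (by norm_num)), integral_const]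
    simp [hL.le]
  filter_upwards [hc'] with y hy
  rw [hy, evL_apply, hint, primL_apply]
  field_simp
  ring

theorem IsWeakDeriv.ae_unique {L : ℝ} {f g g' : ℝ → ℝ} (h : IsWeakDeriv L f g)
    (h' : IsWeakDeriv L f g') : g =ᵐ[leb L] g' := by
  have key := isOpen_Ioo.ae_eq_zero_of_integral_contDiff_smul_eq_zero (E := ℝ)
    (μ := volume.restrict (Ioo 0 L)) (U := Ioo 0 L) (f := fun y => g y - g' y) ?_ ?_
  · filter_upwards [ae_restrict_of_ae_restrict_of_subset (μ := volume) (subset_refl _) key,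
      ae_restrict_mem measurableSet_Ioo] with y hy hyL
    exact sub_eq_zero.1 (hy hyL)
  · intro x hx
    obtain ⟨s, hs, hi⟩ := (h.locInt_right.sub h'.locInt_right) x hx
    exact ⟨s, hs, hi.restrict⟩
  · intro φ hφ hφs hφt
    have e : ∀ y, φ y • (g y - g' y) = g y * φ y - g' y * φ y := fun y => by
      simp only [smul_eq_mul]; ring
    simp_rw [e]
    rw [integral_sub (integrableOn_mul_of_tsupport measurableSet_Ioo h.locInt_right
      hφ.continuous hφs hφt) (integrableOn_mul_of_tsupport measurableSet_Ioo h'.locInt_right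
      hφ.continuous hφs hφt)]
    have e1 := h.integral_eq φ hφ hφs hφt
    have e2 := h'.integral_eq φ hφ hφs hφt
    linarith

/-- An element of `H^m` is determined by the function itself, weak derivatives being unique. -/
theorem H.ext_zero {L : ℝ} {m : ℕ} {f g : H L m} (h : f.d 0 = g.d 0) : f = g := by
  have key : ∀ k : Fin (m + 1), f.d k = g.d k := by
    intro k
    induction k using Fin.induction with
    | zero => exact h
    | succ k ih =>
      refine Lp.ext ((f.weakDeriv k).ae_unique ?_)
      rw [ih]
      exact g.weakDeriv k
  refine Subtype.ext (PiLp.ext fun k => key k)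

theorem dL_zero_injective (L : ℝ) (m : ℕ) : Function.Injective (dL L m 0) :=
  fun _ _ h => H.ext_zero h

/-- Two functions continuous on `[0, L]` that agree almost everywhere agree on `[0, L]`. -/
theorem eqOn_Icc_of_ae_eq {L : ℝ} (hL : 0 < L) {f g : ℝ → ℝ} (hf : ContinuousOn f (Icc 0 L))
    (hg : ContinuousOn g (Icc 0 L)) (h : f =ᵐ[leb L] g) : EqOn f g (Icc 0 L) := by
  have h1 : EqOn f g (Ioo 0 L) := Measure.eqOn_open_of_ae_eq h isOpen_Ioo
    (hf.mono Ioo_subset_Icc_self) (hg.mono Ioo_subset_Icc_self)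
  refine h1.of_subset_closure hf hg Ioo_subset_Icc_self ?_
  rw [closure_Ioo hL.ne]

/-- All continuous representatives agree with `evL` on the closed interval. -/
theorem IsContRep.eqOn_evL {L : ℝ} (hL : 0 < L) {f : H L 1} {c : ℝ → ℝ}
    (h : IsContRep (f.d 0) c) : EqOn c (evL hL f) (Icc 0 L) :=
  eqOn_Icc_of_ae_eq hL h.1 (evL hL f).continuous.continuousOn
    (h.2.symm.trans (evL_ae_eq hL f))

theorem isContRep_evL {L : ℝ} (hL : 0 < L) (f : H L 1) : IsContRep (f.d 0) (evL hL f) :=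
  ⟨(evL hL f).continuous.continuousOn, evL_ae_eq hL f⟩

theorem IsPrimitiveOn.integral_Ioo {L : ℝ} {u w : ℝ → ℝ} (h : IsPrimitiveOn L u w) :
    ∫ y in Ioo 0 L, w y = u L - u 0 := by
  rw [← intervalIntegral_eq_Ioo h.nonneg, ← h.sub_eq ⟨le_rfl, h.nonneg⟩ ⟨h.nonneg, le_rfl⟩]

theorem IsPrimitiveOn.abs_sub_le {L : ℝ} {u w : ℝ → ℝ} (h : IsPrimitiveOn L u w) {x y : ℝ}
    (hx : x ∈ Icc 0 L) (hy : y ∈ Icc 0 L) : |u y - u x| ≤ ∫ s in Ioo 0 L, |w s| := by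
  rw [h.sub_eq hx hy]
  refine abs_primitive_le ?_ hx hy
  have := h.intble
  rw [intervalIntegrable_iff, uIoc_of_le h.nonneg] at this
  exact this.mono_set Ioo_subset_Ioc_self

end Spaces

/-! ### Representatives of a global solution -/

section Curves

variable {L : ℝ}

theorem MemLp.intervalIntegrable_of_two {E : Type*} [NormedAddCommGroup E] {T : ℝ} (hT : 0 ≤ T)
    {w : ℝ → E} (h : MemLp w 2 (leb T)) : IntervalIntegrable w volume 0 T := by
  rw [intervalIntegrable_iff, uIoc_of_le hT]
  have : IntegrableOn w (Ioo 0 T) := h.integrable (by norm_num)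
  exact this.congr_set_ae Ioo_ae_eq_Ioc.symm

theorem ae_leb_of_ae_Ioi {p : ℝ → Prop} {T : ℝ} (h : ∀ᵐ t ∂volume.restrict (Ioi 0), p t) :
    ∀ᵐ t ∂leb T, p t :=
  ae_restrict_of_ae_restrict_of_subset (fun _ ht => ht.1) h

theorem IsTimeDeriv.isPrimitiveOn {u w : ℝ → L2 L} (h : IsTimeDeriv u w) {T : ℝ} (hT : 0 ≤ T) :
    IsPrimitiveOn T u w := ⟨hT, (h T hT).1, fun t ht => (h t ht.1).2⟩

theorem toL2_evL (hL : 0 < L) (f : H L 1) : toL2 L (evL hL f) = f.d 0 := by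
  refine Lp.ext ?_
  filter_upwards [toL2_coe (L := L) (evL hL f), evL_ae_eq hL f] with y h1 h2
  rw [h1, h2]

/-- Evaluation at a point as a continuous linear functional. -/
abbrev evalAt (y : ℝ) : CB →L[ℝ] ℝ := BoundedContinuousFunction.evalCLM ℝ y

theorem CB.ext_of_clamp {f g : CB} (hL : 0 < L) (hf : ∀ y, f (clamp L y) = f y)
    (hg : ∀ y, g (clamp L y) = g y) (h : EqOn f g (Icc 0 L)) : f = g := by
  ext y
  rw [← hf, ← hg]
  exact h (clamp_mem hL.le y)

theorem nonneg_Icc_of_Ioo (hL : 0 < L) {f : ℝ → ℝ} {a : ℝ} (hf : ContinuousOn f (Icc 0 L))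
    (h : ∀ y ∈ Ioo 0 L, a ≤ f y) : ∀ y ∈ Icc 0 L, a ≤ f y := by
  intro y hy
  rw [← closure_Ioo hL.ne] at hy hf
  exact (isClosed_Ici (a := a)).closure_subset_iff.2 (image_subset_iff.2 fun z hz => h z hz)
    (hf.image_closure ⟨y, hy, rfl⟩)

theorem inner_toL2 (a : CB) (f : L2 L) :
    inner ℝ (toL2 L a) f = ∫ y in Ioo 0 L, f y * a y := by
  rw [L2.inner_eq]
  refine integral_congr_ae ?_
  filter_upwards [toL2_coe (L := L) a] with y h
  rw [h, mul_comm]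

/-- The graph of the weak derivative is closed. -/
theorem isClosed_weakDeriv (L : ℝ) : IsClosed {p : L2 L × L2 L | IsWeakDeriv L p.1 p.2} := by
  let bd : ∀ φ : ℝ → ℝ, Continuous φ → HasCompactSupport φ → CB := fun φ hφ hs =>
    BoundedContinuousFunction.ofNormedAddCommGroup φ hφ
      (Classical.choose (hφ.bounded_above_of_compact_support hs))
      (Classical.choose_spec (hφ.bounded_above_of_compact_support hs))
  have e : {p : L2 L × L2 L | IsWeakDeriv L p.1 p.2} =
      ⋂ φ : {φ : ℝ → ℝ // ContDiff ℝ (⊤ : ℕ∞) φ ∧ HasCompactSupport φ ∧ tsupport φ ⊆ Ioo 0 L},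
        {p : L2 L × L2 L | inner ℝ (toL2 L (bd (deriv φ) (φ.2.1.continuous_deriv (by simp))
          φ.2.2.1.deriv)) p.1 = - inner ℝ (toL2 L (bd φ φ.2.1.continuous φ.2.2.1)) p.2} := by
    ext p
    simp only [mem_ofPred_eq, mem_iInter, inner_toL2]
    constructor
    · intro h φ
      exact h.integral_eq φ φ.2.1 φ.2.2.1 φ.2.2.2
    · intro h
      exact ⟨L2.locInt _, L2.locInt _, fun φ h1 h2 h3 => h ⟨φ, h1, h2, h3⟩⟩
  rw [e]
  exact isClosed_iInter fun φ => isClosed_eq (by fun_prop) (by fun_prop)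

instance H.completeSpace (L : ℝ) (m : ℕ) : CompleteSpace (H L m) := by
  have h : IsClosed (sobolev L m : Set (PiLp 2 fun _ : Fin (m + 1) => L2 L)) := by
    have e : (sobolev L m : Set (PiLp 2 fun _ : Fin (m + 1) => L2 L)) =
        ⋂ k : Fin m, (fun f : PiLp 2 (fun _ : Fin (m + 1) => L2 L) =>
          (f k.castSucc, f k.succ)) ⁻¹' {p : L2 L × L2 L | IsWeakDeriv L p.1 p.2} := by
      ext f
      simp only [mem_iInter]
      rfl
    rw [e]
    exact isClosed_iInter fun k => (isClosed_weakDeriv L).preimage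
      ((PiLp.continuous_apply 2 _ k.castSucc).prodMk (PiLp.continuous_apply 2 _ k.succ))
  exact h.completeSpace_coe

namespace GlobalSolution

variable {R c_v μ κ : ℝ} {ϱ₀ v₀ ϑ₀ : H L 2} (S : GlobalSolution R c_v μ κ L ϱ₀ v₀ ϑ₀)

theorem isPrimitiveOn_v {T : ℝ} (hT : 0 < T) :
    IsPrimitiveOn T (fun t => truncL L 1 (S.v t)) S.v_t :=
  IsPrimitiveOn.of_map_injective (dL L 1 0) (dL_zero_injective L 1)
    (MemLp.intervalIntegrable_of_two hT.le (S.v_t_mem T hT)) (S.v_t_deriv.isPrimitiveOn hT.le)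

theorem isPrimitiveOn_ϑ {T : ℝ} (hT : 0 < T) :
    IsPrimitiveOn T (fun t => truncL L 1 (S.ϑ t)) S.ϑ_t :=
  IsPrimitiveOn.of_map_injective (dL L 1 0) (dL_zero_injective L 1)
    (MemLp.intervalIntegrable_of_two hT.le (S.ϑ_t_mem T hT)) (S.ϑ_t_deriv.isPrimitiveOn hT.le)

theorem isPrimitiveOn_J {T : ℝ} (hT : 0 < T) : IsPrimitiveOn T S.J S.J_t :=
  IsPrimitiveOn.of_map_injective (dL L 2 0) (dL_zero_injective L 2)
    (MemLp.intervalIntegrable_of_two hT.le (S.J_t_mem T hT)) (S.J_t_deriv.isPrimitiveOn hT.le)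

/-- The continuous representative of an `H²` function. -/
def _root_.HeatNS.H.rep (hL : 0 < L) (f : H L 2) : CB := evL hL (truncL L 1 f)

/-- The continuous representative of the derivative of an `H²` function. -/
def _root_.HeatNS.H.rep' (hL : 0 < L) (f : H L 2) : CB := evL hL (derivL L 1 f)

theorem _root_.HeatNS.H.rep_ae_eq (hL : 0 < L) (f : H L 2) : f.d 0 =ᵐ[leb L] f.rep hL :=
  evL_ae_eq hL (truncL L 1 f)

theorem _root_.HeatNS.H.rep'_ae_eq (hL : 0 < L) (f : H L 2) : f.d 1 =ᵐ[leb L] f.rep' hL :=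
  evL_ae_eq hL (derivL L 1 f)

theorem _root_.HeatNS.H.toL2_rep' (hL : 0 < L) (f : H L 2) : toL2 L (f.rep' hL) = f.d 1 :=
  toL2_evL hL (derivL L 1 f)

theorem _root_.HeatNS.H.toL2_rep (hL : 0 < L) (f : H L 2) : toL2 L (f.rep hL) = f.d 0 :=
  toL2_evL hL (truncL L 1 f)

theorem _root_.HeatNS.H.rep_clamp (hL : 0 < L) (f : H L 2) (y : ℝ) :
    f.rep hL (clamp L y) = f.rep hL y := evL_clamp hL _ y

theorem _root_.HeatNS.H.rep'_clamp (hL : 0 < L) (f : H L 2) (y : ℝ) :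
    f.rep' hL (clamp L y) = f.rep' hL y := evL_clamp hL _ y

theorem _root_.HeatNS.H.rep_isPrimitiveOn (hL : 0 < L) (f : H L 2) :
    IsPrimitiveOn L (f.rep hL) (f.rep' hL) :=
  (evL_isPrimitiveOn hL (truncL L 1 f)).congr_ae (evL_ae_eq hL (derivL L 1 f))

theorem _root_.HeatNS.H.rep'_isPrimitiveOn (hL : 0 < L) (f : H L 2) :
    IsPrimitiveOn L (f.rep' hL) (f.d 2) := evL_isPrimitiveOn hL (derivL L 1 f)

theorem _root_.HeatNS.H.continuousOn_rep (hL : 0 < L) {f : ℝ → H L 2} {s : Set ℝ}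
    (hf : ContinuousOn f s) : ContinuousOn (fun t => (f t).rep hL) s :=
  ((evL hL).continuous.comp (truncL L 1).continuous).comp_continuousOn hf

theorem _root_.HeatNS.H.continuousOn_rep' (hL : 0 < L) {f : ℝ → H L 2} {s : Set ℝ}
    (hf : ContinuousOn f s) : ContinuousOn (fun t => (f t).rep' hL) s :=
  ((evL hL).continuous.comp (derivL L 1).continuous).comp_continuousOn hf

theorem rep_J_isPrimitiveOn (hL : 0 < L) {T : ℝ} (hT : 0 < T) :
    IsPrimitiveOn T (fun t => (S.J t).rep hL) (fun t => (S.v t).rep' hL) := by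
  refine ((S.isPrimitiveOn_J hT).map ((evL hL).comp (truncL L 1))).congr_ae ?_
  filter_upwards [ae_leb_of_ae_Ioi S.eq_J] with t ht
  have : truncL L 1 (S.J_t t) = derivL L 1 (S.v t) := H.ext_zero ht
  simp only [ContinuousLinearMap.comp_apply, this]
  rfl

theorem rep_J_zero (hL : 0 < L) : (S.J 0).rep hL = 1 := by
  refine CB.ext_of_clamp hL (H.rep_clamp hL _) (fun y => rfl) ?_
  refine eqOn_Icc_of_ae_eq hL (BoundedContinuousFunction.continuous _).continuousOn
    (BoundedContinuousFunction.continuous _).continuousOn ?_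
  exact (H.rep_ae_eq hL _).symm.trans S.J_init

theorem zero_of_pos {f : ℝ → ℝ} (hf : ContinuousOn f (Ici 0)) (h : ∀ t, 0 < t → f t = 0) :
    ∀ t, 0 ≤ t → f t = 0 := by
  intro t ht
  have hc : IsClosed ({0} : Set ℝ) := isClosed_singleton
  have h1 : t ∈ closure (Ioi (0 : ℝ)) := by rw [closure_Ioi]; exact ht
  rw [← closure_Ioi] at hf
  exact hc.closure_subset_iff.2 (image_subset_iff.2 fun z hz => h z hz)
    (hf.image_closure ⟨t, h1, rfl⟩)

theorem _root_.HeatNS.VanishesAtEnds.evL_eq (hL : 0 < L) {f : H L 1}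
    (h : VanishesAtEnds (f.d 0)) : evL hL f 0 = 0 ∧ evL hL f L = 0 := by
  obtain ⟨c, hc, h0, h1⟩ := h
  have := hc.eqOn_evL hL
  exact ⟨(this ⟨le_rfl, hL.le⟩).symm.trans h0, (this ⟨hL.le, le_rfl⟩).symm.trans h1⟩

theorem rep_v_boundary (hL : 0 < L) : ∀ t, 0 ≤ t →
    (S.v t).rep hL 0 = 0 ∧ (S.v t).rep hL L = 0 := by
  have h : ∀ t, 0 < t → (S.v t).rep hL 0 = 0 ∧ (S.v t).rep hL L = 0 := fun t ht =>
    VanishesAtEnds.evL_eq hL (f := truncL L 1 (S.v t)) (S.v_boundary t ht)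
  have hc := H.continuousOn_rep hL S.v_cont
  intro t ht
  exact ⟨zero_of_pos ((evalAt 0).continuous.comp_continuousOn hc) (fun t ht => (h t ht).1) t ht,
    zero_of_pos ((evalAt L).continuous.comp_continuousOn hc) (fun t ht => (h t ht).2) t ht⟩

theorem rep'_ϑ_boundary (hL : 0 < L) : ∀ t, 0 ≤ t →
    (S.ϑ t).rep' hL 0 = 0 ∧ (S.ϑ t).rep' hL L = 0 := by
  have h : ∀ t, 0 < t → (S.ϑ t).rep' hL 0 = 0 ∧ (S.ϑ t).rep' hL L = 0 := fun t ht =>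
    VanishesAtEnds.evL_eq hL (f := derivL L 1 (S.ϑ t)) (S.ϑ_boundary t ht)
  have hc := H.continuousOn_rep' hL S.ϑ_cont
  intro t ht
  exact ⟨zero_of_pos ((evalAt 0).continuous.comp_continuousOn hc) (fun t ht => (h t ht).1) t ht,
    zero_of_pos ((evalAt L).continuous.comp_continuousOn hc) (fun t ht => (h t ht).2) t ht⟩

theorem _root_.HeatNS.IsBoundedBelowBy.le_rep (hL : 0 < L) {f : H L 2} {a : ℝ}
    (h : IsBoundedBelowBy (f.d 0) a) (y : ℝ) : a ≤ f.rep hL y := by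
  obtain ⟨c, hc, h1⟩ := h
  rw [← H.rep_clamp]
  refine nonneg_Icc_of_Ioo hL (f.rep hL).continuous.continuousOn (fun z hz => ?_) _
    (clamp_mem hL.le y)
  have : c z = f.rep hL z := IsContRep.eqOn_evL hL (f := truncL L 1 f) hc (Ioo_subset_Icc_self hz)
  rw [← this]
  exact h1 z hz

theorem _root_.HeatNS.IsPositive.rep_pos (hL : 0 < L) {f : H L 2}
    (h : IsPositive (f.d 0)) {y : ℝ} (hy : y ∈ Ioo 0 L) : 0 < f.rep hL y := by
  obtain ⟨c, hc, h1⟩ := h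
  have : c y = f.rep hL y := IsContRep.eqOn_evL hL (f := truncL L 1 f) hc (Ioo_subset_Icc_self hy)
  rw [← this]
  exact h1 y hy

theorem rep_ϑ_nonneg (hL : 0 < L) {a : ℝ} (ha : 0 < a) (hϑ : IsBoundedBelowBy (ϑ₀.d 0) a) :
    ∀ t, 0 ≤ t → ∀ y, 0 ≤ (S.ϑ t).rep hL y := by
  intro t ht y
  rcases ht.eq_or_lt with rfl | ht
  · rw [S.ϑ_init]
    exact ha.le.trans (hϑ.le_rep hL y)
  · rw [← H.rep_clamp]
    exact nonneg_Icc_of_Ioo hL ((S.ϑ t).rep hL).continuous.continuousOn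
      (fun z hz => ((S.ϑ_pos t ht).rep_pos hL hz).le) _ (clamp_mem hL.le y)

theorem rep_J_pos_Ioo (hL : 0 < L) : ∀ t, 0 ≤ t → ∀ y ∈ Ioo 0 L, 0 < (S.J t).rep hL y := by
  intro t ht y hy
  rcases ht.eq_or_lt with rfl | ht
  · rw [S.rep_J_zero hL]; simp
  · exact (S.J_pos t ht).rep_pos hL hy

/-- The momentum equation in terms of continuous representatives, away from the end points. -/
theorem momentum_Ioo (hL : 0 < L) : ∀ᵐ t ∂volume.restrict (Ioi 0), ∀ y ∈ Ioo 0 L, ∀ z ∈ Ioo 0 L,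
    (μ * (S.v t).rep' hL y - R * ϱ₀.rep hL y * (S.ϑ t).rep hL y) / (S.J t).rep hL y -
      (μ * (S.v t).rep' hL z - R * ϱ₀.rep hL z * (S.ϑ t).rep hL z) / (S.J t).rep hL z =
    primL hL (toL2 L (ϱ₀.rep hL * evL hL (S.v_t t))) y -
      primL hL (toL2 L (ϱ₀.rep hL * evL hL (S.v_t t))) z := by
  filter_upwards [S.eq_v, ae_restrict_mem measurableSet_Ioi] with t ht ht0
  have ht0 : 0 < t := ht0
  have hg : (fun y => ϱ₀.d 0 y * (S.v_t t).d 0 y) =ᵐ[leb L]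
      toL2 L (ϱ₀.rep hL * evL hL (S.v_t t)) := by
    filter_upwards [toL2_coe (L := L) (ϱ₀.rep hL * evL hL (S.v_t t)), H.rep_ae_eq hL ϱ₀,
      evL_ae_eq hL (S.v_t t)] with y h1 h2 h3
    rw [h1, h2, h3]; rfl
  have hgi : IntegrableOn (fun y => ϱ₀.d 0 y * (S.v_t t).d 0 y) (Ioo 0 L) :=
    (L2.integrableOn _).congr hg.symm
  obtain ⟨c, hc⟩ := ht.exists_ae_eq hL hgi
  set P := primL hL (toL2 L (ϱ₀.rep hL * evL hL (S.v_t t))) with hP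
  have hc' : (fun y => (μ * (S.v t).rep' hL y - R * ϱ₀.rep hL y * (S.ϑ t).rep hL y) /
      (S.J t).rep hL y) =ᵐ[leb L] fun y => c + P y := by
    filter_upwards [hc, H.rep_ae_eq hL ϱ₀, H.rep_ae_eq hL (S.J t), H.rep_ae_eq hL (S.ϑ t),
      H.rep'_ae_eq hL (S.v t), ae_restrict_mem measurableSet_Ioo] with y h1 h2 h3 h4 h5 hy
    rw [h2, h3, h4, h5] at h1
    have : ∫ s in (0 : ℝ)..y, ϱ₀.d 0 s * (S.v_t t).d 0 s = P y := by
      rw [hP, primL_apply, clamp_of_mem (Ioo_subset_Icc_self hy),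
        intervalIntegral.integral_of_le hy.1.le, intervalIntegral.integral_of_le hy.1.le,
        integral_Ioc_eq_integral_Ioo, integral_Ioc_eq_integral_Ioo]
      exact integral_congr_ae (ae_restrict_of_ae_restrict_of_subset
        (Ioo_subset_Ioo_right hy.2.le) hg)
    rw [← this, ← h1]
    ring
  have hcont : ContinuousOn (fun y => (μ * (S.v t).rep' hL y -
      R * ϱ₀.rep hL y * (S.ϑ t).rep hL y) / (S.J t).rep hL y) (Ioo 0 L) := by
    refine ContinuousOn.div ?_ ((S.J t).rep hL).continuous.continuousOn
      (fun y hy => (S.rep_J_pos_Ioo hL t ht0.le y hy).ne')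
    have h1 := ((S.v t).rep' hL).continuous
    have h2 := (ϱ₀.rep hL).continuous
    have h3 := ((S.ϑ t).rep hL).continuous
    fun_prop
  have heq := Measure.eqOn_open_of_ae_eq hc' isOpen_Ioo hcont
    (continuous_const.add P.continuous).continuousOn
  intro y hy z hz
  have e1 := heq hy
  have e2 := heq hz
  simp only at e1 e2
  rw [e1, e2]; ring

end GlobalSolution
end Curves

/-! ### Positivity of the Jacobian up to the end points -/

section Positivity

theorem IsPrimitiveOn.log {b : ℝ} {u w : ℝ → ℝ} (h : IsPrimitiveOn b u w)
    (hw : ContinuousOn w (Icc 0 b)) (hu : ∀ t ∈ Icc 0 b, 0 < u t) :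
    IsPrimitiveOn b (fun t => Real.log (u t)) (fun t => w t / u t) :=
  IsPrimitiveOn.of_hasDerivAt h.nonneg
    (h.continuousOn.log fun t ht => (hu t ht).ne')
    (fun t ht => (h.hasDerivAt hw t ht).log (hu t (Ioo_subset_Icc_self ht)).ne')
    (hw.div h.continuousOn fun t ht => (hu t ht).ne')

theorem isPrimitiveOn_integral {E : Type*} [NormedAddCommGroup E] [NormedSpace ℝ E] {b : ℝ}
    (hb : 0 ≤ b) {w : ℝ → E} (hw : IntervalIntegrable w volume 0 b) :
    IsPrimitiveOn b (fun t => ∫ s in (0 : ℝ)..t, w s) w := ⟨hb, hw, fun t _ => by simp⟩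

theorem isPrimitiveOn_integral_of_continuousOn {E : Type*} [NormedAddCommGroup E]
    [NormedSpace ℝ E] {b : ℝ}
    (hb : 0 ≤ b) {w : ℝ → E} (hw : ContinuousOn w (Icc 0 b)) :
    IsPrimitiveOn b (fun t => ∫ s in (0 : ℝ)..t, w s) w :=
  isPrimitiveOn_integral hb (ContinuousOn.intervalIntegrable (by rwa [uIcc_of_le hb]))

/-- The effective viscous flux at `y` and `z` differs by the derivative of the momentum between
these points. Integration in time compares the Jacobians at the two points. -/
theorem log_jacobian_identity {μ b : ℝ} {j j' a a' p p' n N : ℝ → ℝ}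
    (hj : IsPrimitiveOn b j a) (hj' : IsPrimitiveOn b j' a') (hN : IsPrimitiveOn b N n)
    (ha : ContinuousOn a (Icc 0 b)) (ha' : ContinuousOn a' (Icc 0 b))
    (hp : ContinuousOn p (Icc 0 b)) (hp' : ContinuousOn p' (Icc 0 b))
    (hpos : ∀ t ∈ Icc 0 b, 0 < j t) (hpos' : ∀ t ∈ Icc 0 b, 0 < j' t) (h0 : j 0 = 1)
    (h0' : j' 0 = 1)
    (h : ∀ᵐ t ∂leb b, (μ * a t - p t) / j t - (μ * a' t - p' t) / j' t = n t) :
    ∀ t ∈ Icc 0 b, μ * Real.log (j t) - (∫ s in (0 : ℝ)..t, p s / j s) -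
      (μ * Real.log (j' t) - ∫ s in (0 : ℝ)..t, p' s / j' s) = N t - N 0 := by
  have hb := hj.nonneg
  have hl := ((hj.log ha hpos).const_smul μ).sub (isPrimitiveOn_integral_of_continuousOn hb
    (hp.div hj.continuousOn fun t ht => (hpos t ht).ne'))
  have hl' := ((hj'.log ha' hpos').const_smul μ).sub (isPrimitiveOn_integral_of_continuousOn hb
    (hp'.div hj'.continuousOn fun t ht => (hpos' t ht).ne'))
  have hd := ((hl.sub hl').congr_ae (w' := n) (by
    filter_upwards [h] with t ht
    rw [← ht]
    simp only [smul_eq_mul, Pi.div_apply]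
    ring))
  intro t ht
  have e1 := hd.eq_add t ht
  have e2 := hN.eq_add t ht
  simp only [h0, h0', Real.log_one, smul_eq_mul, mul_zero, intervalIntegral.integral_same, sub_zero,
    zero_add, Pi.div_apply] at e1
  linarith

variable {L : ℝ}

namespace GlobalSolution

variable {R c_v μ κ : ℝ} {ϱ₀ v₀ ϑ₀ : H L 2} (S : GlobalSolution R c_v μ κ L ϱ₀ v₀ ϑ₀)

theorem rep_v_isPrimitiveOn (hL : 0 < L) {T : ℝ} (hT : 0 < T) :
    IsPrimitiveOn T (fun t => (S.v t).rep hL) (fun t => evL hL (S.v_t t)) :=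
  (S.isPrimitiveOn_v hT).map (evL hL)

theorem rep_ϑ_isPrimitiveOn (hL : 0 < L) {T : ℝ} (hT : 0 < T) :
    IsPrimitiveOn T (fun t => (S.ϑ t).rep hL) (fun t => evL hL (S.ϑ_t t)) :=
  (S.isPrimitiveOn_ϑ hT).map (evL hL)

/-- The Jacobian stays away from zero up to the end points, without a quantitative bound. -/
theorem exists_rep_J_ge (hL : 0 < L) {T : ℝ} (hT : 0 < T) (hR : 0 < R) (hμ : 0 < μ)
    {a : ℝ} (ha : 0 < a)
    (hϱ : IsBoundedBelowBy (ϱ₀.d 0) a) (hϑ : IsBoundedBelowBy (ϑ₀.d 0) a) :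
    ∃ δ : ℝ, 0 < δ ∧ ∀ t ∈ Icc 0 T, ∀ y, δ ≤ (S.J t).rep hL y := by
  have hsub : Icc 0 T ⊆ Ici (0 : ℝ) := fun t ht => ht.1
  have hJ := S.rep_J_isPrimitiveOn hL hT
  have hv := S.rep_v_isPrimitiveOn hL hT
  have hϑc := (H.continuousOn_rep hL S.ϑ_cont).mono hsub
  have hvc := (H.continuousOn_rep' hL S.v_cont).mono hsub
  have hev : ∀ {f : ℝ → CB} (y : ℝ), ContinuousOn f (Icc 0 T) →
      ContinuousOn (fun t => f t y) (Icc 0 T) := fun y hf =>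
    (evalAt y).continuous.comp_continuousOn hf
  -- the momentum between two points
  let N : ℝ → CB := fun t => primL hL (toL2 L (ϱ₀.rep hL * (S.v t).rep hL))
  have hN : IsPrimitiveOn T N (fun t => primL hL (toL2 L (ϱ₀.rep hL * evL hL (S.v_t t)))) :=
    hv.map ((primL hL).comp ((toL2 L).comp (ContinuousLinearMap.mul ℝ CB (ϱ₀.rep hL))))
  obtain ⟨M, hM0, hM⟩ := hN.exists_bound
  have hz : L / 2 ∈ Ioo 0 L := ⟨by linarith, by linarith⟩
  set z := L / 2 with hzdef
  have hident : ∀ y ∈ Ioo 0 L, ∀ t ∈ Icc 0 T,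
      μ * Real.log ((S.J t).rep hL y) -
        (∫ s in (0 : ℝ)..t, R * ϱ₀.rep hL y * (S.ϑ s).rep hL y / (S.J s).rep hL y) -
      (μ * Real.log ((S.J t).rep hL z) -
        ∫ s in (0 : ℝ)..t, R * ϱ₀.rep hL z * (S.ϑ s).rep hL z / (S.J s).rep hL z) =
      (N t y - N t z) - (N 0 y - N 0 z) := by
    intro y hy
    refine log_jacobian_identity (b := T) (j := fun t => (S.J t).rep hL y)
      (j' := fun t => (S.J t).rep hL z) (a := fun t => (S.v t).rep' hL y)
      (a' := fun t => (S.v t).rep' hL z) (hJ.map (evalAt y)) (hJ.map (evalAt z))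
      ((hN.map (evalAt y)).sub (hN.map (evalAt z))) (hev y hvc) (hev z hvc)
      (continuousOn_const.mul (hev y hϑc)) (continuousOn_const.mul (hev z hϑc))
      (fun t ht => S.rep_J_pos_Ioo hL t ht.1 y hy) (fun t ht => S.rep_J_pos_Ioo hL t ht.1 z hz)
      (by simp [S.rep_J_zero hL]) (by simp [S.rep_J_zero hL]) ?_
    filter_upwards [ae_leb_of_ae_Ioi (S.momentum_Ioo hL)] with t ht
    exact ht y hy z hz
  -- bounds at the base point
  have hlog : ContinuousOn (fun t => μ * Real.log ((S.J t).rep hL z) -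
      ∫ s in (0 : ℝ)..t, R * ϱ₀.rep hL z * (S.ϑ s).rep hL z / (S.J s).rep hL z) (Icc 0 T) := by
    refine ContinuousOn.sub (continuousOn_const.mul ((hev z hJ.continuousOn).log
      fun t ht => (S.rep_J_pos_Ioo hL t ht.1 z hz).ne')) ?_
    exact (isPrimitiveOn_integral_of_continuousOn hT.le
      ((continuousOn_const.mul (hev z hϑc)).div (hev z hJ.continuousOn)
        fun t ht => (S.rep_J_pos_Ioo hL t ht.1 z hz).ne')).continuousOn
  obtain ⟨M', hM'⟩ := isCompact_Icc.exists_bound_of_continuousOn hlog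
  refine ⟨Real.exp ((-M' - 4 * M) / μ), Real.exp_pos _, fun t ht y => ?_⟩
  rw [← H.rep_clamp]
  refine nonneg_Icc_of_Ioo hL ((S.J t).rep hL).continuous.continuousOn (fun y hy => ?_) _
    (clamp_mem hL.le y)
  have hpos := S.rep_J_pos_Ioo hL t ht.1 y hy
  rw [← Real.le_log_iff_exp_le hpos, div_le_iff₀ hμ]
  have e := hident y hy t ht
  have h1 := abs_le.1 (hM' t ht)
  have hπ : 0 ≤ ∫ s in (0 : ℝ)..t, R * ϱ₀.rep hL y * (S.ϑ s).rep hL y / (S.J s).rep hL y := by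
    refine intervalIntegral.integral_nonneg ht.1 fun s hs => ?_
    have h2 := S.rep_J_pos_Ioo hL s hs.1 y hy
    have h3 := S.rep_ϑ_nonneg hL ha hϑ s hs.1 y
    have h4 := ha.le.trans (hϱ.le_rep hL y)
    positivity
  have hb : ∀ t ∈ Icc 0 T, ∀ y, |N t y| ≤ M := fun t ht y =>
    ((N t).norm_coe_le y).trans (hM t ht)
  have h0 : (0 : ℝ) ∈ Icc 0 T := ⟨le_rfl, hT.le⟩
  have b1 := abs_le.1 (hb t ht y)
  have b2 := abs_le.1 (hb t ht z)
  have b3 := abs_le.1 (hb 0 h0 y)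
  have b4 := abs_le.1 (hb 0 h0 z)
  linarith [h1.1, b1.1, b2.2, b3.2, b4.1]

end GlobalSolution

/-- The reciprocal of a function bounded away from zero. -/
theorem exists_mul_eq_one {f : CB} {δ : ℝ} (hδ : 0 < δ) (hf : ∀ y, δ ≤ f y) :
    ∃ g : CB, f * g = 1 := by
  refine ⟨BoundedContinuousFunction.ofNormedAddCommGroup (fun y => (f y)⁻¹)
    (f.continuous.inv₀ fun y => (hδ.trans_le (hf y)).ne') δ⁻¹ fun y => ?_, ?_⟩
  · rw [norm_inv, Real.norm_of_nonneg (hδ.le.trans (hf y))]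
    exact inv_anti₀ hδ (hf y)
  · ext y
    simp [(hδ.trans_le (hf y)).ne']

theorem isUnit_of_ge {f : CB} {δ : ℝ} (hδ : 0 < δ) (hf : ∀ y, δ ≤ f y) : IsUnit f := by
  obtain ⟨g, hg⟩ := exists_mul_eq_one hδ hf
  exact IsUnit.of_mul_eq_one g hg

theorem IsPrimitiveOn.ringInverse {b : ℝ} {u w : ℝ → CB} (h : IsPrimitiveOn b u w)
    (hw : ContinuousOn w (Icc 0 b)) (hu : ∀ t ∈ Icc 0 b, IsUnit (u t)) :
    IsPrimitiveOn b (fun t => Ring.inverse (u t))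
      (fun t => -(Ring.inverse (u t) ^ 2 * w t)) := by
  have hc : ContinuousOn (fun t => Ring.inverse (u t)) (Icc 0 b) := by
    intro t ht
    obtain ⟨x, hx⟩ := hu t ht
    have : ContinuousAt Ring.inverse (u t) := hx ▸ NormedRing.inverse_continuousAt x
    exact this.comp_continuousWithinAt (h.continuousOn t ht)
  refine IsPrimitiveOn.of_hasDerivAt h.nonneg hc (fun t ht => ?_) ((hc.pow 2).mul hw).neg
  obtain ⟨x, hx⟩ := hu t (Ioo_subset_Icc_self ht)
  have h1 : HasFDerivAt Ring.inverse (-ContinuousLinearMap.mulLeftRight ℝ CB ↑x⁻¹ ↑x⁻¹) (u t) :=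
    hx ▸ hasFDerivAt_ringInverse x
  have h2 := h1.comp_hasDerivAt t (h.hasDerivAt hw t ht)
  have h3 : Ring.inverse (u t) = ↑x⁻¹ := by rw [← hx, Ring.inverse_unit]
  rw [h3]
  have h4 : -((↑x⁻¹ : CB) ^ 2 * w t) = -((↑x⁻¹ : CB) * w t * ↑x⁻¹) := by ring
  rw [h4]
  exact h2

theorem mul_ringInverse_apply {f : CB} (hf : IsUnit f) (y : ℝ) :
    f y * Ring.inverse f y = 1 := by
  have := Ring.mul_inverse_cancel f hf
  have h2 := congrArg (fun g : CB => g y) this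
  simpa using h2

end Positivity

/-! ### Solutions in terms of continuous representatives -/

/-- A solution on `[0, L] × [0, T]` in terms of continuous representatives. `I` is the
reciprocal of the Jacobian; `ρ'`, `vy`, `ϑy` are derivatives in space, `vt`, `ϑt` derivatives in
time; `g0` and `h0` are the initial values of `√ρ ∂_t v` and `c_v √ρ ∂_t ϑ`. -/
structure Flow (R c_v μ κ T L : ℝ) where
  L_pos : 0 < L
  T_pos : 0 < T
  R_pos : 0 < R
  c_pos : 0 < c_v
  μ_pos : 0 < μ
  κ_pos : 0 < κ
  /-- The density. -/
  ρ : CB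
  /-- The derivative of the density. -/
  ρ' : CB
  /-- The Jacobian. -/
  J : ℝ → CB
  /-- The reciprocal of the Jacobian. -/
  I : ℝ → CB
  /-- The velocity. -/
  v : ℝ → CB
  /-- The space derivative of the velocity. -/
  vy : ℝ → CB
  /-- The temperature. -/
  ϑ : ℝ → CB
  /-- The space derivative of the temperature. -/
  ϑy : ℝ → CB
  /-- The time derivative of the velocity. -/
  vt : ℝ → H L 1
  /-- The time derivative of the temperature. -/
  ϑt : ℝ → H L 1
  /-- The initial value of `√ρ ∂_t v`. -/
  g0 : L2 L
  /-- The initial value of `c_v √ρ ∂_t ϑ`. -/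
  h0 : L2 L
  ρ_clamp : ∀ y, ρ (clamp L y) = ρ y
  ϑ_clamp : ∀ t y, ϑ t (clamp L y) = ϑ t y
  J_clamp : ∀ t y, J t (clamp L y) = J t y
  vy_clamp : ∀ t y, vy t (clamp L y) = vy t y
  ρ_pos : ∀ y, 0 < ρ y
  J_pos : ∀ t ∈ Icc 0 T, ∀ y, 0 < J t y
  J_mul_I : ∀ t ∈ Icc 0 T, ∀ y, J t y * I t y = 1
  ϑ_nonneg : ∀ t ∈ Icc 0 T, ∀ y, 0 ≤ ϑ t y
  J_zero : J 0 = 1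
  ρ_space : IsPrimitiveOn L ρ ρ'
  v_space : ∀ t, IsPrimitiveOn L (v t) (vy t)
  ϑ_space : ∀ t, IsPrimitiveOn L (ϑ t) (ϑy t)
  v_bdry : ∀ t ∈ Icc 0 T, v t 0 = 0 ∧ v t L = 0
  ϑy_bdry : ∀ t ∈ Icc 0 T, ϑy t 0 = 0 ∧ ϑy t L = 0
  J_time : IsPrimitiveOn T J vy
  I_time : IsPrimitiveOn T I (fun t => -(I t ^ 2 * vy t))
  v_time : IsPrimitiveOn T v (fun t => evL L_pos (vt t))
  ϑ_time : IsPrimitiveOn T ϑ (fun t => evL L_pos (ϑt t))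
  vy_cont : ContinuousOn vy (Icc 0 T)
  ϑy_cont : ContinuousOn ϑy (Icc 0 T)
  vy_time : IsPrimitiveOn T (fun t => toL2 L (vy t)) (fun t => (vt t).d 1)
  ϑy_time : IsPrimitiveOn T (fun t => toL2 L (ϑy t)) (fun t => (ϑt t).d 1)
  vt_mem : MemLp vt 2 (leb T)
  ϑt_mem : MemLp ϑt 2 (leb T)
  momentum : ∀ᵐ t ∂leb T, IsPrimitiveOn L
    ((μ • vy t - R • (ρ * ϑ t)) * I t : CB) (ρ * evL L_pos (vt t) : CB)
  energy : ∀ᵐ t ∂leb T, IsPrimitiveOn L (κ • (ϑy t * I t) : CB)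
    (c_v • (ρ * evL L_pos (ϑt t)) - vy t * ((μ • vy t - R • (ρ * ϑ t)) * I t) : CB)
  momentum_zero : IsPrimitiveOn L ((μ • vy 0 - R • (ρ * ϑ 0)) * I 0 : CB)
    (fun y => Real.sqrt (ρ y) * g0 y)
  energy_zero : IsPrimitiveOn L (κ • (ϑy 0 * I 0) : CB)
    (fun y => Real.sqrt (ρ y) * h0 y - vy 0 y * ((μ • vy 0 - R • (ρ * ϑ 0)) * I 0 : CB) y)

section Construction

variable {L : ℝ}

theorem IsWeakDeriv.isPrimitiveOn (hL : 0 < L) {f g : ℝ → ℝ} (h : IsWeakDeriv L f g) {F W : CB}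
    (hf : f =ᵐ[leb L] F) (hg : g =ᵐ[leb L] W) : IsPrimitiveOn L F W := by
  have hWi : IntegrableOn W (Ioo 0 L) := (W.memLp L).integrable (by norm_num)
  have hgi : IntegrableOn g (Ioo 0 L) := hWi.congr hg.symm
  obtain ⟨c, hc⟩ := h.exists_ae_eq hL hgi
  have hP := isPrimitiveOn_integral hL.le (intervalIntegrable_of_integrableOn_Ioo hL.le hgi)
  have h1 : EqOn F (fun y => c + ∫ s in (0 : ℝ)..y, g s) (Icc 0 L) :=
    eqOn_Icc_of_ae_eq hL F.continuous.continuousOn (continuousOn_const.add hP.continuousOn)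
      (hf.symm.trans hc)
  have h2 : IsPrimitiveOn L (fun y => c + ∫ s in (0 : ℝ)..y, g s) g := by
    simpa using (IsPrimitiveOn.const hL.le c).add hP
  exact (h2.congr_left h1).congr_ae hg

theorem IsPrimitiveOn.exists_zero_of_zero {b : ℝ} {u w : ℝ → ℝ} (h : IsPrimitiveOn b u w)
    (hu : ∀ t ∈ Icc 0 b, u t = 0) : ∀ᵐ t ∂leb b, w t = 0 :=
  (h.congr_left (u' := fun _ => (0 : ℝ)) fun t ht => (hu t ht).symm).ae_eq
    (IsPrimitiveOn.const h.nonneg (0 : ℝ))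

/-- Since `v` vanishes at the end points for all times, so does `∂_t v`. -/
theorem Flow.vt_bdry {R c_v μ κ T : ℝ} (F : Flow R c_v μ κ T L) :
    ∀ᵐ t ∂leb T, evL F.L_pos (F.vt t) 0 = 0 ∧ evL F.L_pos (F.vt t) L = 0 := by
  have h1 := (F.v_time.map (evalAt 0)).exists_zero_of_zero fun t ht => (F.v_bdry t ht).1
  have h2 := (F.v_time.map (evalAt L)).exists_zero_of_zero fun t ht => (F.v_bdry t ht).2
  filter_upwards [h1, h2] with t a b using ⟨a, b⟩

/-- The continuous function `1 / √f`. -/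
theorem exists_inv_sqrt {f : CB} {δ : ℝ} (hδ : 0 < δ) (hf : ∀ y, δ ≤ f y) :
    ∃ g : CB, ∀ y, g y = (Real.sqrt (f y))⁻¹ := by
  refine ⟨BoundedContinuousFunction.ofNormedAddCommGroup (fun y => (Real.sqrt (f y))⁻¹)
    (f.continuous.sqrt.inv₀ fun y => (Real.sqrt_pos.2 (hδ.trans_le (hf y))).ne') (Real.sqrt δ)⁻¹
    fun y => ?_, fun y => rfl⟩
  rw [norm_inv, Real.norm_of_nonneg (Real.sqrt_nonneg _)]
  exact inv_anti₀ (Real.sqrt_pos.2 hδ) (Real.sqrt_le_sqrt (hf y))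

namespace GlobalSolution

variable {R c_v μ κ : ℝ} {ϱ₀ v₀ ϑ₀ : H L 2} (S : GlobalSolution R c_v μ κ L ϱ₀ v₀ ϑ₀)

/-- The momentum equation for continuous representatives: the effective viscous flux is a primitive of
`ρ ∂_t v`. -/
theorem momentum_rep (hL : 0 < L) {T : ℝ}
    (hJ : ∀ t ∈ Icc 0 T, IsUnit ((S.J t).rep hL)) : ∀ᵐ t ∂leb T, IsPrimitiveOn L
    ((μ • (S.v t).rep' hL - R • (ϱ₀.rep hL * (S.ϑ t).rep hL)) * Ring.inverse ((S.J t).rep hL) : CB)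
    (ϱ₀.rep hL * evL hL (S.v_t t) : CB) := by
  filter_upwards [ae_leb_of_ae_Ioi S.eq_v, ae_restrict_mem measurableSet_Ioo] with t ht htT
  refine ht.isPrimitiveOn hL ?_ ?_
  · filter_upwards [H.rep_ae_eq hL ϱ₀, H.rep_ae_eq hL (S.J t), H.rep_ae_eq hL (S.ϑ t),
      H.rep'_ae_eq hL (S.v t)] with y h1 h2 h3 h4
    have h5 := mul_ringInverse_apply (hJ t (Ioo_subset_Icc_self htT)) y
    have h6 : (S.J t).rep hL y ≠ 0 := left_ne_zero_of_mul_eq_one h5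
    have h7 : Ring.inverse ((S.J t).rep hL) y = ((S.J t).rep hL y)⁻¹ := by
      field_simp; linarith
    rw [h1, h2, h3, h4]
    simp only [BoundedContinuousFunction.coe_mul, BoundedContinuousFunction.coe_sub,
      BoundedContinuousFunction.coe_smul, Pi.mul_apply, Pi.sub_apply, smul_eq_mul, h7]
    field_simp
  · filter_upwards [H.rep_ae_eq hL ϱ₀, evL_ae_eq hL (S.v_t t)] with y h1 h2
    rw [h1, h2]; rfl

/-- The energy equation for continuous representatives: the heat flux has the derivative
`c_v ρ ∂_t ϑ - ∂_y v G`. -/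
theorem energy_rep (hL : 0 < L) {T : ℝ}
    (hJ : ∀ t ∈ Icc 0 T, IsUnit ((S.J t).rep hL)) : ∀ᵐ t ∂leb T, IsPrimitiveOn L
    (κ • ((S.ϑ t).rep' hL * Ring.inverse ((S.J t).rep hL)) : CB)
    (c_v • (ϱ₀.rep hL * evL hL (S.ϑ_t t)) - (S.v t).rep' hL *
      ((μ • (S.v t).rep' hL - R • (ϱ₀.rep hL * (S.ϑ t).rep hL)) *
        Ring.inverse ((S.J t).rep hL)) : CB) := by
  filter_upwards [ae_leb_of_ae_Ioi S.eq_ϑ, ae_restrict_mem measurableSet_Ioo] with t ht htT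
  refine ht.isPrimitiveOn hL ?_ ?_
  · filter_upwards [H.rep_ae_eq hL (S.J t), H.rep'_ae_eq hL (S.ϑ t)] with y h2 h3
    have h5 := mul_ringInverse_apply (hJ t (Ioo_subset_Icc_self htT)) y
    have h6 : (S.J t).rep hL y ≠ 0 := left_ne_zero_of_mul_eq_one h5
    have h7 : Ring.inverse ((S.J t).rep hL) y = ((S.J t).rep hL y)⁻¹ := by
      field_simp; linarith
    rw [h2, h3]
    simp only [BoundedContinuousFunction.coe_mul,
      BoundedContinuousFunction.coe_smul, Pi.mul_apply, smul_eq_mul, h7]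
    field_simp
  · filter_upwards [H.rep_ae_eq hL ϱ₀, H.rep_ae_eq hL (S.J t), H.rep_ae_eq hL (S.ϑ t),
      H.rep'_ae_eq hL (S.v t), evL_ae_eq hL (S.ϑ_t t)] with y h1 h2 h3 h4 h8
    have h5 := mul_ringInverse_apply (hJ t (Ioo_subset_Icc_self htT)) y
    have h6 : (S.J t).rep hL y ≠ 0 := left_ne_zero_of_mul_eq_one h5
    have h7 : Ring.inverse ((S.J t).rep hL) y = ((S.J t).rep hL y)⁻¹ := by
      field_simp; linarith
    rw [h1, h2, h3, h4, h8]
    simp only [BoundedContinuousFunction.coe_mul, BoundedContinuousFunction.coe_sub,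
      BoundedContinuousFunction.coe_smul, Pi.mul_apply, Pi.sub_apply, smul_eq_mul, h7]
    field_simp
    ring

/-- The continuous representatives of a global solution, restricted to `[0, T]`. -/
theorem exists_flow (hL : 0 < L) {T : ℝ} (hT : 0 < T) (hR : 0 < R) (hc : 0 < c_v)
    (hμ : 0 < μ) (hκ : 0 < κ)
    {a : ℝ} (ha : 0 < a)
    (hϱ : IsBoundedBelowBy (ϱ₀.d 0) a) (hϑ : IsBoundedBelowBy (ϑ₀.d 0) a) :
    ∃ F : Flow R c_v μ κ T L, F.g0 =ᵐ[leb L] g₀ R μ ϱ₀ v₀ ϑ₀ ∧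
      F.h0 =ᵐ[leb L] h₀ R μ κ ϱ₀ v₀ ϑ₀ ∧ F.ρ = ϱ₀.rep hL ∧ F.ρ' = ϱ₀.rep' hL ∧
      F.J = (fun t => (S.J t).rep hL) ∧ F.v = (fun t => (S.v t).rep hL) ∧
      F.vy = (fun t => (S.v t).rep' hL) ∧ F.ϑ = (fun t => (S.ϑ t).rep hL) ∧
      F.ϑy = (fun t => (S.ϑ t).rep' hL) ∧ F.vt = S.v_t ∧ F.ϑt = S.ϑ_t := by
  have hsub : Icc 0 T ⊆ Ici (0 : ℝ) := fun t ht => ht.1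
  obtain ⟨δ, hδ, hJδ⟩ := S.exists_rep_J_ge hL hT hR hμ ha hϱ hϑ
  have hJ : ∀ t ∈ Icc 0 T, IsUnit ((S.J t).rep hL) := fun t ht => isUnit_of_ge hδ (hJδ t ht)
  have hρa : ∀ y, a ≤ ϱ₀.rep hL y := hϱ.le_rep hL
  obtain ⟨s, hs⟩ := exists_inv_sqrt ha hρa
  have hsq : ∀ y, Real.sqrt (ϱ₀.rep hL y) * s y = 1 := fun y => by
    rw [hs]; exact mul_inv_cancel₀ (Real.sqrt_pos.2 (ha.trans_le (hρa y))).ne'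
  let G0 : L2 L := mulL2 L s (μ • v₀.d 2 - toL2 L (R • (ϱ₀.rep' hL * ϑ₀.rep hL +
    ϱ₀.rep hL * ϑ₀.rep' hL)))
  let H0 : L2 L := mulL2 L s (κ • ϑ₀.d 2 + toL2 L (μ • v₀.rep' hL ^ 2 -
    R • (v₀.rep' hL * ϱ₀.rep hL * ϑ₀.rep hL)))
  have hG0 : G0 =ᵐ[leb L] fun y => s y * (μ * v₀.d 2 y - R * (ϱ₀.rep' hL y * ϑ₀.rep hL y +
      ϱ₀.rep hL y * ϑ₀.rep' hL y)) := by
    refine (mulL2_coe s _).trans ?_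
    filter_upwards [Lp.coeFn_sub (μ • v₀.d 2) (toL2 L (R • (ϱ₀.rep' hL * ϑ₀.rep hL +
      ϱ₀.rep hL * ϑ₀.rep' hL))), Lp.coeFn_smul μ (v₀.d 2), toL2_coe (L := L)
      (R • (ϱ₀.rep' hL * ϑ₀.rep hL + ϱ₀.rep hL * ϑ₀.rep' hL))] with y h1 h2 h3
    rw [h1, Pi.sub_apply, h2, h3]
    simp only [Pi.smul_apply, smul_eq_mul, BoundedContinuousFunction.coe_smul,
      BoundedContinuousFunction.coe_add, BoundedContinuousFunction.coe_mul, Pi.add_apply,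
      Pi.mul_apply]
  have hH0 : H0 =ᵐ[leb L] fun y => s y * (κ * ϑ₀.d 2 y + (μ * v₀.rep' hL y ^ 2 -
      R * (v₀.rep' hL y * ϱ₀.rep hL y * ϑ₀.rep hL y))) := by
    refine (mulL2_coe s _).trans ?_
    filter_upwards [Lp.coeFn_add (κ • ϑ₀.d 2) (toL2 L (μ • v₀.rep' hL ^ 2 -
      R • (v₀.rep' hL * ϱ₀.rep hL * ϑ₀.rep hL))), Lp.coeFn_smul κ (ϑ₀.d 2), toL2_coe (L := L)
      (μ • v₀.rep' hL ^ 2 - R • (v₀.rep' hL * ϱ₀.rep hL * ϑ₀.rep hL))] with y h1 h2 h3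
    rw [h1, Pi.add_apply, h2, h3]
    simp
  have hI0 : Ring.inverse ((S.J 0).rep hL) = 1 := by rw [S.rep_J_zero hL, Ring.inverse_one]
  refine ⟨{
    L_pos := hL
    T_pos := hT
    R_pos := hR
    c_pos := hc
    μ_pos := hμ
    κ_pos := hκ
    ρ := ϱ₀.rep hL
    ρ' := ϱ₀.rep' hL
    J := fun t => (S.J t).rep hL
    I := fun t => Ring.inverse ((S.J t).rep hL)
    v := fun t => (S.v t).rep hL
    vy := fun t => (S.v t).rep' hL
    ϑ := fun t => (S.ϑ t).rep hL
    ϑy := fun t => (S.ϑ t).rep' hL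
    vt := S.v_t
    ϑt := S.ϑ_t
    g0 := G0
    h0 := H0
    ρ_clamp := H.rep_clamp hL _
    ϑ_clamp := fun t => H.rep_clamp hL _
    J_clamp := fun t => H.rep_clamp hL _
    vy_clamp := fun t => H.rep'_clamp hL _
    ρ_pos := fun y => ha.trans_le (hρa y)
    J_pos := fun t ht y => hδ.trans_le (hJδ t ht y)
    J_mul_I := fun t ht y => mul_ringInverse_apply (hJ t ht) y
    ϑ_nonneg := fun t ht => S.rep_ϑ_nonneg hL ha hϑ t ht.1
    J_zero := S.rep_J_zero hL
    ρ_space := H.rep_isPrimitiveOn hL _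
    v_space := fun t => H.rep_isPrimitiveOn hL _
    ϑ_space := fun t => H.rep_isPrimitiveOn hL _
    v_bdry := fun t ht => S.rep_v_boundary hL t ht.1
    ϑy_bdry := fun t ht => S.rep'_ϑ_boundary hL t ht.1
    J_time := S.rep_J_isPrimitiveOn hL hT
    I_time := (S.rep_J_isPrimitiveOn hL hT).ringInverse
      ((H.continuousOn_rep' hL S.v_cont).mono hsub) hJ
    v_time := S.rep_v_isPrimitiveOn hL hT
    ϑ_time := S.rep_ϑ_isPrimitiveOn hL hT
    vy_cont := (H.continuousOn_rep' hL S.v_cont).mono hsub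
    ϑy_cont := (H.continuousOn_rep' hL S.ϑ_cont).mono hsub
    vy_time := ((S.isPrimitiveOn_v hT).map (dL L 1 1)).congr_left
      (fun t _ => H.toL2_rep' hL (S.v t))
    ϑy_time := ((S.isPrimitiveOn_ϑ hT).map (dL L 1 1)).congr_left
      (fun t _ => H.toL2_rep' hL (S.ϑ t))
    vt_mem := S.v_t_mem T hT
    ϑt_mem := S.ϑ_t_mem T hT
    momentum := S.momentum_rep hL hJ
    energy := S.energy_rep hL hJ
    momentum_zero := ?_
    energy_zero := ?_ }, ?_, ?_, rfl, rfl, rfl, rfl, rfl, rfl, rfl, rfl, rfl⟩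
  · have h := ((H.rep'_isPrimitiveOn hL v₀).const_smul μ).sub
      (((H.rep_isPrimitiveOn hL ϱ₀).mul (H.rep_isPrimitiveOn hL ϑ₀)).const_smul R)
    refine (h.congr_left fun y _ => ?_).congr_ae ?_
    · rw [hI0, S.v_init, S.ϑ_init]; simp
    · filter_upwards [hG0] with y hy
      rw [hy, ← mul_assoc, hsq, one_mul]
      simp
  · have h := (H.rep'_isPrimitiveOn hL ϑ₀).const_smul κ
    refine (h.congr_left fun y _ => ?_).congr_ae ?_
    · rw [hI0, S.ϑ_init]; simp
    · filter_upwards [hH0] with y hy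
      rw [hy, ← mul_assoc, hsq, one_mul, hI0, S.v_init, S.ϑ_init]
      simp only [smul_eq_mul, BoundedContinuousFunction.coe_mul, BoundedContinuousFunction.coe_sub,
        BoundedContinuousFunction.coe_smul, Pi.mul_apply, Pi.sub_apply,
        BoundedContinuousFunction.coe_one, Pi.one_apply]
      ring
  · filter_upwards [hG0, H.rep_ae_eq hL ϱ₀, H.rep'_ae_eq hL ϱ₀, H.rep_ae_eq hL ϑ₀,
      H.rep'_ae_eq hL ϑ₀] with y h1 h2 h3 h4 h5
    rw [h1, g₀, h2, h3, h4, h5, hs]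
    field_simp
  · filter_upwards [hH0, H.rep_ae_eq hL ϱ₀, H.rep'_ae_eq hL v₀, H.rep_ae_eq hL ϑ₀]
      with y h1 h2 h3 h4
    rw [h1, h₀, h2, h3, h4, hs]
    field_simp
    ring

end GlobalSolution
end Construction

/-! ### Conservation laws -/

section Integral

variable {L : ℝ}

theorem CB.integrable (f : CB) (L : ℝ) : Integrable f (leb L) :=
  (f.memLp L).integrable (by norm_num)

theorem integL_mono {f g : CB} (h : ∀ y, f y ≤ g y) : integL L f ≤ integL L g := by
  rw [integL_eq, integL_eq]
  exact integral_mono (f.integrable L) (g.integrable L) h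

theorem integL_nonneg {f : CB} (h : ∀ y, 0 ≤ f y) : 0 ≤ integL L f := by
  rw [integL_eq]; exact integral_nonneg h

theorem integL_one (hL : 0 ≤ L) : integL L 1 = L := by
  rw [integL_eq]; simp [hL]

theorem sq_integL_mul_le (f g : CB) :
    integL L (f * g) ^ 2 ≤ integL L (f ^ 2) * integL L (g ^ 2) := by
  simp only [integL_eq]
  exact sq_integral_mul_le (f.memLp L) (g.memLp L)

theorem IsPrimitiveOn.integL_eq {u w : CB} (h : IsPrimitiveOn L u w) :
    integL L w = u L - u 0 := by
  rw [HeatNS.integL_eq, h.integral_Ioo]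

theorem IsPrimitiveOn.mulCB {b : ℝ} {u w u' w' : ℝ → CB} (h : IsPrimitiveOn b u w)
    (h' : IsPrimitiveOn b u' w') :
    IsPrimitiveOn b (fun t => u t * u' t) (fun t => w t * u' t + u t * w' t) :=
  h.bilin (ContinuousLinearMap.mul ℝ CB) h'

/-- The absolute value of a bounded continuous function. -/
def CB.abs' (f : CB) : CB :=
  BoundedContinuousFunction.ofNormedAddCommGroup (fun y => |f y|) f.continuous.abs ‖f‖
    fun y => by rw [Real.norm_eq_abs, abs_abs]; exact f.norm_coe_le y

theorem IsPrimitiveOn.abs_sub_le_integL {u w : CB} (h : IsPrimitiveOn L u w) {x y : ℝ}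
    (hx : x ∈ Icc 0 L) (hy : y ∈ Icc 0 L) : |u y - u x| ≤ integL L w.abs' := by
  rw [HeatNS.integL_eq]
  exact h.abs_sub_le hx hy

theorem CB.norm_le_of_clamp (hL : 0 < L) {f : CB} {M : ℝ} (hf : ∀ y, f (clamp L y) = f y)
    (h : ∀ y ∈ Icc 0 L, |f y| ≤ M) : ‖f‖ ≤ M := by
  have h0 := h 0 ⟨le_rfl, hL.le⟩
  refine (BoundedContinuousFunction.norm_le ((abs_nonneg _).trans h0)).2 fun y => ?_
  rw [← hf]
  exact h _ (clamp_mem hL.le y)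

end Integral

namespace Flow

variable {R c_v μ κ T L : ℝ} (F : Flow R c_v μ κ T L)

/-- The effective viscous flux. -/
def G (t : ℝ) : CB := (μ • F.vy t - R • (F.ρ * F.ϑ t)) * F.I t

/-- The heat flux. -/
def Q (t : ℝ) : CB := κ • (F.ϑy t * F.I t)

/-- The continuous representative of `∂_t v`. -/
def w (t : ℝ) : CB := evL F.L_pos (F.vt t)

/-- The continuous representative of `∂_t ϑ`. -/
def θ (t : ℝ) : CB := evL F.L_pos (F.ϑt t)

/-- The initial energy. -/
def energy₀ : ℝ := integL L ((1 / 2 : ℝ) • (F.ρ * F.v 0 ^ 2) + c_v • (F.ρ * F.ϑ 0))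

/-- The bounds on the data in terms of a single constant. -/
structure Controlled (K : ℝ) : Prop where
  one_le : 1 ≤ K
  L_le : L ≤ K
  one_le_mul_L : 1 ≤ K * L
  ρ_le : ∀ y, F.ρ y ≤ K
  ρ'_le : ∀ y, |F.ρ' y| ≤ K
  one_le_mul_mass : 1 ≤ K * integL L F.ρ
  energy₀_le : F.energy₀ ≤ K
  m₁_le : Real.exp (2 / μ * Real.sqrt (2 * integL L F.ρ * F.energy₀)) ≤ K
  v₀_le : integL L (F.ρ * F.v 0 ^ 4) ≤ K
  ϑ₀_le : integL L (F.ρ * F.ϑ 0 ^ 2) ≤ K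
  vy₀_le : integL L (F.vy 0 ^ 2) ≤ K
  g₀_le : ‖F.g0‖ ^ 2 ≤ K
  h₀_le : ‖F.h0‖ ^ 2 ≤ K

theorem zero_mem (F : Flow R c_v μ κ T L) : (0 : ℝ) ∈ Icc 0 T := ⟨le_rfl, F.T_pos.le⟩

theorem G_space : ∀ᵐ t ∂leb T, IsPrimitiveOn L (F.G t) (F.ρ * F.w t : CB) := F.momentum

theorem Q_space : ∀ᵐ t ∂leb T,
    IsPrimitiveOn L (F.Q t) (c_v • (F.ρ * F.θ t) - F.vy t * F.G t : CB) := F.energy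

theorem v_time' : IsPrimitiveOn T F.v F.w := F.v_time

theorem ϑ_time' : IsPrimitiveOn T F.ϑ F.θ := F.ϑ_time

theorem Q_bdry {t : ℝ} (ht : t ∈ Icc 0 T) : F.Q t 0 = 0 ∧ F.Q t L = 0 := by
  have h := F.ϑy_bdry t ht
  constructor
  · change κ * (F.ϑy t 0 * F.I t 0) = 0
    rw [h.1]; ring
  · change κ * (F.ϑy t L * F.I t L) = 0
    rw [h.2]; ring

theorem I_pos {t : ℝ} (ht : t ∈ Icc 0 T) (y : ℝ) : 0 < F.I t y :=
  pos_of_mul_pos_right (by rw [F.J_mul_I t ht y]; exact one_pos) (F.J_pos t ht y).le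

theorem I_eq_inv {t : ℝ} (ht : t ∈ Icc 0 T) (y : ℝ) : F.I t y = (F.J t y)⁻¹ :=
  eq_inv_of_mul_eq_one_right (F.J_mul_I t ht y)

theorem I_clamp {t : ℝ} (ht : t ∈ Icc 0 T) (y : ℝ) : F.I t (clamp L y) = F.I t y := by
  rw [F.I_eq_inv ht, F.I_eq_inv ht, F.J_clamp]

theorem J_mul_G {t : ℝ} (ht : t ∈ Icc 0 T) (y : ℝ) :
    F.J t y * F.G t y = μ * F.vy t y - R * (F.ρ y * F.ϑ t y) := by
  change F.J t y * ((μ * F.vy t y - R * (F.ρ y * F.ϑ t y)) * F.I t y) = _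
  have := F.J_mul_I t ht y
  linear_combination (μ * F.vy t y - R * (F.ρ y * F.ϑ t y)) * this

theorem I_zero : F.I 0 = 1 := by
  ext y
  have := F.J_mul_I 0 F.zero_mem y
  rw [F.J_zero] at this
  simpa using this

/-- Conservation of volume. -/
theorem integL_J {t : ℝ} (ht : t ∈ Icc 0 T) : integL L (F.J t) = L := by
  have h := (F.J_time.map (integL L)).congr_ae (w' := fun _ => (0 : ℝ)) (by
    filter_upwards [ae_restrict_mem measurableSet_Ioo] with t ht
    have ht' := Ioo_subset_Icc_self ht
    rw [(F.v_space t).integL_eq, (F.v_bdry t ht').1, (F.v_bdry t ht').2, sub_zero])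
  have := h.eq_add t ht
  simpa [F.J_zero, integL_one F.L_pos.le] using this

theorem energy_isPrimitiveOn :
    IsPrimitiveOn T (fun t => (1 / 2 : ℝ) • (F.ρ * F.v t ^ 2) + c_v • (F.ρ * F.ϑ t))
      (fun t => F.ρ * (F.v t * F.w t) + c_v • (F.ρ * F.θ t)) := by
  have h1 := ((F.v_time'.mulCB F.v_time').map (ContinuousLinearMap.mul ℝ CB F.ρ)).const_smul
    (1 / 2 : ℝ)
  have h2 := (F.ϑ_time'.map (ContinuousLinearMap.mul ℝ CB F.ρ)).const_smul c_v
  refine ((h1.add h2).congr_left fun t _ => ?_).congr_ae (Eventually.of_forall fun t => ?_)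
  · ext y
    change 1 / 2 * (F.ρ y * F.v t y ^ 2) + c_v * (F.ρ y * F.ϑ t y) =
      1 / 2 * (F.ρ y * (F.v t y * F.v t y)) + c_v * (F.ρ y * F.ϑ t y)
    ring
  · ext y
    change 1 / 2 * (F.ρ y * (F.w t y * F.v t y + F.v t y * F.w t y)) + c_v * (F.ρ y * F.θ t y) =
      F.ρ y * (F.v t y * F.w t y) + c_v * (F.ρ y * F.θ t y)
    ring

/-- The energy flux `v G + Q` is the primitive of the time derivative of the energy density. -/
theorem flux_space : ∀ᵐ t ∂leb T, IsPrimitiveOn L (F.v t * F.G t + F.Q t : CB)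
    (F.ρ * (F.v t * F.w t) + c_v • (F.ρ * F.θ t) : CB) := by
  filter_upwards [F.G_space, F.Q_space] with t h1 h2
  refine (((F.v_space t).mul h1).add h2).congr_ae (Eventually.of_forall fun y => ?_)
  change F.vy t y * F.G t y + F.v t y * (F.ρ y * F.w t y) + (c_v * (F.ρ y * F.θ t y) -
    F.vy t y * F.G t y) = F.ρ y * (F.v t y * F.w t y) + c_v * (F.ρ y * F.θ t y)
  ring

theorem flux_bdry {t : ℝ} (ht : t ∈ Icc 0 T) :
    (F.v t * F.G t + F.Q t : CB) 0 = 0 ∧ (F.v t * F.G t + F.Q t : CB) L = 0 := by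
  have h1 := F.v_bdry t ht
  have h2 := F.Q_bdry ht
  constructor
  · change F.v t 0 * F.G t 0 + F.Q t 0 = 0
    rw [h1.1, h2.1]; ring
  · change F.v t L * F.G t L + F.Q t L = 0
    rw [h1.2, h2.2]; ring

/-- Conservation of energy. -/
theorem integL_energy {t : ℝ} (ht : t ∈ Icc 0 T) :
    integL L ((1 / 2 : ℝ) • (F.ρ * F.v t ^ 2) + c_v • (F.ρ * F.ϑ t)) = F.energy₀ := by
  have h := (F.energy_isPrimitiveOn.map (integL L)).congr_ae (w' := fun _ => (0 : ℝ)) (by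
    filter_upwards [ae_restrict_mem measurableSet_Ioo, F.flux_space] with t ht h1
    have ht' := Ioo_subset_Icc_self ht
    rw [h1.integL_eq, (F.flux_bdry ht').1, (F.flux_bdry ht').2, sub_zero])
  have := h.eq_add t ht
  simpa [energy₀] using this

theorem integL_kinetic_nonneg (t : ℝ) : 0 ≤ integL L (F.ρ * F.v t ^ 2) :=
  integL_nonneg fun y => mul_nonneg (F.ρ_pos y).le (sq_nonneg (F.v t y))

theorem integL_heat_nonneg {t : ℝ} (ht : t ∈ Icc 0 T) : 0 ≤ integL L (F.ρ * F.ϑ t) :=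
  integL_nonneg fun y => mul_nonneg (F.ρ_pos y).le (F.ϑ_nonneg t ht y)

theorem integL_energy_split {t : ℝ} (ht : t ∈ Icc 0 T) :
    1 / 2 * integL L (F.ρ * F.v t ^ 2) + c_v * integL L (F.ρ * F.ϑ t) = F.energy₀ := by
  have := F.integL_energy ht
  simpa only [map_add, map_smul, smul_eq_mul] using this

theorem kinetic_le {t : ℝ} (ht : t ∈ Icc 0 T) : integL L (F.ρ * F.v t ^ 2) ≤ 2 * F.energy₀ := by
  have h1 := F.integL_energy_split ht
  have h2 := mul_nonneg F.c_pos.le (F.integL_heat_nonneg ht)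
  linarith

theorem heat_le {t : ℝ} (ht : t ∈ Icc 0 T) : integL L (F.ρ * F.ϑ t) ≤ F.energy₀ / c_v := by
  rw [le_div_iff₀ F.c_pos]
  have h1 := F.integL_energy_split ht
  have h2 := F.integL_kinetic_nonneg t
  linarith

theorem energy₀_nonneg : 0 ≤ F.energy₀ := by
  have h1 := F.integL_energy_split F.zero_mem
  have h2 := F.integL_kinetic_nonneg 0
  have h3 := mul_nonneg F.c_pos.le (F.integL_heat_nonneg F.zero_mem)
  linarith

end Flow

/-! ### The representation of the Jacobian -/

namespace Flow

variable {R c_v μ κ T L : ℝ} (F : Flow R c_v μ κ T L)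

/-- The momentum of the fluid in `[0, y]`. -/
def N (t : ℝ) : CB := primL F.L_pos (toL2 L (F.ρ * F.v t))

theorem N_time : IsPrimitiveOn T F.N (fun t => primL F.L_pos (toL2 L (F.ρ * F.w t))) :=
  F.v_time'.map ((primL F.L_pos).comp ((toL2 L).comp (ContinuousLinearMap.mul ℝ CB F.ρ)))

theorem primL_toL2 (hL : 0 < L) (f : CB) {y : ℝ} (hy : y ∈ Icc 0 L) :
    primL hL (toL2 L f) y = ∫ s in (0 : ℝ)..y, f s := by
  rw [primL_apply, clamp_of_mem hy, intervalIntegral.integral_of_le hy.1,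
    intervalIntegral.integral_of_le hy.1, integral_Ioc_eq_integral_Ioo,
    integral_Ioc_eq_integral_Ioo]
  exact integral_congr_ae (ae_restrict_of_ae_restrict_of_subset (Ioo_subset_Ioo_right hy.2)
    (toL2_coe f))

/-- Cauchy--Schwarz with the weight `ρ`. -/
theorem sq_integL_weight_le (f g : CB) (ρ : CB) (hρ : ∀ y, 0 ≤ ρ y) :
    integL L (ρ * (f * g)) ^ 2 ≤ integL L (ρ * f ^ 2) * integL L (ρ * g ^ 2) := by
  have hs : Continuous fun y => Real.sqrt (ρ y) := ρ.continuous.sqrt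
  let s : CB := BoundedContinuousFunction.ofNormedAddCommGroup (fun y => Real.sqrt (ρ y)) hs
    (Real.sqrt ‖ρ‖) fun y => by
      rw [Real.norm_of_nonneg (Real.sqrt_nonneg _)]
      exact Real.sqrt_le_sqrt ((le_abs_self _).trans (ρ.norm_coe_le y))
  have hss : ∀ y, s y * s y = ρ y := fun y => Real.mul_self_sqrt (hρ y)
  have h := sq_integL_mul_le (L := L) (s * f) (s * g)
  have e1 : s * f * (s * g) = ρ * (f * g) := by
    ext y
    change s y * f y * (s y * g y) = ρ y * (f y * g y)
    rw [← hss]; ring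
  have e2 : ∀ f : CB, (s * f) ^ 2 = ρ * f ^ 2 := fun f => by
    ext y
    change (s y * f y) ^ 2 = ρ y * f y ^ 2
    rw [← hss]; ring
  rwa [e1, e2, e2] at h

/-- The momentum of `[0, y]` is bounded by mass and energy, by the Cauchy--Schwarz inequality. -/
theorem abs_N_le {t : ℝ} (ht : t ∈ Icc 0 T) {y : ℝ} (hy : y ∈ Icc 0 L) :
    |F.N t y| ≤ Real.sqrt (2 * integL L F.ρ * F.energy₀) := by
  have h1 : |F.N t y| ≤ integL L (F.ρ * (1 * (F.v t).abs')) := by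
    rw [N, primL_toL2 F.L_pos _ hy, integL_eq]
    refine (abs_primitive_le ((F.ρ * F.v t : CB).integrable L) ⟨le_rfl, F.L_pos.le⟩ hy).trans
      (le_of_eq ?_)
    refine integral_congr_ae (Eventually.of_forall fun s => ?_)
    change |F.ρ s * F.v t s| = F.ρ s * (1 * |F.v t s|)
    rw [abs_mul, abs_of_pos (F.ρ_pos s), one_mul]
  have h2 := sq_integL_weight_le (L := L) 1 (F.v t).abs' F.ρ fun y => (F.ρ_pos y).le
  have e : F.ρ * (F.v t).abs' ^ 2 = F.ρ * F.v t ^ 2 := by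
    ext y
    change F.ρ y * |F.v t y| ^ 2 = F.ρ y * F.v t y ^ 2
    rw [sq_abs]
  rw [e, one_pow, mul_one] at h2
  refine h1.trans (Real.le_sqrt_of_sq_le (h2.trans ?_))
  have h3 := F.kinetic_le ht
  have h4 : 0 ≤ integL L F.ρ := integL_nonneg fun y => (F.ρ_pos y).le
  nlinarith

/-- The pressure, integrated in time. -/
def pint (t y : ℝ) : ℝ := ∫ s in (0 : ℝ)..t, R * F.ρ y * F.ϑ s y / F.J s y

theorem eval_continuousOn {f : ℝ → CB} {s : Set ℝ} (y : ℝ) (hf : ContinuousOn f s) :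
    ContinuousOn (fun t => f t y) s := (evalAt y).continuous.comp_continuousOn hf

theorem continuousOn_pressure (y : ℝ) :
    ContinuousOn (fun s => R * F.ρ y * F.ϑ s y / F.J s y) (Icc 0 T) :=
  (continuousOn_const.mul (eval_continuousOn y F.ϑ_time.continuousOn)).div
    (eval_continuousOn y F.J_time.continuousOn) fun t ht => (F.J_pos t ht y).ne'

theorem pint_time (y : ℝ) : IsPrimitiveOn T (fun t => F.pint t y)
    (fun s => R * F.ρ y * F.ϑ s y / F.J s y) :=
  isPrimitiveOn_integral_of_continuousOn F.T_pos.le (F.continuousOn_pressure y)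

theorem pint_nonneg {t : ℝ} (ht : t ∈ Icc 0 T) (y : ℝ) : 0 ≤ F.pint t y := by
  refine intervalIntegral.integral_nonneg ht.1 fun s hs => ?_
  have hs' : s ∈ Icc 0 T := ⟨hs.1, hs.2.trans ht.2⟩
  have h1 := F.R_pos
  have h2 := F.ρ_pos y
  have h3 := F.ϑ_nonneg s hs' y
  have h4 := F.J_pos s hs' y
  positivity

/-- Integrating the momentum equation in space and time expresses the oscillation of `log J` in space by
the momentum and the time integral of the pressure. -/
theorem log_J_eq {t : ℝ} (ht : t ∈ Icc 0 T) {y : ℝ} (hy : y ∈ Icc 0 L) :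
    μ * Real.log (F.J t y) - F.pint t y - (μ * Real.log (F.J t 0) - F.pint t 0) =
      F.N t y - F.N 0 y := by
  have h0 : (0 : ℝ) ∈ Icc 0 L := ⟨le_rfl, F.L_pos.le⟩
  have h := log_jacobian_identity (b := T) (μ := μ) (j := fun t => F.J t y)
    (j' := fun t => F.J t 0) (a := fun t => F.vy t y)
    (a' := fun t => F.vy t 0) (p := fun t => R * F.ρ y * F.ϑ t y)
    (p' := fun t => R * F.ρ 0 * F.ϑ t 0)
    (n := fun t => primL F.L_pos (toL2 L (F.ρ * F.w t)) y)
    (F.J_time.map (evalAt y)) (F.J_time.map (evalAt 0))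
    (F.N_time.map (evalAt y)) (eval_continuousOn y F.vy_cont) (eval_continuousOn 0 F.vy_cont)
    (continuousOn_const.mul (eval_continuousOn y F.ϑ_time.continuousOn))
    (continuousOn_const.mul (eval_continuousOn 0 F.ϑ_time.continuousOn))
    (fun t ht => F.J_pos t ht y) (fun t ht => F.J_pos t ht 0)
    (by simp [F.J_zero]) (by simp [F.J_zero]) ?_ t ht
  · exact h
  · filter_upwards [F.G_space, ae_restrict_mem measurableSet_Ioo] with t h1 ht
    have ht' := Ioo_subset_Icc_self ht
    have h2 := h1.sub_eq h0 hy
    rw [primL_toL2 F.L_pos _ hy, ← h2]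
    have e : ∀ y, (μ * F.vy t y - R * F.ρ y * F.ϑ t y) / F.J t y = F.G t y := fun y => by
      rw [div_eq_iff (F.J_pos t ht' y).ne', mul_comm (F.G t y), F.J_mul_G ht']; ring
    rw [e, e]

/-- The time dependent factor in the representation of the Jacobian. -/
def hfun (t : ℝ) : ℝ := F.J t 0 * Real.exp (-(F.pint t 0 / μ))

theorem hfun_pos {t : ℝ} (ht : t ∈ Icc 0 T) : 0 < F.hfun t :=
  mul_pos (F.J_pos t ht 0) (Real.exp_pos _)

/-- The constant `m₁` of the data. -/
def m : ℝ := Real.exp (2 / μ * Real.sqrt (2 * integL L F.ρ * F.energy₀))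

theorem one_le_m : 1 ≤ F.m := Real.one_le_exp (by
  have := F.μ_pos; positivity)

/-- The representation `J = h B e^{pint/μ}` with `1 / m ≤ B ≤ m`. -/
theorem J_rep {t : ℝ} (ht : t ∈ Icc 0 T) {y : ℝ} (hy : y ∈ Icc 0 L) :
    F.J t y ≤ F.hfun t * F.m * Real.exp (F.pint t y / μ) ∧
      F.hfun t * Real.exp (F.pint t y / μ) ≤ F.m * F.J t y := by
  have hμ := F.μ_pos
  have h := F.log_J_eq ht hy
  have b1 := abs_le.1 (F.abs_N_le ht hy)
  have b2 := abs_le.1 (F.abs_N_le F.zero_mem hy)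
  set B := Real.sqrt (2 * integL L F.ρ * F.energy₀) with hB
  have e : F.J t y = F.hfun t * Real.exp (F.pint t y / μ) * Real.exp ((F.N t y - F.N 0 y) / μ) := by
    rw [hfun, mul_assoc, mul_assoc, ← Real.exp_add, ← Real.exp_add]
    conv_lhs => rw [← Real.exp_log (F.J_pos t ht y)]
    conv_rhs => rw [← Real.exp_log (F.J_pos t ht 0)]
    rw [← Real.exp_add]
    congr 1
    field_simp
    linarith
  have hm1 : Real.exp ((F.N t y - F.N 0 y) / μ) ≤ F.m := by
    refine Real.exp_le_exp.2 ?_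
    rw [div_le_iff₀ hμ, ← hB]
    have : 2 / μ * B * μ = 2 * B := by field_simp
    linarith [b1.2, b2.1]
  have hm2 : 1 ≤ F.m * Real.exp ((F.N t y - F.N 0 y) / μ) := by
    rw [m, ← Real.exp_add]
    refine Real.one_le_exp ?_
    rw [← hB]
    have : 2 / μ * B + (F.N t y - F.N 0 y) / μ = (2 * B + (F.N t y - F.N 0 y)) / μ := by
      field_simp
    rw [this]
    refine div_nonneg ?_ hμ.le
    linarith [b1.1, b2.2]
  have hp : 0 < F.hfun t * Real.exp (F.pint t y / μ) := mul_pos (F.hfun_pos ht) (Real.exp_pos _)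
  constructor
  · rw [e]
    calc _ ≤ F.hfun t * Real.exp (F.pint t y / μ) * F.m := by gcongr
      _ = _ := by ring
  · conv_rhs => rw [e]
    nlinarith

/-- Since the pressure is nonnegative, the representation bounds `hfun` by a multiple of `J`; integrating
in space and using `∫ J = L` gives a bound that does not depend on time. -/
theorem hfun_le {t : ℝ} (ht : t ∈ Icc 0 T) : F.hfun t ≤ F.m := by
  have h1 : ∀ y, F.hfun t ≤ F.m * F.J t y := fun y => by
    rw [← F.J_clamp]
    have h2 := (F.J_rep ht (clamp_mem F.L_pos.le y)).2
    have h3 : 1 ≤ Real.exp (F.pint t (clamp L y) / μ) :=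
      Real.one_le_exp (div_nonneg (F.pint_nonneg ht _) F.μ_pos.le)
    nlinarith [F.hfun_pos ht]
  have h2 := integL_mono (L := L) (f := F.hfun t • (1 : CB)) (g := F.m • F.J t) fun y => by
    change F.hfun t * 1 ≤ F.m * F.J t y
    rw [mul_one]; exact h1 y
  simp only [map_smul, smul_eq_mul, integL_one F.L_pos.le, F.integL_J ht] at h2
  exact le_of_mul_le_mul_right h2 F.L_pos

theorem continuousOn_hfun : ContinuousOn F.hfun (Icc 0 T) := by
  refine (eval_continuousOn 0 F.J_time.continuousOn).mul ?_
  exact Real.continuous_exp.comp_continuousOn ((F.pint_time 0).continuousOn.div_const μ).neg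

/-- The time derivative of `e^{pint/μ}` contains `1 / J`, which the representation of `J` bounds by
`m / (hfun e^{pint/μ})`, so that the exponential cancels. -/
theorem exp_pint_le {t : ℝ} (ht : t ∈ Icc 0 T) {y : ℝ} (hy : y ∈ Icc 0 L) :
    Real.exp (F.pint t y / μ) ≤
      1 + R * F.m / μ * ∫ s in (0 : ℝ)..t, (F.hfun s)⁻¹ * (F.ρ y * F.ϑ s y) := by
  have hμ := F.μ_pos
  have h1 := ((F.pint_time y).const_smul μ⁻¹).exp
  have h2 := h1.eq_add t ht
  have e0 : F.pint 0 y = 0 := by simp [pint]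
  rw [e0, smul_zero, Real.exp_zero, smul_eq_mul, inv_mul_eq_div] at h2
  rw [h2, ← intervalIntegral.integral_const_mul]
  refine add_le_add le_rfl (intervalIntegral.integral_mono_on ht.1 (h1.intble_mem F.zero_mem ht)
    ?_ fun s hs => ?_)
  · refine ContinuousOn.intervalIntegrable ?_
    rw [uIcc_of_le ht.1]
    refine ContinuousOn.mono ?_ (Icc_subset_Icc_right ht.2)
    exact continuousOn_const.mul ((F.continuousOn_hfun.inv₀ fun s hs => (F.hfun_pos hs).ne').mul
      (continuousOn_const.mul (eval_continuousOn y F.ϑ_time.continuousOn)))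
  · have hs' : s ∈ Icc 0 T := ⟨hs.1, hs.2.trans ht.2⟩
    have h3 := (F.J_rep hs' hy).2
    have h4 := F.J_pos s hs' y
    have h5 := F.hfun_pos hs'
    have h6 : Real.exp (F.pint s y / μ) / F.J s y ≤ F.m * (F.hfun s)⁻¹ := by
      rw [div_le_iff₀ h4]
      calc Real.exp (F.pint s y / μ) = (F.hfun s * Real.exp (F.pint s y / μ)) * (F.hfun s)⁻¹ := by
            field_simp
        _ ≤ (F.m * F.J s y) * (F.hfun s)⁻¹ := by gcongr
        _ = _ := by ring
    simp only [smul_eq_mul]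
    rw [inv_mul_eq_div]
    have h7 : 0 ≤ R * F.ρ y * F.ϑ s y / μ := by
      have := F.R_pos; have := F.ρ_pos y; have := F.ϑ_nonneg s hs' y; positivity
    calc _ = (R * F.ρ y * F.ϑ s y / μ) * (Real.exp (F.pint s y / μ) / F.J s y) := by ring
      _ ≤ (R * F.ρ y * F.ϑ s y / μ) * (F.m * (F.hfun s)⁻¹) := by gcongr
      _ = _ := by ring

/-- Integrating the representation of `J` in space, `∫ J = L` and the bound on `∫ ρ ϑ` from the
conservation of energy turn `exp_pint_le` into a Gronwall inequality for `1 / hfun`. -/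
theorem inv_hfun_le {t : ℝ} (ht : t ∈ Icc 0 T) :
    (F.hfun t)⁻¹ ≤ F.m * Real.exp (R * F.m ^ 2 * F.energy₀ / (μ * c_v * L) * T) := by
  have hμ := F.μ_pos
  have hc := F.c_pos
  have hL := F.L_pos
  have hR := F.R_pos
  have hm := F.one_le_m
  have hE := F.energy₀_nonneg
  set a := R * F.m ^ 2 * F.energy₀ / (μ * c_v * L) with ha
  have ha0 : 0 ≤ a := by positivity
  have hinv : ContinuousOn (fun s => (F.hfun s)⁻¹) (Icc 0 T) :=
    F.continuousOn_hfun.inv₀ fun s hs => (F.hfun_pos hs).ne'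
  have hρϑ : ContinuousOn (fun s => (F.hfun s)⁻¹ • (F.ρ * F.ϑ s)) (Icc 0 T) :=
    hinv.smul (continuousOn_const.mul F.ϑ_time.continuousOn)
  have hP := isPrimitiveOn_integral_of_continuousOn F.T_pos.le hρϑ
  have key : ∀ t ∈ Icc 0 T, (F.hfun t)⁻¹ ≤ F.m + ∫ s in (0 : ℝ)..t, a * (F.hfun s)⁻¹ := by
    intro t ht
    have h1 : ∀ y, F.J t y ≤ F.hfun t * F.m * (1 + R * F.m / μ *
        (∫ s in (0 : ℝ)..t, (F.hfun s)⁻¹ • (F.ρ * F.ϑ s)) y) := by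
      intro y
      have h2 := (F.J_rep ht (clamp_mem hL.le y)).1
      have h3 := F.exp_pint_le ht (clamp_mem hL.le y)
      have e : (∫ s in (0 : ℝ)..t, (F.hfun s)⁻¹ • (F.ρ * F.ϑ s)) y =
          ∫ s in (0 : ℝ)..t, (F.hfun s)⁻¹ * (F.ρ y * F.ϑ s y) :=
        ((evalAt y).intervalIntegral_comp_comm (hP.intble_mem F.zero_mem ht)).symm
      rw [e]
      rw [F.J_clamp, F.ρ_clamp] at *
      simp only [F.ϑ_clamp] at h3
      refine h2.trans ?_
      have := F.hfun_pos ht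
      gcongr
    have h2 := integL_mono (L := L) (f := F.J t) (g := (F.hfun t * F.m) • ((1 : CB) +
      (R * F.m / μ) • ∫ s in (0 : ℝ)..t, (F.hfun s)⁻¹ • (F.ρ * F.ϑ s))) h1
    have h3 : integL L (∫ s in (0 : ℝ)..t, (F.hfun s)⁻¹ • (F.ρ * F.ϑ s)) ≤
        F.energy₀ / c_v * ∫ s in (0 : ℝ)..t, (F.hfun s)⁻¹ := by
      rw [← (integL L).intervalIntegral_comp_comm (hP.intble_mem F.zero_mem ht),
        ← intervalIntegral.integral_const_mul]
      refine intervalIntegral.integral_mono_on ht.1 ?_ ?_ fun s hs => ?_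
      · exact ((hP.map (integL L)).intble_mem F.zero_mem ht)
      · refine ContinuousOn.intervalIntegrable ?_
        rw [uIcc_of_le ht.1]
        exact (continuousOn_const.mul hinv).mono (Icc_subset_Icc_right ht.2)
      · have hs' : s ∈ Icc 0 T := ⟨hs.1, hs.2.trans ht.2⟩
        rw [map_smul, smul_eq_mul, mul_comm]
        exact mul_le_mul_of_nonneg_right (F.heat_le hs') (inv_nonneg.2 (F.hfun_pos hs').le)
    simp only [map_smul, map_add, smul_eq_mul, integL_one hL.le, F.integL_J ht] at h2
    have hh := F.hfun_pos ht
    rw [intervalIntegral.integral_const_mul]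
    set X := ∫ s in (0 : ℝ)..t, (F.hfun s)⁻¹ with hX
    have h4 : L ≤ F.hfun t * F.m * (L + R * F.m / μ * (F.energy₀ / c_v * X)) := by
      refine h2.trans ?_
      gcongr
    rw [inv_le_iff_one_le_mul₀ hh]
    have h5 : F.hfun t * F.m * (L + R * F.m / μ * (F.energy₀ / c_v * X)) =
        L * ((F.m + a * X) * F.hfun t) := by
      rw [ha]; field_simp
    rw [h5] at h4
    exact le_of_mul_le_mul_left (by linarith) hL
  have hg := gronwall_integral (b := T) (A := F.m) (f := fun s => (F.hfun s)⁻¹) (a := fun _ => a)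
    F.T_pos.le intervalIntegrable_const (Eventually.of_forall fun _ => ha0)
    (ContinuousOn.intervalIntegrable (by
      rw [uIcc_of_le F.T_pos.le]; exact continuousOn_const.mul hinv))
    (by
      filter_upwards [ae_restrict_mem measurableSet_Ioo] with s hs using
        key s (Ioo_subset_Icc_self hs)) t ht
  refine (key t ht).trans (hg.trans ?_)
  rw [intervalIntegral.integral_const, sub_zero, smul_eq_mul, mul_comm t a]
  have := ht.2
  gcongr

/-- Lower bound for the Jacobian and its upper bound in terms of the temperature. -/
theorem exists_J_bounds (R c_v μ κ T K : ℝ) : ∃ C : ℝ, 1 ≤ C ∧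
    ∀ {L : ℝ} (F : Flow R c_v μ κ T L), F.Controlled K → ∀ t ∈ Icc 0 T,
      (∀ y, F.I t y ≤ C) ∧
      ‖F.J t‖ ≤ C * (1 + ∫ s in (0 : ℝ)..t, ‖F.ρ * F.ϑ s‖) := by
  set a := R * K ^ 2 * K * K / (μ * c_v) with ha
  refine ⟨K ^ 2 * (1 + |R / μ| * K * (K * Real.exp (a * T))) + K * (K * Real.exp (a * T)) + 1, ?_,
    fun {L} F hF t ht => ?_⟩
  · have h1 : 0 ≤ K ^ 2 * (1 + |R / μ| * K * (K * Real.exp (a * T))) := by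
      have : 0 ≤ |R / μ| * K * (K * Real.exp (a * T)) := by
        rw [mul_assoc, ← mul_assoc K K]
        exact mul_nonneg (abs_nonneg _) (mul_nonneg (mul_self_nonneg _) (Real.exp_pos _).le)
      positivity
    have h2 : 0 ≤ K * (K * Real.exp (a * T)) := by
      rw [← mul_assoc]
      exact mul_nonneg (mul_self_nonneg _) (Real.exp_pos _).le
    linarith
  have hμ := F.μ_pos
  have hc := F.c_pos
  have hL := F.L_pos
  have hR := F.R_pos
  have hT := F.T_pos
  have hm := F.one_le_m
  have hE := F.energy₀_nonneg
  have hK := hF.one_le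
  have hmK : F.m ≤ K := hF.m₁_le
  have hinvL : L⁻¹ ≤ K := by rw [inv_le_iff_one_le_mul₀ hL]; exact hF.one_le_mul_L
  have hih : ∀ t ∈ Icc 0 T, (F.hfun t)⁻¹ ≤ K * Real.exp (a * T) := by
    intro t ht
    refine (F.inv_hfun_le ht).trans ?_
    have : R * F.m ^ 2 * F.energy₀ / (μ * c_v * L) ≤ a := by
      have e : R * F.m ^ 2 * F.energy₀ / (μ * c_v * L) =
        R * F.m ^ 2 * F.energy₀ * L⁻¹ / (μ * c_v) := by field_simp
      rw [e, ha]
      have := hF.energy₀_le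
      gcongr
    gcongr
  set Z := K * Real.exp (a * T) with hZ
  have hZ0 : 0 < Z := by positivity
  have habs : |R / μ| = R / μ := abs_of_pos (by positivity)
  rw [habs]
  have e1 : ∀ y, 1 ≤ K * Z * F.J t y := by
    intro y
    rw [← F.J_clamp]
    have h1 := (F.J_rep ht (clamp_mem hL.le y)).2
    have h2 : 1 ≤ Real.exp (F.pint t (clamp L y) / μ) :=
      Real.one_le_exp (div_nonneg (F.pint_nonneg ht _) hμ.le)
    have h3 := hih t ht
    have h4 := F.hfun_pos ht
    rw [inv_le_iff_one_le_mul₀ h4] at h3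
    have h5 := F.J_pos t ht (clamp L y)
    calc 1 ≤ Z * F.hfun t := h3
      _ ≤ Z * (F.hfun t * Real.exp (F.pint t (clamp L y) / μ)) := by
        gcongr; exact le_mul_of_one_le_right h4.le h2
      _ ≤ Z * (F.m * F.J t (clamp L y)) := by gcongr
      _ ≤ Z * (K * F.J t (clamp L y)) := by gcongr
      _ = _ := by ring
  have hA : ContinuousOn (fun s => ‖F.ρ * F.ϑ s‖) (Icc 0 T) :=
    (continuousOn_const.mul F.ϑ_time.continuousOn).norm
  have hA' := isPrimitiveOn_integral_of_continuousOn hT.le hA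
  have hAi : 0 ≤ ∫ s in (0 : ℝ)..t, ‖F.ρ * F.ϑ s‖ :=
    intervalIntegral.integral_nonneg ht.1 fun s _ => norm_nonneg _
  constructor
  · intro y
    have h1 : F.I t y ≤ K * Z := by
      have := e1 y
      have h2 := F.J_mul_I t ht y
      have h3 := F.I_pos ht y
      nlinarith
    have : 0 ≤ K ^ 2 * (1 + R / μ * K * Z) := by positivity
    linarith
  · have hC : K ^ 2 * (1 + R / μ * K * Z) ≤ K ^ 2 * (1 + R / μ * K * Z) + K * Z + 1 := by
      have : 0 ≤ K * Z := by positivity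
      linarith
    refine le_trans ?_ (mul_le_mul_of_nonneg_right hC (by linarith))
    refine CB.norm_le_of_clamp hL (F.J_clamp t) fun y hy => ?_
    rw [abs_of_pos (F.J_pos t ht y)]
    have h1 := (F.J_rep ht hy).1
    have h2 := F.exp_pint_le ht hy
    have h3 : ∫ s in (0 : ℝ)..t, (F.hfun s)⁻¹ * (F.ρ y * F.ϑ s y) ≤
        Z * ∫ s in (0 : ℝ)..t, ‖F.ρ * F.ϑ s‖ := by
      rw [← intervalIntegral.integral_const_mul]
      refine intervalIntegral.integral_mono_on ht.1 ?_ ?_ fun s hs => ?_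
      · refine ContinuousOn.intervalIntegrable ?_
        rw [uIcc_of_le ht.1]
        exact ((F.continuousOn_hfun.inv₀ fun s hs => (F.hfun_pos hs).ne').mul
          (continuousOn_const.mul (eval_continuousOn y F.ϑ_time.continuousOn))).mono
          (Icc_subset_Icc_right ht.2)
      · exact (hA'.intble_mem F.zero_mem ht).const_mul _
      · have hs' : s ∈ Icc 0 T := ⟨hs.1, hs.2.trans ht.2⟩
        have h4 : F.ρ y * F.ϑ s y ≤ ‖F.ρ * F.ϑ s‖ :=
          (le_abs_self _).trans ((F.ρ * F.ϑ s).norm_coe_le y)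
        have h5 := hih s hs'
        have h6 : 0 ≤ F.ρ y * F.ϑ s y := mul_nonneg (F.ρ_pos y).le (F.ϑ_nonneg s hs' y)
        gcongr
    have h4 := F.hfun_le ht
    have h5 := F.hfun_pos ht
    set X := ∫ s in (0 : ℝ)..t, ‖F.ρ * F.ϑ s‖ with hX
    calc F.J t y ≤ F.hfun t * F.m * Real.exp (F.pint t y / μ) := h1
      _ ≤ F.hfun t * F.m * (1 + R * F.m / μ * (Z * X)) := by
        have : R * F.m / μ * ∫ s in (0 : ℝ)..t, (F.hfun s)⁻¹ * (F.ρ y * F.ϑ s y) ≤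
          R * F.m / μ * (Z * X) := by gcongr
        have h7 : 0 ≤ F.hfun t * F.m := by positivity
        exact mul_le_mul_of_nonneg_left (by linarith) h7
      _ ≤ K * K * (1 + R * K / μ * (Z * X)) := by
        have := h4.trans hmK
        gcongr
      _ ≤ K ^ 2 * (1 + R / μ * K * Z) * (1 + X) := by
        have : 0 ≤ K ^ 2 * (R / μ * K * Z + X) := by positivity
        have e : K ^ 2 * (1 + R / μ * K * Z) * (1 + X) - K * K * (1 + R * K / μ * (Z * X)) =
          K ^ 2 * (R / μ * K * Z + X) := by field_simp; ring
        linarith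

end Flow

/-! ### Sup norms of the temperature and the pressure -/

section Auxiliary

variable {L : ℝ}

theorem integL_mono_on {f g : CB} (h : ∀ y ∈ Ioo 0 L, f y ≤ g y) : integL L f ≤ integL L g := by
  rw [integL_eq, integL_eq]
  exact setIntegral_mono_on (f.integrable L) (g.integrable L) measurableSet_Ioo h

/-- A function is somewhere at most its weighted mean. -/
theorem exists_mul_integL_le (hL : 0 < L) (ρ f : CB) (hρ : ∀ y, 0 ≤ ρ y) :
    ∃ y ∈ Icc 0 L, f y * integL L ρ ≤ integL L (ρ * f) := by
  obtain ⟨y, hy, hm⟩ := isCompact_Icc.exists_isMinOn (nonempty_Icc.2 hL.le) f.continuous.continuousOn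
  refine ⟨y, hy, ?_⟩
  have h := integL_mono_on (L := L) (f := f y • ρ) (g := ρ * f) fun z hz => by
    change f y * ρ z ≤ ρ z * f z
    rw [mul_comm]
    exact mul_le_mul_of_nonneg_left (hm (Ioo_subset_Icc_self hz)) (hρ z)
  simpa only [map_smul, smul_eq_mul] using h

theorem sq_intervalIntegral_le {t : ℝ} (ht : 0 ≤ t) {f : ℝ → ℝ} (hf : ContinuousOn f (Icc 0 t)) :
    (∫ s in (0 : ℝ)..t, f s) ^ 2 ≤ t * ∫ s in (0 : ℝ)..t, f s ^ 2 := by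
  obtain ⟨M, hM⟩ := isCompact_Icc.exists_bound_of_continuousOn hf
  have h1 : MemLp f 2 (leb t) :=
    MemLp.of_bound ((hf.mono Ioo_subset_Icc_self).aestronglyMeasurable measurableSet_Ioo) M (by
      filter_upwards [ae_restrict_mem measurableSet_Ioo] with s hs using
        hM s (Ioo_subset_Icc_self hs))
  have h2 := sq_integral_mul_le (memLp_const (1 : ℝ)) h1
  rw [intervalIntegral_eq_Ioo ht, intervalIntegral_eq_Ioo ht]
  simpa [ht] using h2

theorem intervalIntegral_mono_of_continuousOn {b t : ℝ} (ht : t ∈ Icc 0 b) {f g : ℝ → ℝ}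
    (hf : ContinuousOn f (Icc 0 b)) (hg : ContinuousOn g (Icc 0 b))
    (h : ∀ s ∈ Icc 0 b, f s ≤ g s) :
    ∫ s in (0 : ℝ)..t, f s ≤ ∫ s in (0 : ℝ)..t, g s := by
  have hs : Icc 0 t ⊆ Icc 0 b := Icc_subset_Icc_right ht.2
  refine intervalIntegral.integral_mono_on ht.1 ?_ ?_ fun s hs' => h s (hs hs')
  · exact ContinuousOn.intervalIntegrable (by rw [uIcc_of_le ht.1]; exact hf.mono hs)
  · exact ContinuousOn.intervalIntegrable (by rw [uIcc_of_le ht.1]; exact hg.mono hs)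

/-- Young's inequality in the form in which the sup norm `A` of `ρ ϑ` is absorbed by the
dissipation `D`, at the expense of the square of the sup norm `N` of the Jacobian. -/
theorem exists_sq_le_of_le {ε a k q b : ℝ} (hε : 0 < ε) (hb : 0 < b) (hq : 0 ≤ q) :
    ∃ C : ℝ, 0 ≤ C ∧ ∀ A B X D N : ℝ, 0 ≤ B → 0 ≤ X → 0 ≤ D → 0 ≤ N → B ^ 2 ≤ b * (1 + D) →
      A ^ 2 ≤ a ^ 2 + 2 * (k * a) * B + 2 * X → X ^ 2 ≤ D * (N * (q * B)) →
      A ^ 2 ≤ ε * D + C * (1 + N ^ 2) := by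
  have hη : 0 < ε / (3 * b) := by positivity
  refine ⟨a ^ 2 + (k * a) ^ 2 / (ε / (3 * b)) + ε + (3 / ε * q) ^ 2 / (4 * (ε / (3 * b))),
    by positivity, fun A B X D N hB0 hX0 hD hN hB hA hX => ?_⟩
  set η := ε / (3 * b) with hηd
  have hηb : η * b = ε / 3 := by rw [hηd]; field_simp
  have h0 : η * B ^ 2 ≤ ε / 3 * (1 + D) := by
    rw [← hηb, mul_assoc]; gcongr
  have h1 : 2 * (k * a) * B ≤ η * B ^ 2 + (k * a) ^ 2 / η := by
    have e : η * B ^ 2 + (k * a) ^ 2 / η - 2 * (k * a) * B = (η * B - k * a) ^ 2 / η := by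
      field_simp; ring
    have : 0 ≤ (η * B - k * a) ^ 2 / η := by positivity
    linarith
  set r := 3 / ε * q * B * N with hr
  have hr0 : 0 ≤ r := by positivity
  have h2 : 2 * X ≤ ε / 3 * D + r := by
    have h3 : X ^ 2 ≤ (ε / 3 * D) * r := by
      refine hX.trans (le_of_eq ?_)
      rw [hr]; field_simp
    have hs : 0 ≤ ε / 3 * D + r := by positivity
    nlinarith [sq_nonneg (ε / 3 * D - r)]
  have h3 : r ≤ η * B ^ 2 + (3 / ε * q) ^ 2 / (4 * η) * N ^ 2 := by
    have e : η * B ^ 2 + (3 / ε * q) ^ 2 / (4 * η) * N ^ 2 - r =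
        (2 * η * B - 3 / ε * q * N) ^ 2 / (4 * η) := by
      rw [hr]; field_simp; ring
    have : 0 ≤ (2 * η * B - 3 / ε * q * N) ^ 2 / (4 * η) := by positivity
    linarith
  set z := (3 / ε * q) ^ 2 / (4 * η) with hz
  have hz0 : 0 ≤ z := by positivity
  set x := (k * a) ^ 2 / η with hx
  have hx0 : 0 ≤ x := by positivity
  have : 0 ≤ (a ^ 2 + x + ε) * N ^ 2 := by positivity
  nlinarith

theorem CB.sq_norm_le_of_clamp (hL : 0 < L) {f : CB} {M : ℝ} (hf : ∀ y, f (clamp L y) = f y)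
    (h : ∀ y ∈ Icc 0 L, f y ^ 2 ≤ M) : ‖f‖ ^ 2 ≤ M := by
  have h0 : 0 ≤ M := (sq_nonneg _).trans (h 0 ⟨le_rfl, hL.le⟩)
  have h1 : ‖f‖ ≤ Real.sqrt M := CB.norm_le_of_clamp hL hf fun y hy => Real.abs_le_sqrt (h y hy)
  calc ‖f‖ ^ 2 ≤ Real.sqrt M ^ 2 := by gcongr
    _ = M := Real.sq_sqrt h0

end Auxiliary

namespace Flow

variable {R c_v μ κ T L : ℝ} (F : Flow R c_v μ κ T L)

/-- The dissipation `∫ (∂_y ϑ)² / J`. -/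
def D (t : ℝ) : ℝ := integL L (F.ϑy t ^ 2 * F.I t)

theorem D_nonneg {t : ℝ} (ht : t ∈ Icc 0 T) : 0 ≤ F.D t :=
  integL_nonneg fun y => mul_nonneg (sq_nonneg (F.ϑy t y)) (F.I_pos ht y).le

theorem continuousOn_D : ContinuousOn F.D (Icc 0 T) :=
  (integL L).continuous.comp_continuousOn ((F.ϑy_cont.pow 2).mul F.I_time.continuousOn)

theorem sq_integL_abs_ϑy_le {t : ℝ} (ht : t ∈ Icc 0 T) (g : CB) :
    integL L ((F.ϑy t).abs' * g) ^ 2 ≤ F.D t * integL L (F.J t * g ^ 2) := by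
  have h := sq_integL_weight_le (L := L) (F.ϑy t).abs' (F.J t * g) (F.I t)
    fun y => (F.I_pos ht y).le
  have e1 : F.I t * ((F.ϑy t).abs' * (F.J t * g)) = (F.ϑy t).abs' * g := by
    ext y
    change F.I t y * (|F.ϑy t y| * (F.J t y * g y)) = |F.ϑy t y| * g y
    linear_combination (|F.ϑy t y| * g y) * F.J_mul_I t ht y
  have e2 : F.I t * (F.ϑy t).abs' ^ 2 = F.ϑy t ^ 2 * F.I t := by
    ext y
    change F.I t y * |F.ϑy t y| ^ 2 = F.ϑy t y ^ 2 * F.I t y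
    rw [sq_abs, mul_comm]
  have e3 : F.I t * (F.J t * g) ^ 2 = F.J t * g ^ 2 := by
    ext y
    change F.I t y * (F.J t y * g y) ^ 2 = F.J t y * g y ^ 2
    linear_combination (F.J t y * g y ^ 2) * F.J_mul_I t ht y
  rwa [e1, e2, e3] at h

variable {F} {K : ℝ}

theorem Controlled.heat_le (hF : F.Controlled K) {t : ℝ} (ht : t ∈ Icc 0 T) :
    integL L (F.ρ * F.ϑ t) ≤ K / c_v :=
  (F.heat_le ht).trans (div_le_div_of_nonneg_right hF.energy₀_le F.c_pos.le)

/-- The sup norm of the temperature is controlled by the dissipation. -/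
theorem Controlled.sq_norm_ϑ_le (hF : F.Controlled K) {t : ℝ} (ht : t ∈ Icc 0 T) :
    ‖F.ϑ t‖ ^ 2 ≤ 2 * ((K ^ 2 / c_v) ^ 2 + K) * (1 + F.D t) := by
  have hK := hF.one_le
  have hD := F.D_nonneg ht
  obtain ⟨z, hz, h1⟩ := exists_mul_integL_le F.L_pos F.ρ (F.ϑ t) fun y => (F.ρ_pos y).le
  have h2 : F.ϑ t z ≤ K ^ 2 / c_v := by
    have h3 := F.ϑ_nonneg t ht z
    have h4 := hF.one_le_mul_mass
    calc F.ϑ t z ≤ F.ϑ t z * (K * integL L F.ρ) := le_mul_of_one_le_right h3 h4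
      _ = K * (F.ϑ t z * integL L F.ρ) := by ring
      _ ≤ K * (K / c_v) := by gcongr; exact h1.trans (hF.heat_le ht)
      _ = K ^ 2 / c_v := by ring
  have h5 := F.sq_integL_abs_ϑy_le ht 1
  rw [mul_one, one_pow, mul_one, F.integL_J ht] at h5
  refine CB.sq_norm_le_of_clamp F.L_pos (F.ϑ_clamp t) fun y hy => ?_
  have h6 := (le_abs_self _).trans ((F.ϑ_space t).abs_sub_le_integL hz hy)
  have h7 : F.ϑ t y ≤ K ^ 2 / c_v + integL L (F.ϑy t).abs' := by linarith
  have h8 := F.ϑ_nonneg t ht y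
  have h9 : F.D t * L ≤ F.D t * K := by gcongr; exact hF.L_le
  calc F.ϑ t y ^ 2 ≤ (K ^ 2 / c_v + integL L (F.ϑy t).abs') ^ 2 := by gcongr
    _ ≤ 2 * (K ^ 2 / c_v) ^ 2 + 2 * integL L (F.ϑy t).abs' ^ 2 := by
      nlinarith [sq_nonneg (K ^ 2 / c_v - integL L (F.ϑy t).abs')]
    _ ≤ 2 * ((K ^ 2 / c_v) ^ 2 + K) * (1 + F.D t) := by
      have : 0 ≤ (K ^ 2 / c_v) ^ 2 * F.D t := by positivity
      nlinarith

/-- The square of `ρ ϑ` at any point, bounded by its mean value and the integral of its derivative. -/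
theorem Controlled.sq_norm_ρϑ_le (hF : F.Controlled K) {t : ℝ} (ht : t ∈ Icc 0 T) :
    ‖F.ρ * F.ϑ t‖ ^ 2 ≤ (K ^ 2 / c_v) ^ 2 + 2 * (K * (K ^ 2 / c_v)) * ‖F.ϑ t‖
      + 2 * integL L ((F.ϑy t).abs' * (F.ρ ^ 2 * F.ϑ t)) := by
  have hK := hF.one_le
  have hc := F.c_pos
  have hcl : ∀ y, (F.ρ * F.ϑ t) (clamp L y) = (F.ρ * F.ϑ t) y := fun y => by
    change F.ρ (clamp L y) * F.ϑ t (clamp L y) = F.ρ y * F.ϑ t y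
    rw [F.ρ_clamp, F.ϑ_clamp]
  have hpos : ∀ y, 0 ≤ F.ρ y * F.ϑ t y := fun y =>
    mul_nonneg (F.ρ_pos y).le (F.ϑ_nonneg t ht y)
  obtain ⟨z, hz, h1⟩ := exists_mul_integL_le F.L_pos 1 (F.ρ * F.ϑ t) fun y => zero_le_one
  rw [integL_one F.L_pos.le, one_mul] at h1
  have h2 : F.ρ z * F.ϑ t z ≤ K ^ 2 / c_v := by
    calc F.ρ z * F.ϑ t z ≤ (F.ρ z * F.ϑ t z) * (K * L) :=
          le_mul_of_one_le_right (hpos z) hF.one_le_mul_L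
      _ = K * (F.ρ z * F.ϑ t z * L) := by ring
      _ ≤ K * (K / c_v) := by gcongr; exact h1.trans (hF.heat_le ht)
      _ = K ^ 2 / c_v := by ring
  have hP := (F.ρ_space.mul (F.ϑ_space t))
  have hP2 := hP.mul hP
  refine CB.sq_norm_le_of_clamp F.L_pos hcl fun y hy => ?_
  have h3 : IsPrimitiveOn L ((F.ρ * F.ϑ t) ^ 2 : CB)
      ((2 : ℝ) • ((F.ρ * F.ϑ t) * (F.ρ' * F.ϑ t + F.ρ * F.ϑy t)) : CB) := by
    refine (hP2.congr_left fun y _ => ?_).congr_ae (Eventually.of_forall fun y => ?_)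
    · change (F.ρ y * F.ϑ t y) ^ 2 = _
      ring
    · change _ = 2 * ((F.ρ y * F.ϑ t y) * (F.ρ' y * F.ϑ t y + F.ρ y * F.ϑy t y))
      ring
  have h4 := (le_abs_self _).trans (h3.abs_sub_le_integL hz hy)
  have h5 : integL L ((2 : ℝ) • ((F.ρ * F.ϑ t) * (F.ρ' * F.ϑ t + F.ρ * F.ϑy t)) : CB).abs' ≤
      integL L ((2 * (K * ‖F.ϑ t‖)) • (F.ρ * F.ϑ t) +
        (2 : ℝ) • ((F.ϑy t).abs' * (F.ρ ^ 2 * F.ϑ t))) := integL_mono fun y => by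
    change |2 * ((F.ρ y * F.ϑ t y) * (F.ρ' y * F.ϑ t y + F.ρ y * F.ϑy t y))| ≤
      2 * (K * ‖F.ϑ t‖) * (F.ρ y * F.ϑ t y) + 2 * (|F.ϑy t y| * (F.ρ y ^ 2 * F.ϑ t y))
    have a1 := hpos y
    have a2 : |F.ρ' y * F.ϑ t y + F.ρ y * F.ϑy t y| ≤ K * ‖F.ϑ t‖ + F.ρ y * |F.ϑy t y| := by
      refine (abs_add_le _ _).trans (add_le_add ?_ ?_)
      · rw [abs_mul]
        exact mul_le_mul (hF.ρ'_le y) ((F.ϑ t).norm_coe_le y) (abs_nonneg _) (by linarith)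
      · rw [abs_mul, abs_of_pos (F.ρ_pos y)]
    rw [abs_mul, abs_mul, abs_of_nonneg a1, abs_two]
    calc _ ≤ 2 * ((F.ρ y * F.ϑ t y) * (K * ‖F.ϑ t‖ + F.ρ y * |F.ϑy t y|)) := by gcongr
      _ = _ := by ring
  simp only [map_add, map_smul, smul_eq_mul] at h5
  have h6 : (F.ρ z * F.ϑ t z) ^ 2 ≤ (K ^ 2 / c_v) ^ 2 := by
    have := hpos z
    gcongr
  have h7 : 2 * (K * ‖F.ϑ t‖) * integL L (F.ρ * F.ϑ t) ≤ 2 * (K * (K ^ 2 / c_v)) * ‖F.ϑ t‖ := by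
    have h8 : integL L (F.ρ * F.ϑ t) ≤ K ^ 2 / c_v := by
      refine (hF.heat_le ht).trans (div_le_div_of_nonneg_right ?_ hc.le)
      nlinarith
    calc _ ≤ 2 * (K * ‖F.ϑ t‖) * (K ^ 2 / c_v) := by gcongr
      _ = _ := by ring
  change (F.ρ y * F.ϑ t y) ^ 2 ≤ _
  change (F.ρ y * F.ϑ t y) ^ 2 - (F.ρ z * F.ϑ t z) ^ 2 ≤ _ at h4
  linarith

/-- The derivative term in `sq_norm_ρϑ_le` by the dissipation, with only a bounded mass of `ρ ϑ` and
sup norms as factors. -/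
theorem Controlled.sq_integL_ϑy_le (hF : F.Controlled K) {t : ℝ} (ht : t ∈ Icc 0 T) :
    integL L ((F.ϑy t).abs' * (F.ρ ^ 2 * F.ϑ t)) ^ 2 ≤
      F.D t * (‖F.J t‖ * (K ^ 4 / c_v * ‖F.ϑ t‖)) := by
  have hK := hF.one_le
  have hc := F.c_pos
  refine (F.sq_integL_abs_ϑy_le ht _).trans
    (mul_le_mul_of_nonneg_left ?_ (F.D_nonneg ht))
  have h := integL_mono (L := L) (f := F.J t * (F.ρ ^ 2 * F.ϑ t) ^ 2)
    (g := (‖F.J t‖ * (K ^ 3 * ‖F.ϑ t‖)) • (F.ρ * F.ϑ t)) fun y => by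
      change F.J t y * (F.ρ y ^ 2 * F.ϑ t y) ^ 2 ≤
        (‖F.J t‖ * (K ^ 3 * ‖F.ϑ t‖)) * (F.ρ y * F.ϑ t y)
      have h1 := (le_abs_self _).trans ((F.J t).norm_coe_le y)
      have h2 := (le_abs_self _).trans ((F.ϑ t).norm_coe_le y)
      have h3 := F.ρ_pos y
      have h4 := F.ϑ_nonneg t ht y
      have h5 := hF.ρ_le y
      have h6 := F.J_pos t ht y
      calc _ = F.J t y * (F.ρ y ^ 3 * F.ϑ t y) * (F.ρ y * F.ϑ t y) := by ring
        _ ≤ (‖F.J t‖ * (K ^ 3 * ‖F.ϑ t‖)) * (F.ρ y * F.ϑ t y) := by gcongr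
  simp only [map_smul, smul_eq_mul] at h
  refine h.trans ?_
  calc _ ≤ (‖F.J t‖ * (K ^ 3 * ‖F.ϑ t‖)) * (K / c_v) := by gcongr; exact hF.heat_le ht
    _ = _ := by ring

/-- The sup norm of `ρ ϑ` is controlled by an arbitrarily small multiple of the dissipation and
the sup norm of the Jacobian. -/
theorem exists_sq_norm_ρϑ_le (R c_v μ κ T K ε : ℝ) (hK : 1 ≤ K) (hc : 0 < c_v) (hε : 0 < ε) :
    ∃ C : ℝ, 0 ≤ C ∧ ∀ {L : ℝ} (F : Flow R c_v μ κ T L), F.Controlled K → ∀ t ∈ Icc 0 T,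
      ‖F.ρ * F.ϑ t‖ ^ 2 ≤ ε * F.D t + C * (1 + ‖F.J t‖ ^ 2) := by
  obtain ⟨C, hC, h⟩ := exists_sq_le_of_le (ε := ε) (a := K ^ 2 / c_v) (k := K) (q := K ^ 4 / c_v)
    (b := 2 * ((K ^ 2 / c_v) ^ 2 + K)) hε (by positivity) (by positivity)
  refine ⟨C, hC, fun F hF t ht => h _ _ _ _ _ (norm_nonneg _) (integL_nonneg fun y => ?_)
    (F.D_nonneg ht) (norm_nonneg _) (hF.sq_norm_ϑ_le ht) (hF.sq_norm_ρϑ_le ht)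
    (hF.sq_integL_ϑy_le ht)⟩
  exact mul_nonneg (abs_nonneg _) (mul_nonneg (sq_nonneg (F.ρ y)) (F.ϑ_nonneg t ht y))

end Flow

/-! ### The balance of the higher energy -/

/-- The quadratic form in the dissipation of the higher energy is coercive up to the pressure
term. -/
theorem higher_energy_coercive {R c μ κ M a b p : ℝ} (hc : 0 < c) (hμ : 0 < μ) (hκ : 0 < κ)
    (hM0 : 0 ≤ M) (hM : 2 * M * μ = 1 + (κ + c * μ) ^ 2 / (c * κ)) :
    c * κ / 2 * b ^ 2 - (c * R ^ 2 / κ + (1 + 9 * M) * R ^ 2 / (4 * μ)) * p ^ 2 ≤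
      (a + c * b) * (μ * a - R * p + κ * b) + 3 * M * a * (μ * a - R * p) := by
  have h1 : 0 ≤ c * κ / 4 * (b + 2 * ((κ + c * μ) / (c * κ)) * a) ^ 2 := by positivity
  have h2 : 0 ≤ c * κ / 4 * (b - 2 * R / κ * p) ^ 2 := by positivity
  have h3 : 0 ≤ μ * (a - R / (2 * μ) * p) ^ 2 := by positivity
  have h4 : 0 ≤ M * μ * (a - 3 * R / (2 * μ) * p) ^ 2 := by positivity
  have h5 : 0 ≤ a ^ 2 := sq_nonneg a
  have e : (a + c * b) * (μ * a - R * p + κ * b) + 3 * M * a * (μ * a - R * p) -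
      (c * κ / 2 * b ^ 2 - (c * R ^ 2 / κ + (1 + 9 * M) * R ^ 2 / (4 * μ)) * p ^ 2) =
      c * κ / 4 * (b + 2 * ((κ + c * μ) / (c * κ)) * a) ^ 2 +
      c * κ / 4 * (b - 2 * R / κ * p) ^ 2 + μ * (a - R / (2 * μ) * p) ^ 2 +
      M * μ * (a - 3 * R / (2 * μ) * p) ^ 2 +
      (2 * M * μ - (κ + c * μ) ^ 2 / (c * κ)) * a ^ 2 := by
    field_simp
    ring
  rw [hM] at e
  linarith

namespace Flow

variable {R c_v μ κ T L : ℝ} (F : Flow R c_v μ κ T L)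

/-- The specific energy. -/
def e (t : ℝ) : CB := (1 / 2 : ℝ) • F.v t ^ 2 + c_v • F.ϑ t

theorem e_time : IsPrimitiveOn T F.e (fun t => F.v t * F.w t + c_v • F.θ t) := by
  have h := ((F.v_time'.mulCB F.v_time').const_smul (1 / 2 : ℝ)).add (F.ϑ_time'.const_smul c_v)
  refine (h.congr_left fun t _ => ?_).congr_ae (Eventually.of_forall fun t => ?_)
  · ext y
    change 1 / 2 * F.v t y ^ 2 + c_v * F.ϑ t y = 1 / 2 * (F.v t y * F.v t y) + c_v * F.ϑ t y
    ring
  · ext y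
    change 1 / 2 * (F.w t y * F.v t y + F.v t y * F.w t y) + c_v * F.θ t y =
      F.v t y * F.w t y + c_v * F.θ t y
    ring

theorem e_space (t : ℝ) : IsPrimitiveOn L (F.e t) (F.v t * F.vy t + c_v • F.ϑy t : CB) := by
  have h := (((F.v_space t).mul (F.v_space t)).const_smul (1 / 2 : ℝ)).add
    ((F.ϑ_space t).const_smul c_v)
  refine (h.congr_left fun y _ => ?_).congr_ae (Eventually.of_forall fun y => ?_)
  · change 1 / 2 * F.v t y ^ 2 + c_v * F.ϑ t y = 1 / 2 * (F.v t y * F.v t y) + c_v * F.ϑ t y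
    ring
  · change 1 / 2 * (F.vy t y * F.v t y + F.v t y * F.vy t y) + c_v * F.ϑy t y =
      F.v t y * F.vy t y + c_v * F.ϑy t y
    ring

/-- The higher energy density `ρ e² / 2 + M ρ v⁴ / 4`. -/
def e₂ (M t : ℝ) : CB :=
  (1 / 2 : ℝ) • (F.ρ * F.e t ^ 2) + (M / 4) • (F.ρ * F.v t ^ 4)

/-- The dissipation of the higher energy. -/
def Z (M t : ℝ) : CB :=
  (F.v t * F.vy t + c_v • F.ϑy t) * (F.v t * F.G t + F.Q t) +
    (3 * M) • (F.v t ^ 2 * (F.vy t * F.G t))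

theorem e₂_time (M : ℝ) : IsPrimitiveOn T (F.e₂ M) (fun t =>
    F.ρ * (F.e t * (F.v t * F.w t + c_v • F.θ t)) + M • (F.ρ * (F.v t ^ 3 * F.w t))) := by
  have h1 := ((F.e_time.mulCB F.e_time).map (ContinuousLinearMap.mul ℝ CB F.ρ)).const_smul
    (1 / 2 : ℝ)
  have h2 := F.v_time'.mulCB F.v_time'
  have h3 := ((h2.mulCB h2).map (ContinuousLinearMap.mul ℝ CB F.ρ)).const_smul (M / 4)
  refine ((h1.add h3).congr_left fun t _ => ?_).congr_ae (Eventually.of_forall fun t => ?_)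
  · ext y
    change 1 / 2 * (F.ρ y * F.e t y ^ 2) + M / 4 * (F.ρ y * F.v t y ^ 4) =
      1 / 2 * (F.ρ y * (F.e t y * F.e t y)) +
        M / 4 * (F.ρ y * (F.v t y * F.v t y * (F.v t y * F.v t y)))
    ring
  · ext y
    change 1 / 2 * (F.ρ y * ((F.v t y * F.w t y + c_v * F.θ t y) * F.e t y +
        F.e t y * (F.v t y * F.w t y + c_v * F.θ t y))) +
      M / 4 * (F.ρ y * ((F.w t y * F.v t y + F.v t y * F.w t y) * (F.v t y * F.v t y) +
        (F.v t y * F.v t y) * (F.w t y * F.v t y + F.v t y * F.w t y))) =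
      F.ρ y * (F.e t y * (F.v t y * F.w t y + c_v * F.θ t y)) + M * (F.ρ y * (F.v t y ^ 3 * F.w t y))
    ring

/-- The balance of the higher energy; the boundary terms vanish with `v` and the heat flux. -/
theorem integL_e₂_time (M : ℝ) :
    IsPrimitiveOn T (fun t => integL L (F.e₂ M t)) (fun t => -integL L (F.Z M t)) := by
  refine ((F.e₂_time M).map (integL L)).congr_ae ?_
  filter_upwards [F.flux_space, F.G_space, ae_restrict_mem measurableSet_Ioo] with t h1 h2 ht
  have ht' := Ioo_subset_Icc_self ht
  have h3 := (F.e_space t).mul h1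
  have h4 := (((F.v_space t).mul ((F.v_space t).mul (F.v_space t))).mul h2).const_smul M
  have h5 : IsPrimitiveOn L
      (F.e t * (F.v t * F.G t + F.Q t) + M • (F.v t ^ 3 * F.G t) : CB)
      ((F.ρ * (F.e t * (F.v t * F.w t + c_v • F.θ t)) + M • (F.ρ * (F.v t ^ 3 * F.w t))) +
        F.Z M t : CB) := by
    refine ((h3.add h4).congr_left fun y _ => ?_).congr_ae (Eventually.of_forall fun y => ?_)
    · change F.e t y * (F.v t y * F.G t y + F.Q t y) + M * (F.v t y ^ 3 * F.G t y) =
        F.e t y * (F.v t y * F.G t y + F.Q t y) +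
          M * (F.v t y * (F.v t y * F.v t y) * F.G t y)
      ring
    · change (F.v t y * F.vy t y + c_v * F.ϑy t y) * (F.v t y * F.G t y + F.Q t y) +
        F.e t y * (F.ρ y * (F.v t y * F.w t y) + c_v * (F.ρ y * F.θ t y)) +
        M * ((F.vy t y * (F.v t y * F.v t y) + F.v t y * (F.vy t y * F.v t y +
          F.v t y * F.vy t y)) * F.G t y + (F.v t y * (F.v t y * F.v t y)) * (F.ρ y * F.w t y)) =
        (F.ρ y * (F.e t y * (F.v t y * F.w t y + c_v * F.θ t y)) +
          M * (F.ρ y * (F.v t y ^ 3 * F.w t y))) +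
        ((F.v t y * F.vy t y + c_v * F.ϑy t y) * (F.v t y * F.G t y + F.Q t y) +
          3 * M * (F.v t y ^ 2 * (F.vy t y * F.G t y)))
      ring
  have h6 := h5.integL_eq
  have b1 := F.v_bdry t ht'
  have b2 := F.Q_bdry ht'
  have e1 : (F.e t * (F.v t * F.G t + F.Q t) + M • (F.v t ^ 3 * F.G t) : CB) 0 = 0 := by
    change F.e t 0 * (F.v t 0 * F.G t 0 + F.Q t 0) + M * (F.v t 0 ^ 3 * F.G t 0) = 0
    rw [b1.1, b2.1]; ring
  have e2 : (F.e t * (F.v t * F.G t + F.Q t) + M • (F.v t ^ 3 * F.G t) : CB) L = 0 := by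
    change F.e t L * (F.v t L * F.G t L + F.Q t L) + M * (F.v t L ^ 3 * F.G t L) = 0
    rw [b1.2, b2.2]; ring
  rw [e1, e2, sub_zero, map_add] at h6
  exact eq_neg_of_add_eq_zero_left h6

/-- The dissipation of the higher energy bounds `∫ (∂_y ϑ)² / J` up to the pressure terms, for `M` as in
the hypothesis `hM`, which makes the quadratic form in `∂_y ϑ` and `v ∂_y v` coercive. The pressure
terms are estimated by sup norms. -/
theorem integL_Z_ge {M : ℝ} (hM0 : 0 ≤ M)
    (hM : 2 * M * μ = 1 + (κ + c_v * μ) ^ 2 / (c_v * κ)) {K C₀ : ℝ} (hF : F.Controlled K) {t : ℝ}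
    (ht : t ∈ Icc 0 T) (hI : ∀ y, F.I t y ≤ C₀) :
    c_v * κ / 2 * F.D t - (c_v * R ^ 2 / κ + (1 + 9 * M) * R ^ 2 / (4 * μ)) * (2 * K * C₀) *
      (‖F.ρ * F.ϑ t‖ * ‖F.ϑ t‖) ≤ integL L (F.Z M t) := by
  have hc := F.c_pos
  have hμ := F.μ_pos
  have hκ := F.κ_pos
  set C := c_v * R ^ 2 / κ + (1 + 9 * M) * R ^ 2 / (4 * μ) with hC
  have hC0 : 0 ≤ C := by positivity
  have hC₀ : 0 ≤ C₀ := (F.I_pos ht 0).le.trans (hI 0)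
  have h := integL_mono (L := L) (g := F.Z M t) (f := (c_v * κ / 2) • (F.ϑy t ^ 2 * F.I t) -
      (C * C₀ * (‖F.ρ * F.ϑ t‖ * ‖F.ϑ t‖)) • (F.ρ * F.v t ^ 2)) fun y => by
    change c_v * κ / 2 * (F.ϑy t y ^ 2 * F.I t y) -
      C * C₀ * (‖F.ρ * F.ϑ t‖ * ‖F.ϑ t‖) * (F.ρ y * F.v t y ^ 2) ≤
      (F.v t y * F.vy t y + c_v * F.ϑy t y) *
        (F.v t y * ((μ * F.vy t y - R * (F.ρ y * F.ϑ t y)) * F.I t y) + κ * (F.ϑy t y * F.I t y)) +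
      3 * M * (F.v t y ^ 2 * (F.vy t y * ((μ * F.vy t y - R * (F.ρ y * F.ϑ t y)) * F.I t y)))
    have h1 := higher_energy_coercive (R := R) (a := F.v t y * F.vy t y) (b := F.ϑy t y)
      (p := F.ρ y * F.ϑ t y * F.v t y) hc hμ hκ hM0 hM
    have h2 := mul_le_mul_of_nonneg_right h1 (F.I_pos ht y).le
    rw [← hC] at h2
    have h3 : C * (F.ρ y * F.ϑ t y * F.v t y) ^ 2 * F.I t y ≤
        C * C₀ * (‖F.ρ * F.ϑ t‖ * ‖F.ϑ t‖) * (F.ρ y * F.v t y ^ 2) := by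
      have a1 := hI y
      have a2 : F.ρ y * F.ϑ t y ≤ ‖F.ρ * F.ϑ t‖ :=
        (le_abs_self _).trans ((F.ρ * F.ϑ t).norm_coe_le y)
      have a3 : F.ϑ t y ≤ ‖F.ϑ t‖ := (le_abs_self _).trans ((F.ϑ t).norm_coe_le y)
      have a4 := F.ρ_pos y
      have a5 := F.ϑ_nonneg t ht y
      have a6 := F.I_pos ht y
      calc _ = C * F.I t y * ((F.ρ y * F.ϑ t y) * F.ϑ t y) * (F.ρ y * F.v t y ^ 2) := by ring
        _ ≤ _ := by gcongr
    linarith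
  simp only [map_sub, map_smul, smul_eq_mul] at h
  have h1 : C * C₀ * (‖F.ρ * F.ϑ t‖ * ‖F.ϑ t‖) * integL L (F.ρ * F.v t ^ 2) ≤
      C * (2 * K * C₀) * (‖F.ρ * F.ϑ t‖ * ‖F.ϑ t‖) := by
    have h2 := F.kinetic_le ht
    have h3 := hF.energy₀_le
    calc _ ≤ C * C₀ * (‖F.ρ * F.ϑ t‖ * ‖F.ϑ t‖) * (2 * K) := by gcongr; linarith
      _ = _ := by ring
  rw [D]
  linarith

theorem integL_e₂_ge {M : ℝ} (hM0 : 0 ≤ M) {t : ℝ} (ht : t ∈ Icc 0 T) :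
    c_v ^ 2 / 2 * integL L (F.ρ * F.ϑ t ^ 2) ≤ integL L (F.e₂ M t) := by
  have h := integL_mono (L := L) (f := (c_v ^ 2 / 2) • (F.ρ * F.ϑ t ^ 2)) (g := F.e₂ M t)
    fun y => by
      change c_v ^ 2 / 2 * (F.ρ y * F.ϑ t y ^ 2) ≤
        1 / 2 * (F.ρ y * (1 / 2 * F.v t y ^ 2 + c_v * F.ϑ t y) ^ 2) + M / 4 * (F.ρ y * F.v t y ^ 4)
      have h1 := F.ρ_pos y
      have h2 := F.ϑ_nonneg t ht y
      have h3 := F.c_pos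
      have h4 : 0 ≤ M / 4 * (F.ρ y * F.v t y ^ 4) := by positivity
      have h5 : (c_v * F.ϑ t y) ^ 2 ≤ (1 / 2 * F.v t y ^ 2 + c_v * F.ϑ t y) ^ 2 := by
        gcongr; nlinarith [sq_nonneg (F.v t y)]
      have h6 := mul_le_mul_of_nonneg_left h5 h1.le
      linarith
  simpa only [map_smul, smul_eq_mul] using h

theorem integL_e₂_zero_le {M K : ℝ} (hM0 : 0 ≤ M) (hF : F.Controlled K) :
    integL L (F.e₂ M 0) ≤ ((1 + M) / 4 + c_v ^ 2) * K := by
  have h := integL_mono (L := L) (f := F.e₂ M 0)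
    (g := ((1 + M) / 4) • (F.ρ * F.v 0 ^ 4) + (c_v ^ 2) • (F.ρ * F.ϑ 0 ^ 2))
    fun y => by
      change 1 / 2 * (F.ρ y * (1 / 2 * F.v 0 y ^ 2 + c_v * F.ϑ 0 y) ^ 2) +
        M / 4 * (F.ρ y * F.v 0 y ^ 4) ≤
        (1 + M) / 4 * (F.ρ y * F.v 0 y ^ 4) + c_v ^ 2 * (F.ρ y * F.ϑ 0 y ^ 2)
      have h1 := mul_nonneg (F.ρ_pos y).le
        (sq_nonneg (1 / 2 * F.v 0 y ^ 2 - c_v * F.ϑ 0 y))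
      nlinarith
  simp only [map_add, map_smul, smul_eq_mul] at h
  have h1 := hF.v₀_le
  have h2 := hF.ϑ₀_le
  have h3 := F.c_pos
  calc _ ≤ _ := h
    _ ≤ (1 + M) / 4 * K + c_v ^ 2 * K := by gcongr
    _ = _ := by ring

end Flow

/-! ### The upper bound for the Jacobian -/

namespace Flow

theorem continuousOn_norm_J {R c_v μ κ T L : ℝ} (F : Flow R c_v μ κ T L) :
    ContinuousOn (fun t => ‖F.J t‖) (Icc 0 T) := F.J_time.continuousOn.norm

/-- The balance of the higher energy after absorption of the pressure term. -/
theorem exists_higher_energy_le (R c_v μ κ T K : ℝ) (hK : 1 ≤ K) (hc : 0 < c_v) (hμ : 0 < μ)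
    (hκ : 0 < κ) : ∃ Y C : ℝ, 0 ≤ Y ∧ 0 ≤ C ∧
      ∀ {L : ℝ} (F : Flow R c_v μ κ T L), F.Controlled K → ∀ t ∈ Icc 0 T,
        c_v ^ 2 / 2 * integL L (F.ρ * F.ϑ t ^ 2) + c_v * κ / 4 * (∫ s in (0 : ℝ)..t, F.D s) ≤
          Y + C * ∫ s in (0 : ℝ)..t, (1 + ‖F.J s‖ ^ 2) := by
  obtain ⟨C₀, hC₀, hJ⟩ := exists_J_bounds R c_v μ κ T K
  set M := (1 + (κ + c_v * μ) ^ 2 / (c_v * κ)) / (2 * μ) with hMd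
  have hM0 : 0 ≤ M := by positivity
  have hM : 2 * M * μ = 1 + (κ + c_v * μ) ^ 2 / (c_v * κ) := by rw [hMd]; field_simp
  set c₅ := (c_v * R ^ 2 / κ + (1 + 9 * M) * R ^ 2 / (4 * μ)) * (2 * K * C₀) with hc₅
  set b := 2 * ((K ^ 2 / c_v) ^ 2 + K) with hb
  have hb0 : 0 < b := by positivity
  set δ := c_v * κ / (8 * b) with hδ
  have hδ0 : 0 < δ := by positivity
  set ε := c_v * κ / 8 / (c₅ ^ 2 / (4 * δ) + 1) with hε
  have hε0 : 0 < ε := by positivity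
  have hεδ : c₅ ^ 2 / (4 * δ) * ε ≤ c_v * κ / 8 := by
    rw [hε, mul_div_assoc', div_le_iff₀ (by positivity)]
    have : 0 < c_v * κ / 8 := by positivity
    nlinarith
  obtain ⟨C₁, hC₁, hA⟩ := exists_sq_norm_ρϑ_le R c_v μ κ T K ε hK hc hε0
  refine ⟨((1 + M) / 4 + c_v ^ 2) * K, c_v * κ / 8 + c₅ ^ 2 / (4 * δ) * C₁, by positivity,
    by positivity, fun {L} F hF t ht => ?_⟩
  set C₄ := c_v * κ / 8 + c₅ ^ 2 / (4 * δ) * C₁ with hC₄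
  have hT := F.T_pos
  have key : ∀ s ∈ Icc 0 T, -integL L (F.Z M s) ≤
      C₄ * (1 + ‖F.J s‖ ^ 2) - c_v * κ / 4 * F.D s := by
    intro s hs
    have h1 := F.integL_Z_ge hM0 hM hF hs (hJ F hF s hs).1
    rw [← hc₅] at h1
    have h2 := hF.sq_norm_ϑ_le hs
    rw [← hb] at h2
    have h3 := hA F hF s hs
    set A := ‖F.ρ * F.ϑ s‖
    set B := ‖F.ϑ s‖
    have h4 : c₅ * (A * B) ≤ δ * B ^ 2 + c₅ ^ 2 / (4 * δ) * A ^ 2 := by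
      have e : δ * B ^ 2 + c₅ ^ 2 / (4 * δ) * A ^ 2 - c₅ * (A * B) =
          (2 * δ * B - c₅ * A) ^ 2 / (4 * δ) := by field_simp; ring
      have : 0 ≤ (2 * δ * B - c₅ * A) ^ 2 / (4 * δ) := by positivity
      linarith
    have h5 : δ * B ^ 2 ≤ c_v * κ / 8 * (1 + F.D s) := by
      have : δ * b = c_v * κ / 8 := by rw [hδ]; field_simp
      rw [← this, mul_assoc]
      gcongr
    have h6 : c₅ ^ 2 / (4 * δ) * A ^ 2 ≤
        c_v * κ / 8 * F.D s + c₅ ^ 2 / (4 * δ) * C₁ * (1 + ‖F.J s‖ ^ 2) := by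
      have hz : 0 ≤ c₅ ^ 2 / (4 * δ) := by positivity
      have := mul_le_mul_of_nonneg_left h3 hz
      have := mul_le_mul_of_nonneg_right hεδ (F.D_nonneg hs)
      linarith
    have h7 : 0 ≤ c_v * κ / 8 * ‖F.J s‖ ^ 2 := by positivity
    rw [hC₄]
    linarith
  have h1 := (F.integL_e₂_time M).eq_add t ht
  have hf : ContinuousOn (fun s => 1 + ‖F.J s‖ ^ 2) (Icc 0 T) :=
    continuousOn_const.add (F.continuousOn_norm_J.pow 2)
  have i1 := (isPrimitiveOn_integral_of_continuousOn hT.le hf).intble_mem F.zero_mem ht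
  have i2 := (isPrimitiveOn_integral_of_continuousOn hT.le F.continuousOn_D).intble_mem
    F.zero_mem ht
  have h2 : ∫ s in (0 : ℝ)..t, -integL L (F.Z M s) ≤
      ∫ s in (0 : ℝ)..t, (C₄ * (1 + ‖F.J s‖ ^ 2) - c_v * κ / 4 * F.D s) :=
    intervalIntegral.integral_mono_on ht.1 ((F.integL_e₂_time M).intble_mem F.zero_mem ht)
      ((i1.const_mul _).sub (i2.const_mul _)) fun s hs => key s ⟨hs.1, hs.2.trans ht.2⟩
  rw [intervalIntegral.integral_sub (i1.const_mul _) (i2.const_mul _),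
    intervalIntegral.integral_const_mul, intervalIntegral.integral_const_mul] at h2
  have h3 := F.integL_e₂_ge hM0 ht
  have h4 := F.integL_e₂_zero_le hM0 hF
  linarith

/-- The upper bound for the Jacobian. The representation bounds `‖J‖²` by the time integral of
`‖ρ ϑ‖²`, this by the dissipation and `‖J‖²`, and the dissipation by the time integral of `‖J‖²`, so
that Gronwall's inequality applies. -/
theorem exists_sq_norm_J_le (R c_v μ κ T K : ℝ) (hK : 1 ≤ K) (hc : 0 < c_v) (hμ : 0 < μ)
    (hκ : 0 < κ) (hT : 0 < T) : ∃ Γ : ℝ, 0 ≤ Γ ∧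
      ∀ {L : ℝ} (F : Flow R c_v μ κ T L), F.Controlled K → ∀ t ∈ Icc 0 T,
        1 + ‖F.J t‖ ^ 2 ≤ Γ := by
  obtain ⟨C₀, hC₀, hJ⟩ := exists_J_bounds R c_v μ κ T K
  obtain ⟨Y, C₄, hY, hC₄, hE⟩ := exists_higher_energy_le R c_v μ κ T K hK hc hμ hκ
  obtain ⟨C₁, hC₁, hA⟩ := exists_sq_norm_ρϑ_le R c_v μ κ T K 1 hK hc one_pos
  set A₀ := 1 + 2 * C₀ ^ 2 * (1 + T * (4 / (c_v * κ) * Y)) with hA₀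
  set a := 2 * C₀ ^ 2 * T * (4 / (c_v * κ) * C₄ + C₁) with ha
  refine ⟨A₀ * Real.exp (T * a), by positivity, fun {L} F hF t ht => ?_⟩
  have hf : ContinuousOn (fun s => 1 + ‖F.J s‖ ^ 2) (Icc 0 T) :=
    continuousOn_const.add (F.continuousOn_norm_J.pow 2)
  have hAc : ContinuousOn (fun s => ‖F.ρ * F.ϑ s‖) (Icc 0 T) :=
    (continuousOn_const.mul F.ϑ_time.continuousOn).norm
  have key : ∀ t ∈ Icc 0 T, 1 + ‖F.J t‖ ^ 2 ≤
      A₀ + ∫ s in (0 : ℝ)..t, a * (1 + ‖F.J s‖ ^ 2) := by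
    intro t ht
    have i1 := (isPrimitiveOn_integral_of_continuousOn hT.le hf).intble_mem F.zero_mem ht
    have i2 := (isPrimitiveOn_integral_of_continuousOn hT.le F.continuousOn_D).intble_mem
      F.zero_mem ht
    have h1 := (hJ F hF t ht).2
    have h2 := sq_intervalIntegral_le ht.1 (hAc.mono (Icc_subset_Icc_right ht.2))
    have h3 := intervalIntegral_mono_of_continuousOn ht (hAc.pow 2)
      ((continuousOn_const.mul F.continuousOn_D).add (continuousOn_const.mul hf))
      fun s hs => hA F hF s hs
    simp only [Pi.pow_apply, Pi.add_apply, Pi.mul_apply] at h3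
    rw [intervalIntegral.integral_add (i2.const_mul _) (i1.const_mul _),
      intervalIntegral.integral_const_mul, intervalIntegral.integral_const_mul, one_mul] at h3
    have h4 := hE F hF t ht
    have h5 : 0 ≤ c_v ^ 2 / 2 * integL L (F.ρ * F.ϑ t ^ 2) :=
      mul_nonneg (by positivity) (integL_nonneg fun y =>
        mul_nonneg (F.ρ_pos y).le (sq_nonneg (F.ϑ t y)))
    rw [intervalIntegral.integral_const_mul]
    set X := ∫ s in (0 : ℝ)..t, (1 + ‖F.J s‖ ^ 2)
    set W := ∫ s in (0 : ℝ)..t, F.D s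
    set V := ∫ s in (0 : ℝ)..t, ‖F.ρ * F.ϑ s‖
    set V2 := ∫ s in (0 : ℝ)..t, ‖F.ρ * F.ϑ s‖ ^ 2
    have hW : W ≤ 4 / (c_v * κ) * (Y + C₄ * X) := by
      have e : 4 / (c_v * κ) * (c_v * κ / 4 * W) = W := by field_simp
      rw [← e]
      gcongr
      linarith
    have hV2 : 0 ≤ V2 := intervalIntegral.integral_nonneg ht.1 fun s _ => sq_nonneg _
    have h6 : V ^ 2 ≤ T * (4 / (c_v * κ) * (Y + C₄ * X) + C₁ * X) := by
      calc V ^ 2 ≤ t * V2 := h2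
        _ ≤ T * V2 := by gcongr; exact ht.2
        _ ≤ _ := by gcongr; linarith
    calc 1 + ‖F.J t‖ ^ 2 ≤ 1 + (C₀ * (1 + V)) ^ 2 := by gcongr
      _ ≤ 1 + 2 * C₀ ^ 2 * (1 + V ^ 2) := by
        have : 0 ≤ C₀ ^ 2 * (1 - V) ^ 2 := by positivity
        linarith
      _ ≤ 1 + 2 * C₀ ^ 2 * (1 + T * (4 / (c_v * κ) * (Y + C₄ * X) + C₁ * X)) := by gcongr
      _ = A₀ + a * X := by rw [hA₀, ha]; ring
  have hg := gronwall_integral (b := T) (A := A₀) (f := fun s => 1 + ‖F.J s‖ ^ 2)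
    (a := fun _ => a) hT.le intervalIntegrable_const
    (Eventually.of_forall fun _ => by positivity)
    (ContinuousOn.intervalIntegrable (by
      rw [uIcc_of_le hT.le]; exact continuousOn_const.mul hf))
    (by
      filter_upwards [ae_restrict_mem measurableSet_Ioo] with s hs using
        key s (Ioo_subset_Icc_self hs)) t ht
  refine (key t ht).trans (hg.trans ?_)
  rw [intervalIntegral.integral_const, sub_zero, smul_eq_mul]
  have := ht.2
  have : 0 ≤ a := by positivity
  gcongr

/-- Bounds for the Jacobian and for the temperature in the energy space. -/
structure EnergyBounded {R c_v μ κ T L : ℝ} (F : Flow R c_v μ κ T L) (C : ℝ) : Prop where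
  one_le : 1 ≤ C
  I_le : ∀ t ∈ Icc 0 T, ∀ y, F.I t y ≤ C
  J_le : ∀ t ∈ Icc 0 T, ∀ y, F.J t y ≤ C
  ϑ_le : ∀ t ∈ Icc 0 T, integL L (F.ρ * F.ϑ t ^ 2) ≤ C
  D_int : ∫ s in (0 : ℝ)..T, F.D s ≤ C
  ϑ_int : ∫ s in (0 : ℝ)..T, ‖F.ϑ s‖ ^ 2 ≤ C

/-- The bounds for the Jacobian and the higher energy in terms of the constant of the data. -/
theorem exists_energyBounded (R c_v μ κ T K : ℝ) (hK : 1 ≤ K) (hc : 0 < c_v) (hμ : 0 < μ)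
    (hκ : 0 < κ) (hT : 0 < T) : ∃ C : ℝ,
      ∀ {L : ℝ} (F : Flow R c_v μ κ T L), F.Controlled K → F.EnergyBounded C := by
  obtain ⟨C₀, hC₀, hJ⟩ := exists_J_bounds R c_v μ κ T K
  obtain ⟨Y, C₄, hY, hC₄, hE⟩ := exists_higher_energy_le R c_v μ κ T K hK hc hμ hκ
  obtain ⟨Γ, hΓ, hN⟩ := exists_sq_norm_J_le R c_v μ κ T K hK hc hμ hκ hT
  set b := 2 * ((K ^ 2 / c_v) ^ 2 + K) with hb
  set S := Y + C₄ * (T * Γ) with hS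
  have hS0 : 0 ≤ S := by positivity
  set x := 4 / (c_v * κ) * S with hx
  have hx0 : 0 ≤ x := by positivity
  set z := 2 / c_v ^ 2 * S with hz
  have hz0 : 0 ≤ z := by positivity
  have hb0 : 0 ≤ b * (T + x) := by positivity
  refine ⟨C₀ + Γ + z + x + b * (T + x), fun {L} F hF => ?_⟩
  have hf : ContinuousOn (fun s => 1 + ‖F.J s‖ ^ 2) (Icc 0 T) :=
    continuousOn_const.add (F.continuousOn_norm_J.pow 2)
  have h1 : ∀ t ∈ Icc 0 T, ∫ s in (0 : ℝ)..t, (1 + ‖F.J s‖ ^ 2) ≤ T * Γ := by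
    intro t ht
    have h2 := intervalIntegral_mono_of_continuousOn ht hf continuousOn_const (g := fun _ => Γ)
      fun s hs => hN F hF s hs
    rw [intervalIntegral.integral_const, sub_zero, smul_eq_mul] at h2
    refine h2.trans ?_
    gcongr
    exact ht.2
  have h2 : ∀ t ∈ Icc 0 T,
      c_v ^ 2 / 2 * integL L (F.ρ * F.ϑ t ^ 2) + c_v * κ / 4 * (∫ s in (0 : ℝ)..t, F.D s) ≤ S :=
    fun t ht => (hE F hF t ht).trans (by
      rw [hS]
      have := h1 t ht
      gcongr)
  have h3 : ∀ t ∈ Icc 0 T, 0 ≤ ∫ s in (0 : ℝ)..t, F.D s := fun t ht =>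
    intervalIntegral.integral_nonneg ht.1 fun s hs => F.D_nonneg ⟨hs.1, hs.2.trans ht.2⟩
  have hTm : T ∈ Icc 0 T := ⟨hT.le, le_rfl⟩
  have hD : ∫ s in (0 : ℝ)..T, F.D s ≤ x := by
    have h5 : 0 ≤ integL L (F.ρ * F.ϑ T ^ 2) := integL_nonneg fun y =>
      mul_nonneg (F.ρ_pos y).le (sq_nonneg (F.ϑ T y))
    have h6 := h2 T hTm
    have h7 : 0 ≤ c_v ^ 2 / 2 * integL L (F.ρ * F.ϑ T ^ 2) := by positivity
    set W := ∫ s in (0 : ℝ)..T, F.D s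
    have e : 4 / (c_v * κ) * (c_v * κ / 4 * W) = W := by field_simp
    rw [← e, hx]
    gcongr
    linarith
  refine ⟨by linarith, fun t ht y => ?_, fun t ht y => ?_, fun t ht => ?_, ?_, ?_⟩
  · have := (hJ F hF t ht).1 y
    linarith
  · have h4 := (le_abs_self _).trans ((F.J t).norm_coe_le y)
    have h5 := hN F hF t ht
    nlinarith [sq_nonneg (‖F.J t‖ - 1)]
  · have h4 := h2 t ht
    have h5 := h3 t ht
    have h6 : 0 ≤ c_v * κ / 4 * ∫ s in (0 : ℝ)..t, F.D s := by positivity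
    have h7 : integL L (F.ρ * F.ϑ t ^ 2) ≤ z := by
      set W := integL L (F.ρ * F.ϑ t ^ 2)
      have e : 2 / c_v ^ 2 * (c_v ^ 2 / 2 * W) = W := by field_simp
      rw [← e, hz]
      gcongr
      linarith
    linarith
  · linarith
  · have h4 := intervalIntegral_mono_of_continuousOn hTm (F.ϑ_time.continuousOn.norm.pow 2)
      (continuousOn_const.mul (continuousOn_const.add F.continuousOn_D))
      fun s hs => hF.sq_norm_ϑ_le hs
    simp only [Pi.pow_apply, Pi.add_apply, Pi.mul_apply] at h4
    rw [← hb, intervalIntegral.integral_const_mul, intervalIntegral.integral_add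
      intervalIntegrable_const ((isPrimitiveOn_integral_of_continuousOn hT.le
        F.continuousOn_D).intble_mem F.zero_mem hTm), intervalIntegral.integral_const] at h4
    simp only [sub_zero, smul_eq_mul, mul_one] at h4
    have h5 : b * (T + ∫ s in (0 : ℝ)..T, F.D s) ≤ b * (T + x) := by
      have : 0 ≤ b := by positivity
      gcongr
    linarith

end Flow

/-! ### The effective viscous flux -/

section L2

variable {L : ℝ}

theorem mulL2_toL2 (a b : CB) : mulL2 L a (toL2 L b) = toL2 L (a * b) := by
  refine Lp.ext ?_
  filter_upwards [mulL2_coe (L := L) a (toL2 L b), toL2_coe (L := L) b,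
    toL2_coe (L := L) (a * b)] with y h1 h2 h3
  rw [h1, h2, h3]; rfl

theorem inner_toL2_toL2 (a b : CB) : inner ℝ (toL2 L a) (toL2 L b) = integL L (a * b) := by
  rw [inner_toL2, HeatNS.integL_eq]
  refine integral_congr_ae ?_
  filter_upwards [toL2_coe (L := L) b] with y h
  rw [h, mul_comm]; rfl

theorem norm_sq_toL2 (a : CB) : ‖toL2 L a‖ ^ 2 = integL L (a ^ 2) := by
  rw [← real_inner_self_eq_norm_sq, inner_toL2_toL2, pow_two]

theorem inner_mulL2_left (a : CB) (f g : L2 L) :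
    inner ℝ (mulL2 L a f) g = inner ℝ f (mulL2 L a g) := by
  rw [L2.inner_eq, L2.inner_eq]
  refine integral_congr_ae ?_
  filter_upwards [mulL2_coe a f, mulL2_coe a g] with y h1 h2
  rw [h1, h2]; ring

/-- Integration by parts against an element of `H¹`, without boundary terms. -/
theorem IsPrimitiveOn.inner_d_one (hL : 0 < L) {g h : CB} (hg : IsPrimitiveOn L g h) {f : H L 1}
    (h0 : g 0 * evL hL f 0 = 0) (h1 : g L * evL hL f L = 0) :
    inner ℝ (toL2 L g) (f.d 1) = -integL L (h * evL hL f) := by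
  have h2 := (hg.mul (evL_isPrimitiveOn hL f)).integral_Ioo
  have hi : Integrable (fun y => h y * evL hL f y) (leb L) := (h * evL hL f : CB).integrable L
  rw [h0, h1, sub_zero, integral_add hi
    (integrable_mul_of_memLp (g.memLp L) (memLp_coe (f.d 1)))] at h2
  rw [inner_toL2, HeatNS.integL_eq]
  simp only [mul_comm (f.d 1 _)]
  change _ = -∫ y in Ioo 0 L, h y * evL hL f y
  linarith

end L2

namespace Flow

variable {R c_v μ κ T L : ℝ} (F : Flow R c_v μ κ T L)

/-- The numerator of the effective viscous flux. -/
def q (t : ℝ) : CB := μ • F.vy t - R • (F.ρ * F.ϑ t)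

/-- The time derivative of the numerator of the effective viscous flux. -/
def qt (t : ℝ) : L2 L := μ • (F.vt t).d 1 - R • toL2 L (F.ρ * F.θ t)

/-- The time derivative of the effective viscous flux. -/
def Gt (t : ℝ) : L2 L := mulL2 L (F.I t) (F.qt t - toL2 L (F.vy t * F.G t))

theorem q_time : IsPrimitiveOn T (fun t => toL2 L (F.q t)) F.qt := by
  have h := (F.vy_time.const_smul μ).sub ((F.ϑ_time'.map
    ((toL2 L).comp (ContinuousLinearMap.mul ℝ CB F.ρ))).const_smul R)
  refine h.congr_left fun t _ => ?_
  change toL2 L (μ • F.vy t - R • (F.ρ * F.ϑ t)) = μ • toL2 L (F.vy t) - R • toL2 L (F.ρ * F.ϑ t)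
  rw [map_sub, map_smul, map_smul]

theorem G_time : IsPrimitiveOn T (fun t => toL2 L (F.G t)) F.Gt := by
  refine ((F.I_time.bilin (mulL2 L) F.q_time).congr_left fun t _ => ?_).congr_ae
    (Eventually.of_forall fun t => ?_)
  · rw [mulL2_toL2, mul_comm]; rfl
  · change mulL2 L (-(F.I t ^ 2 * F.vy t)) (toL2 L (F.q t)) + mulL2 L (F.I t) (F.qt t) =
      mulL2 L (F.I t) (F.qt t - toL2 L (F.vy t * F.G t))
    rw [map_sub, mulL2_toL2, mulL2_toL2]
    have e : -(F.I t ^ 2 * F.vy t) * F.q t = -(F.I t * (F.vy t * F.G t)) := by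
      change -(F.I t ^ 2 * F.vy t) * F.q t = -(F.I t * (F.vy t * (F.q t * F.I t)))
      ring
    rw [e, map_neg]
    abel

theorem continuousOn_G : ContinuousOn F.G (Icc 0 T) :=
  ((F.vy_cont.const_smul μ).sub ((continuousOn_const.mul F.ϑ_time.continuousOn).const_smul R)).mul
    F.I_time.continuousOn

theorem G_clamp {t : ℝ} (ht : t ∈ Icc 0 T) (y : ℝ) : F.G t (clamp L y) = F.G t y := by
  change (μ * F.vy t (clamp L y) - R * (F.ρ (clamp L y) * F.ϑ t (clamp L y))) *
    F.I t (clamp L y) = (μ * F.vy t y - R * (F.ρ y * F.ϑ t y)) * F.I t y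
  rw [F.vy_clamp, F.ρ_clamp, F.ϑ_clamp, F.I_clamp ht]

/-- `∫ ρ (∂_t v)²`. -/
def W (t : ℝ) : ℝ := integL L (F.ρ * F.w t ^ 2)

theorem W_nonneg (t : ℝ) : 0 ≤ F.W t :=
  integL_nonneg fun y => mul_nonneg (F.ρ_pos y).le (sq_nonneg (F.w t y))

/-- `∫ G ∂_t ∂_y v = -∫ ρ (∂_t v)²`, by parts in space and the momentum equation. -/
theorem inner_G_vt : ∀ᵐ t ∂leb T, inner ℝ (toL2 L (F.G t)) ((F.vt t).d 1) = -F.W t := by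
  filter_upwards [F.G_space, F.vt_bdry] with t h1 h2
  rw [h1.inner_d_one F.L_pos (by rw [h2.1, mul_zero]) (by rw [h2.2, mul_zero])]
  change -integL L (F.ρ * F.w t * F.w t) = -integL L (F.ρ * F.w t ^ 2)
  rw [mul_assoc, pow_two]

/-- The energy equation tested with `G`, the heat flux being integrated by parts. -/
theorem integL_G_θ : ∀ᵐ t ∂leb T, c_v * integL L (F.G t * (F.ρ * F.θ t)) =
    integL L (F.vy t * F.G t ^ 2) - integL L (F.ρ * (F.w t * F.Q t)) := by
  filter_upwards [F.G_space, F.Q_space, ae_restrict_mem measurableSet_Ioo] with t h1 h2 ht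
  have h3 : IsPrimitiveOn L (F.G t * F.Q t : CB)
    (c_v • (F.G t * (F.ρ * F.θ t)) - F.vy t * F.G t ^ 2 + F.ρ * (F.w t * F.Q t) : CB) := by
    refine (h1.mul h2).congr_ae (Eventually.of_forall fun y => ?_)
    change F.ρ y * F.w t y * F.Q t y + F.G t y * (c_v * (F.ρ y * F.θ t y) - F.vy t y * F.G t y) =
      c_v * (F.G t y * (F.ρ y * F.θ t y)) - F.vy t y * F.G t y ^ 2 + F.ρ y * (F.w t y * F.Q t y)
    ring
  have h4 := h3.integL_eq
  have b := F.Q_bdry (Ioo_subset_Icc_self ht)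
  have e1 : (F.G t * F.Q t : CB) 0 = 0 := by
    change F.G t 0 * F.Q t 0 = 0
    rw [b.1, mul_zero]
  have e2 : (F.G t * F.Q t : CB) L = 0 := by
    change F.G t L * F.Q t L = 0
    rw [b.2, mul_zero]
  rw [e1, e2, map_add, map_sub, map_smul, smul_eq_mul] at h4
  linarith

/-- The functional `½ ∫ J G²`. -/
def Φ (t : ℝ) : ℝ := 1 / 2 * integL L (F.G t * F.q t)

/-- The balance for `Φ`: testing with `G` makes `∫ ρ (∂_t v)²` appear as the dissipation. -/
theorem Φ_time : IsPrimitiveOn T F.Φ (fun t => -(μ * F.W t) +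
    R / c_v * integL L (F.ρ * (F.w t * F.Q t)) -
      (R / c_v + 1 / 2) * integL L (F.vy t * F.G t ^ 2)) := by
  have h := (F.G_time.bilin (innerSL ℝ) F.q_time).const_smul (1 / 2 : ℝ)
  refine (h.congr_left fun t _ => ?_).congr_ae ?_
  · change 1 / 2 * integL L (F.G t * F.q t) = 1 / 2 * inner ℝ (toL2 L (F.G t)) (toL2 L (F.q t))
    rw [inner_toL2_toL2]
  · filter_upwards [F.inner_G_vt, F.integL_G_θ] with t h1 h2
    change 1 / 2 * (inner ℝ (F.Gt t) (toL2 L (F.q t)) + inner ℝ (toL2 L (F.G t)) (F.qt t)) = _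
    have e1 : inner ℝ (F.Gt t) (toL2 L (F.q t)) =
        inner ℝ (toL2 L (F.G t)) (F.qt t) - integL L (F.vy t * F.G t ^ 2) := by
      rw [Gt, inner_mulL2_left, mulL2_toL2, inner_sub_left, real_inner_comm,
        inner_toL2_toL2]
      have e2 : F.I t * F.q t = F.G t := mul_comm _ _
      rw [e2, pow_two, mul_assoc]
    have e3 : inner ℝ (toL2 L (F.G t)) (F.qt t) =
        -(μ * F.W t) - R * integL L (F.G t * (F.ρ * F.θ t)) := by
      rw [qt, inner_sub_right, inner_smul_right, inner_smul_right, h1, inner_toL2_toL2]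
      ring
    have e4 : integL L (F.G t * (F.ρ * F.θ t)) =
      (integL L (F.vy t * F.G t ^ 2) - integL L (F.ρ * (F.w t * F.Q t))) / c_v := by
      rw [eq_div_iff F.c_pos.ne', ← h2, mul_comm]
    rw [e1, e3, e4]
    ring

theorem G_mul_q {t : ℝ} (y : ℝ) : (F.G t * F.q t) y = F.I t y * F.q t y ^ 2 := by
  change F.q t y * F.I t y * F.q t y = _
  ring

theorem Φ_nonneg {t : ℝ} (ht : t ∈ Icc 0 T) : 0 ≤ F.Φ t :=
  mul_nonneg (by norm_num) (integL_nonneg fun y => by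
    rw [G_mul_q]; exact mul_nonneg (F.I_pos ht y).le (sq_nonneg _))

theorem integL_kinetic_time :
    IsPrimitiveOn T (fun t => 1 / 2 * integL L (F.ρ * F.v t ^ 2))
      (fun t => -integL L (F.vy t * F.G t)) := by
  have h := (((F.v_time'.mulCB F.v_time').map (ContinuousLinearMap.mul ℝ CB F.ρ)).map
    (integL L)).const_smul (1 / 2 : ℝ)
  refine (h.congr_left fun t _ => ?_).congr_ae ?_
  · change 1 / 2 * integL L (F.ρ * F.v t ^ 2) = 1 / 2 * integL L (F.ρ * (F.v t * F.v t))
    rw [pow_two]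
  · filter_upwards [F.G_space, ae_restrict_mem measurableSet_Ioo] with t h1 ht
    have b := F.v_bdry t (Ioo_subset_Icc_self ht)
    have h2 : IsPrimitiveOn L (F.v t * F.G t : CB)
        (F.vy t * F.G t + (1 / 2 : ℝ) • (F.ρ * (F.w t * F.v t + F.v t * F.w t)) : CB) := by
      refine ((F.v_space t).mul h1).congr_ae (Eventually.of_forall fun y => ?_)
      change F.vy t y * F.G t y + F.v t y * (F.ρ y * F.w t y) =
        F.vy t y * F.G t y + 1 / 2 * (F.ρ y * (F.w t y * F.v t y + F.v t y * F.w t y))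
      ring
    have h3 := h2.integL_eq
    have e1 : (F.v t * F.G t : CB) 0 = 0 := by
      change F.v t 0 * F.G t 0 = 0
      rw [b.1, zero_mul]
    have e2 : (F.v t * F.G t : CB) L = 0 := by
      change F.v t L * F.G t L = 0
      rw [b.2, zero_mul]
    rw [e1, e2, sub_zero, map_add, map_smul] at h3
    exact eq_neg_of_add_eq_zero_right h3

variable {F} {K C : ℝ}

theorem Controlled.mass_le (hF : F.Controlled K) : integL L F.ρ ≤ K ^ 2 := by
  have h := integL_mono (L := L) (f := F.ρ) (g := K • (1 : CB)) fun y => by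
    change F.ρ y ≤ K * 1
    rw [mul_one]; exact hF.ρ_le y
  rw [map_smul, integL_one F.L_pos.le, smul_eq_mul] at h
  have := hF.one_le
  nlinarith [hF.L_le]

theorem EnergyBounded.one_le_I (hE : F.EnergyBounded C) {t : ℝ} (ht : t ∈ Icc 0 T) (y : ℝ) :
    1 ≤ C * F.I t y := by
  rw [← F.J_mul_I t ht y]
  exact mul_le_mul_of_nonneg_right (hE.J_le t ht y) (F.I_pos ht y).le

theorem integL_sq_G_le (hE : F.EnergyBounded C) {t : ℝ} (ht : t ∈ Icc 0 T) :
    integL L (F.G t ^ 2) ≤ 2 * C * F.Φ t := by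
  have h := integL_mono (L := L) (f := F.G t ^ 2) (g := C • (F.G t * F.q t)) fun y => by
    change (F.q t y * F.I t y) ^ 2 ≤ C * (F.G t * F.q t) y
    rw [G_mul_q]
    have h1 := hE.I_le t ht y
    have h2 := F.I_pos ht y
    calc _ = F.I t y * (F.I t y * F.q t y ^ 2) := by ring
      _ ≤ _ := by gcongr
  rw [map_smul, smul_eq_mul] at h
  rw [Φ]
  linarith

/-- The sup norm of the effective viscous flux. -/
theorem sq_norm_G_le (hF : F.Controlled K) (hE : F.EnergyBounded C) :
    ∀ᵐ t ∂leb T, ‖F.G t‖ ^ 2 ≤ 4 * K * C * F.Φ t + 2 * K ^ 2 * F.W t := by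
  filter_upwards [F.G_space, ae_restrict_mem measurableSet_Ioo] with t h1 ht
  have ht' := Ioo_subset_Icc_self ht
  have hK := hF.one_le
  obtain ⟨z, hz, h2⟩ := exists_mul_integL_le F.L_pos 1 (F.G t ^ 2) fun y => zero_le_one
  rw [integL_one F.L_pos.le, one_mul] at h2
  change F.G t z ^ 2 * L ≤ _ at h2
  have h3 : F.G t z ^ 2 ≤ K * (2 * C * F.Φ t) := by
    calc F.G t z ^ 2 ≤ F.G t z ^ 2 * (K * L) :=
          le_mul_of_one_le_right (sq_nonneg _) hF.one_le_mul_L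
      _ = K * (F.G t z ^ 2 * L) := by ring
      _ ≤ _ := mul_le_mul_of_nonneg_left (h2.trans (integL_sq_G_le hE ht')) (by linarith)
  have h4 : integL L (F.ρ * F.w t : CB).abs' ^ 2 ≤ K ^ 2 * F.W t := by
    have h5 := sq_integL_weight_le (L := L) 1 (F.w t).abs' F.ρ fun y => (F.ρ_pos y).le
    have e1 : F.ρ * (1 * (F.w t).abs') = (F.ρ * F.w t : CB).abs' := by
      ext y
      change F.ρ y * (1 * |F.w t y|) = |F.ρ y * F.w t y|
      rw [abs_mul, abs_of_pos (F.ρ_pos y), one_mul]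
    have e2 : F.ρ * (F.w t).abs' ^ 2 = F.ρ * F.w t ^ 2 := by
      ext y
      change F.ρ y * |F.w t y| ^ 2 = F.ρ y * F.w t y ^ 2
      rw [sq_abs]
    rw [e1, e2, one_pow, mul_one] at h5
    exact h5.trans (mul_le_mul_of_nonneg_right hF.mass_le (F.W_nonneg t))
  refine CB.sq_norm_le_of_clamp F.L_pos (F.G_clamp ht') fun y hy => ?_
  have h5 := h1.abs_sub_le_integL hz hy
  have h6 : (F.G t y - F.G t z) ^ 2 ≤ K ^ 2 * F.W t := by
    rw [← sq_abs]
    exact (pow_le_pow_left₀ (abs_nonneg _) h5 2).trans h4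
  nlinarith [sq_nonneg (F.G t y - 2 * F.G t z)]

theorem integL_sq_vy_le (hF : F.Controlled K) (hE : F.EnergyBounded C) {t : ℝ}
    (ht : t ∈ Icc 0 T) :
    μ ^ 2 * integL L (F.vy t ^ 2) ≤ 4 * C * F.Φ t + 2 * R ^ 2 * (K * C) := by
  have h := integL_mono (L := L) (f := (μ ^ 2) • F.vy t ^ 2)
    (g := (2 * C) • (F.G t * F.q t) + (2 * R ^ 2 * K) • (F.ρ * F.ϑ t ^ 2)) fun y => by
    change μ ^ 2 * F.vy t y ^ 2 ≤ 2 * C * (F.G t * F.q t) y + 2 * R ^ 2 * K * (F.ρ y * F.ϑ t y ^ 2)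
    rw [G_mul_q]
    have e : F.q t y = μ * F.vy t y - R * (F.ρ y * F.ϑ t y) := rfl
    have h1 : F.q t y ^ 2 ≤ C * F.I t y * F.q t y ^ 2 :=
      le_mul_of_one_le_left (sq_nonneg _) (hE.one_le_I ht y)
    have h2 : F.ρ y * (F.ρ y * F.ϑ t y ^ 2) ≤ K * (F.ρ y * F.ϑ t y ^ 2) :=
      mul_le_mul_of_nonneg_right (hF.ρ_le y) (mul_nonneg (F.ρ_pos y).le (sq_nonneg _))
    have h3 := mul_le_mul_of_nonneg_left h2 (sq_nonneg R)
    rw [e] at h1 ⊢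
    nlinarith [sq_nonneg (μ * F.vy t y - 2 * (R * (F.ρ y * F.ϑ t y)))]
  simp only [map_add, map_smul, smul_eq_mul] at h
  have h1 := hE.ϑ_le t ht
  have hK := hF.one_le
  have h2 : 2 * R ^ 2 * K * integL L (F.ρ * F.ϑ t ^ 2) ≤ 2 * R ^ 2 * K * C := by gcongr
  rw [Φ]
  linarith

theorem Φ_le (hF : F.Controlled K) (hE : F.EnergyBounded C) {t : ℝ} (ht : t ∈ Icc 0 T) :
    F.Φ t ≤ C * (μ ^ 2 * integL L (F.vy t ^ 2) + R ^ 2 * (K * integL L (F.ρ * F.ϑ t ^ 2))) := by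
  have hK := hF.one_le
  have hC := hE.one_le
  have h := integL_mono (L := L) (f := F.G t * F.q t)
    (g := (2 * C * μ ^ 2) • F.vy t ^ 2 + (2 * C * R ^ 2 * K) • (F.ρ * F.ϑ t ^ 2)) fun y => by
    change (F.G t * F.q t) y ≤
      2 * C * μ ^ 2 * F.vy t y ^ 2 + 2 * C * R ^ 2 * K * (F.ρ y * F.ϑ t y ^ 2)
    rw [G_mul_q]
    have e : F.q t y = μ * F.vy t y - R * (F.ρ y * F.ϑ t y) := rfl
    have h2 : F.ρ y * (F.ρ y * F.ϑ t y ^ 2) ≤ K * (F.ρ y * F.ϑ t y ^ 2) :=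
      mul_le_mul_of_nonneg_right (hF.ρ_le y) (mul_nonneg (F.ρ_pos y).le (sq_nonneg _))
    have h3 := mul_le_mul_of_nonneg_left h2 (sq_nonneg R)
    have h4 : F.q t y ^ 2 ≤ 2 * μ ^ 2 * F.vy t y ^ 2 + 2 * R ^ 2 * K * (F.ρ y * F.ϑ t y ^ 2) := by
      rw [e]
      nlinarith [sq_nonneg (μ * F.vy t y + R * (F.ρ y * F.ϑ t y))]
    calc F.I t y * F.q t y ^ 2 ≤ C * F.q t y ^ 2 :=
          mul_le_mul_of_nonneg_right (hE.I_le t ht y) (sq_nonneg _)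
      _ ≤ C * _ := mul_le_mul_of_nonneg_left h4 (by linarith)
      _ = _ := by ring
  simp only [map_add, map_smul, smul_eq_mul] at h
  rw [Φ]
  linarith

end Flow

/-! ### Bounds for the effective viscous flux -/

theorem intervalIntegral_mono_ae {b t : ℝ} (ht : t ∈ Icc 0 b) {f g : ℝ → ℝ}
    (hf : IntervalIntegrable f volume 0 b) (hg : IntervalIntegrable g volume 0 b)
    (h : ∀ᵐ s ∂leb b, f s ≤ g s) : ∫ s in (0 : ℝ)..t, f s ≤ ∫ s in (0 : ℝ)..t, g s := by
  have h0 : (0 : ℝ) ∈ Icc 0 b := ⟨le_rfl, ht.1.trans ht.2⟩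
  refine intervalIntegral.integral_mono_ae_restrict ht.1 (intervalIntegrable_of_mem hf h0 ht)
    (intervalIntegrable_of_mem hg h0 ht) ?_
  rw [← restrict_Ioo_eq_restrict_Icc]
  exact ae_restrict_of_ae_restrict_of_subset (Ioo_subset_Ioo_right ht.2) h

namespace Flow

variable {R c_v μ κ T L : ℝ} {F : Flow R c_v μ κ T L} {K C : ℝ}

theorem integL_ρ_Q_le (hF : F.Controlled K) (hE : F.EnergyBounded C) {t : ℝ} (ht : t ∈ Icc 0 T) :
    integL L (F.ρ * F.Q t ^ 2) ≤ K * κ ^ 2 * C * F.D t := by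
  have hK := hF.one_le
  have h := integL_mono (L := L) (f := F.ρ * F.Q t ^ 2)
    (g := (K * κ ^ 2 * C) • (F.ϑy t ^ 2 * F.I t)) fun y => by
    change F.ρ y * (κ * (F.ϑy t y * F.I t y)) ^ 2 ≤ K * κ ^ 2 * C * (F.ϑy t y ^ 2 * F.I t y)
    have h1 := hF.ρ_le y
    have h2 := hE.I_le t ht y
    have h3 := F.I_pos ht y
    calc _ = F.ρ y * κ ^ 2 * F.I t y * (F.ϑy t y ^ 2 * F.I t y) := by ring
      _ ≤ _ := by gcongr
  simpa only [D, map_smul, smul_eq_mul] using h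

/-- Young's inequality with the weight `ρ`. -/
theorem integL_weight_le (ρ f g : CB) (hρ : ∀ y, 0 ≤ ρ y) {η : ℝ} (hη : 0 < η) :
    integL L (ρ * (f * g)) ≤ η * integL L (ρ * f ^ 2) + 1 / (4 * η) * integL L (ρ * g ^ 2) := by
  have h := integL_mono (L := L) (f := ρ * (f * g))
    (g := η • (ρ * f ^ 2) + (1 / (4 * η)) • (ρ * g ^ 2)) fun y => by
    change ρ y * (f y * g y) ≤ η * (ρ y * f y ^ 2) + 1 / (4 * η) * (ρ y * g y ^ 2)
    have e : η * (ρ y * f y ^ 2) + 1 / (4 * η) * (ρ y * g y ^ 2) - ρ y * (f y * g y) =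
        ρ y * ((2 * η * f y - g y) ^ 2 / (4 * η)) := by field_simp; ring
    have := mul_nonneg (hρ y) (show 0 ≤ (2 * η * f y - g y) ^ 2 / (4 * η) by positivity)
    linarith
  simpa only [map_add, map_smul, smul_eq_mul] using h

/-- The cubic term in the balance for `Φ`, from below: as the pressure is nonnegative,
`μ ∂_y v ≥ J G`, so that the factor `-∂_y v` is at most `‖G‖ J / μ`. -/
theorem neg_integL_vy_G_le {t : ℝ} (ht : t ∈ Icc 0 T) :
    -integL L (F.vy t * F.G t ^ 2) ≤ 2 / μ * (‖F.G t‖ * F.Φ t) := by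
  have hμ := F.μ_pos
  have h := integL_mono (L := L) (f := -(F.vy t * F.G t ^ 2))
    (g := (‖F.G t‖ / μ) • (F.G t * F.q t)) fun y => by
    change -(F.vy t y * F.G t y ^ 2) ≤ ‖F.G t‖ / μ * (F.G t * F.q t) y
    rw [G_mul_q]
    have e1 : F.I t y * F.q t y ^ 2 = F.J t y * F.G t y ^ 2 := by
      change F.I t y * F.q t y ^ 2 = F.J t y * (F.q t y * F.I t y) ^ 2
      linear_combination (-(F.I t y * F.q t y ^ 2)) * F.J_mul_I t ht y
    have h1 := F.J_mul_G ht y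
    have h2 : 0 ≤ R * (F.ρ y * F.ϑ t y) :=
      mul_nonneg F.R_pos.le (mul_nonneg (F.ρ_pos y).le (F.ϑ_nonneg t ht y))
    have h3 : -F.G t y ≤ ‖F.G t‖ := (neg_le_abs _).trans ((F.G t).norm_coe_le y)
    have h4 : 0 ≤ F.J t y * F.G t y ^ 2 := mul_nonneg (F.J_pos t ht y).le (sq_nonneg _)
    rw [e1, div_mul_eq_mul_div, le_div_iff₀ hμ]
    calc -(F.vy t y * F.G t y ^ 2) * μ =
        -F.G t y * (F.J t y * F.G t y ^ 2) - R * (F.ρ y * F.ϑ t y) * F.G t y ^ 2 := by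
          linear_combination (F.G t y ^ 2) * h1
      _ ≤ -F.G t y * (F.J t y * F.G t y ^ 2) := by
          have := mul_nonneg h2 (sq_nonneg (F.G t y)); linarith
      _ ≤ _ := mul_le_mul_of_nonneg_right h3 h4
  rw [map_neg, map_smul, smul_eq_mul] at h
  refine h.trans (le_of_eq ?_)
  rw [Φ]
  ring

/-- The constant in the differential inequality for `Φ`. -/
def fluxConst (R c_v μ K C : ℝ) : ℝ :=
  μ * C + 8 * K ^ 2 * (R / c_v + 1 / 2) ^ 2 / μ ^ 3

theorem fluxConst_nonneg (hμ : 0 < μ) (hC : 1 ≤ C) : 0 ≤ fluxConst R c_v μ K C := by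
  rw [fluxConst]; positivity

/-- The differential inequality for `Φ`; it is quadratic in `Φ`, but `Φ` is integrable in time. -/
theorem Φ_deriv_le (hF : F.Controlled K) (hE : F.EnergyBounded C) :
    ∀ᵐ t ∂leb T, -(μ * F.W t) + R / c_v * integL L (F.ρ * (F.w t * F.Q t)) -
      (R / c_v + 1 / 2) * integL L (F.vy t * F.G t ^ 2) ≤
      (R / c_v) ^ 2 / μ * (K * κ ^ 2 * C) * F.D t +
        fluxConst R c_v μ K C * (1 + F.Φ t) * F.Φ t - μ / 2 * F.W t := by
  filter_upwards [sq_norm_G_le hF hE, ae_restrict_mem measurableSet_Ioo] with t hG ht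
  have ht' := Ioo_subset_Icc_self ht
  have hμ := F.μ_pos
  have hR := F.R_pos
  have hc := F.c_pos
  have hK := hF.one_le
  have hC := hE.one_le
  have hΦ := F.Φ_nonneg ht'
  have hW := F.W_nonneg t
  set s := R / c_v + 1 / 2 with hs
  have hs0 : 0 < s := by positivity
  set r := R / c_v with hr
  have hr0 : 0 < r := by positivity
  have h1 : r * integL L (F.ρ * (F.w t * F.Q t)) ≤
      μ / 4 * F.W t + r ^ 2 / μ * (K * κ ^ 2 * C) * F.D t := by
    have h2 := integL_weight_le (L := L) F.ρ (F.w t) (F.Q t) (fun y => (F.ρ_pos y).le)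
      (η := μ / (4 * r)) (by positivity)
    have h3 := mul_le_mul_of_nonneg_left h2 hr0.le
    have h4 := integL_ρ_Q_le hF hE ht'
    have h5 : r ^ 2 / μ * integL L (F.ρ * F.Q t ^ 2) ≤ r ^ 2 / μ * (K * κ ^ 2 * C * F.D t) := by
      gcongr
    rw [W]
    have e : r * (μ / (4 * r) * integL L (F.ρ * F.w t ^ 2) +
        1 / (4 * (μ / (4 * r))) * integL L (F.ρ * F.Q t ^ 2)) =
        μ / 4 * integL L (F.ρ * F.w t ^ 2) + r ^ 2 / μ * integL L (F.ρ * F.Q t ^ 2) := by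
      field_simp
    linarith
  have h2 : -(s * integL L (F.vy t * F.G t ^ 2)) ≤
      μ / 4 * F.W t + fluxConst R c_v μ K C * (1 + F.Φ t) * F.Φ t := by
    have h3 := mul_le_mul_of_nonneg_left (neg_integL_vy_G_le (F := F) ht') hs0.le
    set g := ‖F.G t‖
    set φ := F.Φ t
    set η := μ / (8 * K ^ 2) with hη
    have hη0 : 0 < η := by positivity
    have h4 : s * (2 / μ * (g * φ)) ≤ η * g ^ 2 + (s / μ) ^ 2 / η * φ ^ 2 := by
      have e : η * g ^ 2 + (s / μ) ^ 2 / η * φ ^ 2 - s * (2 / μ * (g * φ)) =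
          (η * g - s / μ * φ) ^ 2 / η := by field_simp; ring
      have : 0 ≤ (η * g - s / μ * φ) ^ 2 / η := by positivity
      linarith
    have h5 : η * g ^ 2 ≤ μ / 4 * F.W t + μ * C * φ := by
      have h6 := mul_le_mul_of_nonneg_left hG hη0.le
      have e : η * (4 * K * C * φ + 2 * K ^ 2 * F.W t) = μ / 4 * F.W t + μ * C * φ / (2 * K) := by
        rw [hη]; field_simp; ring
      have h7 : μ * C * φ / (2 * K) ≤ μ * C * φ := div_le_self (by positivity) (by linarith)
      linarith
    have e : (s / μ) ^ 2 / η = 8 * K ^ 2 * s ^ 2 / μ ^ 3 := by rw [hη]; field_simp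
    rw [e] at h4
    rw [fluxConst, ← hs]
    have h8 : 0 ≤ μ * C * φ ^ 2 := by positivity
    have h9 : 0 ≤ 8 * K ^ 2 * s ^ 2 / μ ^ 3 * φ := by positivity
    linarith
  linarith

/-- The initial value of `Φ` involves no derivative of order two, as `J = 1` initially. -/
theorem Φ_zero_le (hF : F.Controlled K) : F.Φ 0 ≤ (μ ^ 2 + R ^ 2 * K) * K := by
  have hK := hF.one_le
  have h := integL_mono (L := L) (f := F.G 0 * F.q 0)
    (g := (2 * μ ^ 2) • F.vy 0 ^ 2 + (2 * R ^ 2 * K) • (F.ρ * F.ϑ 0 ^ 2)) fun y => by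
    change (F.G 0 * F.q 0) y ≤ 2 * μ ^ 2 * F.vy 0 y ^ 2 + 2 * R ^ 2 * K * (F.ρ y * F.ϑ 0 y ^ 2)
    rw [G_mul_q, F.I_zero]
    change 1 * (μ * F.vy 0 y - R * (F.ρ y * F.ϑ 0 y)) ^ 2 ≤ _
    have h2 : F.ρ y * (F.ρ y * F.ϑ 0 y ^ 2) ≤ K * (F.ρ y * F.ϑ 0 y ^ 2) :=
      mul_le_mul_of_nonneg_right (hF.ρ_le y) (mul_nonneg (F.ρ_pos y).le (sq_nonneg _))
    have h3 := mul_le_mul_of_nonneg_left h2 (sq_nonneg R)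
    nlinarith [sq_nonneg (μ * F.vy 0 y + R * (F.ρ y * F.ϑ 0 y))]
  simp only [map_add, map_smul, smul_eq_mul] at h
  have h1 : 2 * μ ^ 2 * integL L (F.vy 0 ^ 2) ≤ 2 * μ ^ 2 * K := by
    have := hF.vy₀_le; gcongr
  have h2 : 2 * R ^ 2 * K * integL L (F.ρ * F.ϑ 0 ^ 2) ≤ 2 * R ^ 2 * K * K := by
    have := hF.ϑ₀_le; gcongr
  rw [Φ]
  linarith

theorem continuousOn_sq_norm_vy (F : Flow R c_v μ κ T L) :
    ContinuousOn (fun t => integL L (F.vy t ^ 2)) (Icc 0 T) :=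
  (integL L).continuous.comp_continuousOn (F.vy_cont.pow 2)

/-- The dissipation of the kinetic energy. -/
theorem integral_sq_vy_le (hF : F.Controlled K) (hE : F.EnergyBounded C) :
    ∫ s in (0 : ℝ)..T, integL L (F.vy s ^ 2) ≤
      2 * C / μ * (K + T * (R ^ 2 / (2 * μ) * (C * (K * C)))) := by
  have hμ := F.μ_pos
  have hK := hF.one_le
  have hC := hE.one_le
  have hT := F.T_pos
  have hTm : T ∈ Icc 0 T := ⟨hT.le, le_rfl⟩
  set B := R ^ 2 / (2 * μ) * (C * (K * C)) with hB
  have key : ∀ s ∈ Icc 0 T, -integL L (F.vy s * F.G s) ≤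
      B - μ / (2 * C) * integL L (F.vy s ^ 2) := by
    intro t ht
    have h := integL_mono (L := L) (f := -(F.vy t * F.G t))
      (g := (R ^ 2 / (2 * μ) * C * K) • (F.ρ * F.ϑ t ^ 2) - (μ / (2 * C)) • F.vy t ^ 2) fun y => by
      change -(F.vy t y * ((μ * F.vy t y - R * (F.ρ y * F.ϑ t y)) * F.I t y)) ≤
        R ^ 2 / (2 * μ) * C * K * (F.ρ y * F.ϑ t y ^ 2) - μ / (2 * C) * F.vy t y ^ 2
      have h1 := hE.I_le t ht y
      have h2 := hE.one_le_I ht y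
      have h3 := F.I_pos ht y
      have h4 := hF.ρ_le y
      have h5 := F.ρ_pos y
      have h6 : μ / (2 * C) * F.vy t y ^ 2 ≤ μ / 2 * F.vy t y ^ 2 * F.I t y := by
        calc _ = μ / (2 * C) * F.vy t y ^ 2 * 1 := by ring
          _ ≤ μ / (2 * C) * F.vy t y ^ 2 * (C * F.I t y) := by gcongr
          _ = _ := by field_simp
      have h7 : R ^ 2 / (2 * μ) * (F.ρ y * F.ϑ t y) ^ 2 * F.I t y ≤
          R ^ 2 / (2 * μ) * C * K * (F.ρ y * F.ϑ t y ^ 2) := by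
        calc _ = R ^ 2 / (2 * μ) * F.I t y * F.ρ y * (F.ρ y * F.ϑ t y ^ 2) := by ring
          _ ≤ _ := by gcongr
      have h8 : -(F.vy t y * ((μ * F.vy t y - R * (F.ρ y * F.ϑ t y)) * F.I t y)) ≤
          R ^ 2 / (2 * μ) * (F.ρ y * F.ϑ t y) ^ 2 * F.I t y - μ / 2 * F.vy t y ^ 2 * F.I t y := by
        have e : R ^ 2 / (2 * μ) * (F.ρ y * F.ϑ t y) ^ 2 * F.I t y -
            μ / 2 * F.vy t y ^ 2 * F.I t y +
            (F.vy t y * ((μ * F.vy t y - R * (F.ρ y * F.ϑ t y)) * F.I t y)) =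
            (μ * F.vy t y - R * (F.ρ y * F.ϑ t y)) ^ 2 / (2 * μ) * F.I t y := by
          field_simp; ring
        have : 0 ≤ (μ * F.vy t y - R * (F.ρ y * F.ϑ t y)) ^ 2 / (2 * μ) * F.I t y := by positivity
        linarith
      linarith
    simp only [map_neg, map_sub, map_smul, smul_eq_mul] at h
    have h1 : R ^ 2 / (2 * μ) * C * K * integL L (F.ρ * F.ϑ t ^ 2) ≤ B := by
      rw [hB]
      calc _ ≤ R ^ 2 / (2 * μ) * C * K * C := by have := hE.ϑ_le t ht; gcongr
        _ = _ := by ring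
    linarith
  have i2 := (isPrimitiveOn_integral_of_continuousOn hT.le F.continuousOn_sq_norm_vy).intble_mem
    F.zero_mem hTm
  have h1 := F.integL_kinetic_time.eq_add T hTm
  have h2 := intervalIntegral.integral_mono_on hT.le (F.integL_kinetic_time.intble)
    (intervalIntegrable_const.sub (i2.const_mul _)) key
  rw [intervalIntegral.integral_sub intervalIntegrable_const (i2.const_mul _),
    intervalIntegral.integral_const_mul (μ / (2 * C)), intervalIntegral.integral_const, sub_zero,
    smul_eq_mul] at h2
  have h3 := F.integL_kinetic_nonneg T
  have h4 := F.kinetic_le F.zero_mem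
  have h5 := hF.energy₀_le
  set X := ∫ s in (0 : ℝ)..T, integL L (F.vy s ^ 2)
  have e : 2 * C / μ * (μ / (2 * C) * X) = X := by field_simp
  rw [← e]
  have : 0 ≤ 2 * C / μ := by positivity
  gcongr
  linarith

/-- Bounds on the effective viscous flux. -/
structure FluxBounded {R c_v μ κ T L : ℝ} (F : Flow R c_v μ κ T L) (C : ℝ) : Prop where
  Φ_le : ∀ t ∈ Icc 0 T, F.Φ t ≤ C
  G_int : ∫ s in (0 : ℝ)..T, ‖F.G s‖ ^ 2 ≤ C

theorem memLp_w (F : Flow R c_v μ κ T L) : MemLp F.w 2 (leb T) :=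
  (evL F.L_pos).comp_memLp' F.vt_mem

theorem memLp_θ (F : Flow R c_v μ κ T L) : MemLp F.θ 2 (leb T) :=
  (evL F.L_pos).comp_memLp' F.ϑt_mem

theorem intervalIntegrable_integL_mul_sq {w : ℝ → CB} (hT : 0 ≤ T) (hw : MemLp w 2 (leb T))
    (a : CB) : IntervalIntegrable (fun t => integL L (a * w t ^ 2)) volume 0 T := by
  refine intervalIntegrable_of_integrableOn_Ioo hT ?_
  have h1 : Integrable (fun t => ‖w t‖ ^ 2) (leb T) := hw.integrable_norm_pow (by norm_num)
  refine (h1.const_mul (‖integL L‖ * ‖a‖)).mono' ?_ (Eventually.of_forall fun t => ?_)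
  · exact ((integL L).continuous.comp (continuous_const.mul (continuous_pow 2))).comp_aestronglyMeasurable
      hw.1
  · refine ((integL L).le_opNorm _).trans ?_
    rw [mul_assoc]
    gcongr
    refine (norm_mul_le _ _).trans ?_
    gcongr
    exact norm_pow_le _ _

theorem intervalIntegrable_W (F : Flow R c_v μ κ T L) : IntervalIntegrable F.W volume 0 T :=
  intervalIntegrable_integL_mul_sq F.T_pos.le F.memLp_w F.ρ

/-- Gronwall's inequality for `Φ`, and the sup norm of `G` from `∂_y G = ρ ∂_t v`. -/
theorem exists_fluxBounded (R c_v μ κ T K C : ℝ) (hK : 1 ≤ K) (hC : 1 ≤ C)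
    (hμ : 0 < μ) (hT : 0 < T) : ∃ C' : ℝ, 0 ≤ C' ∧
      ∀ {L : ℝ} (F : Flow R c_v μ κ T L), F.Controlled K → F.EnergyBounded C →
        F.FluxBounded C' := by
  set k := fluxConst R c_v μ K C with hk
  have hk0 : 0 ≤ k := fluxConst_nonneg hμ hC
  set d := (R / c_v) ^ 2 / μ * (K * κ ^ 2 * C) with hd
  have hd0 : 0 ≤ d := by positivity
  set X := 2 * C / μ * (K + T * (R ^ 2 / (2 * μ) * (C * (K * C)))) with hX
  have hX0 : 0 ≤ X := by positivity
  set P := C * (μ ^ 2 * X + R ^ 2 * (K * (T * C))) with hP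
  have hP0 : 0 ≤ P := by positivity
  set A := (μ ^ 2 + R ^ 2 * K) * K + d * C with hA
  have hA0 : 0 ≤ A := by positivity
  set Γ := A * Real.exp (k * (T + P)) with hΓ
  have hΓ0 : 0 ≤ Γ := by positivity
  set w := 2 / μ * Γ with hw
  have hw0 : 0 ≤ w := by positivity
  have hg0 : 0 ≤ 4 * K * C * P + 2 * K ^ 2 * w := by positivity
  refine ⟨Γ + w + (4 * K * C * P + 2 * K ^ 2 * w), by positivity, fun {L} F hF hE => ?_⟩
  have hTm : T ∈ Icc 0 T := ⟨hT.le, le_rfl⟩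
  have hΦc := F.Φ_time.continuousOn
  have hPhi : ∫ s in (0 : ℝ)..T, F.Φ s ≤ P := by
    have hc1 : ContinuousOn (fun s => integL L (F.ρ * F.ϑ s ^ 2)) (Icc 0 T) :=
      (integL L).continuous.comp_continuousOn
        (continuousOn_const.mul (F.ϑ_time.continuousOn.pow 2))
    have i1 := (isPrimitiveOn_integral_of_continuousOn hT.le F.continuousOn_sq_norm_vy).intble
    have h1 := intervalIntegral_mono_of_continuousOn hTm hΦc
      (g := fun s => C * μ ^ 2 * integL L (F.vy s ^ 2) + C * R ^ 2 * (K * C))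
      ((continuousOn_const.mul F.continuousOn_sq_norm_vy).add continuousOn_const)
      fun s hs => by
        refine (Φ_le hF hE hs).trans ?_
        have h2 := hE.ϑ_le s hs
        have : C * (R ^ 2 * (K * integL L (F.ρ * F.ϑ s ^ 2))) ≤ C * (R ^ 2 * (K * C)) := by gcongr
        linarith
    rw [intervalIntegral.integral_add (i1.const_mul _) intervalIntegrable_const,
      intervalIntegral.integral_const_mul, intervalIntegral.integral_const, sub_zero,
      smul_eq_mul] at h1
    have h3 := integral_sq_vy_le hF hE
    rw [← hX] at h3
    refine h1.trans ?_
    have h4 : C * μ ^ 2 * (∫ s in (0 : ℝ)..T, integL L (F.vy s ^ 2)) ≤ C * μ ^ 2 * X := by gcongr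
    rw [hP]
    linarith
  have iΦ := (isPrimitiveOn_integral_of_continuousOn hT.le hΦc).intble
  have hac : ContinuousOn (fun s => k * (1 + F.Φ s)) (Icc 0 T) :=
    continuousOn_const.mul (continuousOn_const.add hΦc)
  have haf : ContinuousOn (fun s => k * (1 + F.Φ s) * F.Φ s) (Icc 0 T) := hac.mul hΦc
  have hPaf := isPrimitiveOn_integral_of_continuousOn hT.le haf
  have hPD := isPrimitiveOn_integral_of_continuousOn hT.le F.continuousOn_D
  have hPW := isPrimitiveOn_integral hT.le F.intervalIntegrable_W
  have key : ∀ t ∈ Icc 0 T, F.Φ t + μ / 2 * (∫ s in (0 : ℝ)..t, F.W s) ≤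
      A + ∫ s in (0 : ℝ)..t, k * (1 + F.Φ s) * F.Φ s := by
    intro t ht
    have h1 := F.Φ_time.eq_add t ht
    have i1 := hPaf.intble_mem F.zero_mem ht
    have i2 := hPD.intble_mem F.zero_mem ht
    have i3 := hPW.intble_mem F.zero_mem ht
    have h3 := Φ_deriv_le hF hE
    rw [← hk, ← hd] at h3
    have h2 := intervalIntegral_mono_ae ht F.Φ_time.intble
      (((hPD.intble.const_mul d).add hPaf.intble).sub (F.intervalIntegrable_W.const_mul (μ / 2))) h3
    rw [intervalIntegral.integral_sub ((i2.const_mul d).add i1) (i3.const_mul (μ / 2)),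
      intervalIntegral.integral_add (i2.const_mul d) i1, intervalIntegral.integral_const_mul d,
      intervalIntegral.integral_const_mul] at h2
    have h6 := Φ_zero_le hF
    have h7 : ∫ s in (0 : ℝ)..t, F.D s ≤ C := by
      refine le_trans ?_ hE.D_int
      exact intervalIntegral.integral_mono_interval le_rfl ht.1 ht.2
        (by
          filter_upwards [ae_restrict_mem measurableSet_Ioc] with s hs using
            F.D_nonneg (Ioc_subset_Icc_self hs)) hPD.intble
    have h8 : d * (∫ s in (0 : ℝ)..t, F.D s) ≤ d * C := by gcongr
    rw [hA]
    linarith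
  have hWn : ∀ t ∈ Icc 0 T, 0 ≤ ∫ s in (0 : ℝ)..t, F.W s := fun t ht =>
    intervalIntegral.integral_nonneg ht.1 fun s _ => F.W_nonneg s
  have hgr : ∀ t ∈ Icc 0 T, A + ∫ s in (0 : ℝ)..t, k * (1 + F.Φ s) * F.Φ s ≤ Γ := by
    intro t ht
    have h1 := gronwall_integral (b := T) (A := A) (f := F.Φ) (a := fun s => k * (1 + F.Φ s)) hT.le
      (isPrimitiveOn_integral_of_continuousOn hT.le hac).intble
      (by
        filter_upwards [ae_restrict_mem measurableSet_Ioo] with s hs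
        have := F.Φ_nonneg (Ioo_subset_Icc_self hs)
        positivity) hPaf.intble
      (by
        filter_upwards [ae_restrict_mem measurableSet_Ioo] with s hs
        have h2 := key s (Ioo_subset_Icc_self hs)
        have h3 := hWn s (Ioo_subset_Icc_self hs)
        have h4 : 0 ≤ μ / 2 * ∫ r in (0 : ℝ)..s, F.W r := by positivity
        linarith) t ht
    refine h1.trans ?_
    rw [hΓ]
    gcongr
    have h5 : ∫ s in (0 : ℝ)..t, k * (1 + F.Φ s) ≤ ∫ s in (0 : ℝ)..T, k * (1 + F.Φ s) :=
      intervalIntegral.integral_mono_interval le_rfl ht.1 ht.2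
        (by
          filter_upwards [ae_restrict_mem measurableSet_Ioc] with s hs
          have := F.Φ_nonneg (Ioc_subset_Icc_self hs)
          change 0 ≤ k * (1 + F.Φ s)
          positivity) (isPrimitiveOn_integral_of_continuousOn hT.le hac).intble
    refine h5.trans ?_
    rw [intervalIntegral.integral_const_mul, intervalIntegral.integral_add
      intervalIntegrable_const iΦ, intervalIntegral.integral_const]
    simp only [sub_zero, smul_eq_mul, mul_one]
    gcongr
  have hW : ∫ s in (0 : ℝ)..T, F.W s ≤ w := by
    have h1 := key T hTm
    have h2 := hgr T hTm
    have h3 := F.Φ_nonneg hTm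
    set Y := ∫ s in (0 : ℝ)..T, F.W s
    have e : 2 / μ * (μ / 2 * Y) = Y := by field_simp
    rw [← e, hw]
    gcongr
    linarith
  refine ⟨fun t ht => ?_, ?_⟩
  · have h1 := key t ht
    have h2 := hgr t ht
    have h3 := hWn t ht
    have h4 : 0 ≤ μ / 2 * ∫ r in (0 : ℝ)..t, F.W r := by positivity
    linarith
  · have h1 := intervalIntegral_mono_ae hTm
      ((isPrimitiveOn_integral_of_continuousOn hT.le (F.continuousOn_G.norm.pow 2)).intble)
      ((iΦ.const_mul (4 * K * C)).add (F.intervalIntegrable_W.const_mul (2 * K ^ 2)))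
      (sq_norm_G_le hF hE)
    simp only [Pi.pow_apply] at h1
    rw [intervalIntegral.integral_add (iΦ.const_mul (4 * K * C))
      (F.intervalIntegrable_W.const_mul (2 * K ^ 2)), intervalIntegral.integral_const_mul,
      intervalIntegral.integral_const_mul] at h1
    have h2 : 4 * K * C * (∫ s in (0 : ℝ)..T, F.Φ s) ≤ 4 * K * C * P := by gcongr
    have h3 : 2 * K ^ 2 * (∫ s in (0 : ℝ)..T, F.W s) ≤ 2 * K ^ 2 * w := by gcongr
    linarith

end Flow

/-! ### Bounds independent of time derivatives -/

namespace Flow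

variable {R c_v μ κ T L : ℝ} {F : Flow R c_v μ κ T L} {K C C' : ℝ}

/-- The sup norm of `∂_y v` from `μ ∂_y v = J G + R ρ ϑ`. -/
theorem sq_norm_vy_le (hF : F.Controlled K) (hE : F.EnergyBounded C) {t : ℝ} (ht : t ∈ Icc 0 T) :
    ‖F.vy t‖ ^ 2 ≤ 2 / μ ^ 2 * (C ^ 2 * ‖F.G t‖ ^ 2 + R ^ 2 * K ^ 2 * ‖F.ϑ t‖ ^ 2) := by
  have hμ := F.μ_pos
  have hR := F.R_pos
  have hK := hF.one_le
  have hC := hE.one_le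
  refine CB.sq_norm_le_of_clamp F.L_pos (F.vy_clamp t) fun y _ => ?_
  have h1 := F.J_mul_G ht y
  have h2 := sq_le_sq' (neg_le_of_abs_le ((F.G t).norm_coe_le y))
    (le_of_abs_le ((F.G t).norm_coe_le y))
  have h3 := (le_abs_self _).trans ((F.ϑ t).norm_coe_le y)
  have h4 := F.ϑ_nonneg t ht y
  have h5 := hF.ρ_le y
  have h6 := F.ρ_pos y
  have h7 := hE.J_le t ht y
  have h8 := F.J_pos t ht y
  have h9 : (F.J t y * F.G t y) ^ 2 ≤ C ^ 2 * ‖F.G t‖ ^ 2 := by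
    rw [mul_pow]; gcongr
  have h10 : (R * (F.ρ y * F.ϑ t y)) ^ 2 ≤ R ^ 2 * K ^ 2 * ‖F.ϑ t‖ ^ 2 := by
    rw [← mul_pow, ← mul_pow, mul_assoc]; gcongr
  have e : F.vy t y = (F.J t y * F.G t y + R * (F.ρ y * F.ϑ t y)) / μ := by
    rw [h1, eq_div_iff hμ.ne']; ring
  rw [e, div_pow, div_mul_eq_mul_div]
  gcongr
  nlinarith [sq_nonneg (F.J t y * F.G t y - R * (F.ρ y * F.ϑ t y))]

/-- The derivative of the initial temperature vanishes at the end points, and is bounded in terms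
of `h0`. -/
theorem D_zero_le (hF : F.Controlled K) (hE : F.EnergyBounded C) (hG : F.FluxBounded C') :
    F.D 0 ≤ K * ((K ^ 2 + 2 * K + 2 * C * C') / (2 * κ)) ^ 2 := by
  have hκ := F.κ_pos
  have hK := hF.one_le
  have hC := hE.one_le
  have b := F.Q_bdry F.zero_mem
  have hz : (0 : ℝ) ∈ Icc 0 L := ⟨le_rfl, F.L_pos.le⟩
  set x := (K ^ 2 + 2 * K + 2 * C * C') / (2 * κ) with hx
  have hGc : integL L (F.G 0 ^ 2) ≤ 2 * C * C' := by
    refine (integL_sq_G_le hE F.zero_mem).trans ?_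
    have := hG.Φ_le 0 F.zero_mem
    gcongr
  have key : ∀ y ∈ Ioo 0 L, |F.ϑy 0 y * F.I 0 y| ≤ x := by
    intro y hy
    have h1 := F.energy_zero.abs_sub_le hz (Ioo_subset_Icc_self hy)
    change |F.Q 0 y - F.Q 0 0| ≤ ∫ s in Ioo 0 L, |Real.sqrt (F.ρ s) * F.h0 s -
      F.vy 0 s * F.G 0 s| at h1
    have i1 : Integrable (fun s => F.h0 s ^ 2) (leb L) := (memLp_coe F.h0).integrable_sq
    have i2 := (F.ρ + F.vy 0 ^ 2 + F.G 0 ^ 2 : CB).integrable L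
    have h2 : ∫ s in Ioo 0 L, |Real.sqrt (F.ρ s) * F.h0 s - F.vy 0 s * F.G 0 s| ≤
        ∫ s in Ioo 0 L, 1 / 2 * ((F.ρ + F.vy 0 ^ 2 + F.G 0 ^ 2 : CB) s + F.h0 s ^ 2) := by
      refine integral_mono_of_nonneg (Eventually.of_forall fun s => abs_nonneg _)
        ((i2.add i1).const_mul _) (Eventually.of_forall fun s => ?_)
      change |Real.sqrt (F.ρ s) * F.h0 s - F.vy 0 s * F.G 0 s| ≤
        1 / 2 * ((F.ρ s + F.vy 0 s ^ 2 + F.G 0 s ^ 2) + F.h0 s ^ 2)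
      have h3 := Real.sq_sqrt (F.ρ_pos s).le
      rw [abs_le]
      constructor <;> nlinarith [sq_nonneg (Real.sqrt (F.ρ s) + F.h0 s),
        sq_nonneg (F.vy 0 s - F.G 0 s), sq_nonneg (Real.sqrt (F.ρ s) - F.h0 s),
        sq_nonneg (F.vy 0 s + F.G 0 s)]
    rw [integral_const_mul, integral_add i2 i1, ← HeatNS.integL_eq, ← L2.norm_sq_eq, map_add,
      map_add] at h2
    have h3 := hF.mass_le
    have h4 := hF.vy₀_le
    have h5 := hF.h₀_le
    rw [b.1, sub_zero] at h1
    change |κ * (F.ϑy 0 y * F.I 0 y)| ≤ _ at h1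
    rw [abs_mul, abs_of_pos hκ] at h1
    rw [hx, le_div_iff₀ (by positivity)]
    linarith
  have h := integL_mono_on (L := L) (f := F.ϑy 0 ^ 2 * F.I 0) (g := (x ^ 2) • (1 : CB))
    fun y hy => by
    change F.ϑy 0 y ^ 2 * F.I 0 y ≤ x ^ 2 * 1
    have h1 := key y hy
    rw [F.I_zero] at h1 ⊢
    change |F.ϑy 0 y * 1| ≤ x at h1
    change F.ϑy 0 y ^ 2 * 1 ≤ x ^ 2 * 1
    rw [mul_one] at h1
    rw [mul_one, mul_one, ← sq_abs]
    gcongr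
  rw [map_smul, integL_one F.L_pos.le, smul_eq_mul] at h
  rw [D, mul_comm K]
  refine h.trans ?_
  have := hF.L_le
  gcongr

/-- The bounds on which the estimates of the time derivatives rest, in terms of a single
constant. -/
structure Tame {R c_v μ κ T L : ℝ} (F : Flow R c_v μ κ T L) (M : ℝ) : Prop where
  one_le : 1 ≤ M
  L_le : L ≤ M
  ρ_le : ∀ y, F.ρ y ≤ M
  ρ'_le : ∀ y, |F.ρ' y| ≤ M
  one_le_mul_mass : 1 ≤ M * integL L F.ρ
  I_le : ∀ t ∈ Icc 0 T, ∀ y, F.I t y ≤ M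
  J_le : ∀ t ∈ Icc 0 T, ∀ y, F.J t y ≤ M
  vy_le : ∀ t ∈ Icc 0 T, integL L (F.vy t ^ 2) ≤ M
  G_le : ∀ t ∈ Icc 0 T, integL L (F.G t ^ 2) ≤ M
  norm_ϑ_le : ∀ t ∈ Icc 0 T, ‖F.ϑ t‖ ^ 2 ≤ M * (1 + F.D t)
  norm_G_le : ∀ᵐ t ∂leb T, ‖F.G t‖ ^ 2 ≤ M * (1 + F.W t)
  norm_vy_le : ∀ t ∈ Icc 0 T, ‖F.vy t‖ ^ 2 ≤ M * (‖F.G t‖ ^ 2 + ‖F.ϑ t‖ ^ 2)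
  ϑ_int : ∫ s in (0 : ℝ)..T, ‖F.ϑ s‖ ^ 2 ≤ M
  vy_int : ∫ s in (0 : ℝ)..T, ‖F.vy s‖ ^ 2 ≤ M
  D_zero : F.D 0 ≤ M
  g₀_le : ‖F.g0‖ ^ 2 ≤ M
  h₀_le : ‖F.h0‖ ^ 2 ≤ M

/-- All bounds of `Tame` hold with a constant that depends on the data only through `Controlled`. -/
theorem exists_tame (R c_v μ κ T K : ℝ) (hK : 1 ≤ K) (hc : 0 < c_v) (hμ : 0 < μ)
    (hκ : 0 < κ) (hT : 0 < T) : ∃ M : ℝ, 1 ≤ M ∧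
      ∀ {L : ℝ} (F : Flow R c_v μ κ T L), F.Controlled K → F.Tame M := by
  obtain ⟨C₀, hE⟩ := exists_energyBounded R c_v μ κ T K hK hc hμ hκ hT
  set C := max 1 C₀ with hCd
  have hC : 1 ≤ C := le_max_left _ _
  obtain ⟨C', hC', hFl⟩ := exists_fluxBounded R c_v μ κ T K C hK hC hμ hT
  set a₁ := (4 * C * C' + 2 * R ^ 2 * (K * C)) / μ ^ 2 with ha₁
  have ha₁0 : 0 ≤ a₁ := by positivity
  set a₂ := 2 * C * C' with ha₂
  have ha₂0 : 0 ≤ a₂ := by positivity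
  set a₃ := 2 * ((K ^ 2 / c_v) ^ 2 + K) with ha₃
  have ha₃0 : 0 ≤ a₃ := by positivity
  set a₄ := 4 * K * C * C' with ha₄
  have ha₄0 : 0 ≤ a₄ := by positivity
  set a₅ := 2 / μ ^ 2 * (C ^ 2 + R ^ 2 * K ^ 2) with ha₅
  have ha₅0 : 0 ≤ a₅ := by positivity
  set a₆ := a₅ * (C' + C) with ha₆
  have ha₆0 : 0 ≤ a₆ := by positivity
  set a₇ := K * ((K ^ 2 + 2 * K + 2 * C * C') / (2 * κ)) ^ 2 with ha₇
  have ha₇0 : 0 ≤ a₇ := by positivity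
  have hK2 : 0 ≤ 2 * K ^ 2 := by positivity
  refine ⟨K + C + a₁ + a₂ + a₃ + a₄ + 2 * K ^ 2 + a₅ + a₆ + a₇, by linarith, fun {L} F hF => ?_⟩
  have hTm : T ∈ Icc 0 T := ⟨hT.le, le_rfl⟩
  have hE : F.EnergyBounded C := by
    have h := hE F hF
    have h1 : C₀ ≤ C := le_max_right _ _
    exact ⟨hC, fun t ht y => (h.I_le t ht y).trans h1, fun t ht y => (h.J_le t ht y).trans h1,
      fun t ht => (h.ϑ_le t ht).trans h1, h.D_int.trans h1, h.ϑ_int.trans h1⟩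
  have hG := hFl F hF hE
  set M := K + C + a₁ + a₂ + a₃ + a₄ + 2 * K ^ 2 + a₅ + a₆ + a₇ with hM
  have hKM : K ≤ M := by linarith
  have hCM : C ≤ M := by linarith
  have hvy : ∀ t ∈ Icc 0 T, ‖F.vy t‖ ^ 2 ≤ a₅ * (‖F.G t‖ ^ 2 + ‖F.ϑ t‖ ^ 2) := fun t ht => by
    refine (sq_norm_vy_le hF hE ht).trans ?_
    have h0 : 0 ≤ 2 / μ ^ 2 := by positivity
    have h1 : 0 ≤ C ^ 2 * ‖F.ϑ t‖ ^ 2 := by positivity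
    have h2 : 0 ≤ R ^ 2 * K ^ 2 * ‖F.G t‖ ^ 2 := by positivity
    have h3 := mul_nonneg h0 h1
    have h4 := mul_nonneg h0 h2
    rw [ha₅]
    linarith
  refine
    { one_le := by linarith
      L_le := hF.L_le.trans hKM
      ρ_le := fun y => (hF.ρ_le y).trans hKM
      ρ'_le := fun y => (hF.ρ'_le y).trans hKM
      one_le_mul_mass := hF.one_le_mul_mass.trans (mul_le_mul_of_nonneg_right hKM
        (integL_nonneg fun y => (F.ρ_pos y).le))
      I_le := fun t ht y => (hE.I_le t ht y).trans hCM
      J_le := fun t ht y => (hE.J_le t ht y).trans hCM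
      vy_le := fun t ht => ?_
      G_le := fun t ht => ?_
      norm_ϑ_le := fun t ht => (hF.sq_norm_ϑ_le ht).trans
        (mul_le_mul_of_nonneg_right (by linarith) (by linarith [F.D_nonneg ht]))
      norm_G_le := ?_
      norm_vy_le := fun t ht => (hvy t ht).trans
        (mul_le_mul_of_nonneg_right (by linarith) (by positivity))
      ϑ_int := hE.ϑ_int.trans hCM
      vy_int := ?_
      D_zero := (D_zero_le hF hE hG).trans (by linarith)
      g₀_le := hF.g₀_le.trans hKM
      h₀_le := hF.h₀_le.trans hKM }
  · have h1 := integL_sq_vy_le hF hE ht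
    have h2 := hG.Φ_le t ht
    have h3 : integL L (F.vy t ^ 2) ≤ a₁ := by
      rw [ha₁, le_div_iff₀ (by positivity), mul_comm]
      have : 4 * C * F.Φ t ≤ 4 * C * C' := by gcongr
      linarith
    linarith
  · have h1 := integL_sq_G_le hE ht
    have h2 := hG.Φ_le t ht
    have h3 : 2 * C * F.Φ t ≤ 2 * C * C' := by gcongr
    linarith
  · filter_upwards [sq_norm_G_le hF hE, ae_restrict_mem measurableSet_Ioo] with t h1 ht
    have h2 := hG.Φ_le t (Ioo_subset_Icc_self ht)
    have h3 : 4 * K * C * F.Φ t ≤ a₄ := by rw [ha₄]; gcongr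
    have h4 := F.W_nonneg t
    have h5 : (2 * K ^ 2) * F.W t ≤ M * F.W t := by gcongr; linarith
    linarith
  · have i1 : IntervalIntegrable (fun s => ‖F.G s‖ ^ 2) volume 0 T :=
      (isPrimitiveOn_integral_of_continuousOn hT.le (F.continuousOn_G.norm.pow 2)).intble
    have i2 : IntervalIntegrable (fun s => ‖F.ϑ s‖ ^ 2) volume 0 T := (isPrimitiveOn_integral_of_continuousOn hT.le
      (F.ϑ_time.continuousOn.norm.pow 2)).intble
    have h1 := intervalIntegral_mono_of_continuousOn hTm (F.vy_cont.norm.pow 2)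
      (continuousOn_const.mul ((F.continuousOn_G.norm.pow 2).add
        (F.ϑ_time.continuousOn.norm.pow 2))) hvy
    simp only [Pi.pow_apply, Pi.add_apply, Pi.mul_apply] at h1
    rw [intervalIntegral.integral_const_mul, intervalIntegral.integral_add i1 i2] at h1
    have h2 : a₅ * ((∫ s in (0 : ℝ)..T, ‖F.G s‖ ^ 2) + ∫ s in (0 : ℝ)..T, ‖F.ϑ s‖ ^ 2) ≤ a₆ := by
      rw [ha₆]
      have := hG.G_int
      have := hE.ϑ_int
      gcongr
    linarith

end Flow

/-! ### The energy inequality for the rate of the velocity -/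

section Bilinear

variable {L T : ℝ}

theorem memLp_bilin {E F G : Type*} [NormedAddCommGroup E] [NormedSpace ℝ E]
    [NormedAddCommGroup F] [NormedSpace ℝ F] [NormedAddCommGroup G] [NormedSpace ℝ G]
    (B : E →L[ℝ] F →L[ℝ] G) {u : ℝ → E} {w : ℝ → F} (hu : ContinuousOn u (Icc 0 T))
    (hw : MemLp w 2 (leb T)) : MemLp (fun t => B (u t) (w t)) 2 (leb T) := by
  obtain ⟨M, hM⟩ := isCompact_Icc.exists_bound_of_continuousOn hu
  have hum : AEStronglyMeasurable u (leb T) :=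
    (hu.aestronglyMeasurable_of_isCompact isCompact_Icc measurableSet_Icc).mono_measure
      (Measure.restrict_mono Ioo_subset_Icc_self le_rfl)
  refine hw.of_le_mul (c := ‖B‖ * M) (B.aestronglyMeasurable_comp₂ hum hw.1) ?_
  filter_upwards [ae_restrict_mem measurableSet_Ioo] with t ht
  refine (B.le_opNorm₂ _ _).trans ?_
  have := hM t (Ioo_subset_Icc_self ht)
  gcongr

theorem MemLp.map_clm {α E G : Type*} [NormedAddCommGroup E] [NormedSpace ℝ E]
    [NormedAddCommGroup G] [NormedSpace ℝ G] {m : MeasurableSpace α} {ν : Measure α} (A : E →L[ℝ] G)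
    {w : α → E} (hw : MemLp w 2 ν) : MemLp (fun t => A (w t)) 2 ν := A.comp_memLp' hw

/-- Pairing with the derivative of an element of `H¹`. -/
def pairD (L : ℝ) : L2 L →L[ℝ] (H L 1 →L[ℝ] ℝ) :=
  (ContinuousLinearMap.precomp ℝ (dL L 1 1) : (L2 L →L[ℝ] ℝ) →L[ℝ] (H L 1 →L[ℝ] ℝ)).comp
    (innerSL ℝ : L2 L →L[ℝ] (L2 L →L[ℝ] ℝ))

theorem mul_sq_norm_le_inner_mulL2 {a : CB} {m : ℝ} (ha : ∀ y, m ≤ a y) (f : L2 L) :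
    m * ‖f‖ ^ 2 ≤ inner ℝ f (mulL2 L a f) := by
  rw [L2.norm_sq_eq, L2.inner_eq, ← integral_const_mul]
  refine integral_mono_ae ((memLp_coe f).integrable_sq.const_mul _)
    (integrable_mul_of_memLp (memLp_coe f) (memLp_coe _)) ?_
  filter_upwards [mulL2_coe a f] with y h
  rw [h]
  nlinarith [mul_le_mul_of_nonneg_right (ha y) (sq_nonneg (f y))]

theorem sq_norm_mulL2_le {a : CB} {M : ℝ} (ha : ∀ y, |a y| ≤ M) (f : L2 L) :
    ‖mulL2 L a f‖ ^ 2 ≤ M ^ 2 * ‖f‖ ^ 2 := by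
  rw [L2.norm_sq_eq, L2.norm_sq_eq, ← integral_const_mul]
  refine integral_mono_ae (memLp_coe _).integrable_sq
    ((memLp_coe f).integrable_sq.const_mul _) ?_
  filter_upwards [mulL2_coe a f] with y h
  rw [h, mul_pow, ← sq_abs (a y)]
  have := ha y
  gcongr

/-- Young's inequality for the inner product of `L²`. -/
theorem inner_le_young (f g : L2 L) {η : ℝ} (hη : 0 < η) :
    inner ℝ f g ≤ η * ‖f‖ ^ 2 + 1 / (4 * η) * ‖g‖ ^ 2 := by
  have h := real_inner_le_norm f g
  have e : η * ‖f‖ ^ 2 + 1 / (4 * η) * ‖g‖ ^ 2 - ‖f‖ * ‖g‖ =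
      (2 * η * ‖f‖ - ‖g‖) ^ 2 / (4 * η) := by field_simp; ring
  have : 0 ≤ (2 * η * ‖f‖ - ‖g‖) ^ 2 / (4 * η) := by positivity
  linarith

theorem CB.exists_sqrt (ρ : CB) : ∃ r : CB, ∀ y, r y = Real.sqrt (ρ y) :=
  ⟨BoundedContinuousFunction.ofNormedAddCommGroup (fun y => Real.sqrt (ρ y)) ρ.continuous.sqrt
    (Real.sqrt ‖ρ‖) fun y => by
      rw [Real.norm_of_nonneg (Real.sqrt_nonneg _)]
      exact Real.sqrt_le_sqrt ((le_abs_self _).trans (ρ.norm_coe_le y)), fun _ => rfl⟩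

theorem le_on_Icc_of_ae_le (hT : 0 < T) {f g : ℝ → ℝ} (hf : ContinuousOn f (Icc 0 T))
    (hg : ContinuousOn g (Icc 0 T)) (h : ∀ᵐ t ∂leb T, f t ≤ g t) : ∀ t ∈ Icc 0 T, f t ≤ g t := by
  have h1 : EqOn f (fun t => min (f t) (g t)) (Icc 0 T) :=
    eqOn_Icc_of_ae_eq hT hf (hf.inf hg) (by
      filter_upwards [h] with t ht
      exact (min_eq_left ht).symm)
  intro t ht
  rw [h1 ht]
  exact min_le_right _ _

end Bilinear

namespace Flow

variable {R c_v μ κ T L : ℝ} (F : Flow R c_v μ κ T L)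

theorem memLp_qt : MemLp F.qt 2 (leb T) := by
  have h1 : MemLp (fun t => (F.vt t).d 1) 2 (leb T) := (dL L 1 1).comp_memLp' F.vt_mem
  have h2 : MemLp (fun t => toL2 L (F.ρ * F.θ t)) 2 (leb T) :=
    ((toL2 L).comp (ContinuousLinearMap.mul ℝ CB F.ρ)).comp_memLp' F.memLp_θ
  exact (h1.const_smul μ).sub (h2.const_smul R)

theorem memLp_of_continuousOn {E : Type*} [NormedAddCommGroup E] {u : ℝ → E}
    (hu : ContinuousOn u (Icc 0 T)) : MemLp u 2 (leb T) := by
  obtain ⟨M, hM⟩ := isCompact_Icc.exists_bound_of_continuousOn hu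
  refine MemLp.of_bound ((hu.aestronglyMeasurable_of_isCompact isCompact_Icc
    measurableSet_Icc).mono_measure (Measure.restrict_mono Ioo_subset_Icc_self le_rfl)) M ?_
  filter_upwards [ae_restrict_mem measurableSet_Ioo] with t ht using hM t (Ioo_subset_Icc_self ht)

theorem memLp_Gt : MemLp F.Gt 2 (leb T) :=
  memLp_bilin (mulL2 L) F.I_time.continuousOn (F.memLp_qt.sub (memLp_of_continuousOn
    ((toL2 L).continuous.comp_continuousOn (F.vy_cont.mul F.continuousOn_G))))

/-- The energy inequality for `∂_t v`. The momentum equation identifies `U(t) = -∂_y G(t)`, tested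
with `∂_t v(t)`, with the weighted product of `∂_t v`, so that differences of `U` control
differences of `∫ ρ (∂_t v)²`. -/
theorem W_le : ∀ᵐ t ∂leb T, F.W t ≤ ‖F.g0‖ ^ 2 +
    2 * ∫ s in (0 : ℝ)..t, -inner ℝ (F.Gt s) ((F.vt s).d 1) := by
  have hU : IsPrimitiveOn T (fun t => -pairD L (toL2 L (F.G t))) (fun t => -pairD L (F.Gt t)) := by
    have h := IsPrimitiveOn.map (F := H L 1 →L[ℝ] ℝ) (pairD L) F.G_time
    exact h.neg
  have hU2 : MemLp (fun t => -pairD L (F.Gt t)) 2 (leb T) := by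
    have h := MemLp.map_clm (G := H L 1 →L[ℝ] ℝ) (pairD L) F.memLp_Gt
    exact h.neg
  have key : ∀ t, IsPrimitiveOn L (F.G t) (F.ρ * F.w t : CB) → ∀ φ : H L 1,
      evL F.L_pos φ 0 = 0 ∧ evL F.L_pos φ L = 0 →
      (-pairD L (toL2 L (F.G t))) φ = integL L (F.ρ * (F.w t * evL F.L_pos φ)) := by
    intro t ht φ hφ
    change -inner ℝ (toL2 L (F.G t)) (φ.d 1) = _
    rw [ht.inner_d_one F.L_pos (by rw [hφ.1, mul_zero]) (by rw [hφ.2, mul_zero]), neg_neg,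
      mul_assoc]
  refine (energy_inequality_of_difference F.T_pos hU hU2 F.vt_mem
    (f := F.W) (f0 := ‖F.g0‖ ^ 2) ?_ (g := {t | IsPrimitiveOn L (F.G t) (F.ρ * F.w t : CB) ∧
      evL F.L_pos (F.vt t) 0 = 0 ∧ evL F.L_pos (F.vt t) L = 0}) ?_ ?_ ?_).mono fun t ht => ht
  · have := F.intervalIntegrable_W
    rw [intervalIntegrable_iff, uIoc_of_le F.T_pos.le] at this
    exact this.mono_set Ioo_subset_Ioc_self
  · filter_upwards [F.G_space, F.vt_bdry] with t h1 h2 using ⟨h1, h2⟩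
  · intro t ht _
    rw [sub_apply, key t ht.1 _ ht.2]
    obtain ⟨r, hr⟩ := CB.exists_sqrt F.ρ
    have hP := F.momentum_zero.mul (evL_isPrimitiveOn F.L_pos (F.vt t))
    have h1 := hP.integral_Ioo
    have i1 : Integrable (fun y => Real.sqrt (F.ρ y) * F.g0 y * evL F.L_pos (F.vt t) y)
        (leb L) := by
      refine (integrable_mul_of_memLp ((r * F.w t).memLp L) (memLp_coe F.g0)).congr
        (Eventually.of_forall fun y => ?_)
      change r y * F.w t y * F.g0 y = Real.sqrt (F.ρ y) * F.g0 y * F.w t y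
      rw [hr]; ring
    have i2 : Integrable (fun y => F.G 0 y * (F.vt t).d 1 y) (leb L) :=
      integrable_mul_of_memLp ((F.G 0).memLp L) (memLp_coe _)
    rw [ht.2.1, ht.2.2, mul_zero, mul_zero, sub_zero] at h1
    have h2 : inner ℝ (toL2 L (r * F.w t)) F.g0 + inner ℝ (toL2 L (F.G 0)) ((F.vt t).d 1) = 0 := by
      refine Eq.trans ?_ h1
      rw [inner_toL2, inner_toL2, ← integral_add ?_ ?_]
      · refine integral_congr_ae (Eventually.of_forall fun y => ?_)
        change F.g0 y * (r y * F.w t y) + (F.vt t).d 1 y * F.G 0 y =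
          Real.sqrt (F.ρ y) * F.g0 y * F.w t y + F.G 0 y * (F.vt t).d 1 y
        rw [hr]; ring
      · exact integrable_mul_of_memLp (memLp_coe F.g0) ((r * F.w t).memLp L)
      · exact integrable_mul_of_memLp (memLp_coe _) ((F.G 0).memLp L)
    have h3 : ‖toL2 L (r * F.w t)‖ ^ 2 = F.W t := by
      rw [norm_sq_toL2, W]
      congr 1
      ext y
      change (r y * F.w t y) ^ 2 = F.ρ y * F.w t y ^ 2
      rw [hr, mul_pow, Real.sq_sqrt (F.ρ_pos y).le]
    have h4 := norm_sub_sq_real (toL2 L (r * F.w t)) F.g0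
    have h5 := sq_nonneg ‖toL2 L (r * F.w t) - F.g0‖
    have h6 : integL L (F.ρ * (F.w t * evL F.L_pos (F.vt t))) = F.W t := by
      change integL L (F.ρ * (F.w t * F.w t)) = _
      rw [W, pow_two]
    change F.W t - ‖F.g0‖ ^ 2 ≤ 2 * (_ - -inner ℝ (toL2 L (F.G 0)) ((F.vt t).d 1))
    rw [h6]
    linarith
  · intro t ht _ s hs _ _
    rw [sub_apply, key t ht.1 _ ht.2, key s hs.1 _ ht.2, ← map_sub, ← smul_eq_mul, ← map_smul, W, W,
      ← map_sub]
    refine integL_mono fun y => ?_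
    change F.ρ y * F.w t y ^ 2 - F.ρ y * F.w s y ^ 2 ≤
      2 * (F.ρ y * (F.w t y * F.w t y) - F.ρ y * (F.w s y * F.w t y))
    nlinarith [mul_nonneg (F.ρ_pos y).le (sq_nonneg (F.w t y - F.w s y))]

end Flow

/-! ### The rate of the temperature, by parts in time -/

namespace Flow

variable {R c_v μ κ T L : ℝ} (F : Flow R c_v μ κ T L)

/-- `∫ (∂_t ∂_y v)²`. -/
def V (t : ℝ) : ℝ := ‖(F.vt t).d 1‖ ^ 2

/-- `∫ ρ (∂_t ϑ)²`. -/
def Θ (t : ℝ) : ℝ := integL L (F.ρ * F.θ t ^ 2)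

theorem V_nonneg (t : ℝ) : 0 ≤ F.V t := sq_nonneg _

theorem Θ_nonneg (t : ℝ) : 0 ≤ F.Θ t :=
  integL_nonneg fun y => mul_nonneg (F.ρ_pos y).le (sq_nonneg (F.θ t y))

theorem intervalIntegrable_Θ : IntervalIntegrable F.Θ volume 0 T :=
  intervalIntegrable_integL_mul_sq F.T_pos.le F.memLp_θ F.ρ

theorem intervalIntegrable_sq_norm {E : Type*} [NormedAddCommGroup E] (hT : 0 ≤ T) {w : ℝ → E}
    (hw : MemLp w 2 (leb T)) : IntervalIntegrable (fun t => ‖w t‖ ^ 2) volume 0 T :=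
  intervalIntegrable_of_integrableOn_Ioo hT (hw.integrable_norm_pow (by norm_num))

theorem intervalIntegrable_V : IntervalIntegrable F.V volume 0 T :=
  intervalIntegrable_sq_norm F.T_pos.le ((dL L 1 1).comp_memLp' F.vt_mem)

/-- Time derivative of `(κ/2) ∫ (∂_y ϑ)² / J`. -/
theorem heat_dissipation_time :
    IsPrimitiveOn T (fun t => κ / 2 * F.D t) (fun t => -(c_v * F.Θ t) +
      integL L (F.vy t * (F.G t * F.θ t)) -
      κ / 2 * integL L (F.ϑy t ^ 2 * (F.I t ^ 2 * F.vy t))) := by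
  have h1 := F.I_time.bilin (mulL2 L) F.ϑy_time
  have h2 := (h1.bilin (innerSL ℝ) F.ϑy_time).const_smul (κ / 2)
  refine (h2.congr_left fun t _ => ?_).congr_ae ?_
  · change κ / 2 * integL L (F.ϑy t ^ 2 * F.I t) =
      κ / 2 * inner ℝ (mulL2 L (F.I t) (toL2 L (F.ϑy t))) (toL2 L (F.ϑy t))
    rw [mulL2_toL2, inner_toL2_toL2]
    congr 2
    ring
  · filter_upwards [F.Q_space, ae_restrict_mem measurableSet_Ioo] with t hQ ht
    have b := F.Q_bdry (Ioo_subset_Icc_self ht)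
    have h3 := hQ.inner_d_one F.L_pos (f := F.ϑt t) (by rw [b.1, zero_mul]) (by rw [b.2, zero_mul])
    have e1 : toL2 L (F.Q t) = κ • toL2 L (F.I t * F.ϑy t) := by
      rw [← map_smul, mul_comm]; rfl
    rw [e1, inner_smul_left] at h3
    have e2 : (c_v • (F.ρ * F.θ t) - F.vy t * F.G t) * evL F.L_pos (F.ϑt t) =
        c_v • (F.ρ * F.θ t ^ 2) - F.vy t * (F.G t * F.θ t) := by
      ext y
      change (c_v * (F.ρ y * F.θ t y) - F.vy t y * F.G t y) * F.θ t y =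
        c_v * (F.ρ y * F.θ t y ^ 2) - F.vy t y * (F.G t y * F.θ t y)
      ring
    rw [e2, map_sub, map_smul, smul_eq_mul] at h3
    change κ / 2 * (inner ℝ (mulL2 L (-(F.I t ^ 2 * F.vy t)) (toL2 L (F.ϑy t)) +
      mulL2 L (F.I t) ((F.ϑt t).d 1)) (toL2 L (F.ϑy t)) +
      inner ℝ (mulL2 L (F.I t) (toL2 L (F.ϑy t))) ((F.ϑt t).d 1)) = _
    rw [inner_add_left, inner_mulL2_left (F.I t) ((F.ϑt t).d 1), real_inner_comm _ ((F.ϑt t).d 1),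
      mulL2_toL2, mulL2_toL2, inner_toL2_toL2]
    have e3 : -(F.I t ^ 2 * F.vy t) * F.ϑy t * F.ϑy t =
        -(F.ϑy t ^ 2 * (F.I t ^ 2 * F.vy t)) := by ring
    rw [e3, map_neg, Θ]
    simp only [conj_trivial] at h3
    linarith

/-- The work of the effective viscous flux, weighted by the temperature. -/
def work (t : ℝ) : ℝ := integL L (F.vy t * (F.G t * F.ϑ t))

/-- The product rule for `work`, where `∂_t ∂_y v` and `∂_t G` are only square integrable. -/
theorem work_time : IsPrimitiveOn T F.work (fun t =>
    inner ℝ ((F.vt t).d 1) (toL2 L (F.ϑ t * F.G t)) + (integL L (F.vy t * (F.G t * F.θ t)) +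
      inner ℝ (toL2 L (F.vy t * F.ϑ t)) (F.Gt t))) := by
  have h1 := F.ϑ_time'.bilin (mulL2 L) F.G_time
  refine ((F.vy_time.bilin (innerSL ℝ) h1).congr_left fun t _ => ?_).congr_ae
    (Eventually.of_forall fun t => ?_)
  · change integL L (F.vy t * (F.G t * F.ϑ t)) =
      inner ℝ (toL2 L (F.vy t)) (mulL2 L (F.ϑ t) (toL2 L (F.G t)))
    rw [mulL2_toL2, inner_toL2_toL2, mul_comm (F.G t)]
  · change inner ℝ ((F.vt t).d 1) (mulL2 L (F.ϑ t) (toL2 L (F.G t))) +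
      inner ℝ (toL2 L (F.vy t)) (mulL2 L (F.θ t) (toL2 L (F.G t)) + mulL2 L (F.ϑ t) (F.Gt t)) = _
    rw [inner_add_right, mulL2_toL2, mulL2_toL2, inner_toL2_toL2, ← inner_mulL2_left, mulL2_toL2,
      mul_comm (F.θ t), mul_comm (F.ϑ t) (F.vy t)]

/-- The functional `(κ/2) ∫ (∂_y ϑ)² / J - ∫ ∂_y v G ϑ`. -/
def Ψ (t : ℝ) : ℝ := κ / 2 * F.D t - F.work t

/-- The balance for `Ψ`. The term `∫ ∂_y v G ∂_t ϑ` of the heat equation tested with `∂_t ϑ` cancels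
against the derivative of `work`, which is why `work` is subtracted. -/
theorem Ψ_time : IsPrimitiveOn T F.Ψ (fun t => -(c_v * F.Θ t) -
    κ / 2 * integL L (F.ϑy t ^ 2 * (F.I t ^ 2 * F.vy t)) -
    inner ℝ ((F.vt t).d 1) (toL2 L (F.ϑ t * F.G t)) -
    inner ℝ (toL2 L (F.vy t * F.ϑ t)) (F.Gt t)) := by
  refine (F.heat_dissipation_time.sub F.work_time).congr_ae (Eventually.of_forall fun t => ?_)
  change -(c_v * F.Θ t) + integL L (F.vy t * (F.G t * F.θ t)) -
      κ / 2 * integL L (F.ϑy t ^ 2 * (F.I t ^ 2 * F.vy t)) -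
    (inner ℝ ((F.vt t).d 1) (toL2 L (F.ϑ t * F.G t)) + (integL L (F.vy t * (F.G t * F.θ t)) +
      inner ℝ (toL2 L (F.vy t * F.ϑ t)) (F.Gt t))) = _
  ring

variable {F} {M : ℝ}

theorem integL_mul_sq_le {a b : CB} {x : ℝ} (ha : ‖a‖ ^ 2 ≤ x) :
    integL L ((a * b) ^ 2) ≤ x * integL L (b ^ 2) := by
  have h := integL_mono (L := L) (f := (a * b) ^ 2) (g := x • b ^ 2) fun y => by
    change (a y * b y) ^ 2 ≤ x * b y ^ 2
    rw [mul_pow]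
    have h1 : a y ^ 2 ≤ ‖a‖ ^ 2 := by
      rw [← sq_abs]
      have := a.norm_coe_le y
      gcongr
    exact mul_le_mul_of_nonneg_right (h1.trans ha) (sq_nonneg _)
  simpa only [map_smul, smul_eq_mul] using h

theorem integL_ρ_θ_le (hM : F.Tame M) (t : ℝ) : integL L ((F.ρ * F.θ t) ^ 2) ≤ M * F.Θ t := by
  have h := integL_mono (L := L) (f := (F.ρ * F.θ t) ^ 2) (g := M • (F.ρ * F.θ t ^ 2)) fun y => by
    change (F.ρ y * F.θ t y) ^ 2 ≤ M * (F.ρ y * F.θ t y ^ 2)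
    have h1 := hM.ρ_le y
    have h2 := F.ρ_pos y
    calc _ = F.ρ y * (F.ρ y * F.θ t y ^ 2) := by ring
      _ ≤ _ := by gcongr
  simpa only [Θ, map_smul, smul_eq_mul] using h

theorem integL_vy_G_le (hM : F.Tame M) {t : ℝ} (ht : t ∈ Icc 0 T) :
    integL L ((F.vy t * F.G t) ^ 2) ≤ M * ‖F.vy t‖ ^ 2 := by
  refine (integL_mul_sq_le le_rfl).trans ?_
  rw [mul_comm]
  exact mul_le_mul_of_nonneg_right (hM.G_le t ht) (sq_nonneg _)

theorem sq_norm_pressure_rate_le (hM : F.Tame M) {t : ℝ} (ht : t ∈ Icc 0 T) :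
    ‖R • toL2 L (F.ρ * F.θ t) + toL2 L (F.vy t * F.G t)‖ ^ 2 ≤
      2 * R ^ 2 * M * F.Θ t + 2 * M * ‖F.vy t‖ ^ 2 := by
  have h1 := integL_ρ_θ_le hM t
  have h2 := integL_vy_G_le hM ht
  rw [← norm_sq_toL2] at h1 h2
  have h3 := parallelogram_law_with_norm ℝ (R • toL2 L (F.ρ * F.θ t)) (toL2 L (F.vy t * F.G t))
  have h4 := sq_nonneg ‖R • toL2 L (F.ρ * F.θ t) - toL2 L (F.vy t * F.G t)‖
  have h5 : ‖R • toL2 L (F.ρ * F.θ t)‖ ^ 2 = R ^ 2 * ‖toL2 L (F.ρ * F.θ t)‖ ^ 2 := by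
    rw [norm_smul, mul_pow, Real.norm_eq_abs, sq_abs]
  have h6 := mul_le_mul_of_nonneg_left h1 (sq_nonneg R)
  nlinarith

theorem Gt_eq (t : ℝ) : F.Gt t = mulL2 L (F.I t) (μ • (F.vt t).d 1 -
    (R • toL2 L (F.ρ * F.θ t) + toL2 L (F.vy t * F.G t))) := by
  rw [Gt, qt, sub_sub]

/-- Viscosity in the energy inequality for `∂_t v`. -/
theorem neg_inner_Gt_le (hM : F.Tame M) {t : ℝ} (ht : t ∈ Icc 0 T) :
    2 * -inner ℝ (F.Gt t) ((F.vt t).d 1) ≤ -(μ / M * F.V t) +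
      2 * M ^ 4 * R ^ 2 / μ * F.Θ t + 2 * M ^ 4 / μ * ‖F.vy t‖ ^ 2 := by
  have hμ := F.μ_pos
  have hM1 := hM.one_le
  have hM0 : 0 < M := by linarith
  set φ := (F.vt t).d 1 with hφ
  set z := R • toL2 L (F.ρ * F.θ t) + toL2 L (F.vy t * F.G t) with hz
  have h1 : inner ℝ (F.Gt t) φ = μ * inner ℝ φ (mulL2 L (F.I t) φ) -
      inner ℝ z (mulL2 L (F.I t) φ) := by
    rw [Gt_eq, inner_mulL2_left, inner_sub_left, inner_smul_left]
    rfl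
  have h2 : M⁻¹ * F.V t ≤ inner ℝ φ (mulL2 L (F.I t) φ) := by
    refine mul_sq_norm_le_inner_mulL2 (fun y => ?_) φ
    rw [inv_le_iff_one_le_mul₀ hM0, ← F.J_mul_I t ht y, mul_comm]
    exact mul_le_mul_of_nonneg_left (hM.J_le t ht y) (F.I_pos ht y).le
  have h3 := inner_le_young z (mulL2 L (F.I t) φ) (η := M ^ 3 / (2 * μ)) (by positivity)
  have h4 : ‖mulL2 L (F.I t) φ‖ ^ 2 ≤ M ^ 2 * F.V t := by
    refine sq_norm_mulL2_le (fun y => ?_) φ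
    rw [abs_of_pos (F.I_pos ht y)]
    exact hM.I_le t ht y
  have h5 := sq_norm_pressure_rate_le hM ht
  rw [← hz] at h5
  have h6 : 1 / (4 * (M ^ 3 / (2 * μ))) * ‖mulL2 L (F.I t) φ‖ ^ 2 ≤ μ / (2 * M) * F.V t := by
    calc _ ≤ 1 / (4 * (M ^ 3 / (2 * μ))) * (M ^ 2 * F.V t) := by gcongr
      _ = _ := by field_simp; norm_num
  have h7 : M ^ 3 / (2 * μ) * ‖z‖ ^ 2 ≤
      M ^ 4 * R ^ 2 / μ * F.Θ t + M ^ 4 / μ * ‖F.vy t‖ ^ 2 := by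
    calc _ ≤ M ^ 3 / (2 * μ) * (2 * R ^ 2 * M * F.Θ t + 2 * M * ‖F.vy t‖ ^ 2) := by gcongr
      _ = _ := by field_simp
  have h8 := mul_le_mul_of_nonneg_left h2 hμ.le
  have e : μ * (M⁻¹ * F.V t) = μ / M * F.V t := by ring
  have e2 : μ / (2 * M) * F.V t = μ / M * F.V t / 2 := by field_simp
  have e3 : 2 * M ^ 4 * R ^ 2 / μ * F.Θ t = 2 * (M ^ 4 * R ^ 2 / μ * F.Θ t) := by ring
  have e4 : 2 * M ^ 4 / μ * ‖F.vy t‖ ^ 2 = 2 * (M ^ 4 / μ * ‖F.vy t‖ ^ 2) := by ring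
  rw [e] at h8
  rw [e2] at h6
  rw [h1, e3, e4]
  generalize inner ℝ φ (mulL2 L (F.I t) φ) = A at *
  generalize inner ℝ z (mulL2 L (F.I t) φ) = B at *
  generalize 1 / (4 * (M ^ 3 / (2 * μ))) * ‖mulL2 L (F.I t) φ‖ ^ 2 = x at *
  generalize M ^ 3 / (2 * μ) * ‖z‖ ^ 2 = w at *
  linarith

/-- Every term in the balance for `Ψ` is either absorbed by `∫ ρ (∂_t ϑ)²`, bounded by a small multiple
of `∫ (∂_t ∂_y v)²`, or integrable in time. -/
theorem Ψ_deriv_le (hM : F.Tame M) {t : ℝ} (ht : t ∈ Icc 0 T) {δ : ℝ} (hδ : 0 < δ) :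
    -(c_v * F.Θ t) - κ / 2 * integL L (F.ϑy t ^ 2 * (F.I t ^ 2 * F.vy t)) -
      inner ℝ ((F.vt t).d 1) (toL2 L (F.ϑ t * F.G t)) -
      inner ℝ (toL2 L (F.vy t * F.ϑ t)) (F.Gt t) ≤
      -(c_v / 2 * F.Θ t) + δ * F.V t + κ / 2 * M * (‖F.vy t‖ * F.D t) +
        (M / (2 * δ) + μ ^ 2 * M ^ 3 / (2 * δ) + R ^ 2 * M ^ 4 / c_v + M ^ 3) * ‖F.ϑ t‖ ^ 2 +
        M * ‖F.vy t‖ ^ 2 := by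
  have hμ := F.μ_pos
  have hc := F.c_pos
  have hκ := F.κ_pos
  have hR := F.R_pos
  have hM1 := hM.one_le
  set φ := (F.vt t).d 1 with hφ
  have h1 : -(κ / 2 * integL L (F.ϑy t ^ 2 * (F.I t ^ 2 * F.vy t))) ≤
      κ / 2 * M * (‖F.vy t‖ * F.D t) := by
    have h := integL_mono (L := L) (f := -(F.ϑy t ^ 2 * (F.I t ^ 2 * F.vy t)))
      (g := (M * ‖F.vy t‖) • (F.ϑy t ^ 2 * F.I t)) fun y => by
      change -(F.ϑy t y ^ 2 * (F.I t y ^ 2 * F.vy t y)) ≤ M * ‖F.vy t‖ * (F.ϑy t y ^ 2 * F.I t y)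
      have h1 := F.I_pos ht y
      have h2 := hM.I_le t ht y
      have h3 : -F.vy t y ≤ ‖F.vy t‖ := (neg_le_abs _).trans ((F.vy t).norm_coe_le y)
      calc _ = (F.ϑy t y ^ 2 * F.I t y) * F.I t y * (-F.vy t y) := by ring
        _ ≤ (F.ϑy t y ^ 2 * F.I t y) * F.I t y * ‖F.vy t‖ := by gcongr
        _ ≤ (F.ϑy t y ^ 2 * F.I t y) * M * ‖F.vy t‖ := by gcongr
        _ = _ := by ring
    rw [map_neg, map_smul, smul_eq_mul] at h
    have h2 := mul_le_mul_of_nonneg_left h (show 0 ≤ κ / 2 by positivity)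
    rw [D]
    linarith
  have h2 : -inner ℝ φ (toL2 L (F.ϑ t * F.G t)) ≤ δ / 2 * F.V t + M / (2 * δ) * ‖F.ϑ t‖ ^ 2 := by
    have h := inner_le_young φ (-toL2 L (F.ϑ t * F.G t)) (η := δ / 2) (by positivity)
    rw [inner_neg_right, norm_neg, norm_sq_toL2] at h
    have h3 : integL L ((F.ϑ t * F.G t) ^ 2) ≤ M * ‖F.ϑ t‖ ^ 2 := by
      refine (integL_mul_sq_le le_rfl).trans ?_
      rw [mul_comm]
      exact mul_le_mul_of_nonneg_right (hM.G_le t ht) (sq_nonneg _)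
    refine h.trans (add_le_add le_rfl ?_)
    calc _ ≤ 1 / (4 * (δ / 2)) * (M * ‖F.ϑ t‖ ^ 2) := by gcongr
      _ = _ := by field_simp; norm_num
  set p := F.I t * (F.vy t * F.ϑ t) with hp
  have hpn : ‖toL2 L p‖ ^ 2 ≤ M ^ 3 * ‖F.ϑ t‖ ^ 2 := by
    rw [norm_sq_toL2]
    have h := integL_mono (L := L) (f := p ^ 2) (g := (M ^ 2 * ‖F.ϑ t‖ ^ 2) • F.vy t ^ 2) fun y => by
      change (F.I t y * (F.vy t y * F.ϑ t y)) ^ 2 ≤ M ^ 2 * ‖F.ϑ t‖ ^ 2 * F.vy t y ^ 2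
      have a1 := F.I_pos ht y
      have a2 := hM.I_le t ht y
      have a3 := F.ϑ_nonneg t ht y
      have a4 : F.ϑ t y ≤ ‖F.ϑ t‖ := (le_abs_self _).trans ((F.ϑ t).norm_coe_le y)
      calc _ = F.I t y ^ 2 * F.ϑ t y ^ 2 * F.vy t y ^ 2 := by ring
        _ ≤ _ := by gcongr
    rw [map_smul, smul_eq_mul] at h
    refine h.trans ?_
    calc _ ≤ M ^ 2 * ‖F.ϑ t‖ ^ 2 * M := by have := hM.vy_le t ht; gcongr
      _ = _ := by ring
  have h3 : -inner ℝ (toL2 L (F.vy t * F.ϑ t)) (F.Gt t) ≤ δ / 2 * F.V t +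
      μ ^ 2 / (2 * δ) * ‖toL2 L p‖ ^ 2 + c_v / 2 * F.Θ t + R ^ 2 * M / c_v * ‖toL2 L p‖ ^ 2 +
      ‖toL2 L p‖ ^ 2 + M * ‖F.vy t‖ ^ 2 := by
    have e : inner ℝ (toL2 L (F.vy t * F.ϑ t)) (F.Gt t) = μ * inner ℝ (toL2 L p) φ -
        (R * inner ℝ (toL2 L p) (toL2 L (F.ρ * F.θ t)) +
          inner ℝ (toL2 L p) (toL2 L (F.vy t * F.G t))) := by
      rw [Gt_eq, ← inner_mulL2_left, mulL2_toL2, inner_sub_right, inner_add_right,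
        inner_smul_right, inner_smul_right]
    have h4 := inner_le_young φ (-(μ • toL2 L p)) (η := δ / 2) (by positivity)
    rw [inner_neg_right, inner_smul_right, norm_neg, norm_smul, mul_pow, Real.norm_eq_abs, sq_abs,
      real_inner_comm] at h4
    have h5 := inner_le_young (R • toL2 L p) (toL2 L (F.ρ * F.θ t)) (η := M / (2 * c_v))
      (by positivity)
    rw [inner_smul_left, norm_smul, mul_pow, Real.norm_eq_abs, sq_abs, norm_sq_toL2 (F.ρ * F.θ t)]
      at h5
    simp only [conj_trivial] at h5
    have h6 := inner_le_young (toL2 L p) (toL2 L (F.vy t * F.G t)) (η := 1) one_pos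
    rw [norm_sq_toL2 (F.vy t * F.G t)] at h6
    have h7 := integL_vy_G_le hM ht
    have h8 := integL_ρ_θ_le hM t
    have h9 : 1 / (4 * (M / (2 * c_v))) * integL L ((F.ρ * F.θ t) ^ 2) ≤ c_v / 2 * F.Θ t := by
      calc _ ≤ 1 / (4 * (M / (2 * c_v))) * (M * F.Θ t) := by gcongr
        _ = _ := by field_simp; norm_num
    have h10 : 0 ≤ M * ‖F.vy t‖ ^ 2 := by positivity
    have h11 : 0 ≤ R ^ 2 * M / c_v * ‖toL2 L p‖ ^ 2 := by positivity
    have e1 : M / (2 * c_v) * (R ^ 2 * ‖toL2 L p‖ ^ 2) =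
      R ^ 2 * M / c_v * ‖toL2 L p‖ ^ 2 / 2 := by field_simp
    have e2 : 1 / (4 * (δ / 2)) * (μ ^ 2 * ‖toL2 L p‖ ^ 2) =
      μ ^ 2 / (2 * δ) * ‖toL2 L p‖ ^ 2 := by field_simp; norm_num
    rw [e]
    rw [e2] at h4
    rw [e1] at h5
    change _ ≤ δ / 2 * F.V t + _ at h4
    linarith
  have h4 := mul_le_mul_of_nonneg_left hpn
    (show 0 ≤ μ ^ 2 / (2 * δ) + R ^ 2 * M / c_v + 1 by positivity)
  have e : (μ ^ 2 / (2 * δ) + R ^ 2 * M / c_v + 1) * (M ^ 3 * ‖F.ϑ t‖ ^ 2) =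
    (μ ^ 2 * M ^ 3 / (2 * δ) + R ^ 2 * M ^ 4 / c_v + M ^ 3) * ‖F.ϑ t‖ ^ 2 := by field_simp
  rw [e] at h4
  linarith

end Flow

/-! ### Bounds for the rate of the velocity -/

theorem intervalIntegrable_inner {E : Type*} [NormedAddCommGroup E] [InnerProductSpace ℝ E] {T : ℝ}
    (hT : 0 ≤ T) {u w : ℝ → E} (hu : MemLp u 2 (leb T)) (hw : MemLp w 2 (leb T)) :
    IntervalIntegrable (fun t => inner ℝ (u t) (w t)) volume 0 T :=
  intervalIntegrable_of_integrableOn_Ioo hT ((hu.norm.integrable_mul hw.norm).mono'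
    (hu.1.inner hw.1) (Eventually.of_forall fun t => norm_inner_le_norm (u t) (w t)))

theorem intervalIntegral_le_of_ae_le {T C : ℝ} (hT : 0 < T) {f : ℝ → ℝ}
    (hf : IntervalIntegrable f volume 0 T) (h : ∀ᵐ t ∂leb T, ∫ s in (0 : ℝ)..t, f s ≤ C) :
    ∫ s in (0 : ℝ)..T, f s ≤ C :=
  le_on_Icc_of_ae_le hT (isPrimitiveOn_integral hT.le hf).continuousOn continuousOn_const h T
    ⟨hT.le, le_rfl⟩

namespace Flow

variable {R c_v μ κ T L : ℝ} {F : Flow R c_v μ κ T L} {M : ℝ}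

theorem abs_work_le (hM : F.Tame M) {t : ℝ} (ht : t ∈ Icc 0 T) :
    |F.work t| ≤ κ / 4 * (1 + F.D t) + M ^ 3 / κ := by
  have hκ := F.κ_pos
  have hM1 := hM.one_le
  have hD := F.D_nonneg ht
  have h1 := sq_integL_mul_le (L := L) (F.vy t) (F.G t * F.ϑ t)
  have h2 : integL L ((F.G t * F.ϑ t) ^ 2) ≤ M * (1 + F.D t) * M := by
    rw [mul_comm (F.G t)]
    refine (integL_mul_sq_le (hM.norm_ϑ_le t ht)).trans ?_
    have := hM.G_le t ht
    gcongr
  have h3 := hM.vy_le t ht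
  have h4 : F.work t ^ 2 ≤ M ^ 3 * (1 + F.D t) := by
    calc _ ≤ _ := h1
      _ ≤ M * (M * (1 + F.D t) * M) := by
        have := integL_nonneg (L := L) (f := (F.G t * F.ϑ t) ^ 2) fun y =>
          sq_nonneg ((F.G t * F.ϑ t) y)
        gcongr
      _ = _ := by ring
  refine abs_le_of_sq_le_sq (h4.trans ?_) (by positivity)
  have e : M ^ 3 * (1 + F.D t) = 4 * (κ / 4 * (1 + F.D t)) * (M ^ 3 / κ) := by field_simp
  rw [e]
  nlinarith [sq_nonneg (κ / 4 * (1 + F.D t) - M ^ 3 / κ)]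

/-- The bounds obtained from the estimate of `√ρ ∂_t v`. -/
structure RateBounded {R c_v μ κ T L : ℝ} (F : Flow R c_v μ κ T L) (C : ℝ) : Prop where
  D_le : ∀ t ∈ Icc 0 T, F.D t ≤ C
  W_le : ∀ᵐ t ∂leb T, F.W t ≤ C
  V_int : ∫ s in (0 : ℝ)..T, F.V s ≤ C
  norm_ϑ_le : ∀ t ∈ Icc 0 T, ‖F.ϑ t‖ ^ 2 ≤ C
  norm_G_le : ∀ t ∈ Icc 0 T, ‖F.G t‖ ^ 2 ≤ C
  norm_vy_le : ∀ t ∈ Icc 0 T, ‖F.vy t‖ ^ 2 ≤ C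

/-- The sum of the energy inequality for `∂_t v`, weighted by a small `l`, and of the balance for `Ψ`.
The weight lets `Ψ` absorb `∫ ρ (∂_t ϑ)²`, and `δ` is small relative to `l`. -/
theorem energy_rate_le (hM : F.Tame M) {l δ B : ℝ} (hl : 0 < l)
    (hδ : 0 < δ) (h1 : l * (2 * M ^ 4 * R ^ 2 / μ) ≤ c_v / 4) (h2 : 2 * δ ≤ l * (μ / M))
    (hB : M / (2 * δ) + μ ^ 2 * M ^ 3 / (2 * δ) + R ^ 2 * M ^ 4 / c_v + M ^ 3 ≤ B)
    (hB' : l * (2 * M ^ 4 / μ) + M ≤ B) : ∀ᵐ t ∂leb T,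
      l * F.W t + F.Ψ t + δ * ∫ s in (0 : ℝ)..t, F.V s ≤
        l * M + F.Ψ 0 + 2 * B * M + κ / 2 * M * ∫ s in (0 : ℝ)..t, ‖F.vy s‖ * F.D s := by
  have hT := F.T_pos
  have hM1 := hM.one_le
  have hμ := F.μ_pos
  have hc := F.c_pos
  have hB0 : 0 ≤ B := le_trans (by positivity) hB'
  have iV := F.intervalIntegrable_V
  have ivy : IntervalIntegrable (fun t => ‖F.vy t‖ ^ 2) volume 0 T :=
    (F.vy_cont.norm.pow 2).intervalIntegrable_of_Icc hT.le
  have iϑ : IntervalIntegrable (fun t => ‖F.ϑ t‖ ^ 2) volume 0 T :=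
    (F.ϑ_time.continuousOn.norm.pow 2).intervalIntegrable_of_Icc hT.le
  have iD : IntervalIntegrable (fun t => ‖F.vy t‖ * F.D t) volume 0 T :=
    (F.vy_cont.norm.mul F.continuousOn_D).intervalIntegrable_of_Icc hT.le
  have iG : IntervalIntegrable (fun t => -inner ℝ (F.Gt t) ((F.vt t).d 1)) volume 0 T :=
    (intervalIntegrable_inner hT.le F.memLp_Gt ((dL L 1 1).comp_memLp' F.vt_mem)).neg
  have hΨ := F.Ψ_time
  have bound : ∀ s ∈ Icc 0 T, l * 2 * -inner ℝ (F.Gt s) ((F.vt s).d 1) +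
      (-(c_v * F.Θ s) - κ / 2 * integL L (F.ϑy s ^ 2 * (F.I s ^ 2 * F.vy s)) -
        inner ℝ ((F.vt s).d 1) (toL2 L (F.ϑ s * F.G s)) -
        inner ℝ (toL2 L (F.vy s * F.ϑ s)) (F.Gt s)) ≤
      (-δ * F.V s + κ / 2 * M * (‖F.vy s‖ * F.D s)) + (B * ‖F.ϑ s‖ ^ 2 + B * ‖F.vy s‖ ^ 2) := by
    intro s hs
    have a1 := mul_le_mul_of_nonneg_left (neg_inner_Gt_le hM hs) hl.le
    have a2 := Ψ_deriv_le hM hs hδ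
    have a3 := mul_le_mul_of_nonneg_right h1 (F.Θ_nonneg s)
    have a4 := mul_le_mul_of_nonneg_right h2 (F.V_nonneg s)
    have a5 := mul_le_mul_of_nonneg_right hB (sq_nonneg ‖F.ϑ s‖)
    have a6 := mul_le_mul_of_nonneg_right hB' (sq_nonneg ‖F.vy s‖)
    have a7 := mul_nonneg hc.le (F.Θ_nonneg s)
    linarith
  filter_upwards [F.W_le, ae_restrict_mem measurableSet_Ioo] with t hW ht
  have ht' := Ioo_subset_Icc_self ht
  have m := intervalIntegral_mono_ae ht' ((iG.const_mul (l * 2)).add hΨ.intble)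
    (((iV.const_mul (-δ)).add (iD.const_mul (κ / 2 * M))).add
      ((iϑ.const_mul B).add (ivy.const_mul B)))
    ((ae_restrict_mem measurableSet_Ioo).mono fun s hs => bound s (Ioo_subset_Icc_self hs))
  have q {f : ℝ → ℝ} (hf : IntervalIntegrable f volume 0 T) : IntervalIntegrable f volume 0 t :=
    intervalIntegrable_of_mem hf F.zero_mem ht'
  rw [intervalIntegral.integral_add (q (iG.const_mul (l * 2))) (q hΨ.intble),
    intervalIntegral.integral_add ((q (iV.const_mul (-δ))).add (q (iD.const_mul (κ / 2 * M))))
      ((q (iϑ.const_mul B)).add (q (ivy.const_mul B))),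
    intervalIntegral.integral_add (q (iV.const_mul (-δ))) (q (iD.const_mul (κ / 2 * M))),
    intervalIntegral.integral_add (q (iϑ.const_mul B)) (q (ivy.const_mul B))] at m
  simp only [intervalIntegral.integral_const_mul] at m
  have e := hΨ.eq_add t ht'
  have b1 : ∫ s in (0 : ℝ)..t, ‖F.ϑ s‖ ^ 2 ≤ M :=
    (intervalIntegral.integral_mono_interval le_rfl ht'.1 ht'.2
      (Eventually.of_forall fun s => sq_nonneg _) iϑ).trans hM.ϑ_int
  have b2 : ∫ s in (0 : ℝ)..t, ‖F.vy s‖ ^ 2 ≤ M :=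
    (intervalIntegral.integral_mono_interval le_rfl ht'.1 ht'.2
      (Eventually.of_forall fun s => sq_nonneg _) ivy).trans hM.vy_int
  have b3 := mul_le_mul_of_nonneg_left b1 hB0
  have b4 := mul_le_mul_of_nonneg_left b2 hB0
  have b5 := mul_le_mul_of_nonneg_left (hW.trans (add_le_add_left hM.g₀_le _)) hl.le
  generalize (∫ s in (0 : ℝ)..t, -inner ℝ (F.Gt s) ((F.vt s).d 1)) = x at *
  linarith

/-- Gronwall's inequality for the sum of `energy_rate_le`, the remaining factor `‖∂_y v‖` being
square integrable in time. -/
theorem exists_energy_rate_le (R c_v μ κ T M : ℝ) (hM1 : 1 ≤ M) (hc : 0 < c_v) (hμ : 0 < μ)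
    (hκ : 0 < κ) (hT : 0 < T) : ∃ l δ X : ℝ, 0 < l ∧ 0 < δ ∧ 0 ≤ X ∧
      ∀ {L : ℝ} (F : Flow R c_v μ κ T L), F.Tame M → ∀ᵐ t ∂leb T,
        l * F.W t + κ / 4 * F.D t + δ * ∫ s in (0 : ℝ)..t, F.V s ≤ κ / 4 * X := by
  have hM0 : 0 < M := by linarith
  set a := 2 * M ^ 4 * R ^ 2 / μ with ha
  have ha0 : 0 ≤ a := by positivity
  set l := c_v / (4 * (a + 1)) with hl
  have hl0 : 0 < l := by positivity
  set δ := l * (μ / M) / 2 with hδ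
  have hδ0 : 0 < δ := by positivity
  set B := (M / (2 * δ) + μ ^ 2 * M ^ 3 / (2 * δ) + R ^ 2 * M ^ 4 / c_v + M ^ 3) +
    (l * (2 * M ^ 4 / μ) + M) with hB
  have hB1 : 0 ≤ M / (2 * δ) + μ ^ 2 * M ^ 3 / (2 * δ) + R ^ 2 * M ^ 4 / c_v + M ^ 3 := by
    positivity
  have hB2 : 0 ≤ l * (2 * M ^ 4 / μ) + M := by positivity
  set A := l * M + κ / 2 * M + κ / 4 * (2 + M) + 2 * (M ^ 3 / κ) + 2 * B * M with hA
  have hA0 : 0 ≤ A := by positivity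
  set X := 4 * A / κ * Real.exp (2 * M * (T + M)) with hX
  have hX0 : 0 ≤ X := by positivity
  refine ⟨l, δ, X, hl0, hδ0, hX0, fun {L} F hM => ?_⟩
  have hla : l * a ≤ c_v / 4 := by
    rw [hl, div_mul_eq_mul_div, div_le_div_iff₀ (by positivity) (by positivity)]
    nlinarith
  have key := energy_rate_le hM hl0 hδ0 hla (by rw [hδ]; linarith)
    (show _ ≤ B by rw [hB]; linarith) (show _ ≤ B by rw [hB]; linarith)
  have hcD : ContinuousOn (fun t => ‖F.vy t‖ * F.D t) (Icc 0 T) :=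
    F.vy_cont.norm.mul F.continuousOn_D
  have h0 : F.Ψ 0 ≤ κ / 2 * M + (κ / 4 * (1 + M) + M ^ 3 / κ) := by
    have h1 := abs_le.1 (abs_work_le hM F.zero_mem)
    have h2 := mul_le_mul_of_nonneg_left hM.D_zero hκ.le
    rw [Ψ]
    linarith
  have key2 : ∀ᵐ t ∂leb T, l * F.W t + κ / 4 * F.D t + δ * ∫ s in (0 : ℝ)..t, F.V s ≤
      κ / 4 * (4 * A / κ + ∫ s in (0 : ℝ)..t, 2 * M * ‖F.vy s‖ * F.D s) := by
    filter_upwards [key, ae_restrict_mem measurableSet_Ioo] with t h ht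
    have h1 := abs_le.1 (abs_work_le hM (Ioo_subset_Icc_self ht))
    have e : F.Ψ t = κ / 2 * F.D t - F.work t := rfl
    have e2 : ∫ s in (0 : ℝ)..t, 2 * M * ‖F.vy s‖ * F.D s =
        2 * M * ∫ s in (0 : ℝ)..t, ‖F.vy s‖ * F.D s := by
      rw [← intervalIntegral.integral_const_mul]
      simp only [mul_assoc]
    have e3 : κ / 4 * (4 * A / κ + ∫ s in (0 : ℝ)..t, 2 * M * ‖F.vy s‖ * F.D s) =
        A + κ / 2 * M * ∫ s in (0 : ℝ)..t, ‖F.vy s‖ * F.D s := by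
      rw [e2]; field_simp; ring
    rw [e3]
    linarith
  have hVn : ∀ t ∈ Icc 0 T, 0 ≤ ∫ s in (0 : ℝ)..t, F.V s := fun t ht =>
    intervalIntegral.integral_nonneg ht.1 fun s _ => F.V_nonneg s
  have hg := gronwall_integral (f := F.D) (a := fun s => 2 * M * ‖F.vy s‖) (A := 4 * A / κ) hT.le
    ((continuousOn_const.mul F.vy_cont.norm).intervalIntegrable_of_Icc hT.le)
    (Eventually.of_forall fun t => by positivity)
    (((continuousOn_const.mul F.vy_cont.norm).mul
      F.continuousOn_D).intervalIntegrable_of_Icc hT.le) (by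
      filter_upwards [key2, ae_restrict_mem measurableSet_Ioo] with t h ht
      have h1 := mul_nonneg hl0.le (F.W_nonneg t)
      have h2 := mul_nonneg hδ0.le (hVn t (Ioo_subset_Icc_self ht))
      have h3 : κ / 4 * F.D t ≤
        κ / 4 * (4 * A / κ + ∫ s in (0 : ℝ)..t, 2 * M * ‖F.vy s‖ * F.D s) := by linarith
      exact le_of_mul_le_mul_left h3 (by positivity))
  have hexp : ∀ t ∈ Icc 0 T, ∫ s in (0 : ℝ)..t, 2 * M * ‖F.vy s‖ ≤ 2 * M * (T + M) := by
    intro t ht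
    have ivy : IntervalIntegrable (fun t => ‖F.vy t‖ ^ 2) volume 0 T :=
      (F.vy_cont.norm.pow 2).intervalIntegrable_of_Icc hT.le
    rw [intervalIntegral.integral_const_mul]
    have h1 : ∫ s in (0 : ℝ)..t, ‖F.vy s‖ ≤ ∫ s in (0 : ℝ)..t, (1 + ‖F.vy s‖ ^ 2) :=
      intervalIntegral_mono_of_continuousOn ht F.vy_cont.norm
        (continuousOn_const.add (F.vy_cont.norm.pow 2)) fun s _ => by
          nlinarith [sq_nonneg (‖F.vy s‖ - 1), sq_nonneg ‖F.vy s‖]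
    rw [intervalIntegral.integral_add (by simp) (intervalIntegrable_of_mem ivy F.zero_mem ht),
      intervalIntegral.integral_const, smul_eq_mul, mul_one, sub_zero] at h1
    have b2 : ∫ s in (0 : ℝ)..t, ‖F.vy s‖ ^ 2 ≤ M :=
      (intervalIntegral.integral_mono_interval le_rfl ht.1 ht.2
        (Eventually.of_forall fun s => sq_nonneg _) ivy).trans hM.vy_int
    have := ht.2
    gcongr
    linarith
  filter_upwards [key2, ae_restrict_mem measurableSet_Ioo] with t h ht
  have ht' := Ioo_subset_Icc_self ht
  refine h.trans (mul_le_mul_of_nonneg_left ((hg t ht').trans ?_) (by positivity))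
  have := hexp t ht'
  rw [hX]
  gcongr

/-- The bounds of `RateBounded` hold with a constant that depends only on the constant of `Tame`. -/
theorem exists_rateBounded (R c_v μ κ T M : ℝ) (hM1 : 1 ≤ M) (hc : 0 < c_v) (hμ : 0 < μ)
    (hκ : 0 < κ) (hT : 0 < T) : ∃ C : ℝ,
      ∀ {L : ℝ} (F : Flow R c_v μ κ T L), F.Tame M → F.RateBounded C := by
  have hM0 : 0 < M := by linarith
  obtain ⟨l, δ, X, hl0, hδ0, hX0, key⟩ := exists_energy_rate_le R c_v μ κ T M hM1 hc hμ hκ hT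
  obtain ⟨C₁, hC₁⟩ : ∃ C₁, C₁ = κ / 4 * X / l := ⟨_, rfl⟩
  have hC₁0 : 0 ≤ C₁ := hC₁ ▸ by positivity
  obtain ⟨C₂, hC₂⟩ : ∃ C₂, C₂ = κ / 4 * X / δ := ⟨_, rfl⟩
  have hC₂0 : 0 ≤ C₂ := hC₂ ▸ by positivity
  refine ⟨X + C₁ + C₂ + M * (1 + X) + M * (1 + C₁) + M * (M * (1 + X) + M * (1 + C₁)),
    fun {L} F hM => ?_⟩
  have key3 := key F hM
  have hVn : ∀ t ∈ Icc 0 T, 0 ≤ ∫ s in (0 : ℝ)..t, F.V s := fun t ht =>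
    intervalIntegral.integral_nonneg ht.1 fun s _ => F.V_nonneg s
  have hD : ∀ t ∈ Icc 0 T, F.D t ≤ X := by
    refine le_on_Icc_of_ae_le hT F.continuousOn_D continuousOn_const ?_
    filter_upwards [key3, ae_restrict_mem measurableSet_Ioo] with t h ht
    have h1 := mul_nonneg hl0.le (F.W_nonneg t)
    have h2 := mul_nonneg hδ0.le (hVn t (Ioo_subset_Icc_self ht))
    have h3 : κ / 4 * F.D t ≤ κ / 4 * X := by linarith
    exact le_of_mul_le_mul_left h3 (by positivity)
  have hW : ∀ᵐ t ∂leb T, F.W t ≤ C₁ := by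
    filter_upwards [key3, ae_restrict_mem measurableSet_Ioo] with t h ht
    have h1 := mul_nonneg hκ.le (F.D_nonneg (Ioo_subset_Icc_self ht))
    have h2 := mul_nonneg hδ0.le (hVn t (Ioo_subset_Icc_self ht))
    rw [hC₁, le_div_iff₀ hl0]
    linarith
  have hV : ∫ s in (0 : ℝ)..T, F.V s ≤ C₂ := by
    refine intervalIntegral_le_of_ae_le hT F.intervalIntegrable_V ?_
    filter_upwards [key3, ae_restrict_mem measurableSet_Ioo] with t h ht
    have h1 := mul_nonneg hκ.le (F.D_nonneg (Ioo_subset_Icc_self ht))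
    have h2 := mul_nonneg hl0.le (F.W_nonneg t)
    rw [hC₂, le_div_iff₀ hδ0]
    linarith
  have hϑ : ∀ t ∈ Icc 0 T, ‖F.ϑ t‖ ^ 2 ≤ M * (1 + X) := fun t ht =>
    (hM.norm_ϑ_le t ht).trans (by have := hD t ht; gcongr)
  have hG : ∀ t ∈ Icc 0 T, ‖F.G t‖ ^ 2 ≤ M * (1 + C₁) := by
    refine le_on_Icc_of_ae_le hT (F.continuousOn_G.norm.pow 2) continuousOn_const ?_
    filter_upwards [hM.norm_G_le, hW] with t h1 h2
    exact h1.trans (by gcongr)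
  have hvy : ∀ t ∈ Icc 0 T, ‖F.vy t‖ ^ 2 ≤ M * (M * (1 + X) + M * (1 + C₁)) := fun t ht =>
    (hM.norm_vy_le t ht).trans (by
      have h1 := hG t ht
      have h2 := hϑ t ht
      have h3 : ‖F.G t‖ ^ 2 + ‖F.ϑ t‖ ^ 2 ≤ M * (1 + X) + M * (1 + C₁) := by linarith
      gcongr)
  have p1 : 0 ≤ M * (1 + X) := by positivity
  have p2 : 0 ≤ M * (1 + C₁) := by positivity
  have p3 : 0 ≤ M * (M * (1 + X) + M * (1 + C₁)) := by positivity
  exact ⟨fun t ht => (hD t ht).trans (by linarith), hW.mono fun t h => h.trans (by linarith),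
    hV.trans (by linarith), fun t ht => (hϑ t ht).trans (by linarith),
    fun t ht => (hG t ht).trans (by linarith), fun t ht => (hvy t ht).trans (by linarith)⟩

end Flow

/-! ### The energy inequality for the rate of the temperature -/

/-- Pairing with an element of `H¹`. -/
def pairZ (L : ℝ) : L2 L →L[ℝ] (H L 1 →L[ℝ] ℝ) :=
  (ContinuousLinearMap.precomp ℝ (dL L 1 0) : (L2 L →L[ℝ] ℝ) →L[ℝ] (H L 1 →L[ℝ] ℝ)).comp
    (innerSL ℝ : L2 L →L[ℝ] (L2 L →L[ℝ] ℝ))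

/-- A Poincaré inequality with a weighted mean. -/
theorem sq_norm_evL_le {L M : ℝ} (hL : 0 < L) (hLM : L ≤ M) {ρ : CB} (hρ : ∀ y, 0 ≤ ρ y)
    (hm : 1 ≤ M * integL L ρ) (f : H L 1) :
    ‖evL hL f‖ ^ 2 ≤ 2 * M * (integL L (ρ * evL hL f ^ 2) + ‖f.d 1‖ ^ 2) := by
  have hM : 0 < M := hL.trans_le hLM
  obtain ⟨z, hz, h1⟩ := exists_mul_integL_le hL ρ (evL hL f ^ 2) hρ
  change evL hL f z ^ 2 * integL L ρ ≤ _ at h1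
  have h2 : evL hL f z ^ 2 ≤ M * integL L (ρ * evL hL f ^ 2) := by
    calc evL hL f z ^ 2 ≤ evL hL f z ^ 2 * (M * integL L ρ) :=
          le_mul_of_one_le_right (sq_nonneg _) hm
      _ = M * (evL hL f z ^ 2 * integL L ρ) := by ring
      _ ≤ _ := by gcongr
  refine CB.sq_norm_le_of_clamp hL (fun y => evL_clamp hL f y) fun y hy => ?_
  have h3 := (evL_isPrimitiveOn hL f).abs_sub_le hz hy
  have h4 := sq_integral_mul_le (μ := leb L) (memLp_const (1 : ℝ)) (memLp_coe (f.d 1)).abs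
  simp only [one_mul, one_pow, sq_abs, Pi.abs_apply] at h4
  rw [← L2.norm_sq_eq] at h4
  have e : ∫ _ in Ioo 0 L, (1 : ℝ) = L := by simp [hL.le]
  rw [e] at h4
  have h5 : (evL hL f y - evL hL f z) ^ 2 ≤ M * ‖f.d 1‖ ^ 2 := by
    rw [← sq_abs]
    calc _ ≤ (∫ y in Ioo 0 L, |f.d 1 y|) ^ 2 := by gcongr
      _ ≤ _ := h4
      _ ≤ _ := by gcongr
  nlinarith [sq_nonneg (evL hL f z - (evL hL f y - evL hL f z))]

theorem L2.ext_inner_toL2 {L : ℝ} {f g : L2 L}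
    (h : ∀ φ : CB, inner ℝ (toL2 L φ) f = inner ℝ (toL2 L φ) g) : f = g := by
  have hd : DenseRange (toL2 L) :=
    BoundedContinuousFunction.toLp_denseRange ℝ (leb L) ℝ (by norm_num)
  refine ext_inner_left ℝ fun x => ?_
  exact congrFun (hd.equalizer (g := fun x : L2 L => inner ℝ x f)
    (h := fun x : L2 L => inner ℝ x g) (by fun_prop) (by fun_prop) (funext h)) x

namespace Flow

variable {R c_v μ κ T L : ℝ} (F : Flow R c_v μ κ T L)

/-- The time derivative of the heat flux. -/
def Qt (t : ℝ) : L2 L :=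
  κ • (mulL2 L (-(F.I t ^ 2 * F.vy t)) (toL2 L (F.ϑy t)) + mulL2 L (F.I t) ((F.ϑt t).d 1))

/-- The time derivative of the heat source `∂_y v G`. -/
def St (t : ℝ) : L2 L := mulL2 L (F.G t) ((F.vt t).d 1) + mulL2 L (F.vy t) (F.Gt t)

theorem Q_time : IsPrimitiveOn T (fun t => toL2 L (F.Q t)) F.Qt := by
  refine ((F.I_time.bilin (mulL2 L) F.ϑy_time).const_smul κ).congr_left fun t _ => ?_
  change toL2 L (κ • (F.ϑy t * F.I t)) = κ • mulL2 L (F.I t) (toL2 L (F.ϑy t))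
  rw [mulL2_toL2, map_smul, mul_comm]

theorem memLp_Qt : MemLp F.Qt 2 (leb T) := by
  have h1 := memLp_of_continuousOn ((toL2 L).continuous.comp_continuousOn
    (((F.I_time.continuousOn.pow 2).mul F.vy_cont).neg.mul F.ϑy_cont))
  have h2 := memLp_bilin (mulL2 L) F.I_time.continuousOn ((dL L 1 1).comp_memLp' F.ϑt_mem)
  have h3 : MemLp (fun t => mulL2 L (-(F.I t ^ 2 * F.vy t)) (toL2 L (F.ϑy t))) 2 (leb T) := by
    simp only [mulL2_toL2]
    exact h1
  exact (h3.add h2).const_smul κ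

theorem memLp_St : MemLp F.St 2 (leb T) :=
  (memLp_bilin (mulL2 L) F.continuousOn_G ((dL L 1 1).comp_memLp' F.vt_mem)).add
    (memLp_bilin (mulL2 L) F.vy_cont F.memLp_Gt)

/-- Both factors are merely differentiable in `L²`; the product rule is obtained by testing with
continuous functions. -/
theorem source_time : IsPrimitiveOn T (fun t => toL2 L (F.vy t * F.G t)) F.St := by
  have hT := F.T_pos.le
  refine ⟨hT, MemLp.intervalIntegrable_of_two hT F.memLp_St, fun t ht => ?_⟩
  have hi : IntervalIntegrable F.St volume 0 t :=
    intervalIntegrable_of_mem (MemLp.intervalIntegrable_of_two hT F.memLp_St) F.zero_mem ht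
  refine L2.ext_inner_toL2 fun φ => ?_
  have h : inner ℝ (toL2 L (F.vy t)) (mulL2 L φ (toL2 L (F.G t))) =
      inner ℝ (toL2 L (F.vy 0)) (mulL2 L φ (toL2 L (F.G 0))) + ∫ s in (0 : ℝ)..t,
        (inner ℝ ((F.vt s).d 1) (mulL2 L φ (toL2 L (F.G s))) +
          inner ℝ (toL2 L (F.vy s)) (mulL2 L φ (F.Gt s))) :=
    (F.vy_time.bilin (innerSL ℝ) (F.G_time.map (mulL2 L φ))).eq_add t ht
  have hJ := (innerSL ℝ (toL2 L φ)).intervalIntegral_comp_comm hi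
  change _ = inner ℝ (toL2 L φ) (∫ s in (0 : ℝ)..t, F.St s) at hJ
  rw [inner_add_right, ← hJ]
  have e : ∀ s, inner ℝ (toL2 L φ) (toL2 L (F.vy s * F.G s)) =
      inner ℝ (toL2 L (F.vy s)) (mulL2 L φ (toL2 L (F.G s))) := fun s => by
    rw [mulL2_toL2, inner_toL2_toL2, inner_toL2_toL2, mul_left_comm]
  rw [e, e, h]
  congr 2
  funext s
  change _ = inner ℝ (toL2 L φ) (F.St s)
  rw [St, inner_add_right, ← inner_mulL2_left (F.G s), ← inner_mulL2_left (F.vy s),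
    ← inner_mulL2_left φ (toL2 L (F.vy s)), mulL2_toL2, mulL2_toL2, mulL2_toL2, real_inner_comm,
    mulL2_toL2, mul_comm φ, mul_comm φ]

/-- The energy inequality for `∂_t ϑ`: its initial value is `h0`, whose norm does not involve the
infimum of the density. -/
theorem Θ_le : ∀ᵐ t ∂leb T, c_v * F.Θ t ≤ ‖F.h0‖ ^ 2 / c_v +
    2 * ∫ s in (0 : ℝ)..t, (inner ℝ (F.St s) ((F.ϑt s).d 0) - inner ℝ (F.Qt s) ((F.ϑt s).d 1)) := by
  have hc := F.c_pos
  have hU : IsPrimitiveOn T (fun t => pairZ L (toL2 L (F.vy t * F.G t)) - pairD L (toL2 L (F.Q t)))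
      (fun t => pairZ L (F.St t) - pairD L (F.Qt t)) := by
    have h1 := IsPrimitiveOn.map (F := H L 1 →L[ℝ] ℝ) (pairZ L) F.source_time
    have h2 := IsPrimitiveOn.map (F := H L 1 →L[ℝ] ℝ) (pairD L) F.Q_time
    exact h1.sub h2
  have hU2 : MemLp (fun t => pairZ L (F.St t) - pairD L (F.Qt t)) 2 (leb T) := by
    have h1 := MemLp.map_clm (G := H L 1 →L[ℝ] ℝ) (pairZ L) F.memLp_St
    have h2 := MemLp.map_clm (G := H L 1 →L[ℝ] ℝ) (pairD L) F.memLp_Qt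
    exact h1.sub h2
  have key : ∀ t ∈ Icc 0 T,
      IsPrimitiveOn L (F.Q t) (c_v • (F.ρ * F.θ t) - F.vy t * F.G t : CB) → ∀ φ : H L 1,
      (pairZ L (toL2 L (F.vy t * F.G t)) - pairD L (toL2 L (F.Q t))) φ =
        c_v * integL L (F.ρ * (F.θ t * evL F.L_pos φ)) := by
    intro t ht hQ φ
    have b := F.Q_bdry ht
    change inner ℝ (toL2 L (F.vy t * F.G t)) (φ.d 0) - inner ℝ (toL2 L (F.Q t)) (φ.d 1) = _
    rw [hQ.inner_d_one F.L_pos (by rw [b.1, zero_mul]) (by rw [b.2, zero_mul]),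
      ← toL2_evL F.L_pos φ, inner_toL2_toL2, ← smul_eq_mul c_v, ← (integL L).map_smul,
      sub_neg_eq_add, ← (integL L).map_add]
    congr 1
    ext y
    change F.vy t y * F.G t y * evL F.L_pos φ y +
      (c_v * (F.ρ y * F.θ t y) - F.vy t y * F.G t y) * evL F.L_pos φ y =
      c_v * (F.ρ y * (F.θ t y * evL F.L_pos φ y))
    ring
  refine (energy_inequality_of_difference F.T_pos hU hU2 F.ϑt_mem
    (f := fun t => c_v * F.Θ t) (f0 := ‖F.h0‖ ^ 2 / c_v) ?_
    (g := {t | IsPrimitiveOn L (F.Q t) (c_v • (F.ρ * F.θ t) - F.vy t * F.G t : CB)})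
    F.Q_space ?_ ?_).mono fun t ht => ht
  · have := F.intervalIntegrable_Θ.const_mul c_v
    rw [intervalIntegrable_iff, uIoc_of_le F.T_pos.le] at this
    exact this.mono_set Ioo_subset_Ioc_self
  · intro t ht ht0
    rw [sub_apply, key t (Ioo_subset_Icc_self ht0) ht]
    obtain ⟨r, hr⟩ := CB.exists_sqrt F.ρ
    have hP := F.energy_zero.mul (evL_isPrimitiveOn F.L_pos (F.ϑt t))
    have h1 := hP.integral_Ioo
    have b := F.Q_bdry F.zero_mem
    change _ = F.Q 0 L * _ - F.Q 0 0 * _ at h1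
    rw [b.1, b.2, zero_mul, zero_mul, sub_zero] at h1
    have i1 := integrable_mul_of_memLp (memLp_coe F.h0) ((r * F.θ t).memLp L)
    have i2 := (F.vy 0 * F.G 0 * F.θ t : CB).integrable L
    have i3 := integrable_mul_of_memLp (memLp_coe ((F.ϑt t).d 1)) ((F.Q 0).memLp L)
    have h2 : inner ℝ (toL2 L (r * F.θ t)) F.h0 - integL L (F.vy 0 * F.G 0 * F.θ t) +
        inner ℝ (toL2 L (F.Q 0)) ((F.ϑt t).d 1) = 0 := by
      refine Eq.trans ?_ h1
      have i4 : Integrable (fun y => F.h0 y * (r * F.θ t) y - (F.vy 0 * F.G 0 * F.θ t) y) (leb L) :=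
        i1.sub i2
      rw [inner_toL2, inner_toL2, HeatNS.integL_eq, ← integral_sub i1 i2, ← integral_add i4 i3]
      refine integral_congr_ae (Eventually.of_forall fun y => ?_)
      change F.h0 y * (r y * F.θ t y) - F.vy 0 y * F.G 0 y * F.θ t y + (F.ϑt t).d 1 y * F.Q 0 y =
        (Real.sqrt (F.ρ y) * F.h0 y - F.vy 0 y * F.G 0 y) * F.θ t y + F.Q 0 y * (F.ϑt t).d 1 y
      rw [hr]; ring
    have h3 : ‖toL2 L (r * F.θ t)‖ ^ 2 = F.Θ t := by
      rw [norm_sq_toL2, Θ]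
      congr 1
      ext y
      change (r y * F.θ t y) ^ 2 = F.ρ y * F.θ t y ^ 2
      rw [hr, mul_pow, Real.sq_sqrt (F.ρ_pos y).le]
    have h6 : integL L (F.ρ * (F.θ t * evL F.L_pos (F.ϑt t))) = F.Θ t := by
      change integL L (F.ρ * (F.θ t * F.θ t)) = _
      rw [Θ, pow_two]
    have h7 : (pairZ L (toL2 L (F.vy 0 * F.G 0)) - pairD L (toL2 L (F.Q 0))) (F.ϑt t) =
        inner ℝ (toL2 L (r * F.θ t)) F.h0 := by
      change inner ℝ (toL2 L (F.vy 0 * F.G 0)) ((F.ϑt t).d 0) -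
        inner ℝ (toL2 L (F.Q 0)) ((F.ϑt t).d 1) = _
      rw [← toL2_evL F.L_pos, inner_toL2_toL2]
      change integL L (F.vy 0 * F.G 0 * F.θ t) - _ = _
      linarith
    have h8 := inner_le_young (toL2 L (r * F.θ t)) F.h0 (η := c_v / 2) (by positivity)
    rw [h3] at h8
    rw [h6, h7]
    have e : 1 / (4 * (c_v / 2)) * ‖F.h0‖ ^ 2 = ‖F.h0‖ ^ 2 / c_v / 2 := by field_simp; norm_num
    rw [e] at h8
    linarith
  · intro t ht ht0 s hs hs0 _
    rw [sub_apply, key t (Ioo_subset_Icc_self ht0) ht, key s (Ioo_subset_Icc_self hs0) hs,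
      ← mul_sub, ← mul_sub, mul_left_comm]
    refine mul_le_mul_of_nonneg_left ?_ hc.le
    rw [← map_sub, ← smul_eq_mul, ← map_smul, Θ, Θ, ← map_sub]
    refine integL_mono fun y => ?_
    change F.ρ y * F.θ t y ^ 2 - F.ρ y * F.θ s y ^ 2 ≤
      2 * (F.ρ y * (F.θ t y * F.θ t y) - F.ρ y * (F.θ s y * F.θ t y))
    nlinarith [mul_nonneg (F.ρ_pos y).le (sq_nonneg (F.θ t y - F.θ s y))]

end Flow

/-! ### Bounds for the rate of the temperature -/

theorem integL_sq_le {L : ℝ} (hL : 0 < L) (f : CB) : integL L (f ^ 2) ≤ L * ‖f‖ ^ 2 := by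
  have h := Flow.integL_mul_sq_le (L := L) (a := f) (b := 1) le_rfl
  rwa [mul_one, one_pow, integL_one hL.le, mul_comm] at h

theorem sq_norm_add_le {E : Type*} [NormedAddCommGroup E] [InnerProductSpace ℝ E] (x y : E) :
    ‖x + y‖ ^ 2 ≤ 2 * ‖x‖ ^ 2 + 2 * ‖y‖ ^ 2 := by
  have h := parallelogram_law_with_norm ℝ x y
  nlinarith [sq_nonneg ‖x - y‖]

theorem sq_norm_mulL2_le_norm (a : CB) (f : L2 L) : ‖mulL2 L a f‖ ^ 2 ≤ ‖a‖ ^ 2 * ‖f‖ ^ 2 :=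
  sq_norm_mulL2_le (fun y => a.norm_coe_le y) f

namespace Flow

variable {R c_v μ κ T L : ℝ} (F : Flow R c_v μ κ T L) {M C : ℝ}

/-- `∫ (∂_t ∂_y ϑ)²`. -/
def Ξ (t : ℝ) : ℝ := ‖(F.ϑt t).d 1‖ ^ 2

theorem Ξ_nonneg (t : ℝ) : 0 ≤ F.Ξ t := sq_nonneg _

theorem intervalIntegrable_Ξ : IntervalIntegrable F.Ξ volume 0 T :=
  intervalIntegrable_sq_norm F.T_pos.le ((dL L 1 1).comp_memLp' F.ϑt_mem)

variable {F}

theorem Tame.sq_norm_θ_le (hM : F.Tame M) (t : ℝ) : ‖F.θ t‖ ^ 2 ≤ 2 * M * (F.Θ t + F.Ξ t) :=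
  sq_norm_evL_le F.L_pos hM.L_le (fun y => (F.ρ_pos y).le) hM.one_le_mul_mass (F.ϑt t)

theorem Tame.sq_norm_ϑt_le (hM : F.Tame M) (t : ℝ) :
    ‖(F.ϑt t).d 0‖ ^ 2 ≤ 2 * M ^ 2 * (F.Θ t + F.Ξ t) := by
  rw [← toL2_evL F.L_pos, norm_sq_toL2]
  refine (integL_sq_le F.L_pos _).trans ?_
  have h1 := hM.sq_norm_θ_le t
  have h2 := hM.L_le
  have h3 := hM.one_le
  calc L * ‖F.θ t‖ ^ 2 ≤ M * (2 * M * (F.Θ t + F.Ξ t)) := by gcongr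
    _ = _ := by ring

/-- `∂_t G` in `L²` by the rates of `v` and `ϑ`. -/
theorem sq_norm_Gt_le (hM : F.Tame M) (hC : F.RateBounded C) {t : ℝ} (ht : t ∈ Icc 0 T) :
    ‖F.Gt t‖ ^ 2 ≤ 2 * M ^ 2 * μ ^ 2 * F.V t +
      (4 * R ^ 2 * M ^ 3 * F.Θ t + 4 * M ^ 3 * C) := by
  have hM1 := hM.one_le
  have h1 := sq_norm_pressure_rate_le hM ht
  have h2 := hC.norm_vy_le t ht
  rw [Gt_eq]
  set z := R • toL2 L (F.ρ * F.θ t) + toL2 L (F.vy t * F.G t)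
  have h3 : ‖mulL2 L (F.I t) (μ • (F.vt t).d 1 - z)‖ ^ 2 ≤ M ^ 2 * ‖μ • (F.vt t).d 1 - z‖ ^ 2 :=
    sq_norm_mulL2_le (fun y => by rw [abs_of_pos (F.I_pos ht y)]; exact hM.I_le t ht y) _
  have h4 := sq_norm_add_le (μ • (F.vt t).d 1) (-z)
  rw [← sub_eq_add_neg, norm_neg, norm_smul, mul_pow, Real.norm_eq_abs, sq_abs] at h4
  calc _ ≤ _ := h3
    _ ≤ M ^ 2 * (2 * (μ ^ 2 * F.V t) + 2 * (2 * R ^ 2 * M * F.Θ t + 2 * M * C)) := by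
      gcongr
      exact h4.trans (by gcongr; exacts [le_rfl, h1.trans (by gcongr)])
    _ = _ := by ring

/-- The leading part of `∂_t Q` is `κ ∂_t ∂_y ϑ / J`, which makes `∫ (∂_t ∂_y ϑ)²` the dissipation. -/
theorem neg_inner_Qt_le (hM : F.Tame M) (hC : F.RateBounded C) {t : ℝ} (ht : t ∈ Icc 0 T) :
    -inner ℝ (F.Qt t) ((F.ϑt t).d 1) ≤ -(3 * κ / (4 * M) * F.Ξ t) + κ * M ^ 4 * C ^ 2 := by
  have hM1 := hM.one_le
  have hκ := F.κ_pos
  set φ := (F.ϑt t).d 1 with hφ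
  set p := F.I t ^ 2 * F.vy t * F.ϑy t with hp
  have e : inner ℝ (F.Qt t) φ = κ * (inner ℝ φ (mulL2 L (F.I t) φ) - inner ℝ φ (toL2 L p)) := by
    have e0 : -(F.I t ^ 2 * F.vy t) * F.ϑy t = -p := by rw [hp]; ring
    rw [Qt, inner_smul_left, inner_add_left, mulL2_toL2, e0, map_neg, inner_neg_left,
      real_inner_comm (toL2 L p) φ, real_inner_comm φ (mulL2 L (F.I t) φ)]
    simp only [conj_trivial]
    ring
  have h1 : M⁻¹ * F.Ξ t ≤ inner ℝ φ (mulL2 L (F.I t) φ) := by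
    refine mul_sq_norm_le_inner_mulL2 (fun y => ?_) φ
    rw [inv_le_iff_one_le_mul₀ (by linarith), ← F.J_mul_I t ht y, mul_comm]
    exact mul_le_mul_of_nonneg_left (hM.J_le t ht y) (F.I_pos ht y).le
  have h2 := inner_le_young φ (toL2 L p) (η := 1 / (4 * M)) (by positivity)
  have h3 : ‖toL2 L p‖ ^ 2 ≤ M ^ 3 * C ^ 2 := by
    have hC0 : 0 ≤ C := (sq_nonneg _).trans (hC.norm_vy_le t ht)
    rw [norm_sq_toL2]
    have h := integL_mono (L := L) (f := p ^ 2) (g := (M ^ 3 * C) • (F.ϑy t ^ 2 * F.I t))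
      fun y => by
      change (F.I t y ^ 2 * F.vy t y * F.ϑy t y) ^ 2 ≤ M ^ 3 * C * (F.ϑy t y ^ 2 * F.I t y)
      have a1 := F.I_pos ht y
      have a2 := hM.I_le t ht y
      have a3 : F.vy t y ^ 2 ≤ C := by
        refine le_trans ?_ (hC.norm_vy_le t ht)
        rw [← sq_abs]
        have := (F.vy t).norm_coe_le y
        gcongr
      calc _ = F.I t y ^ 3 * F.vy t y ^ 2 * (F.ϑy t y ^ 2 * F.I t y) := by ring
        _ ≤ _ := by gcongr
    rw [map_smul, smul_eq_mul] at h
    refine h.trans ?_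
    calc _ ≤ M ^ 3 * C * C := by have := hC.D_le t ht; gcongr; exact this
      _ = _ := by ring
  have h4 : 1 / (4 * (1 / (4 * M))) * ‖toL2 L p‖ ^ 2 ≤ M ^ 4 * C ^ 2 := by
    calc _ ≤ 1 / (4 * (1 / (4 * M))) * (M ^ 3 * C ^ 2) := by gcongr
      _ = _ := by field_simp
  have h5 : inner ℝ φ (toL2 L p) - inner ℝ φ (mulL2 L (F.I t) φ) ≤
      -(3 / (4 * M) * F.Ξ t) + M ^ 4 * C ^ 2 := by
    have e3 : 3 / (4 * M) * F.Ξ t = M⁻¹ * F.Ξ t - 1 / (4 * M) * F.Ξ t := by field_simp; ring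
    change _ ≤ 1 / (4 * M) * F.Ξ t + _ at h2
    linarith
  rw [e]
  calc _ = κ * (inner ℝ φ (toL2 L p) - inner ℝ φ (mulL2 L (F.I t) φ)) := by ring
    _ ≤ κ * (-(3 / (4 * M) * F.Ξ t) + M ^ 4 * C ^ 2) := by gcongr
    _ = _ := by ring

/-- Young's inequality for the heat source, with the small weight `η` on `∂_t ϑ`. -/
theorem inner_St_le (hM : F.Tame M) (hC : F.RateBounded C) {t : ℝ} (ht : t ∈ Icc 0 T) {η : ℝ}
    (hη : 0 < η) : inner ℝ (F.St t) ((F.ϑt t).d 0) ≤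
      4 * M ^ 2 * η * (F.Θ t + F.Ξ t) + C / (4 * η) * (F.V t + (2 * M ^ 2 * μ ^ 2 * F.V t +
      (4 * R ^ 2 * M ^ 3 * F.Θ t + 4 * M ^ 3 * C))) := by
  have hC0 : 0 ≤ C := (sq_nonneg _).trans (hC.norm_vy_le t ht)
  have h1 := inner_le_young ((F.ϑt t).d 0) (mulL2 L (F.G t) ((F.vt t).d 1)) hη
  have h2 := inner_le_young ((F.ϑt t).d 0) (mulL2 L (F.vy t) (F.Gt t)) hη
  have h3 := mul_le_mul_of_nonneg_left (hM.sq_norm_ϑt_le t) hη.le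
  have h4 : ‖mulL2 L (F.G t) ((F.vt t).d 1)‖ ^ 2 ≤ C * F.V t :=
    (sq_norm_mulL2_le_norm _ _).trans
      (mul_le_mul_of_nonneg_right (hC.norm_G_le t ht) (sq_nonneg _))
  have h5 : ‖mulL2 L (F.vy t) (F.Gt t)‖ ^ 2 ≤ C * (2 * M ^ 2 * μ ^ 2 * F.V t +
      (4 * R ^ 2 * M ^ 3 * F.Θ t + 4 * M ^ 3 * C)) :=
    (sq_norm_mulL2_le_norm _ _).trans (mul_le_mul (hC.norm_vy_le t ht) (sq_norm_Gt_le hM hC ht)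
      (sq_nonneg _) hC0)
  have h6 := mul_le_mul_of_nonneg_left (add_le_add h4 h5) (show 0 ≤ 1 / (4 * η) by positivity)
  rw [St, inner_add_left, real_inner_comm, real_inner_comm ((F.ϑt t).d 0)]
  calc _ ≤ 2 * (η * (2 * M ^ 2 * (F.Θ t + F.Ξ t))) + 1 / (4 * η) * (C * F.V t +
        C * (2 * M ^ 2 * μ ^ 2 * F.V t + (4 * R ^ 2 * M ^ 3 * F.Θ t + 4 * M ^ 3 * C))) := by
        linarith
    _ = _ := by ring

/-- The bounds for `√ρ ∂_t ϑ` and `∂_t ∂_y ϑ`. -/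
theorem exists_heat_rate_le (R c_v μ κ T M C : ℝ) (hM1 : 1 ≤ M) (hc : 0 < c_v) (hκ : 0 < κ)
    (hT : 0 < T) : ∃ C' : ℝ,
      ∀ {L : ℝ} (F : Flow R c_v μ κ T L), F.Tame M → F.RateBounded C →
        (∀ᵐ t ∂leb T, F.Θ t ≤ C') ∧ ∫ s in (0 : ℝ)..T, F.Ξ s ≤ C' := by
  have hM0 : 0 < M := by linarith
  obtain ⟨η, hη⟩ : ∃ η, η = κ / (16 * M ^ 3) := ⟨_, rfl⟩
  have hη0 : 0 < η := hη ▸ by positivity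
  obtain ⟨b, hb⟩ : ∃ b, b = |C| / (4 * η) := ⟨_, rfl⟩
  have hb0 : 0 ≤ b := hb ▸ by positivity
  obtain ⟨B, hB⟩ : ∃ B, B = 4 * M ^ 2 * η + b * (1 + 2 * M ^ 2 * μ ^ 2 + 4 * R ^ 2 * M ^ 3 +
    4 * M ^ 3 * |C|) + κ * M ^ 4 * C ^ 2 := ⟨_, rfl⟩
  have hB0 : 0 ≤ B := hB ▸ by positivity
  obtain ⟨A, hA⟩ : ∃ A, A = (M / c_v + 2 * B * (T + |C|)) / c_v := ⟨_, rfl⟩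
  have hA0 : 0 ≤ A := hA ▸ by positivity
  obtain ⟨X, hX⟩ : ∃ X, X = A * Real.exp (2 * B / c_v * T) := ⟨_, rfl⟩
  have hX0 : 0 ≤ X := hX ▸ by positivity
  refine ⟨X + c_v * X * M / κ, fun {L} F hM hC => ?_⟩
  have hC0 : 0 ≤ C := (sq_nonneg _).trans (hC.norm_vy_le 0 F.zero_mem)
  rw [abs_of_nonneg hC0] at hb hB hA
  have bound : ∀ s ∈ Icc 0 T, inner ℝ (F.St s) ((F.ϑt s).d 0) - inner ℝ (F.Qt s) ((F.ϑt s).d 1) ≤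
      (B + B * F.V s) + (B * F.Θ s + -(κ / (2 * M)) * F.Ξ s) := by
    intro s hs
    have h1 := neg_inner_Qt_le hM hC hs
    have h2 := inner_St_le hM hC hs hη0
    rw [← hb] at h2
    have e1 : 4 * M ^ 2 * η * F.Ξ s = κ / (4 * M) * F.Ξ s := by rw [hη]; field_simp; norm_num
    have e2 : 3 * κ / (4 * M) * F.Ξ s = κ / (4 * M) * F.Ξ s + κ / (2 * M) * F.Ξ s := by
      field_simp; ring
    have hV := F.V_nonneg s
    have hΘ := F.Θ_nonneg s
    have b1 : b * (1 + 2 * M ^ 2 * μ ^ 2) ≤ B := by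
      have : 0 ≤ 4 * M ^ 2 * η + b * (4 * R ^ 2 * M ^ 3 + 4 * M ^ 3 * C) + κ * M ^ 4 * C ^ 2 := by
        positivity
      rw [hB]; linarith
    have b2 : 4 * M ^ 2 * η + b * (4 * R ^ 2 * M ^ 3) ≤ B := by
      have : 0 ≤ b * (1 + 2 * M ^ 2 * μ ^ 2 + 4 * M ^ 3 * C) + κ * M ^ 4 * C ^ 2 := by positivity
      rw [hB]; linarith
    have b3 : b * (4 * M ^ 3 * C) + κ * M ^ 4 * C ^ 2 ≤ B := by
      have : 0 ≤ 4 * M ^ 2 * η + b * (1 + 2 * M ^ 2 * μ ^ 2 + 4 * R ^ 2 * M ^ 3) := by positivity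
      rw [hB]; linarith
    have c1 := mul_le_mul_of_nonneg_right b1 hV
    have c2 := mul_le_mul_of_nonneg_right b2 hΘ
    linarith
  have iV := F.intervalIntegrable_V
  have iΘ := F.intervalIntegrable_Θ
  have iΞ := F.intervalIntegrable_Ξ
  have i0 : IntervalIntegrable (fun t => inner ℝ (F.St t) ((F.ϑt t).d 0) -
      inner ℝ (F.Qt t) ((F.ϑt t).d 1)) volume 0 T :=
    (intervalIntegrable_inner hT.le F.memLp_St ((dL L 1 0).comp_memLp' F.ϑt_mem)).sub
      (intervalIntegrable_inner hT.le F.memLp_Qt ((dL L 1 1).comp_memLp' F.ϑt_mem))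
  have iB : IntervalIntegrable (fun _ => B) volume 0 T := by simp
  have key : ∀ᵐ t ∂leb T, c_v * F.Θ t + κ / M * ∫ s in (0 : ℝ)..t, F.Ξ s ≤
      c_v * (A + ∫ s in (0 : ℝ)..t, 2 * B / c_v * F.Θ s) := by
    filter_upwards [F.Θ_le, ae_restrict_mem measurableSet_Ioo] with t hW ht
    have ht' := Ioo_subset_Icc_self ht
    have m := intervalIntegral_mono_ae ht' i0
      ((iB.add (iV.const_mul B)).add ((iΘ.const_mul B).add (iΞ.const_mul (-(κ / (2 * M))))))
      ((ae_restrict_mem measurableSet_Ioo).mono fun s hs => bound s (Ioo_subset_Icc_self hs))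
    have q {f : ℝ → ℝ} (hf : IntervalIntegrable f volume 0 T) : IntervalIntegrable f volume 0 t :=
      intervalIntegrable_of_mem hf F.zero_mem ht'
    rw [intervalIntegral.integral_add ((q iB).add (q (iV.const_mul B)))
        ((q (iΘ.const_mul B)).add (q (iΞ.const_mul _))),
      intervalIntegral.integral_add (q iB) (q (iV.const_mul B)),
      intervalIntegral.integral_add (q (iΘ.const_mul B)) (q (iΞ.const_mul _))] at m
    simp only [intervalIntegral.integral_const_mul, intervalIntegral.integral_const, smul_eq_mul,
      sub_zero] at m ⊢
    have b1 : ∫ s in (0 : ℝ)..t, F.V s ≤ C :=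
      (intervalIntegral.integral_mono_interval le_rfl ht'.1 ht'.2
        (Eventually.of_forall fun s => F.V_nonneg s) iV).trans hC.V_int
    have b2 := mul_le_mul_of_nonneg_left (add_le_add ht'.2 b1) hB0
    have b3 : ‖F.h0‖ ^ 2 / c_v ≤ M / c_v := by have := hM.h₀_le; gcongr
    have e : c_v * (A + 2 * B / c_v * ∫ s in (0 : ℝ)..t, F.Θ s) =
      M / c_v + 2 * B * (T + C) + 2 * B * ∫ s in (0 : ℝ)..t, F.Θ s := by
      rw [hA]; field_simp
    have e2 : κ / M * ∫ s in (0 : ℝ)..t, F.Ξ s = 2 * (κ / (2 * M) * ∫ s in (0 : ℝ)..t, F.Ξ s) := by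
      field_simp
    rw [e, e2]
    linarith
  have hΞn : ∀ t ∈ Icc 0 T, 0 ≤ ∫ s in (0 : ℝ)..t, F.Ξ s := fun t ht =>
    intervalIntegral.integral_nonneg ht.1 fun s _ => F.Ξ_nonneg s
  have hg := gronwall_integral (f := F.Θ) (a := fun _ => 2 * B / c_v) (A := A) hT.le (by simp)
    (Eventually.of_forall fun t => by positivity) (iΘ.const_mul _) (by
      filter_upwards [key, ae_restrict_mem measurableSet_Ioo] with t h ht
      have h2 : 0 ≤ κ / M * ∫ s in (0 : ℝ)..t, F.Ξ s :=
        mul_nonneg (by positivity) (hΞn t (Ioo_subset_Icc_self ht))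
      exact le_of_mul_le_mul_left (by linarith) hc)
  have key3 : ∀ᵐ t ∂leb T, c_v * F.Θ t + κ / M * ∫ s in (0 : ℝ)..t, F.Ξ s ≤ c_v * X := by
    filter_upwards [key, ae_restrict_mem measurableSet_Ioo] with t h ht
    have ht' := Ioo_subset_Icc_self ht
    refine h.trans (mul_le_mul_of_nonneg_left ((hg t ht').trans ?_) hc.le)
    rw [hX, intervalIntegral.integral_const, smul_eq_mul, sub_zero, mul_comm t]
    have := ht'.2
    gcongr
  have hp : 0 ≤ c_v * X * M / κ := by positivity
  refine ⟨?_, (intervalIntegral_le_of_ae_le hT iΞ (C := c_v * X * M / κ) ?_).trans (by linarith)⟩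
  · filter_upwards [key3, ae_restrict_mem measurableSet_Ioo] with t h ht
    have h2 : 0 ≤ κ / M * ∫ s in (0 : ℝ)..t, F.Ξ s :=
      mul_nonneg (by positivity) (hΞn t (Ioo_subset_Icc_self ht))
    have := le_of_mul_le_mul_left (show c_v * F.Θ t ≤ c_v * X by linarith) hc
    linarith
  · filter_upwards [key3] with t h
    have h2 := mul_nonneg hc.le (F.Θ_nonneg t)
    rw [le_div_iff₀ hκ]
    have h3 : κ / M * ∫ s in (0 : ℝ)..t, F.Ξ s ≤ c_v * X := by linarith
    rw [div_mul_eq_mul_div, div_le_iff₀ hM0] at h3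
    linarith

end Flow

/-! ### Second and third space derivatives -/

section Calculus

variable {L : ℝ} {u u' : CB} {f f' : L2 L}

/-- The continuous function `u` has the `L²` derivative `f` on `(0, L)`. -/
def HasDerivL2 (u : CB) (f : L2 L) : Prop := IsPrimitiveOn L u f

theorem IsPrimitiveOn.hasDerivL2 {w : CB} (h : IsPrimitiveOn L u w) : HasDerivL2 u (toL2 L w) :=
  h.congr_ae (toL2_coe w).symm

theorem hasDerivL2_evL (hL : 0 < L) (f : H L 1) : HasDerivL2 (evL hL f) (f.d 1) :=
  evL_isPrimitiveOn hL f

namespace HasDerivL2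

theorem add (h : HasDerivL2 u f) (h' : HasDerivL2 u' f') : HasDerivL2 (u + u') (f + f') :=
  (IsPrimitiveOn.add h h').congr_ae (Lp.coeFn_add f f').symm

theorem sub (h : HasDerivL2 u f) (h' : HasDerivL2 u' f') : HasDerivL2 (u - u') (f - f') :=
  (IsPrimitiveOn.sub h h').congr_ae (Lp.coeFn_sub f f').symm

theorem smul (c : ℝ) (h : HasDerivL2 u f) : HasDerivL2 (c • u) (c • f) :=
  (IsPrimitiveOn.const_smul c h).congr_ae (Lp.coeFn_smul c f).symm

theorem mul (h : HasDerivL2 u f) (h' : HasDerivL2 u' f') :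
    HasDerivL2 (u * u') (mulL2 L u' f + mulL2 L u f') := by
  refine (IsPrimitiveOn.mul h h').congr_ae ?_
  filter_upwards [Lp.coeFn_add (mulL2 L u' f) (mulL2 L u f'), mulL2_coe u' f, mulL2_coe u f']
    with y h1 h2 h3
  rw [h1, Pi.add_apply, h2, h3, mul_comm (u' y)]

theorem congr (hL : 0 < L) (h : HasDerivL2 u f) (he : toL2 L u = toL2 L u') : HasDerivL2 u' f := by
  refine IsPrimitiveOn.congr_left h ?_
  refine eqOn_Icc_of_ae_eq hL u'.continuous.continuousOn u.continuous.continuousOn ?_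
  have h1 := toL2_coe (L := L) u'
  rw [← he] at h1
  exact h1.symm.trans (toL2_coe u)

theorem unique (h : HasDerivL2 u f) (h' : HasDerivL2 u f') : f = f' :=
  Lp.ext (IsPrimitiveOn.ae_eq h h')

end HasDerivL2

end Calculus

/-- The second and third derivatives in a flow. -/
structure Flow.Smooth {R c_v μ κ T L : ℝ} (F : Flow R c_v μ κ T L) where
  /-- The second derivative of the density. -/
  ρ'' : L2 L
  /-- The space derivative of the Jacobian. -/
  Jy : ℝ → CB
  /-- The second space derivative of the Jacobian. -/
  Jyy : ℝ → L2 L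
  /-- The second space derivative of the velocity. -/
  vyy : ℝ → L2 L
  /-- The second space derivative of the temperature. -/
  ϑyy : ℝ → L2 L
  /-- The third space derivative of the velocity. -/
  vyyy : ℝ → L2 L
  /-- The third space derivative of the temperature. -/
  ϑyyy : ℝ → L2 L
  ϑy_clamp : ∀ t y, F.ϑy t (clamp L y) = F.ϑy t y
  ρ'_space : HasDerivL2 F.ρ' ρ''
  J_space : ∀ t, IsPrimitiveOn L (F.J t) (Jy t)
  Jy_space : ∀ t, HasDerivL2 (Jy t) (Jyy t)
  vy_space : ∀ t, HasDerivL2 (F.vy t) (vyy t)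
  ϑy_space : ∀ t, HasDerivL2 (F.ϑy t) (ϑyy t)
  vyy_space : ∀ᵐ t ∂leb T, ∃ N : CB, toL2 L N = vyy t ∧ HasDerivL2 N (vyyy t)
  ϑyy_space : ∀ᵐ t ∂leb T, ∃ N : CB, toL2 L N = ϑyy t ∧ HasDerivL2 N (ϑyyy t)
  Jy_time : IsPrimitiveOn T (fun t => toL2 L (Jy t)) vyy
  Jyy_time : IsPrimitiveOn T Jyy vyyy
  vyy_cont : ContinuousOn vyy (Icc 0 T)
  ϑyy_cont : ContinuousOn ϑyy (Icc 0 T)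
  vyyy_mem : MemLp vyyy 2 (leb T)
  ϑyyy_mem : MemLp ϑyyy 2 (leb T)

namespace Flow.Smooth

variable {R c_v μ κ T L : ℝ} {F : Flow R c_v μ κ T L} (A : F.Smooth)

theorem Jy_zero : toL2 L (A.Jy 0) = 0 := by
  have h := (A.J_space 0).hasDerivL2
  rw [F.J_zero] at h
  exact h.unique ((IsPrimitiveOn.const F.L_pos.le (1 : ℝ)).congr_ae (Lp.coeFn_zero ..).symm)

theorem Jyy_zero : A.Jyy 0 = 0 := by
  have h := (A.Jy_space 0).congr F.L_pos (u' := 0) (by rw [A.Jy_zero, map_zero])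
  exact h.unique ((IsPrimitiveOn.const F.L_pos.le (0 : ℝ)).congr_ae (Lp.coeFn_zero ..).symm)

/-- The continuous representative of `∂_y² v`, from the momentum equation. -/
def Nv (t : ℝ) : CB :=
  μ⁻¹ • (R • (F.ρ' * F.ϑ t + F.ρ * F.ϑy t) + (A.Jy t * F.G t + F.J t * (F.ρ * F.w t)))

/-- The continuous representative of `∂_y² ϑ`, from the energy equation. -/
def Nϑ (t : ℝ) : CB :=
  κ⁻¹ • (A.Jy t * F.Q t + F.J t * (c_v • (F.ρ * F.θ t) - F.vy t * F.G t))

theorem vyy_eq : ∀ᵐ t ∂leb T, A.vyy t = toL2 L (A.Nv t) := by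
  filter_upwards [F.G_space, ae_restrict_mem measurableSet_Ioo] with t hG ht
  have hμ := F.μ_pos.ne'
  have h1 := (A.J_space t).hasDerivL2.mul hG.hasDerivL2
  have h2 := (F.ρ_space.hasDerivL2.mul (F.ϑ_space t).hasDerivL2).smul R
  have h3 := (h1.add h2).smul μ⁻¹
  have e : μ⁻¹ • (F.J t * F.G t + R • (F.ρ * F.ϑ t)) = F.vy t := by
    ext y
    change μ⁻¹ * (F.J t y * F.G t y + R * (F.ρ y * F.ϑ t y)) = F.vy t y
    rw [F.J_mul_G (Ioo_subset_Icc_self ht) y]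
    field_simp
    ring
  rw [e] at h3
  rw [(A.vy_space t).unique h3, mulL2_toL2, mulL2_toL2, mulL2_toL2, mulL2_toL2, ← map_add,
    ← map_add, ← (toL2 L).map_smul, ← map_add, ← (toL2 L).map_smul, Nv]
  congr 1
  ext y
  change μ⁻¹ * (F.G t y * A.Jy t y + F.J t y * (F.ρ y * F.w t y) +
      R * (F.ϑ t y * F.ρ' y + F.ρ y * F.ϑy t y)) =
    μ⁻¹ * (R * (F.ρ' y * F.ϑ t y + F.ρ y * F.ϑy t y) +
      (A.Jy t y * F.G t y + F.J t y * (F.ρ y * F.w t y)))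
  ring

theorem ϑyy_eq : ∀ᵐ t ∂leb T, A.ϑyy t = toL2 L (A.Nϑ t) := by
  filter_upwards [F.Q_space, ae_restrict_mem measurableSet_Ioo] with t hQ ht
  have hκ := F.κ_pos.ne'
  have h3 := ((A.J_space t).hasDerivL2.mul hQ.hasDerivL2).smul κ⁻¹
  have e : κ⁻¹ • (F.J t * F.Q t) = F.ϑy t := by
    ext y
    change κ⁻¹ * (F.J t y * (κ * (F.ϑy t y * F.I t y))) = F.ϑy t y
    have := F.J_mul_I t (Ioo_subset_Icc_self ht) y
    calc _ = (κ⁻¹ * κ) * F.ϑy t y * (F.J t y * F.I t y) := by ring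
      _ = _ := by rw [this, inv_mul_cancel₀ hκ, one_mul, mul_one]
  rw [e] at h3
  rw [(A.ϑy_space t).unique h3, mulL2_toL2, mulL2_toL2, ← map_add, ← (toL2 L).map_smul, Nϑ,
    mul_comm (F.Q t)]

theorem vyyy_eq : ∀ᵐ t ∂leb T, A.vyyy t = μ⁻¹ • (R • ((mulL2 L (F.ϑ t) A.ρ'' +
      toL2 L (F.ρ' * F.ϑy t)) + (toL2 L (F.ϑy t * F.ρ') + mulL2 L F.ρ (A.ϑyy t))) +
    ((mulL2 L (F.G t) (A.Jyy t) + toL2 L (A.Jy t * (F.ρ * F.w t))) +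
      (toL2 L ((F.ρ * F.w t) * A.Jy t) + mulL2 L (F.J t) (toL2 L (F.w t * F.ρ') +
        mulL2 L F.ρ ((F.vt t).d 1))))) := by
  filter_upwards [A.vyy_eq, A.vyy_space, F.G_space] with t h1 ⟨N, hN, h2⟩ hG
  have h3 := h2.congr F.L_pos (hN.trans h1)
  have h4 := ((((A.ρ'_space.mul (F.ϑ_space t).hasDerivL2).add
    (F.ρ_space.hasDerivL2.mul (A.ϑy_space t))).smul R).add
    (((A.Jy_space t).mul hG.hasDerivL2).add ((A.J_space t).hasDerivL2.mul
      (F.ρ_space.hasDerivL2.mul (hasDerivL2_evL F.L_pos (F.vt t)))))).smul μ⁻¹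
  rw [h3.unique h4]
  simp only [mulL2_toL2]
  rfl

theorem ϑyyy_eq : ∀ᵐ t ∂leb T, A.ϑyyy t = κ⁻¹ • ((mulL2 L (F.Q t) (A.Jyy t) +
      toL2 L (A.Jy t * (c_v • (F.ρ * F.θ t) - F.vy t * F.G t))) +
    (toL2 L ((c_v • (F.ρ * F.θ t) - F.vy t * F.G t) * A.Jy t) + mulL2 L (F.J t)
      (c_v • (toL2 L (F.θ t * F.ρ') + mulL2 L F.ρ ((F.ϑt t).d 1)) -
        (mulL2 L (F.G t) (A.vyy t) + toL2 L (F.vy t * (F.ρ * F.w t)))))) := by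
  filter_upwards [A.ϑyy_eq, A.ϑyy_space, F.G_space, F.Q_space] with t h1 ⟨N, hN, h2⟩ hG hQ
  have h3 := h2.congr F.L_pos (hN.trans h1)
  have h4 := (((A.Jy_space t).mul hQ.hasDerivL2).add ((A.J_space t).hasDerivL2.mul
      (((F.ρ_space.hasDerivL2.mul (hasDerivL2_evL F.L_pos (F.ϑt t))).smul c_v).sub
        ((A.vy_space t).mul hG.hasDerivL2)))).smul κ⁻¹
  rw [h3.unique h4]
  simp only [mulL2_toL2]
  rfl

end Flow.Smooth

/-! ### Bounds in a form without weights -/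

theorem le_one_add_of_sq_le {x C : ℝ} (h : x ^ 2 ≤ C) : x ≤ 1 + C := by
  nlinarith [sq_nonneg (x - 1)]

theorem HasDerivL2.sq_norm_le {L : ℝ} (hL : 0 < L) {u : CB} {f : L2 L} (h : HasDerivL2 u f)
    (hu : ∀ y, u (clamp L y) = u y) (h0 : u 0 = 0) : ‖u‖ ^ 2 ≤ L * ‖f‖ ^ 2 := by
  refine CB.sq_norm_le_of_clamp hL hu fun y hy => ?_
  have h1 := (IsPrimitiveOn.abs_sub_le h ⟨le_rfl, hL.le⟩ hy).trans (L2.integral_abs_le hL.le f)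
  rw [h0, sub_zero] at h1
  rw [← sq_abs]
  calc _ ≤ (Real.sqrt L * ‖f‖) ^ 2 := by gcongr
    _ = _ := by rw [mul_pow, Real.sq_sqrt hL.le]

theorem norm_smul_le_of_le' {E : Type*} [NormedAddCommGroup E] [NormedSpace ℝ E] {r a b : ℝ} {x : E}
    (hr : |r| ≤ a) (hx : ‖x‖ ≤ b) : ‖r • x‖ ≤ a * b := by
  rw [norm_smul]
  exact mul_le_mul hr hx (norm_nonneg _) ((abs_nonneg r).trans hr)

theorem norm_toL2_le {L B : ℝ} (hL : 0 < L) (hB : 1 ≤ B) (hLB : L ≤ B) (f : CB) :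
    ‖toL2 L f‖ ≤ B * ‖f‖ := by
  refine le_of_sq_le_sq ?_ (by positivity)
  rw [norm_sq_toL2, mul_pow]
  refine (integL_sq_le hL f).trans ?_
  have : L ≤ B ^ 2 := by nlinarith
  gcongr

theorem norm_mulL2_le {L : ℝ} (a : CB) (f : L2 L) : ‖mulL2 L a f‖ ≤ ‖a‖ * ‖f‖ := by
  refine le_of_sq_le_sq ?_ (by positivity)
  rw [mul_pow]
  exact sq_norm_mulL2_le_norm a f

theorem norm_toL2_mul_le {L : ℝ} (a b : CB) : ‖toL2 L (a * b)‖ ≤ ‖a‖ * ‖toL2 L b‖ := by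
  rw [← mulL2_toL2]
  exact norm_mulL2_le a _

namespace Flow.Smooth

variable {R c_v μ κ T L : ℝ} {F : Flow R c_v μ κ T L} {M C C' B : ℝ}

/-- The bounds from which the estimates of the second and third space derivatives follow. -/
structure Regular (A : F.Smooth) (B : ℝ) : Prop where
  one_le : 1 ≤ B
  L_le : L ≤ B
  R_le : R ≤ B
  c_le : c_v ≤ B
  inv_μ_le : μ⁻¹ ≤ B
  inv_κ_le : κ⁻¹ ≤ B
  ρ_le : ‖F.ρ‖ ≤ B
  ρ'_le : ‖F.ρ'‖ ≤ B
  ρ''_le : ‖A.ρ''‖ ≤ B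
  J_le : ∀ t ∈ Icc 0 T, ‖F.J t‖ ≤ B
  vy_le : ∀ t ∈ Icc 0 T, ‖F.vy t‖ ≤ B
  ϑ_le : ∀ t ∈ Icc 0 T, ‖F.ϑ t‖ ≤ B
  G_le : ∀ t ∈ Icc 0 T, ‖F.G t‖ ≤ B
  ϑy_le : ∀ t ∈ Icc 0 T, ‖toL2 L (F.ϑy t)‖ ≤ B
  Gy_le : ∀ᵐ t ∂leb T, ‖toL2 L (F.ρ * F.w t)‖ ≤ B
  Qy_le : ∀ᵐ t ∂leb T, ‖toL2 L (c_v • (F.ρ * F.θ t) - F.vy t * F.G t)‖ ≤ B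
  Q_le : ∀ᵐ t ∂leb T, ‖F.Q t‖ ≤ B
  w_le : ∀ᵐ t ∂leb T, ‖F.w t‖ ≤ B * ‖(F.vt t).d 1‖
  θ_le : ∀ᵐ t ∂leb T, ‖F.θ t‖ ≤ B * (1 + ‖(F.ϑt t).d 1‖)
  V_int : ∫ s in (0 : ℝ)..T, F.V s ≤ B
  Ξ_int : ∫ s in (0 : ℝ)..T, F.Ξ s ≤ B

/-- All bounds of `Regular` follow from those of the rates. -/
theorem exists_regular (R c_v μ κ T M C C' K : ℝ) : ∃ B : ℝ, 1 ≤ B ∧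
    ∀ {L : ℝ} (F : Flow R c_v μ κ T L) (A : F.Smooth), F.Tame M → F.RateBounded C →
      (∀ᵐ t ∂leb T, F.Θ t ≤ C') → ∫ s in (0 : ℝ)..T, F.Ξ s ≤ C' → ‖A.ρ''‖ ≤ K →
      A.Regular B := by
  obtain ⟨X, hX⟩ : ∃ X, X = |c_v| * (1 + |M| * |C'|) + (1 + |M| * |C|) := ⟨_, rfl⟩
  have hX0 : 0 ≤ X := hX ▸ by positivity
  obtain ⟨B, hB⟩ : ∃ B, B = 1 + 2 * |M| + 2 * |M| * |C'| + |R| + |c_v| + |μ⁻¹| + |κ⁻¹| + |K| + |C| +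
    |C'| + |M| * |C| + X + |M| * X ^ 2 := ⟨_, rfl⟩
  have p1 := abs_nonneg M
  have p2 := abs_nonneg R
  have p3 := abs_nonneg c_v
  have p4 := abs_nonneg μ⁻¹
  have p5 := abs_nonneg κ⁻¹
  have p6 := abs_nonneg K
  have p7 := abs_nonneg C
  have p8 := abs_nonneg C'
  have p9 := mul_nonneg p1 p8
  have p10 := mul_nonneg p1 p7
  have p11 : 0 ≤ |M| * X ^ 2 := by positivity
  have hB1 : 1 ≤ B := by linarith
  have hBB : B ≤ B ^ 2 := le_self_pow₀ hB1 two_ne_zero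
  refine ⟨B, hB1, fun {L} F A hM hC hΘ hΞ hK => ?_⟩
  have hMM : |M| = M := abs_of_pos (by linarith [hM.one_le])
  have hMB : M ≤ B := by rw [← hMM]; linarith
  have hC' : C' ≤ |C'| := le_abs_self _
  have hCa : C ≤ |C| := le_abs_self _
  have hM0 : 0 < M := by linarith [hM.one_le]
  have hvy : ∀ᵐ t ∂leb T, ‖toL2 L (c_v • (F.ρ * F.θ t) - F.vy t * F.G t)‖ ≤ X := by
    filter_upwards [hΘ, ae_restrict_mem measurableSet_Ioo] with t h1 ht
    have ht' := Ioo_subset_Icc_self ht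
    have a1 : ‖toL2 L (F.ρ * F.θ t)‖ ≤ 1 + |M| * |C'| := by
      refine le_one_add_of_sq_le ?_
      rw [norm_sq_toL2, hMM]
      refine (integL_ρ_θ_le hM t).trans ?_
      have := h1.trans hC'
      gcongr
    have a2 : ‖toL2 L (F.vy t * F.G t)‖ ≤ 1 + |M| * |C| := by
      refine le_one_add_of_sq_le ?_
      rw [norm_sq_toL2, hMM]
      refine (integL_vy_G_le hM ht').trans ?_
      have := (hC.norm_vy_le t ht').trans hCa
      gcongr
    rw [map_sub, (toL2 L).map_smul, hX]
    exact (norm_sub_le _ _).trans (add_le_add (norm_smul_le_of_le' le_rfl a1) a2)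
  constructor
  · exact hB1
  · exact hM.L_le.trans hMB
  · linarith [le_abs_self R]
  · linarith [le_abs_self c_v]
  · linarith [le_abs_self μ⁻¹]
  · linarith [le_abs_self κ⁻¹]
  · refine (BoundedContinuousFunction.norm_le (by linarith)).2 fun y => ?_
    rw [Real.norm_eq_abs, abs_of_pos (F.ρ_pos y)]
    exact (hM.ρ_le y).trans hMB
  · refine (BoundedContinuousFunction.norm_le (by linarith)).2 fun y => ?_
    rw [Real.norm_eq_abs]
    exact (hM.ρ'_le y).trans hMB
  · linarith [le_abs_self K]
  · refine fun t ht => (BoundedContinuousFunction.norm_le (by linarith)).2 fun y => ?_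
    rw [Real.norm_eq_abs, abs_of_pos (F.J_pos t ht y)]
    exact (hM.J_le t ht y).trans hMB
  · intro t ht
    linarith [le_one_add_of_sq_le (hC.norm_vy_le t ht)]
  · intro t ht
    linarith [le_one_add_of_sq_le (hC.norm_ϑ_le t ht)]
  · intro t ht
    linarith [le_one_add_of_sq_le (hC.norm_G_le t ht)]
  · intro t ht
    have h1 : ‖toL2 L (F.ϑy t)‖ ^ 2 ≤ |M| * |C| := by
      have h := integL_mono (L := L) (f := F.ϑy t ^ 2) (g := M • (F.ϑy t ^ 2 * F.I t)) fun y => by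
        change F.ϑy t y ^ 2 ≤ M * (F.ϑy t y ^ 2 * F.I t y)
        have h1 := F.I_pos ht y
        have h2 := hM.J_le t ht y
        calc F.ϑy t y ^ 2 = F.ϑy t y ^ 2 * (F.J t y * F.I t y) := by rw [F.J_mul_I t ht, mul_one]
          _ ≤ F.ϑy t y ^ 2 * (M * F.I t y) := by gcongr
          _ = _ := by ring
      rw [map_smul, smul_eq_mul] at h
      rw [norm_sq_toL2, hMM]
      refine h.trans ?_
      have := (hC.D_le t ht).trans hCa
      exact mul_le_mul_of_nonneg_left this hM0.le
    linarith [le_one_add_of_sq_le h1]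
  · filter_upwards [hC.W_le] with t h1
    have h2 : ‖toL2 L (F.ρ * F.w t)‖ ^ 2 ≤ |M| * |C| := by
      have h := integL_mono (L := L) (f := (F.ρ * F.w t) ^ 2) (g := M • (F.ρ * F.w t ^ 2))
        fun y => by
        change (F.ρ y * F.w t y) ^ 2 ≤ M * (F.ρ y * F.w t y ^ 2)
        have h1 := hM.ρ_le y
        have h2 := F.ρ_pos y
        calc _ = F.ρ y * (F.ρ y * F.w t y ^ 2) := by ring
          _ ≤ _ := by gcongr
      rw [map_smul, smul_eq_mul] at h
      rw [norm_sq_toL2, hMM]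
      exact h.trans (mul_le_mul_of_nonneg_left (h1.trans hCa) hM0.le)
    linarith [le_one_add_of_sq_le h2]
  · filter_upwards [hvy] with t h
    linarith
  · filter_upwards [hvy, F.Q_space, ae_restrict_mem measurableSet_Ioo] with t h1 h2 ht
    have ht' := Ioo_subset_Icc_self ht
    have h3 := h2.hasDerivL2.sq_norm_le F.L_pos (fun y => by
      change κ * (F.ϑy t (clamp L y) * F.I t (clamp L y)) = κ * (F.ϑy t y * F.I t y)
      rw [A.ϑy_clamp, F.I_clamp ht']) (F.Q_bdry ht').1
    have h4 : ‖F.Q t‖ ^ 2 ≤ |M| * X ^ 2 := by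
      refine h3.trans ?_
      have := hM.L_le
      rw [hMM]
      gcongr
    linarith [le_one_add_of_sq_le h4]
  · filter_upwards [F.vt_bdry] with t h1
    have h2 := (hasDerivL2_evL F.L_pos (F.vt t)).sq_norm_le F.L_pos
      (fun y => evL_clamp F.L_pos (F.vt t) y) h1.1
    have h3 : ‖F.w t‖ ^ 2 ≤ L * ‖(F.vt t).d 1‖ ^ 2 := h2
    refine le_of_sq_le_sq (h3.trans ?_) (by positivity)
    rw [mul_pow]
    have : L ≤ B ^ 2 := (hM.L_le.trans hMB).trans hBB
    gcongr
  · filter_upwards [hΘ] with t h1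
    refine le_of_sq_le_sq ((hM.sq_norm_θ_le t).trans ?_) (by positivity)
    have h2 : 2 * M ≤ B ^ 2 := by linarith
    have h3 : 2 * M * C' ≤ B ^ 2 := by
      have : 2 * M * C' ≤ 2 * |M| * |C'| := by rw [hMM]; gcongr
      linarith
    have e : F.Ξ t = ‖(F.ϑt t).d 1‖ ^ 2 := rfl
    rw [e]
    have h4 := norm_nonneg ((F.ϑt t).d 1)
    generalize ‖(F.ϑt t).d 1‖ = x at *
    calc 2 * M * (F.Θ t + x ^ 2) ≤ 2 * M * (C' + x ^ 2) := by gcongr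
      _ = 2 * M * C' + 2 * M * x ^ 2 := by ring
      _ ≤ B ^ 2 + B ^ 2 * x ^ 2 := by gcongr
      _ ≤ B ^ 2 + B ^ 2 * x ^ 2 + 2 * B ^ 2 * x := by
        have : 0 ≤ 2 * B ^ 2 * x := by positivity
        linarith
      _ = _ := by ring
  · exact hC.V_int.trans (by linarith)
  · exact hΞ.trans (by linarith)

end Flow.Smooth

/-! ### Bounds for the second and third space derivatives -/

/-- Grönwall's inequality for curves starting at zero. -/
theorem IsPrimitiveOn.norm_le_of_deriv_le {E : Type*} [NormedAddCommGroup E] [NormedSpace ℝ E]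
    {T a β : ℝ} {u u' : ℝ → E} (h : IsPrimitiveOn T u u') (h0 : u 0 = 0) (ha : 0 ≤ a)
    {b : ℝ → ℝ} (hb : IntervalIntegrable b volume 0 T) (hb0 : ∀ t, 0 ≤ b t)
    (hbβ : ∫ s in (0 : ℝ)..T, b s ≤ β) (hu : ∀ᵐ t ∂leb T, ‖u' t‖ ≤ b t + a * ‖u t‖) :
    ∀ t ∈ Icc 0 T, ‖u t‖ ≤ β * Real.exp (a * T) := by
  have hT := h.nonneg
  have hβ : 0 ≤ β := le_trans (intervalIntegral.integral_nonneg hT fun s _ => hb0 s) hbβ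
  have iu : IntervalIntegrable (fun t => a * ‖u t‖) volume 0 T :=
    (continuousOn_const.mul h.continuousOn.norm).intervalIntegrable_of_Icc hT
  have key : ∀ t ∈ Icc 0 T, ‖u t‖ ≤ β + ∫ s in (0 : ℝ)..t, a * ‖u s‖ := by
    intro t ht
    have h1 := h.eq_add t ht
    rw [h0, zero_add] at h1
    have z : (0 : ℝ) ∈ Icc 0 T := ⟨le_rfl, hT⟩
    have h2 := intervalIntegral_mono_ae ht h.intble.norm (hb.add iu) hu
    rw [intervalIntegral.integral_add (intervalIntegrable_of_mem hb z ht)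
      (intervalIntegrable_of_mem iu z ht)] at h2
    have h3 : ∫ s in (0 : ℝ)..t, b s ≤ β :=
      (intervalIntegral.integral_mono_interval le_rfl ht.1 ht.2 (Eventually.of_forall hb0)
        hb).trans hbβ
    rw [h1]
    exact (intervalIntegral.norm_integral_le_integral_norm ht.1).trans
      (h2.trans (add_le_add_left h3 _))
  intro t ht
  refine (key t ht).trans ((gronwall_integral hT (by simp) (Eventually.of_forall fun _ => ha) iu
    ((ae_restrict_mem measurableSet_Ioo).mono fun s hs => key s (Ioo_subset_Icc_self hs)) t
    ht).trans ?_)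
  rw [intervalIntegral.integral_const, smul_eq_mul, sub_zero, mul_comm t]
  have := ht.2
  gcongr

theorem integral_sq_norm_le {E E' : Type*} [NormedAddCommGroup E] [NormedAddCommGroup E']
    {T p q : ℝ} (hT : 0 ≤ T) {f : ℝ → E} {g : ℝ → E'} (hf : MemLp f 2 (leb T))
    (hg : MemLp g 2 (leb T)) (h : ∀ᵐ t ∂leb T, ‖f t‖ ≤ p + q * ‖g t‖) :
    ∫ s in (0 : ℝ)..T, ‖f s‖ ^ 2 ≤ 2 * p ^ 2 * T + 2 * q ^ 2 * ∫ s in (0 : ℝ)..T, ‖g s‖ ^ 2 := by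
  have ig := Flow.intervalIntegrable_sq_norm hT hg
  have ip : IntervalIntegrable (fun _ => 2 * p ^ 2) volume 0 T := by simp
  have h1 := intervalIntegral_mono_ae ⟨hT, le_rfl⟩ (Flow.intervalIntegrable_sq_norm hT hf)
    (ip.add (ig.const_mul (2 * q ^ 2))) (by
      filter_upwards [h] with t ht
      have h1 : ‖f t‖ ^ 2 ≤ (p + q * ‖g t‖) ^ 2 := by gcongr
      nlinarith [sq_nonneg (p - q * ‖g t‖)])
  rw [intervalIntegral.integral_add ip (ig.const_mul _)] at h1
  simp only [intervalIntegral.integral_const_mul, intervalIntegral.integral_const, smul_eq_mul,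
    sub_zero] at h1
  linarith

theorem norm_toL2_mul_le' {L : ℝ} (a b : CB) : ‖toL2 L (a * b)‖ ≤ ‖b‖ * ‖toL2 L a‖ := by
  rw [mul_comm a]
  exact norm_toL2_mul_le b a

namespace Flow.Smooth

variable {R c_v μ κ T L : ℝ} {F : Flow R c_v μ κ T L} {A : F.Smooth} {B X Y : ℝ}

theorem Regular.norm_vyy_le (h : A.Regular B) : ∀ᵐ t ∂leb T, ‖A.vyy t‖ ≤
    B * (B * (B * (B * B) + B * B) + (B * ‖toL2 L (A.Jy t)‖ + B * B)) := by
  have hB : 0 ≤ B := by linarith [h.one_le]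
  filter_upwards [A.vyy_eq, h.Gy_le, ae_restrict_mem measurableSet_Ioo] with t h1 h2 ht
  have ht' := Ioo_subset_Icc_self ht
  rw [h1, Nv]
  simp only [map_add, map_smul]
  have hμ : |μ⁻¹| ≤ B := by rw [abs_of_pos (inv_pos.2 F.μ_pos)]; exact h.inv_μ_le
  have hR : |R| ≤ B := by rw [abs_of_pos F.R_pos]; exact h.R_le
  refine norm_smul_le_of_le' hμ (norm_add_le_of_le (norm_smul_le_of_le' hR
    (norm_add_le_of_le ?_ ?_)) (norm_add_le_of_le ?_ ?_))
  · exact (norm_toL2_mul_le _ _).trans (mul_le_mul h.ρ'_le ((norm_toL2_le F.L_pos h.one_le h.L_le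
      _).trans (mul_le_mul_of_nonneg_left (h.ϑ_le t ht') hB)) (norm_nonneg _) hB)
  · exact (norm_toL2_mul_le _ _).trans (mul_le_mul h.ρ_le (h.ϑy_le t ht') (norm_nonneg _) hB)
  · exact (norm_toL2_mul_le' _ _).trans (mul_le_mul_of_nonneg_right (h.G_le t ht') (norm_nonneg _))
  · exact (norm_toL2_mul_le _ _).trans (mul_le_mul (h.J_le t ht') h2 (norm_nonneg _) hB)

theorem Regular.norm_ϑyy_le (h : A.Regular B) : ∀ᵐ t ∂leb T, ‖A.ϑyy t‖ ≤
    B * (B * ‖toL2 L (A.Jy t)‖ + B * B) := by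
  have hB : 0 ≤ B := by linarith [h.one_le]
  filter_upwards [A.ϑyy_eq, h.Qy_le, h.Q_le, ae_restrict_mem measurableSet_Ioo] with t h1 h2 h3 ht
  have ht' := Ioo_subset_Icc_self ht
  have hκ : |κ⁻¹| ≤ B := by rw [abs_of_pos (inv_pos.2 F.κ_pos)]; exact h.inv_κ_le
  rw [h1, Nϑ, (toL2 L).map_smul, map_add]
  refine norm_smul_le_of_le' hκ (norm_add_le_of_le ?_ ?_)
  · exact (norm_toL2_mul_le' _ _).trans (mul_le_mul_of_nonneg_right h3 (norm_nonneg _))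
  · exact (norm_toL2_mul_le _ _).trans (mul_le_mul (h.J_le t ht') h2 (norm_nonneg _) hB)

theorem Regular.norm_vyyy_le (h : A.Regular B) (hX : ∀ t ∈ Icc 0 T, ‖toL2 L (A.Jy t)‖ ≤ X)
    (hY : ∀ t ∈ Icc 0 T, ‖A.ϑyy t‖ ≤ Y) : ∀ᵐ t ∂leb T, ‖A.vyyy t‖ ≤
    B * (B * ((B * B + B * B) + (B * B + B * Y)) +
      ((B * ‖A.Jyy t‖ + B * (B * ‖(F.vt t).d 1‖) * X) + (B * (B * ‖(F.vt t).d 1‖) * X +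
        B * ((B * ‖(F.vt t).d 1‖) * (B * B) + B * ‖(F.vt t).d 1‖)))) := by
  have hB : 0 ≤ B := by linarith [h.one_le]
  filter_upwards [A.vyyy_eq, h.w_le, ae_restrict_mem measurableSet_Ioo] with t h1 h2 ht
  have ht' := Ioo_subset_Icc_self ht
  have hμ : |μ⁻¹| ≤ B := by rw [abs_of_pos (inv_pos.2 F.μ_pos)]; exact h.inv_μ_le
  have hR : |R| ≤ B := by rw [abs_of_pos F.R_pos]; exact h.R_le
  have hw : ‖F.ρ * F.w t‖ ≤ B * (B * ‖(F.vt t).d 1‖) :=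
    (norm_mul_le _ _).trans (mul_le_mul h.ρ_le h2 (norm_nonneg _) hB)
  have hw0 : 0 ≤ B * (B * ‖(F.vt t).d 1‖) := by positivity
  rw [h1]
  refine norm_smul_le_of_le' hμ (norm_add_le_of_le (norm_smul_le_of_le' hR
    (norm_add_le_of_le (norm_add_le_of_le ?_ ?_) (norm_add_le_of_le ?_ ?_)))
    (norm_add_le_of_le (norm_add_le_of_le ?_ ?_) (norm_add_le_of_le ?_ ?_)))
  · exact (norm_mulL2_le _ _).trans (mul_le_mul (h.ϑ_le t ht') h.ρ''_le (norm_nonneg _) hB)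
  · exact (norm_toL2_mul_le _ _).trans (mul_le_mul h.ρ'_le (h.ϑy_le t ht') (norm_nonneg _) hB)
  · exact (norm_toL2_mul_le' _ _).trans (mul_le_mul h.ρ'_le (h.ϑy_le t ht') (norm_nonneg _) hB)
  · exact (norm_mulL2_le _ _).trans (mul_le_mul h.ρ_le (hY t ht') (norm_nonneg _) hB)
  · exact (norm_mulL2_le _ _).trans (mul_le_mul_of_nonneg_right (h.G_le t ht') (norm_nonneg _))
  · exact (norm_toL2_mul_le' _ _).trans (mul_le_mul hw (hX t ht') (norm_nonneg _) hw0)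
  · exact (norm_toL2_mul_le _ _).trans (mul_le_mul hw (hX t ht') (norm_nonneg _) hw0)
  · refine (norm_mulL2_le _ _).trans (mul_le_mul (h.J_le t ht') (norm_add_le_of_le ?_ ?_)
      (norm_nonneg _) hB)
    · exact (norm_toL2_mul_le _ _).trans (mul_le_mul h2 ((norm_toL2_le F.L_pos h.one_le h.L_le
        _).trans (mul_le_mul_of_nonneg_left h.ρ'_le hB)) (norm_nonneg _) (by positivity))
    · exact (norm_mulL2_le _ _).trans (mul_le_mul_of_nonneg_right h.ρ_le (norm_nonneg _))

theorem Regular.norm_ϑyyy_le (h : A.Regular B) (hX : ∀ t ∈ Icc 0 T, ‖toL2 L (A.Jy t)‖ ≤ X)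
    (hY : ∀ t ∈ Icc 0 T, ‖A.vyy t‖ ≤ Y) : ∀ᵐ t ∂leb T, ‖A.ϑyyy t‖ ≤
    B * ((B * ‖A.Jyy t‖ + (B * (B * (B * (1 + ‖(F.ϑt t).d 1‖))) + B * B) * X) +
      ((B * (B * (B * (1 + ‖(F.ϑt t).d 1‖))) + B * B) * X +
        B * (B * ((B * (1 + ‖(F.ϑt t).d 1‖)) * (B * B) + B * ‖(F.ϑt t).d 1‖) +
          (B * Y + B * B)))) := by
  have hB : 0 ≤ B := by linarith [h.one_le]
  filter_upwards [A.ϑyyy_eq, h.θ_le, h.Q_le, h.Gy_le, ae_restrict_mem measurableSet_Ioo]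
    with t h1 h2 h3 h4 ht
  have ht' := Ioo_subset_Icc_self ht
  have hκ : |κ⁻¹| ≤ B := by rw [abs_of_pos (inv_pos.2 F.κ_pos)]; exact h.inv_κ_le
  have hc : |c_v| ≤ B := by rw [abs_of_pos F.c_pos]; exact h.c_le
  have hq : ‖c_v • (F.ρ * F.θ t) - F.vy t * F.G t‖ ≤
      B * (B * (B * (1 + ‖(F.ϑt t).d 1‖))) + B * B :=
    norm_sub_le_of_le (norm_smul_le_of_le' hc ((norm_mul_le _ _).trans
      (mul_le_mul h.ρ_le h2 (norm_nonneg _) hB))) ((norm_mul_le _ _).trans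
      (mul_le_mul (h.vy_le t ht') (h.G_le t ht') (norm_nonneg _) hB))
  have hq0 : 0 ≤ B * (B * (B * (1 + ‖(F.ϑt t).d 1‖))) + B * B := by positivity
  rw [h1]
  refine norm_smul_le_of_le' hκ (norm_add_le_of_le (norm_add_le_of_le ?_ ?_)
    (norm_add_le_of_le ?_ ?_))
  · exact (norm_mulL2_le _ _).trans (mul_le_mul_of_nonneg_right h3 (norm_nonneg _))
  · exact (norm_toL2_mul_le' _ _).trans (mul_le_mul hq (hX t ht') (norm_nonneg _) hq0)
  · exact (norm_toL2_mul_le _ _).trans (mul_le_mul hq (hX t ht') (norm_nonneg _) hq0)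
  · refine (norm_mulL2_le _ _).trans (mul_le_mul (h.J_le t ht') (norm_sub_le_of_le
      (norm_smul_le_of_le' hc (norm_add_le_of_le ?_ ?_)) (norm_add_le_of_le ?_ ?_))
      (norm_nonneg _) hB)
    · exact (norm_toL2_mul_le _ _).trans (mul_le_mul h2 ((norm_toL2_le F.L_pos h.one_le h.L_le
        _).trans (mul_le_mul_of_nonneg_left h.ρ'_le hB)) (norm_nonneg _) (by positivity))
    · exact (norm_mulL2_le _ _).trans (mul_le_mul_of_nonneg_right h.ρ_le (norm_nonneg _))
    · exact (norm_mulL2_le _ _).trans (mul_le_mul (h.G_le t ht') (hY t ht') (norm_nonneg _) hB)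
    · exact (norm_toL2_mul_le _ _).trans (mul_le_mul (h.vy_le t ht') h4 (norm_nonneg _) hB)

/-- The second derivatives of `v` and `ϑ` are read off the equations up to `∂_y J`, which is bounded by
Gronwall's inequality, as `∂_t ∂_y J = ∂_y² v`. -/
theorem exists_second_derivative_le (T B : ℝ) (hT : 0 < T) (hB : 1 ≤ B) : ∃ C : ℝ, 0 ≤ C ∧
    ∀ {R c_v μ κ L : ℝ} (F : Flow R c_v μ κ T L) (A : F.Smooth), A.Regular B →
      (∀ t ∈ Icc 0 T, ‖toL2 L (A.Jy t)‖ ≤ C) ∧ (∀ t ∈ Icc 0 T, ‖A.vyy t‖ ≤ C) ∧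
        ∀ t ∈ Icc 0 T, ‖A.ϑyy t‖ ≤ C := by
  have hB0 : 0 ≤ B := by linarith
  obtain ⟨b, hb⟩ : ∃ b, b = B * (B * (B * (B * B) + B * B) + B * B) := ⟨_, rfl⟩
  have hb0 : 0 ≤ b := hb ▸ by positivity
  obtain ⟨X, hX⟩ : ∃ X, X = T * b * Real.exp (B * B * T) := ⟨_, rfl⟩
  have hX0 : 0 ≤ X := hX ▸ by positivity
  have p1 : 0 ≤ b + B * B * X := by positivity
  have p2 : 0 ≤ B * (B * X + B * B) := by positivity
  refine ⟨X + (b + B * B * X) + B * (B * X + B * B), by positivity, fun {R c_v μ κ L} F A h => ?_⟩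
  have h1 : ∀ᵐ t ∂leb T, ‖A.vyy t‖ ≤ b + B * B * ‖toL2 L (A.Jy t)‖ := by
    filter_upwards [h.norm_vyy_le] with t ht
    refine ht.trans (le_of_eq ?_)
    rw [hb]; ring
  have h2 : ∀ t ∈ Icc 0 T, ‖toL2 L (A.Jy t)‖ ≤ X := by
    rw [hX]
    exact A.Jy_time.norm_le_of_deriv_le A.Jy_zero (by positivity) (by simp) (fun _ => hb0)
      (by simp) h1
  have h3 : ∀ t ∈ Icc 0 T, ‖A.vyy t‖ ≤ b + B * B * X := by
    refine le_on_Icc_of_ae_le hT A.vyy_cont.norm continuousOn_const ?_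
    filter_upwards [h1, ae_restrict_mem measurableSet_Ioo] with t h4 ht
    have := h2 t (Ioo_subset_Icc_self ht)
    exact h4.trans (by gcongr)
  have h4 : ∀ t ∈ Icc 0 T, ‖A.ϑyy t‖ ≤ B * (B * X + B * B) := by
    refine le_on_Icc_of_ae_le hT A.ϑyy_cont.norm continuousOn_const ?_
    filter_upwards [h.norm_ϑyy_le, ae_restrict_mem measurableSet_Ioo] with t h4 ht
    have := h2 t (Ioo_subset_Icc_self ht)
    exact h4.trans (by gcongr)
  exact ⟨fun t ht => (h2 t ht).trans (by linarith), fun t ht => (h3 t ht).trans (by linarith),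
    fun t ht => (h4 t ht).trans (by linarith)⟩

/-- The third derivatives are read off the differentiated equations up to `∂_y² J`, which is bounded by
Gronwall's inequality, as `∂_t ∂_y² J = ∂_y³ v`. -/
theorem exists_third_derivative_le (T B X : ℝ) (hT : 0 < T) (hB : 1 ≤ B) (hX : 0 ≤ X) :
    ∃ C : ℝ, 0 ≤ C ∧ ∀ {R c_v μ κ L : ℝ} (F : Flow R c_v μ κ T L) (A : F.Smooth), A.Regular B →
      (∀ t ∈ Icc 0 T, ‖toL2 L (A.Jy t)‖ ≤ X) → (∀ t ∈ Icc 0 T, ‖A.vyy t‖ ≤ X) →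
      (∀ t ∈ Icc 0 T, ‖A.ϑyy t‖ ≤ X) → (∀ t ∈ Icc 0 T, ‖A.Jyy t‖ ≤ C) ∧
        ∫ s in (0 : ℝ)..T, ‖A.vyyy s‖ ^ 2 ≤ C ∧ ∫ s in (0 : ℝ)..T, ‖A.ϑyyy s‖ ^ 2 ≤ C := by
  have hB0 : 0 ≤ B := by linarith
  obtain ⟨k, hk⟩ : ∃ k, k = B * (B * ((B * B + B * B) + (B * B + B * X))) := ⟨_, rfl⟩
  have hk0 : 0 ≤ k := hk ▸ by positivity
  obtain ⟨l, hl⟩ : ∃ l, l = B * (B * B * X + (B * B * X + B * (B * (B * B) + B))) := ⟨_, rfl⟩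
  have hl0 : 0 ≤ l := hl ▸ by positivity
  obtain ⟨Z, hZ⟩ : ∃ Z, Z = (k * T + l * (T + B)) * Real.exp (B * B * T) := ⟨_, rfl⟩
  have hZ0 : 0 ≤ Z := hZ ▸ by positivity
  obtain ⟨k', hk'⟩ : ∃ k', k' = B * ((B * Z + (B * (B * B) + B * B) * X) +
    ((B * (B * B) + B * B) * X + B * (B * (B * (B * B)) + (B * X + B * B)))) := ⟨_, rfl⟩
  obtain ⟨l', hl'⟩ : ∃ l', l' = B * (B * (B * B) * X + (B * (B * B) * X +
    B * (B * (B * (B * B) + B)))) := ⟨_, rfl⟩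
  have q1 : 0 ≤ 2 * (k + B * B * Z) ^ 2 * T + 2 * l ^ 2 * B := by positivity
  have q2 : 0 ≤ 2 * k' ^ 2 * T + 2 * l' ^ 2 * B := by positivity
  refine ⟨Z + (2 * (k + B * B * Z) ^ 2 * T + 2 * l ^ 2 * B) + (2 * k' ^ 2 * T + 2 * l' ^ 2 * B),
    by positivity, fun {R c_v μ κ L} F A h h1 h2 h3 => ?_⟩
  have mv : MemLp (fun t => (F.vt t).d 1) 2 (leb T) := (dL L 1 1).comp_memLp' F.vt_mem
  have mϑ : MemLp (fun t => (F.ϑt t).d 1) 2 (leb T) := (dL L 1 1).comp_memLp' F.ϑt_mem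
  have h4 : ∀ᵐ t ∂leb T, ‖A.vyyy t‖ ≤ (k + l * ‖(F.vt t).d 1‖) + B * B * ‖A.Jyy t‖ := by
    filter_upwards [h.norm_vyyy_le h1 h3] with t ht
    refine ht.trans (le_of_eq ?_)
    rw [hk, hl]; ring
  have i1 : IntervalIntegrable (fun t => ‖(F.vt t).d 1‖) volume 0 T :=
    (MemLp.intervalIntegrable_of_two hT.le mv).norm
  have i2 : IntervalIntegrable (fun _ => k) volume 0 T := by simp
  have i3 : ∫ s in (0 : ℝ)..T, ‖(F.vt s).d 1‖ ≤ T + B := by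
    have i5 : IntervalIntegrable (fun _ => (1 : ℝ)) volume 0 T := by simp
    have i4 := intervalIntegral_mono_ae ⟨hT.le, le_rfl⟩ i1 (i5.add F.intervalIntegrable_V)
      (Eventually.of_forall fun t => le_one_add_of_sq_le (le_refl (F.V t)))
    rw [intervalIntegral.integral_add i5 F.intervalIntegrable_V, intervalIntegral.integral_const,
      smul_eq_mul, mul_one, sub_zero] at i4
    linarith [h.V_int]
  have h5 : ∀ t ∈ Icc 0 T, ‖A.Jyy t‖ ≤ Z := by
    rw [hZ]
    refine A.Jyy_time.norm_le_of_deriv_le A.Jyy_zero (by positivity) (i2.add (i1.const_mul l))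
      (fun t => by positivity) ?_ h4
    rw [intervalIntegral.integral_add i2 (i1.const_mul l), intervalIntegral.integral_const_mul,
      intervalIntegral.integral_const, smul_eq_mul, sub_zero, mul_comm T]
    gcongr
  have h6 : ∀ᵐ t ∂leb T, ‖A.vyyy t‖ ≤ (k + B * B * Z) + l * ‖(F.vt t).d 1‖ := by
    filter_upwards [h4, ae_restrict_mem measurableSet_Ioo] with t ht ht'
    have := mul_le_mul_of_nonneg_left (h5 t (Ioo_subset_Icc_self ht')) (mul_nonneg hB0 hB0)
    linarith
  have h7 : ∀ᵐ t ∂leb T, ‖A.ϑyyy t‖ ≤ k' + l' * ‖(F.ϑt t).d 1‖ := by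
    filter_upwards [h.norm_ϑyyy_le h1 h2, ae_restrict_mem measurableSet_Ioo] with t ht ht'
    have := mul_le_mul_of_nonneg_left (h5 t (Ioo_subset_Icc_self ht')) (mul_nonneg hB0 hB0)
    rw [hk', hl']
    linarith
  have h8 := integral_sq_norm_le hT.le A.vyyy_mem mv h6
  have h9 := integral_sq_norm_le hT.le A.ϑyyy_mem mϑ h7
  have h10 := mul_le_mul_of_nonneg_left h.V_int (show 0 ≤ 2 * l ^ 2 by positivity)
  have h11 := mul_le_mul_of_nonneg_left h.Ξ_int (show 0 ≤ 2 * l' ^ 2 by positivity)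
  have e1 : ∫ s in (0 : ℝ)..T, F.V s = ∫ s in (0 : ℝ)..T, ‖(F.vt s).d 1‖ ^ 2 := rfl
  have e2 : ∫ s in (0 : ℝ)..T, F.Ξ s = ∫ s in (0 : ℝ)..T, ‖(F.ϑt s).d 1‖ ^ 2 := rfl
  rw [e1] at h10
  rw [e2] at h11
  exact ⟨fun t ht => (h5 t ht).trans (by linarith), by linarith, by linarith⟩

end Flow.Smooth

/-! ### Space derivatives of a global solution -/

namespace GlobalSolution

variable {R c_v μ κ L : ℝ} {ϱ₀ v₀ ϑ₀ : H L 2} (S : GlobalSolution R c_v μ κ L ϱ₀ v₀ ϑ₀)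

theorem truncL_v₃ (T : ℝ) : ∀ᵐ t ∂leb T, truncL L 2 (S.v₃ t) = S.v t := by
  filter_upwards [ae_leb_of_ae_Ioi S.v₃_eq] with t ht using H.ext_zero ht

theorem truncL_ϑ₃ (T : ℝ) : ∀ᵐ t ∂leb T, truncL L 2 (S.ϑ₃ t) = S.ϑ t := by
  filter_upwards [ae_leb_of_ae_Ioi S.ϑ₃_eq] with t ht using H.ext_zero ht

theorem J_t_eq (T : ℝ) : ∀ᵐ t ∂leb T, S.J_t t = derivL L 2 (S.v₃ t) := by
  filter_upwards [ae_leb_of_ae_Ioi S.eq_J, S.truncL_v₃ T] with t h1 h2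
  refine H.ext_zero (h1.trans ?_)
  rw [← h2]
  rfl

/-- The derivatives of the components of a global solution. -/
def smooth (hL : 0 < L) {T : ℝ} (hT : 0 < T) (F : Flow R c_v μ κ T L)
    (hρ' : F.ρ' = ϱ₀.rep' hL) (hJ : F.J = fun t => (S.J t).rep hL)
    (hvy : F.vy = fun t => (S.v t).rep' hL) (hϑy : F.ϑy = fun t => (S.ϑ t).rep' hL) :
    F.Smooth where
  ρ'' := ϱ₀.d 2
  Jy t := (S.J t).rep' hL
  Jyy t := (S.J t).d 2
  vyy t := (S.v t).d 2
  ϑyy t := (S.ϑ t).d 2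
  vyyy t := (S.v₃ t).d 3
  ϑyyy t := (S.ϑ₃ t).d 3
  ϑy_clamp t y := by rw [hϑy]; exact H.rep'_clamp hL _ y
  ρ'_space := by rw [hρ']; exact H.rep'_isPrimitiveOn hL ϱ₀
  J_space t := by rw [hJ]; exact H.rep_isPrimitiveOn hL (S.J t)
  Jy_space t := H.rep'_isPrimitiveOn hL (S.J t)
  vy_space t := by rw [hvy]; exact H.rep'_isPrimitiveOn hL (S.v t)
  ϑy_space t := by rw [hϑy]; exact H.rep'_isPrimitiveOn hL (S.ϑ t)
  vyy_space := by
    filter_upwards [S.truncL_v₃ T] with t ht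
    refine ⟨evL hL (derivL L 1 (derivL L 2 (S.v₃ t))), ?_, hasDerivL2_evL hL _⟩
    rw [toL2_evL, ← ht]
    rfl
  ϑyy_space := by
    filter_upwards [S.truncL_ϑ₃ T] with t ht
    refine ⟨evL hL (derivL L 1 (derivL L 2 (S.ϑ₃ t))), ?_, hasDerivL2_evL hL _⟩
    rw [toL2_evL, ← ht]
    rfl
  Jy_time := by
    refine (((S.isPrimitiveOn_J hT).map (dL L 2 1)).congr_left
      fun t _ => H.toL2_rep' hL (S.J t)).congr_ae ?_
    filter_upwards [S.J_t_eq T, S.truncL_v₃ T] with t h1 h2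
    rw [h1, ← h2]
    rfl
  Jyy_time := by
    refine ((S.isPrimitiveOn_J hT).map (dL L 2 2)).congr_ae ?_
    filter_upwards [S.J_t_eq T] with t h1
    rw [h1]
    rfl
  vyy_cont := (dL L 2 2).continuous.comp_continuousOn (S.v_cont.mono fun t ht => ht.1)
  ϑyy_cont := (dL L 2 2).continuous.comp_continuousOn (S.ϑ_cont.mono fun t ht => ht.1)
  vyyy_mem := (dL L 3 3).comp_memLp' (S.v₃_mem T hT)
  ϑyyy_mem := (dL L 3 3).comp_memLp' (S.ϑ₃_mem T hT)

end GlobalSolution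

/-! ### Bounds on the data -/

theorem lpNorm_congr_ae {α : Type*} {m : MeasurableSpace α} {ν : Measure α} {f g : α → ℝ}
    {p : ℝ≥0∞} (h : f =ᵐ[ν] g) : lpNorm f p ν = lpNorm g p ν := by
  by_cases hf : AEStronglyMeasurable f ν
  · rw [← toReal_eLpNorm hf, ← toReal_eLpNorm (hf.congr h), eLpNorm_congr_ae h]
  · rw [lpNorm_of_not_aestronglyMeasurable hf,
      lpNorm_of_not_aestronglyMeasurable fun hg => hf (hg.congr h.symm)]

theorem L2.lpNorm_eq {L : ℝ} (f : L2 L) : lpNorm f 2 (leb L) = ‖f‖ := by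
  rw [Lp.norm_def, toReal_eLpNorm (Lp.aestronglyMeasurable f)]

theorem lpNorm_two_sq {L : ℝ} {f : ℝ → ℝ} {u : CB} (h : f =ᵐ[leb L] u) :
    lpNorm f 2 (leb L) ^ 2 = integL L (u ^ 2) := by
  rw [lpNorm_congr_ae (h.trans (toL2_coe (L := L) u).symm), L2.lpNorm_eq, norm_sq_toL2]

theorem CB.abs_le_lpNorm {L : ℝ} (hL : 0 < L) {f : ℝ → ℝ} {u : CB} (h : f =ᵐ[leb L] u)
    (hu : ∀ y, u (clamp L y) = u y) (y : ℝ) : |u y| ≤ lpNorm f ∞ (leb L) := by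
  rw [lpNorm_congr_ae h, ← hu]
  have hm : MemLp u ∞ (leb L) := MemLp.of_bound u.continuous.aestronglyMeasurable ‖u‖
    (Eventually.of_forall fun y => u.norm_coe_le y)
  exact le_on_Icc_of_ae_le hL u.continuous.abs.continuousOn continuousOn_const
    (ae_le_lpNorm_exponent_top hm) _ (clamp_mem hL.le y)

theorem lpNorm_top_le {L : ℝ} (hL : 0 < L) {f : ℝ → ℝ} {u : CB} (h : f =ᵐ[leb L] u) {m : ℝ}
    (hm : ∀ y, |u y| ≤ m) : lpNorm f ∞ (leb L) ≤ m := by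
  have h0 : leb L ≠ 0 := by
    rw [Ne, Measure.restrict_eq_zero, Real.volume_Ioo, ENNReal.ofReal_eq_zero]
    linarith
  have h1 := lpNorm_mono_real (p := ∞) (μ := leb L) (f := u) (g := fun _ => m) (memLp_const m) hm
  rw [lpNorm_const (by simp) h0] at h1
  rw [lpNorm_congr_ae h]
  simpa [abs_of_nonneg ((abs_nonneg _).trans (hm 0))] using h1

section Density

variable {L : ℝ} {ϱ₀ : H L 2}

theorem rep_le_rhoBar (hL : 0 < L) (ϱ₀ : H L 2) (y : ℝ) : |ϱ₀.rep hL y| ≤ rhoBar ϱ₀ :=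
  CB.abs_le_lpNorm hL (H.rep_ae_eq hL ϱ₀) (H.rep_clamp hL ϱ₀) y

theorem rhoBar_pos (hL : 0 < L) (hϱ : ∀ y, 0 < ϱ₀.rep hL y) : 0 < rhoBar ϱ₀ :=
  (hϱ 0).trans_le ((le_abs_self _).trans (rep_le_rhoBar hL ϱ₀ 0))

theorem real_superlevel_eq (hL : 0 < L) (ϱ₀ : H L 2) :
    ω₀ ϱ₀ = (leb L).real {y | rhoBar ϱ₀ / 2 ≤ ϱ₀.rep hL y} := by
  refine measureReal_congr ?_
  filter_upwards [H.rep_ae_eq hL ϱ₀] with y hy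
  change (rhoBar ϱ₀ / 2 ≤ ϱ₀.d 0 y) = (rhoBar ϱ₀ / 2 ≤ ϱ₀.rep hL y)
  rw [hy]

theorem ω₀_pos (hL : 0 < L) (hϱ : ∀ y, 0 < ϱ₀.rep hL y) : 0 < ω₀ ϱ₀ := by
  have hr := rhoBar_pos hL hϱ
  rw [real_superlevel_eq hL]
  refine lt_of_le_of_ne measureReal_nonneg fun h => ?_
  -- otherwise the density is at most half its supremum
  rw [eq_comm, measureReal_eq_zero_iff] at h
  have h1 : ∀ᵐ y ∂leb L, ϱ₀.rep hL y ≤ rhoBar ϱ₀ / 2 := by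
    filter_upwards [measure_eq_zero_iff_ae_notMem.1 h] with y hy
    exact (not_le.1 hy).le
  have h2 : ∀ y, |ϱ₀.rep hL y| ≤ rhoBar ϱ₀ / 2 := fun y => by
    rw [abs_of_pos (hϱ y), ← H.rep_clamp]
    exact le_on_Icc_of_ae_le hL (ϱ₀.rep hL).continuous.continuousOn continuousOn_const h1 _
      (clamp_mem hL.le y)
  have h3 := lpNorm_top_le hL (H.rep_ae_eq hL ϱ₀) h2
  change rhoBar ϱ₀ ≤ _ at h3
  linarith

theorem mul_ω₀_le_integL (hL : 0 < L) (hϱ : ∀ y, 0 ≤ ϱ₀.rep hL y) :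
    rhoBar ϱ₀ / 2 * ω₀ ϱ₀ ≤ integL L (ϱ₀.rep hL) := by
  rw [real_superlevel_eq hL, HeatNS.integL_eq]
  exact mul_meas_ge_le_integral_of_nonneg (Eventually.of_forall hϱ) ((ϱ₀.rep hL).integrable L) _

end Density

namespace Flow

variable {R c_v μ κ T L : ℝ} {ϱ₀ v₀ ϑ₀ : H L 2} {F : Flow R c_v μ κ T L}

theorem energy₀_eq (hL : 0 < L) (hρ : F.ρ = ϱ₀.rep hL) (hv : F.v 0 = v₀.rep hL)
    (hϑ : F.ϑ 0 = ϑ₀.rep hL) : F.energy₀ = E₀ c_v ϱ₀ v₀ ϑ₀ := by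
  rw [energy₀, E₀, hρ, hv, hϑ, HeatNS.integL_eq]
  refine integral_congr_ae ?_
  filter_upwards [H.rep_ae_eq hL ϱ₀, H.rep_ae_eq hL v₀, H.rep_ae_eq hL ϑ₀] with y h1 h2 h3
  rw [h1, h2, h3]
  change 1 / 2 * (ϱ₀.rep hL y * v₀.rep hL y ^ 2) + c_v * (ϱ₀.rep hL y * ϑ₀.rep hL y) = _
  ring

/-- Bounds for `m₁`, `N₁`, `N₂` and `N₃` control the data. -/
theorem controlled_of_data {M₁ K₁ K₂ K₃ : ℝ} (hL : 0 < L) (hρ : F.ρ = ϱ₀.rep hL)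
    (hρ' : F.ρ' = ϱ₀.rep' hL) (hv : F.v 0 = v₀.rep hL) (hvy : F.vy 0 = v₀.rep' hL)
    (hϑ : F.ϑ 0 = ϑ₀.rep hL) (hg : F.g0 =ᵐ[leb L] g₀ R μ ϱ₀ v₀ ϑ₀)
    (hh : F.h0 =ᵐ[leb L] h₀ R μ κ ϱ₀ v₀ ϑ₀) (hm : m₁ c_v μ ϱ₀ v₀ ϑ₀ ≤ M₁)
    (h1 : N₁ c_v ϱ₀ v₀ ϑ₀ ≤ K₁) (h2 : N₂ ϱ₀ v₀ ϑ₀ ≤ K₂) (h3 : N₃ R μ κ ϱ₀ v₀ ϑ₀ ≤ K₃) :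
    F.Controlled (1 + |K₁| + 2 * K₁ ^ 2 + c_v * |K₁| + |M₁| + K₂ ^ 2 + K₃ ^ 2) := by
  have hc := F.c_pos
  have hρp : ∀ y, 0 < ϱ₀.rep hL y := fun y => by rw [← hρ]; exact F.ρ_pos y
  have hr := rhoBar_pos hL hρp
  have hω := ω₀_pos hL hρp
  have hE := energy₀_eq hL hρ hv hϑ
  have hE0 : 0 ≤ E₀ c_v ϱ₀ v₀ ϑ₀ := hE ▸ F.energy₀_nonneg
  have n1 : 0 ≤ E₀ c_v ϱ₀ v₀ ϑ₀ / c_v := by positivity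
  have n2 : 0 < 1 / rhoBar ϱ₀ := by positivity
  have n3 : 0 < 1 / L := by positivity
  have n4 : 0 < 1 / ω₀ ϱ₀ := by positivity
  have n5 : 0 ≤ lpNorm (ϱ₀.d 1) ∞ (leb L) := lpNorm_nonneg
  rw [N₁] at h1
  have hK : 0 < K₁ := by linarith
  have c1 : E₀ c_v ϱ₀ v₀ ϑ₀ ≤ c_v * K₁ := by
    rw [mul_comm, ← div_le_iff₀ hc]; linarith
  have c2 : 1 ≤ K₁ * L := by rw [← div_le_iff₀ hL]; linarith
  have c3 : 1 ≤ K₁ * rhoBar ϱ₀ := by rw [← div_le_iff₀ hr]; linarith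
  have c4 : 1 ≤ K₁ * ω₀ ϱ₀ := by rw [← div_le_iff₀ hω]; linarith
  have c5 : 1 ≤ 2 * K₁ ^ 2 * integL L F.ρ := by
    have h := mul_ω₀_le_integL hL fun y => (hρp y).le
    rw [← hρ] at h
    calc (1 : ℝ) ≤ (K₁ * rhoBar ϱ₀) * (K₁ * ω₀ ϱ₀) := one_le_mul_of_one_le_of_one_le c3 c4
      _ = 2 * K₁ ^ 2 * (rhoBar ϱ₀ / 2 * ω₀ ϱ₀) := by ring
      _ ≤ _ := by gcongr
  rw [abs_of_pos hK]
  have a1 := abs_nonneg M₁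
  have a2 : 0 ≤ K₁ ^ 2 := sq_nonneg _
  have a3 : 0 ≤ c_v * K₁ := by positivity
  have a4 := sq_nonneg K₂
  have a5 := sq_nonneg K₃
  have b1 : 0 ≤ lpNorm (fun y => Real.sqrt (ϱ₀.d 0 y) * v₀.d 0 y ^ 2) 2 (leb L) := lpNorm_nonneg
  have b2 : 0 ≤ lpNorm (fun y => Real.sqrt (ϱ₀.d 0 y) * ϑ₀.d 0 y) 2 (leb L) := lpNorm_nonneg
  have b3 : 0 ≤ lpNorm (v₀.d 1) 2 (leb L) := lpNorm_nonneg
  have b4 : 0 ≤ lpNorm (ϱ₀.d 2) 2 (leb L) := lpNorm_nonneg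
  have b5 : 0 ≤ lpNorm (g₀ R μ ϱ₀ v₀ ϑ₀) 2 (leb L) := lpNorm_nonneg
  have b6 : 0 ≤ lpNorm (h₀ R μ κ ϱ₀ v₀ ϑ₀) 2 (leb L) := lpNorm_nonneg
  rw [N₂] at h2
  rw [N₃] at h3
  obtain ⟨r, hr'⟩ := CB.exists_sqrt F.ρ
  have key {u : CB} {f : ℝ → ℝ} (hu : f =ᵐ[leb L] u) {x : ℝ} (hx : lpNorm f 2 (leb L) ≤ x) :
      integL L (u ^ 2) ≤ x ^ 2 := by
    rw [← lpNorm_two_sq hu]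
    have : 0 ≤ lpNorm f 2 (leb L) := lpNorm_nonneg
    gcongr
  have e1 : integL L (F.ρ * F.v 0 ^ 4) ≤ K₂ ^ 2 := by
    have h := key (u := r * F.v 0 ^ 2)
      (f := fun y => Real.sqrt (ϱ₀.d 0 y) * v₀.d 0 y ^ 2) (x := K₂) (by
        filter_upwards [H.rep_ae_eq hL ϱ₀, H.rep_ae_eq hL v₀] with y h1 h2
        change _ = r y * F.v 0 y ^ 2
        rw [h1, h2, hr', hρ, hv]) (by linarith)
    refine le_trans (le_of_eq ?_) h
    congr 1
    ext y
    change F.ρ y * F.v 0 y ^ 4 = (r y * F.v 0 y ^ 2) ^ 2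
    rw [hr', mul_pow, Real.sq_sqrt (F.ρ_pos y).le]
    ring
  have e2 : integL L (F.ρ * F.ϑ 0 ^ 2) ≤ K₂ ^ 2 := by
    have h := key (u := r * F.ϑ 0) (f := fun y => Real.sqrt (ϱ₀.d 0 y) * ϑ₀.d 0 y) (x := K₂) (by
        filter_upwards [H.rep_ae_eq hL ϱ₀, H.rep_ae_eq hL ϑ₀] with y h1 h2
        change _ = r y * F.ϑ 0 y
        rw [h1, h2, hr', hρ, hϑ]) (by linarith)
    refine le_trans (le_of_eq ?_) h
    congr 1
    ext y
    change F.ρ y * F.ϑ 0 y ^ 2 = (r y * F.ϑ 0 y) ^ 2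
    rw [hr', mul_pow, Real.sq_sqrt (F.ρ_pos y).le]
  have e3 : integL L (F.vy 0 ^ 2) ≤ K₂ ^ 2 :=
    key (hvy ▸ H.rep'_ae_eq hL v₀) (by linarith)
  have e4 : ‖F.g0‖ ^ 2 ≤ K₃ ^ 2 := by
    rw [← L2.lpNorm_eq, lpNorm_congr_ae hg]
    gcongr
    linarith
  have e5 : ‖F.h0‖ ^ 2 ≤ K₃ ^ 2 := by
    rw [← L2.lpNorm_eq, lpNorm_congr_ae hh]
    gcongr
    linarith
  have e6 : integL L F.ρ = lpNorm (ϱ₀.d 0) 1 (leb L) := by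
    rw [lpNorm_congr_ae (H.rep_ae_eq hL ϱ₀), lpNorm_one_eq_integral_norm
      (ϱ₀.rep hL).continuous.aestronglyMeasurable, hρ, HeatNS.integL_eq]
    refine integral_congr_ae (Eventually.of_forall fun y => ?_)
    change ϱ₀.rep hL y = |ϱ₀.rep hL y|
    rw [abs_of_pos (hρp y)]
  have hm0 : 0 ≤ integL L F.ρ := integL_nonneg fun y => (F.ρ_pos y).le
  constructor
  · linarith
  · linarith
  · exact c2.trans (mul_le_mul_of_nonneg_right (by linarith) hL.le)
  · intro y
    rw [hρ]
    have := (le_abs_self _).trans (rep_le_rhoBar hL ϱ₀ y)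
    linarith
  · intro y
    rw [hρ']
    have := CB.abs_le_lpNorm hL (H.rep'_ae_eq hL ϱ₀) (H.rep'_clamp hL ϱ₀) y
    linarith
  · exact c5.trans (mul_le_mul_of_nonneg_right (by linarith) hm0)
  · rw [hE]; linarith
  · rw [hE, e6]
    have := hm.trans (le_abs_self M₁)
    rw [m₁] at this
    linarith
  · linarith
  · linarith
  · linarith
  · linarith
  · linarith

end Flow

/-! ### Assembling the norms -/

theorem norm_toL2_le_of_norm_le {L B : ℝ} (hL : 0 < L) (hB : 1 ≤ B) (hLB : L ≤ B) {f : CB}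
    (hf : ‖f‖ ≤ B) : ‖toL2 L f‖ ^ 2 ≤ B ^ 4 := by
  have h := (norm_toL2_le hL hB hLB f).trans (mul_le_mul_of_nonneg_left hf (by linarith))
  calc ‖toL2 L f‖ ^ 2 ≤ (B * B) ^ 2 := by gcongr
    _ = _ := by ring

namespace Flow.Smooth

variable {R c_v μ κ T L : ℝ} {F : Flow R c_v μ κ T L} {A : F.Smooth} {B : ℝ}

theorem Regular.sq_norm_toL2_v_le (h : A.Regular B) {t : ℝ} (ht : t ∈ Icc 0 T)
    (hv : ∀ y, F.v t (clamp L y) = F.v t y) : ‖toL2 L (F.v t)‖ ^ 2 ≤ B ^ 7 := by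
  have hB := h.one_le
  have h1 := (F.v_space t).hasDerivL2.sq_norm_le F.L_pos hv (F.v_bdry t ht).1
  have h2 := norm_toL2_le_of_norm_le F.L_pos h.one_le h.L_le (h.vy_le t ht)
  have h3 := norm_toL2_le F.L_pos h.one_le h.L_le (F.v t)
  have h4 := h.L_le
  calc ‖toL2 L (F.v t)‖ ^ 2 ≤ (B * ‖F.v t‖) ^ 2 := by gcongr
    _ = B ^ 2 * ‖F.v t‖ ^ 2 := by ring
    _ ≤ B ^ 2 * (B * B ^ 4) := by
      gcongr
      exact h1.trans (by gcongr)
    _ = _ := by ring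

theorem Regular.sq_norm_vt_le (h : A.Regular B) :
    ∀ᵐ t ∂leb T, ‖F.vt t‖ ^ 2 ≤ (B ^ 4 + 1) * F.V t := by
  have hB := h.one_le
  filter_upwards [h.w_le] with t h1
  have h2 : ‖(F.vt t).d 0‖ ≤ B * (B * ‖(F.vt t).d 1‖) := by
    rw [← toL2_evL F.L_pos]
    exact (norm_toL2_le F.L_pos h.one_le h.L_le _).trans
      (mul_le_mul_of_nonneg_left h1 (by linarith))
  rw [H.norm_sq_eq, Fin.sum_univ_two]
  have h3 : ‖(F.vt t).d 0‖ ^ 2 ≤ (B * (B * ‖(F.vt t).d 1‖)) ^ 2 := by gcongr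
  rw [V]
  linarith

theorem Regular.sq_norm_ϑt_le (h : A.Regular B) :
    ∀ᵐ t ∂leb T, ‖F.ϑt t‖ ^ 2 ≤ 2 * B ^ 4 + (2 * B ^ 4 + 1) * F.Ξ t := by
  have hB := h.one_le
  filter_upwards [h.θ_le] with t h1
  have h2 : ‖(F.ϑt t).d 0‖ ≤ B * (B * (1 + ‖(F.ϑt t).d 1‖)) := by
    rw [← toL2_evL F.L_pos]
    exact (norm_toL2_le F.L_pos h.one_le h.L_le _).trans
      (mul_le_mul_of_nonneg_left h1 (by linarith))
  rw [H.norm_sq_eq, Fin.sum_univ_two, Ξ]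
  generalize ‖(F.ϑt t).d 1‖ = x at *
  have h3 : ‖(F.ϑt t).d 0‖ ^ 2 ≤ (B * (B * (1 + x))) ^ 2 := by gcongr
  have h4 := mul_nonneg (show 0 ≤ B ^ 4 by positivity) (sq_nonneg (1 - x))
  linarith

end Flow.Smooth

namespace GlobalSolution

variable {R c_v μ κ L : ℝ} {ϱ₀ v₀ ϑ₀ : H L 2} (S : GlobalSolution R c_v μ κ L ϱ₀ v₀ ϑ₀)

/-- The final estimate, for a solution all of whose derivatives have been bounded. -/
theorem norm_le_of_regular (hL : 0 < L) {T : ℝ} (hT : 0 < T) (F : Flow R c_v μ κ T L)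
    (hρ' : F.ρ' = ϱ₀.rep' hL) (hJ : F.J = fun t => (S.J t).rep hL)
    (hv : F.v = fun t => (S.v t).rep hL) (hvy : F.vy = fun t => (S.v t).rep' hL)
    (hϑ : F.ϑ = fun t => (S.ϑ t).rep hL) (hϑy : F.ϑy = fun t => (S.ϑ t).rep' hL)
    (hvt : F.vt = S.v_t) (hϑt : F.ϑt = S.ϑ_t) {B X Z : ℝ}
    (h : (S.smooth hL hT F hρ' hJ hvy hϑy).Regular B)
    (hJy : ∀ t ∈ Icc 0 T, ‖toL2 L ((S.J t).rep' hL)‖ ≤ X)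
    (hvyy : ∀ t ∈ Icc 0 T, ‖(S.v t).d 2‖ ≤ X) (hϑyy : ∀ t ∈ Icc 0 T, ‖(S.ϑ t).d 2‖ ≤ X)
    (hJyy : ∀ t ∈ Icc 0 T, ‖(S.J t).d 2‖ ≤ Z)
    (hv₃ : ∫ s in (0 : ℝ)..T, ‖(S.v₃ s).d 3‖ ^ 2 ≤ Z)
    (hϑ₃ : ∫ s in (0 : ℝ)..T, ‖(S.ϑ₃ s).d 3‖ ^ 2 ≤ Z) : ∀ t ∈ Icc 0 T,
    (‖S.J t‖ ^ 2 + ‖S.v t‖ ^ 2 + ‖S.ϑ t‖ ^ 2)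
      + ∫ s in (0 : ℝ)..T, (‖S.J_t s‖ ^ 2 + (‖S.v₃ s‖ ^ 2 + ‖S.ϑ₃ s‖ ^ 2)
        + (‖S.v_t s‖ ^ 2 + ‖S.ϑ_t s‖ ^ 2)) ≤
    (B ^ 7 + 3 * B ^ 4 + B ^ 2 + 3 * X ^ 2 + Z ^ 2) +
      ((B ^ 7 + 5 * B ^ 4 + B ^ 2 + 3 * X ^ 2) * T + 3 * Z + (3 * B ^ 4 + 2) * B) := by
  have hB := h.one_le
  have a1 : ∀ t ∈ Icc 0 T, ‖(S.J t).d 0‖ ^ 2 ≤ B ^ 4 := fun t ht => by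
    have h1 := h.J_le t ht
    rw [hJ] at h1
    rw [← H.toL2_rep hL]
    exact norm_toL2_le_of_norm_le hL h.one_le h.L_le h1
  have a2 : ∀ t ∈ Icc 0 T, ‖(S.J t).d 1‖ ^ 2 ≤ X ^ 2 := fun t ht => by
    have h1 := hJy t ht
    rw [H.toL2_rep'] at h1
    gcongr
  have a3 : ∀ t ∈ Icc 0 T, ‖(S.J t).d 2‖ ^ 2 ≤ Z ^ 2 := fun t ht => by
    have h1 := hJyy t ht
    gcongr
  have a4 : ∀ t ∈ Icc 0 T, ‖(S.v t).d 0‖ ^ 2 ≤ B ^ 7 := fun t ht => by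
    have h1 := h.sq_norm_toL2_v_le ht (by rw [hv]; exact H.rep_clamp hL (S.v t))
    rw [hv] at h1
    rwa [← H.toL2_rep hL]
  have a5 : ∀ t ∈ Icc 0 T, ‖(S.v t).d 1‖ ^ 2 ≤ B ^ 4 := fun t ht => by
    have h1 := h.vy_le t ht
    rw [hvy] at h1
    rw [← H.toL2_rep' hL]
    exact norm_toL2_le_of_norm_le hL h.one_le h.L_le h1
  have a6 : ∀ t ∈ Icc 0 T, ‖(S.v t).d 2‖ ^ 2 ≤ X ^ 2 := fun t ht => by
    have h1 := hvyy t ht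
    gcongr
  have a7 : ∀ t ∈ Icc 0 T, ‖(S.ϑ t).d 0‖ ^ 2 ≤ B ^ 4 := fun t ht => by
    have h1 := h.ϑ_le t ht
    rw [hϑ] at h1
    rw [← H.toL2_rep hL]
    exact norm_toL2_le_of_norm_le hL h.one_le h.L_le h1
  have a8 : ∀ t ∈ Icc 0 T, ‖(S.ϑ t).d 1‖ ^ 2 ≤ B ^ 2 := fun t ht => by
    have h1 := h.ϑy_le t ht
    rw [hϑy] at h1
    rw [← H.toL2_rep' hL]
    gcongr
  have a9 : ∀ t ∈ Icc 0 T, ‖(S.ϑ t).d 2‖ ^ 2 ≤ X ^ 2 := fun t ht => by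
    have h1 := hϑyy t ht
    gcongr
  have i1 := Flow.intervalIntegrable_sq_norm hT.le (S.J_t_mem T hT)
  have i2 := Flow.intervalIntegrable_sq_norm hT.le (S.v₃_mem T hT)
  have i3 := Flow.intervalIntegrable_sq_norm hT.le (S.ϑ₃_mem T hT)
  have i4 := Flow.intervalIntegrable_sq_norm hT.le (S.v_t_mem T hT)
  have i5 := Flow.intervalIntegrable_sq_norm hT.le (S.ϑ_t_mem T hT)
  have j1 : IntervalIntegrable (fun t => ‖(S.v₃ t).d 3‖ ^ 2) volume 0 T :=
    Flow.intervalIntegrable_sq_norm hT.le ((dL L 3 3).comp_memLp' (S.v₃_mem T hT))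
  have j2 : IntervalIntegrable (fun t => ‖(S.ϑ₃ t).d 3‖ ^ 2) volume 0 T :=
    Flow.intervalIntegrable_sq_norm hT.le ((dL L 3 3).comp_memLp' (S.ϑ₃_mem T hT))
  have j3 := F.intervalIntegrable_V
  have j4 := F.intervalIntegrable_Ξ
  have j0 : IntervalIntegrable (fun _ : ℝ => B ^ 7 + 5 * B ^ 4 + B ^ 2 + 3 * X ^ 2) volume 0 T := by
    simp
  have key := intervalIntegral_mono_ae ⟨hT.le, le_rfl⟩ ((i1.add (i2.add i3)).add (i4.add i5))
    (((j0.add (j1.const_mul 2)).add (j2.const_mul 1)).add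
      ((j3.const_mul (B ^ 4 + 1)).add (j4.const_mul (2 * B ^ 4 + 1)))) (by
    filter_upwards [S.J_t_eq T, S.truncL_v₃ T, S.truncL_ϑ₃ T, h.sq_norm_vt_le, h.sq_norm_ϑt_le,
      ae_restrict_mem measurableSet_Ioo] with t h1 h2 h3 h4 h5 ht
    have ht' := Ioo_subset_Icc_self ht
    have b4 := a4 t ht'
    have b5 := a5 t ht'
    have b6 := a6 t ht'
    have b7 := a7 t ht'
    have b8 := a8 t ht'
    have b9 := a9 t ht'
    rw [hvt] at h4
    rw [hϑt] at h5
    rw [← h2] at b4 b5 b6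
    rw [← h3] at b7 b8 b9
    have hJt : ‖S.J_t t‖ ^ 2 = ‖(S.v₃ t).d 1‖ ^ 2 + ‖(S.v₃ t).d 2‖ ^ 2 + ‖(S.v₃ t).d 3‖ ^ 2 := by
      rw [h1, H.norm_sq_eq, Fin.sum_univ_three]
      rfl
    have hvn := H.norm_sq_eq (S.v₃ t)
    have hϑn := H.norm_sq_eq (S.ϑ₃ t)
    rw [Fin.sum_univ_four] at hvn hϑn
    change ‖(S.v₃ t).d 0‖ ^ 2 ≤ _ at b4
    change ‖(S.v₃ t).d 1‖ ^ 2 ≤ _ at b5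
    change ‖(S.v₃ t).d 2‖ ^ 2 ≤ _ at b6
    change ‖(S.ϑ₃ t).d 0‖ ^ 2 ≤ _ at b7
    change ‖(S.ϑ₃ t).d 1‖ ^ 2 ≤ _ at b8
    change ‖(S.ϑ₃ t).d 2‖ ^ 2 ≤ _ at b9
    change ‖S.J_t t‖ ^ 2 + (‖S.v₃ t‖ ^ 2 + ‖S.ϑ₃ t‖ ^ 2) + (‖S.v_t t‖ ^ 2 + ‖S.ϑ_t t‖ ^ 2) ≤ _
    rw [hJt]
    linarith)
  rw [intervalIntegral.integral_add ((j0.add (j1.const_mul 2)).add (j2.const_mul 1))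
      ((j3.const_mul (B ^ 4 + 1)).add (j4.const_mul (2 * B ^ 4 + 1))),
    intervalIntegral.integral_add (j0.add (j1.const_mul 2)) (j2.const_mul 1),
    intervalIntegral.integral_add j0 (j1.const_mul 2),
    intervalIntegral.integral_add (j3.const_mul (B ^ 4 + 1)) (j4.const_mul (2 * B ^ 4 + 1))] at key
  simp only [intervalIntegral.integral_const_mul, intervalIntegral.integral_const, smul_eq_mul,
    sub_zero] at key
  intro t ht
  have c1 := mul_le_mul_of_nonneg_left h.V_int (show 0 ≤ B ^ 4 + 1 by positivity)
  have c2 := mul_le_mul_of_nonneg_left h.Ξ_int (show 0 ≤ 2 * B ^ 4 + 1 by positivity)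
  have b1 := a1 t ht
  have b2 := a2 t ht
  have b3 := a3 t ht
  have b4 := a4 t ht
  have b5 := a5 t ht
  have b6 := a6 t ht
  have b7 := a7 t ht
  have b8 := a8 t ht
  have b9 := a9 t ht
  rw [H.norm_sq_eq (S.J t), H.norm_sq_eq (S.v t), H.norm_sq_eq (S.ϑ t), Fin.sum_univ_three,
    Fin.sum_univ_three, Fin.sum_univ_three]
  linarith

end GlobalSolution

end

end HeatNS

theorem corollary2p4 (R c_v μ κ T M₁ K₁ K₂ K₃ : ℝ)
    (hR : 0 < R) (hc_v : 0 < c_v) (hμ : 0 < μ) (hκ : 0 < κ) (hT : 0 < T) :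
    ∃ C₀ : ℝ, 0 < C₀ ∧ ∃ C : ℝ, 0 < C ∧
      ∀ (L : ℝ) (_ : 0 < L) (ϱ₀ v₀ ϑ₀ : HeatNS.H L 2)
        (_ : ∃ a : ℝ, 0 < a ∧
          HeatNS.IsBoundedBelowBy (ϱ₀.d 0) a ∧ HeatNS.IsBoundedBelowBy (ϑ₀.d 0) a)
        (_ : HeatNS.VanishesAtEnds (v₀.d 0))
        (_ : HeatNS.m₁ c_v μ ϱ₀ v₀ ϑ₀ ≤ M₁)
        (_ : HeatNS.N₁ c_v ϱ₀ v₀ ϑ₀ ≤ K₁)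
        (_ : HeatNS.N₂ ϱ₀ v₀ ϑ₀ ≤ K₂)
        (_ : HeatNS.N₃ R μ κ ϱ₀ v₀ ϑ₀ ≤ K₃)
        (S : HeatNS.GlobalSolution R c_v μ κ L ϱ₀ v₀ ϑ₀),
        (∀ t ∈ Set.Icc 0 T, HeatNS.IsBoundedBelowBy ((S.J t).d 0) C₀) ∧
        (∀ t ∈ Set.Icc 0 T,
          (‖S.J t‖ ^ 2 + ‖S.v t‖ ^ 2 + ‖S.ϑ t‖ ^ 2)
            + ∫ s in (0 : ℝ)..T, (‖S.J_t s‖ ^ 2 + (‖S.v₃ s‖ ^ 2 + ‖S.ϑ₃ s‖ ^ 2)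
                + (‖S.v_t s‖ ^ 2 + ‖S.ϑ_t s‖ ^ 2)) ≤ C) := by
  -- `2 * K₁ ^ 2` bounds the reciprocal of the mass, which is at least `ω₀ sup ρ₀ / 2`, and `c_v * |K₁|`
  -- bounds the energy.
  set K := 1 + |K₁| + 2 * K₁ ^ 2 + c_v * |K₁| + |M₁| + K₂ ^ 2 + K₃ ^ 2 with hK
  have hK1 : 1 ≤ K := by
    have := mul_nonneg hc_v.le (abs_nonneg K₁)
    linarith [abs_nonneg K₁, abs_nonneg M₁, sq_nonneg K₁, sq_nonneg K₂, sq_nonneg K₃]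
  obtain ⟨M, hM1, hM⟩ := HeatNS.Flow.exists_tame R c_v μ κ T K hK1 hc_v hμ hκ hT
  obtain ⟨A, hA⟩ := HeatNS.Flow.exists_rateBounded R c_v μ κ T M hM1 hc_v hμ hκ hT
  obtain ⟨A', hA'⟩ := HeatNS.Flow.exists_heat_rate_le R c_v μ κ T M A hM1 hc_v hκ hT
  obtain ⟨B, hB1, hB⟩ := HeatNS.Flow.Smooth.exists_regular R c_v μ κ T M A A' K₃
  obtain ⟨X, hX0, hX⟩ := HeatNS.Flow.Smooth.exists_second_derivative_le T B hT hB1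
  obtain ⟨Z, -, hZ⟩ := HeatNS.Flow.Smooth.exists_third_derivative_le T B X hT hB1 hX0
  refine ⟨M⁻¹, by positivity, max 1 ((B ^ 7 + 3 * B ^ 4 + B ^ 2 + 3 * X ^ 2 + Z ^ 2) +
    ((B ^ 7 + 5 * B ^ 4 + B ^ 2 + 3 * X ^ 2) * T + 3 * Z + (3 * B ^ 4 + 2) * B)),
    lt_max_of_lt_left one_pos, ?_⟩
  intro L hL ϱ₀ v₀ ϑ₀ ⟨a, ha, hϱ, hϑ⟩ _ hm h1 h2 h3 S
  obtain ⟨F, hg, hh, hρ, hρ', hJ, hv, hvy, hϑ', hϑy, hvt, hϑt⟩ :=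
    S.exists_flow hL hT hR hc_v hμ hκ ha hϱ hϑ
  have hF : F.Controlled K := F.controlled_of_data hL hρ hρ' (by simp only [hv, S.v_init])
    (by simp only [hvy, S.v_init]) (by simp only [hϑ', S.ϑ_init]) hg hh hm h1 h2 h3
  have hFM := hM F hF
  have hFA := hA F hFM
  obtain ⟨hΘ, hΞ⟩ := hA' F hFM hFA
  have hϱ'' : ‖ϱ₀.d 2‖ ≤ K₃ := by
    rw [HeatNS.N₃, HeatNS.L2.lpNorm_eq] at h3
    have e1 : 0 ≤ lpNorm (HeatNS.g₀ R μ ϱ₀ v₀ ϑ₀) 2 (HeatNS.leb L) := lpNorm_nonneg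
    have e2 : 0 ≤ lpNorm (HeatNS.h₀ R μ κ ϱ₀ v₀ ϑ₀) 2 (HeatNS.leb L) := lpNorm_nonneg
    linarith
  have hreg := hB F (S.smooth hL hT F hρ' hJ hvy hϑy) hFM hFA hΘ hΞ hϱ''
  obtain ⟨x1, x2, x3⟩ := hX F _ hreg
  obtain ⟨z1, z2, z3⟩ := hZ F _ hreg x1 x2 x3
  refine ⟨fun t ht => ⟨(S.J t).rep hL, HeatNS.isContRep_evL hL (HeatNS.truncL L 1 (S.J t)),
    fun y _ => ?_⟩, fun t ht => (S.norm_le_of_regular hL hT F hρ' hJ hv hvy hϑ' hϑy hvt hϑt hreg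
      x1 x2 x3 z1 z2 z3 t ht).trans (le_max_right _ _)⟩
  -- The reciprocal of the Jacobian is bounded by `M`.
  have e1 := hFM.I_le t ht y
  have e2 := F.J_mul_I t ht y
  have e3 := F.I_pos ht y
  have e4 : F.J t y = (S.J t).rep hL y := by rw [hJ]
  rw [← e4, eq_inv_of_mul_eq_one_left e2]
  exact inv_anti₀ e3 e1
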